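/- **Setting.** Let $d\ge 1$ and let $\{\Phi_{J_0 m}\}\cup\{\Psi^{\iota}_{lm}\}_{l\ge J_0,\ \iota\in\{0,1\}^d\setminus\{0\}}$ be a compactly supported orthonormal tensor-product wavelet basis of $L^2([0,1]^d)$ of Cohen–Daubechies–Vial type with regularity $S\ge1$ (each $V_j=\mathrm{span}\{\Phi_{jm}\}_m$, $j\ge J_0$, is built from a one-dimensional space containing the polynomials of degree $<S$), where $J_0\ge1$, $2^{J_0}\ge S$. Let $0<\alpha,\beta<S$, $M>0$, $C_1<C_2$. For $a>0$ let $H(a,M)$ be the set of uniformly continuous $h$ on $[0,1]^d$ with $$2^{J_0(a+d/2)}\max_m|\langle h,\Phi_{J_0m}\rangle|+\sup_{l\ge J_0,m,\iota}2^{l(a+d/2)}|\langle h,\Psi^\iota_{lm}\rangle|\le M .$$ Let $\mathcal P_{M}=\mathcal P_{(\alpha,\beta)}$ be the set of laws $\mathbb P$ of $O=(X,A,Y)$ with $X\sim\mathrm{Unif}([0,1]^d)$, $A,Y\in[C_1,C_2]$ a.s., $p=\mathbb E[A|X=\cdot]\in H(\alpha,M)$ and $b=\mathbb E[Y|X=\cdot]\in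 H(\beta,M)$. Assume that $\mathcal P_{M'}\neq\emptyset$ for some $M'<M$ (automatic if $C_1\le0\le C_2$, or if $M$ is large). The functional is $\psi(\mathbb P)=\mathbb E_{\mathbb P}[\mathrm{Cov}_{\mathbb P}(A,Y|X)]$. **Estimators (double sample splitting).** Let $\mathcal D_1,\mathcal D_2,\mathcal D_3,\mathcal D_4$ be disjoint i.i.d. samples of size $n$ (the fourth is used only by MC). A resolution is $k=2^{jd}$ with $j\ge J_0$; write $K_{k}(x,y)=\sum_m\Phi_{jm}(x)\Phi_{jm}(y)$, and $\hat p_{k_1}(x)=\frac1n\sum_{i\in\mathcal D_1}A_iK_{k_1}(X_i,x)$, $\hat b_{k_2}(x)=\frac1n\sum_{i\in\mathcal D_2}Y_iK_{k_2}(X_i,x)$. Put $$\hat\psi^{\mathrm{INT}}_{k_1,k_2}=\frac1n\sum_{i\in\mathcal D_3}A_iY_i-\int_{[0,1]^d}\hat p_{k_1}\hat b_{k_2},\qquad \hat\psi^{\mathrm{MC}}_{k_1,k_2}=\frac1n\sum_{i\in\mathcal D_3}A_iY_i-\frac1n\sum_{i\in\mathcal D_4}\hat p_{k_1}(X_i)\hat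 b_{k_2}(X_i),$$ $$\hat\psi^{\mathrm{IF}}_{k_1,k_2}=\frac1n\sum_{i\in\mathcal D_3}(A_i-\hat p_{k_1}(X_i))(Y_i-\hat b_{k_2}(X_i)).$$ The worst-case risk of $\hat\psi$ is $\sup_{\mathbb P\in\mathcal P_{(\alpha,\beta)}}\mathbb E_{\mathbb P}[(\hat\psi-\psi(\mathbb P))^2]$; the minimax risk is its infimum over all (measurable) estimators based on the same number of observations. A sequence of estimators is *minimax rate optimal* if its worst-case risk is $\asymp$ the minimax risk. Here $a_n\lesssim b_n$ means $a_n\le Cb_n$ for some $C>0$ and all large $n$, and $a_n\asymp b_n$ means $a_n\lesssim b_n\lesssim a_n$. Resolutions $k_1,k_2$ may depend on $n$. **Claim.** The minimax risk for $n$ observations is $\asymp n^{-1}$ if $\frac{\alpha+\beta}2\ge\frac d4$ and $\asymp n^{-\frac{4\alpha+4\beta}{2\alpha+2\beta+d}}$ if $\frac{\alpha+\beta}2<\frac d4$. Moreover: If $\frac{\alpha+\beta}{2}\ge\frac d4$, then 1. $\hat\psi^{\mathrm{INT}}_{k_1,k_2}$ is minimax rate optimal whenever $n^{\frac{d}{2\alpha+2\beta}}\lesssim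 k_1\wedge k_2\lesssim n$; 2. $\hat\psi^{\mathrm{MC}}_{k_1,k_2}$ is minimax rate optimal whenever $n^{\frac{d}{2\alpha+2\beta}}\lesssim k_\ell\lesssim n$ for $\ell=1,2$; 3. $\hat\psi^{\mathrm{IF}}_{k_1,k_2}$ is minimax rate optimal whenever $n^{\frac{d}{2\alpha+2\beta}}\lesssim k_1\vee k_2\lesssim n$. If $\frac{\alpha+\beta}{2}<\frac d4$, then 1. $\hat\psi^{\mathrm{INT}}_{k_1,k_2}$ is minimax rate optimal whenever $k_1\wedge k_2\asymp n^{\frac{2d}{2\alpha+2\beta+d}}$; 2. $\hat\psi^{\mathrm{MC}}_{k_1,k_2}$ is not minimax rate optimal for any choice of $k_1,k_2$. Its best worst-case risk $\inf_{k_1,k_2}\sup_{\mathbb P}\mathbb E_{\mathbb P}[(\hat\psi^{\mathrm{MC}}_{k_1,k_2}-\psi(\mathbb P))^2]$ is $\asymp n^{-\frac{3\alpha+3\beta}{\alpha+\beta+d}}$, and this rate is attained whenever $k_\ell\asymp n^{\frac{3d}{2\alpha+2\beta+2d}}$ for $\ell=1,2$; 3. $\hat\psi^{\mathrm{IF}}_{k_1,k_2}$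 is minimax rate optimal whenever $k_1\vee k_2\asymp n^{\frac{2d}{2\alpha+2\beta+d}}$ and $k_1\wedge k_2\lesssim n$. -/

import Mathlib

open MeasureTheory Set
open scoped ENNReal NNReal BigOperators

noncomputable section

/-! ### Orders of magnitude -/

/-- `a n ≲ b n`: for some constant `C > 0`, `a n ≤ C * b n` for all large `n`. -/
def AsympLE (a b : ℕ → ℝ≥0∞) : Prop :=
  ∃ C : ℝ≥0, 0 < C ∧ ∃ n₀ : ℕ, ∀ n ≥ n₀, a n ≤ C * b n

/-- `a n ≍ b n`. -/
def Asymp (a b : ℕ → ℝ≥0∞) : Prop := AsympLE a b ∧ AsympLE b a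

/-- The sequence `n ↦ n ^ r` for a real exponent `r`. -/
def powRate (r : ℝ) (n : ℕ) : ℝ≥0∞ := ENNReal.ofReal ((n : ℝ) ^ r)

/-! ### Wavelets on the interval and on the cube -/

/-- Lebesgue measure on `[0,1]`. -/
abbrev unitVol : Measure ℝ := volume.restrict (Icc (0 : ℝ) 1)

/-- Generators of a wavelet system adapted to the interval: an interior scaling function `φ` and
wavelet `ψ`, and `S` scaling functions and `S` wavelets for each of the two end points. -/
structure BoundaryWavelets (S : ℕ) where
  φ : ℝ → ℝ
  ψ : ℝ → ℝ
  φL : Fin S → ℝ → ℝ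
  φR : Fin S → ℝ → ℝ
  ψL : Fin S → ℝ → ℝ
  ψR : Fin S → ℝ → ℝ

/-- The `m`-th of the `2 ^ j` functions at level `j`: a dilate by `2 ^ j` of a left edge function for
the first `S` indices, of a (reflected) right edge function for the last `S` indices, and the
translate `2 ^ (j / 2) * f (2 ^ j * x - m)` of the interior function otherwise. -/
def levelFun {S : ℕ} (f : ℝ → ℝ) (fL fR : Fin S → ℝ → ℝ) (j : ℕ) (m : Fin (2 ^ j)) (x : ℝ) : ℝ :=
  (2 : ℝ) ^ ((j : ℝ) / 2) *
    (if h : m.1 < S then fL ⟨m.1, h⟩ (2 ^ j * x)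
     else if h' : 2 ^ j - 1 - m.1 < S then fR ⟨2 ^ j - 1 - m.1, h'⟩ (2 ^ j * (1 - x))
     else f (2 ^ j * x - m.1))

/-- A bounded measurable function of compact support. -/
def IsGenerator (f : ℝ → ℝ) : Prop :=
  Measurable f ∧ HasCompactSupport f ∧ ∃ C : ℝ, ∀ x, |f x| ≤ C

namespace BoundaryWavelets

variable {S : ℕ} (W : BoundaryWavelets S)

/-- The univariate scaling functions at level `j`. -/
def scal (j : ℕ) (m : Fin (2 ^ j)) (x : ℝ) : ℝ := levelFun W.φ W.φL W.φR j m x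

/-- The univariate wavelets at level `j`. -/
def wav (j : ℕ) (m : Fin (2 ^ j)) (x : ℝ) : ℝ := levelFun W.ψ W.ψL W.ψR j m x

/-- `W` generates a compactly supported orthonormal wavelet basis of `L²([0,1])` of
Cohen-Daubechies-Vial type, of regularity `S` and with coarsest level `J₀`. -/
structure IsCDVBasis (J₀ : ℕ) : Prop where
  one_le_S : 1 ≤ S
  one_le_J₀ : 1 ≤ J₀
  S_le : S ≤ 2 ^ J₀
  gen_φ : IsGenerator W.φ
  gen_ψ : IsGenerator W.ψ
  gen_φL : ∀ i, IsGenerator (W.φL i)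
  gen_φR : ∀ i, IsGenerator (W.φR i)
  gen_ψL : ∀ i, IsGenerator (W.ψL i)
  gen_ψR : ∀ i, IsGenerator (W.ψR i)
  /-- The scaling functions of one level are orthonormal. -/
  scal_orthonormal : ∀ j, J₀ ≤ j → ∀ m m' : Fin (2 ^ j),
    ∫ x, W.scal j m x * W.scal j m' x ∂unitVol = if m = m' then 1 else 0
  /-- The wavelets of one level are orthonormal. -/
  wav_orthonormal : ∀ j, J₀ ≤ j → ∀ m m' : Fin (2 ^ j),
    ∫ x, W.wav j m x * W.wav j m' x ∂unitVol = if m = m' then 1 else 0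
  /-- Wavelets are orthogonal to the scaling functions of their level. -/
  scal_wav : ∀ j, J₀ ≤ j → ∀ m m' : Fin (2 ^ j),
    ∫ x, W.scal j m x * W.wav j m' x ∂unitVol = 0
  /-- Multiresolution: `V_j ⊆ V_{j+1}`. -/
  scal_refine : ∀ j, J₀ ≤ j → ∀ m : Fin (2 ^ j), ∃ c : Fin (2 ^ (j + 1)) → ℝ,
    W.scal j m =ᵐ[unitVol] fun x => ∑ i, c i * W.scal (j + 1) i x
  /-- Multiresolution: the wavelets of level `j` lie in `V_{j+1}`. -/
  wav_refine : ∀ j, J₀ ≤ j → ∀ m : Fin (2 ^ j), ∃ c : Fin (2 ^ (j + 1)) → ℝ,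
    W.wav j m =ᵐ[unitVol] fun x => ∑ i, c i * W.scal (j + 1) i x
  /-- Regularity `S`: every `V_j` contains the polynomials of degree at most `S - 1`. -/
  poly_mem : ∀ j, J₀ ≤ j → ∀ r < S, ∃ c : Fin (2 ^ j) → ℝ,
    (fun x : ℝ => x ^ r) =ᵐ[unitVol] fun x => ∑ i, c i * W.scal j i x
  /-- Completeness in `L²([0,1])`. -/
  complete : ∀ h : ℝ → ℝ, MemLp h 2 unitVol →
    (∀ m : Fin (2 ^ J₀), ∫ x, W.scal J₀ m x * h x ∂unitVol = 0) →
    (∀ l, J₀ ≤ l → ∀ m : Fin (2 ^ l), ∫ x, W.wav l m x * h x ∂unitVol = 0) →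
    h =ᵐ[unitVol] 0

/-- Tensor product scaling functions on `[0,1]^d`. -/
def Phi {d : ℕ} (l : ℕ) (m : Fin d → Fin (2 ^ l)) (x : Fin d → ℝ) : ℝ :=
  ∏ i, W.scal l (m i) (x i)

/-- Tensor product wavelets on `[0,1]^d`, of type `ι ∈ {0,1}^d`. -/
def Psi {d : ℕ} (ι : Fin d → Bool) (l : ℕ) (m : Fin d → Fin (2 ^ l)) (x : Fin d → ℝ) : ℝ :=
  ∏ i, if ι i then W.wav l (m i) (x i) else W.scal l (m i) (x i)

/-- The kernel of the projection onto `V_j`, the span of the scaling functions at level `j`; its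
resolution is `k = 2 ^ (j * d)`. -/
def kernel {d : ℕ} (j : ℕ) (x y : Fin d → ℝ) : ℝ :=
  ∑ m : Fin d → Fin (2 ^ j), W.Phi j m x * W.Phi j m y

/-- The Hölder ball `H(a, M)`: uniformly continuous functions on the cube with
`2 ^ (J₀ (a + d/2)) ‖⟨h, Φ_{J₀ ·}⟩‖_∞ + sup_{l, m, ι ≠ 0} 2 ^ (l (a + d/2)) |⟨h, Ψ^ι_{l m}⟩| ≤ M`
(a sum of two suprema is at most `M` iff all sums of two terms are). -/
def holderBall (d J₀ : ℕ) (a M : ℝ) : Set ((Fin d → ℝ) → ℝ) :=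
  {h | UniformContinuousOn h (Icc 0 1) ∧
    ∀ (m₀ : Fin d → Fin (2 ^ J₀)) (l : ℕ), J₀ ≤ l → ∀ (m : Fin d → Fin (2 ^ l))
      (ι : Fin d → Bool), (∃ i, ι i = true) →
      (2 : ℝ) ^ ((J₀ : ℝ) * (a + d / 2)) * |∫ x in Icc 0 1, h x * W.Phi J₀ m₀ x|
        + (2 : ℝ) ^ ((l : ℝ) * (a + d / 2)) * |∫ x in Icc 0 1, h x * W.Psi ι l m x| ≤ M}

end BoundaryWavelets

/-! ### The statistical model and the functional -/

/-- An observation `(X, A, Y)`. -/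
abbrev Obs (d : ℕ) : Type := (Fin d → ℝ) × ℝ × ℝ

/-- The σ-algebra generated by the covariate `X`. -/
abbrev sigmaX (d : ℕ) : MeasurableSpace (Obs d) :=
  MeasurableSpace.comap (fun o : Obs d => o.1) inferInstance

/-- `E[A | X]`. -/
def condA {d : ℕ} (P : ProbabilityMeasure (Obs d)) : Obs d → ℝ :=
  condExp (sigmaX d) (P : Measure (Obs d)) (fun o => o.2.1)

/-- `E[Y | X]`. -/
def condY {d : ℕ} (P : ProbabilityMeasure (Obs d)) : Obs d → ℝ :=
  condExp (sigmaX d) (P : Measure (Obs d)) (fun o => o.2.2)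

/-- `Cov(A, Y | X)`. -/
def condCov {d : ℕ} (P : ProbabilityMeasure (Obs d)) : Obs d → ℝ :=
  condExp (sigmaX d) (P : Measure (Obs d))
    (fun o => (o.2.1 - condA P o) * (o.2.2 - condY P o))

/-- The functional `ψ(P) = E[Cov(A, Y | X)]`. -/
def psi {d : ℕ} (P : ProbabilityMeasure (Obs d)) : ℝ :=
  ∫ o, condCov P o ∂(P : Measure (Obs d))

/-- The model `P_(α, β)`: `X` is uniform on the cube, `A, Y ∈ [C₁, C₂]` almost surely, and the
regression functions `p = E[A | X = ·]` and `b = E[Y | X = ·]` lie in `H(α, M)` and `H(β, M)`. -/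
def model {S : ℕ} (W : BoundaryWavelets S) (d J₀ : ℕ) (α β M C₁ C₂ : ℝ) :
    Set (ProbabilityMeasure (Obs d)) :=
  {P | (P : Measure (Obs d)).map (fun o => o.1) = volume.restrict (Icc (0 : Fin d → ℝ) 1) ∧
    (∀ᵐ o ∂(P : Measure (Obs d)), o.2.1 ∈ Icc C₁ C₂ ∧ o.2.2 ∈ Icc C₁ C₂) ∧
    (∃ p ∈ W.holderBall d J₀ α M, condA P =ᵐ[(P : Measure (Obs d))] fun o => p o.1) ∧
    (∃ b ∈ W.holderBall d J₀ β M, condY P =ᵐ[(P : Measure (Obs d))] fun o => b o.1)}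

/-! ### Risk -/

/-- Mean squared error of `T` for estimating `ψ(P)` from i.i.d. observations indexed by `I`. -/
def risk {d : ℕ} {I : Type} [Fintype I] (T : (I → Obs d) → ℝ) (P : ProbabilityMeasure (Obs d)) :
    ℝ≥0∞ :=
  ∫⁻ o, ENNReal.ofReal ((T o - psi P) ^ 2) ∂(Measure.pi fun _ : I => (P : Measure (Obs d)))

/-- Worst-case mean squared error over the model `Q`. -/
def worstRisk {d : ℕ} {I : Type} [Fintype I] (Q : Set (ProbabilityMeasure (Obs d)))
    (T : (I → Obs d) → ℝ) : ℝ≥0∞ :=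
  ⨆ P ∈ Q, risk T P

/-- Minimax risk: infimum over all (measurable) estimators of the worst-case risk. -/
def minimaxRisk {d : ℕ} (Q : Set (ProbabilityMeasure (Obs d))) (I : Type) [Fintype I] : ℝ≥0∞ :=
  ⨅ T : (I → Obs d) → ℝ, ⨅ _ : Measurable T, worstRisk Q T

/-- A sequence of estimators based on `s` subsamples of size `n` is minimax rate optimal: its
worst-case risk is of the order of the minimax risk for the whole sample. -/
def IsMinimaxRateOptimal {d : ℕ} (Q : Set (ProbabilityMeasure (Obs d))) (s : ℕ)
    (T : ∀ n : ℕ, (Fin s × Fin n → Obs d) → ℝ) : Prop :=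
  Asymp (fun n => worstRisk Q (T n)) (fun n => minimaxRisk Q (Fin s × Fin n))

/-! ### Estimators under double sample splitting -/

namespace BoundaryWavelets

variable {S : ℕ} (W : BoundaryWavelets S)

/-- Approximate wavelet projection estimator of `p` at level `j` from a subsample `D`. -/
def pHat {d n : ℕ} (j : ℕ) (D : Fin n → Obs d) (x : Fin d → ℝ) : ℝ :=
  (1 / (n : ℝ)) * ∑ i, (D i).2.1 * W.kernel j (D i).1 x

/-- Approximate wavelet projection estimator of `b` at level `j` from a subsample `D`. -/
def bHat {d n : ℕ} (j : ℕ) (D : Fin n → Obs d) (x : Fin d → ℝ) : ℝ :=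
  (1 / (n : ℝ)) * ∑ i, (D i).2.2 * W.kernel j (D i).1 x

/-- Integral-based plug-in estimator; `p` and `b` are fitted on the first two of three disjoint
subsamples of size `n`. -/
def psiINT {d : ℕ} (j₁ j₂ n : ℕ) (O : Fin 3 × Fin n → Obs d) : ℝ :=
  (1 / (n : ℝ)) * ∑ i, (O (2, i)).2.1 * (O (2, i)).2.2
    - ∫ x in Icc (0 : Fin d → ℝ) 1,
        W.pHat j₁ (fun i => O (0, i)) x * W.bHat j₂ (fun i => O (1, i)) x

/-- Monte Carlo-based plug-in estimator, with four disjoint subsamples of size `n`. -/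
def psiMC {d : ℕ} (j₁ j₂ n : ℕ) (O : Fin 4 × Fin n → Obs d) : ℝ :=
  (1 / (n : ℝ)) * ∑ i, (O (2, i)).2.1 * (O (2, i)).2.2
    - (1 / (n : ℝ)) * ∑ i, W.pHat j₁ (fun i' => O (0, i')) (O (3, i)).1 *
        W.bHat j₂ (fun i' => O (1, i')) (O (3, i)).1

/-- First-order bias-corrected estimator, with three disjoint subsamples of size `n`. -/
def psiIF {d : ℕ} (j₁ j₂ n : ℕ) (O : Fin 3 × Fin n → Obs d) : ℝ :=
  (1 / (n : ℝ)) * ∑ i,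
    ((O (2, i)).2.1 - W.pHat j₁ (fun i' => O (0, i')) (O (2, i)).1) *
      ((O (2, i)).2.2 - W.bHat j₂ (fun i' => O (1, i')) (O (2, i)).1)

end BoundaryWavelets

/-- The resolutions `k(n) = 2 ^ (j(n) d)` of a sequence of levels. -/
def resol (d : ℕ) (j : ℕ → ℕ) (n : ℕ) : ℝ≥0∞ := ((2 ^ (j n * d) : ℕ) : ℝ≥0∞)

end

/-!
The three risks are evaluated by conditioning on one subsample at a time. A projection
estimator of resolution `k` fitted on `n` observations has mean `Π r`, the projection of the
regression function, and pointwise second moment `O(1 + k / n)`. Integrating a product of two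
independent projection estimators is a bilinear operation in the two samples, so that it costs only
a variance of order `(1 + (k₁ ∧ k₂) / n) / n`, whereas evaluating the two estimators at the points
of a further sample costs the full `(1 + k₁ / n) (1 + k₂ / n) / n`
(`exists_integral_estINT_le`, `exists_integral_estMC_le`, `exists_integral_estIF_le`). As the
projections are nested, the bias of a plug-in estimator is the integral of
`(p - Π p) (b - Π b)` at the coarser of the two levels, and that of the corrected estimator is the
same integral at the finer level. Membership in a Hölder ball makes each factor uniformly
`O(2 ^ (-a j))` (`exists_abs_sub_proj_le`), which gives `exists_worstRisk_le`.

The minimax lower bounds use laws under which `A` and `Y` take the two values `C₁`, `C₂` only. Such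
a law is determined by the conditional means `p`, `b`, `θ` of two signs and their product
(`signLaw`), and its functional is a multiple of `∫ (θ - p b)`. Since the model with a smaller
radius is nonempty, shrinking one of its members towards a constant leaves room for perturbations
by signed sums of small smooth bumps (`exists_perturbable`, based on
`exists_bumpSum_mem_holderBall`). Perturbing `θ` alone gives the parametric bound `1 / n`. For the
slower rate, `p` and `b` are perturbed by bumps whose signs agree on every cube, or are opposite on
every cube, and are averaged over the random signs; `θ` is perturbed so that a single observation
in a cube carries no information on the product of the signs. The two mixtures then differ only
through cubes that contain at least two observations, and a comparison of geometric and arithmetic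
means (`sign_mixture_le`) turns this into a bound for every estimator
(`le_minimaxRisk_of_mixtures`, `exists_le_minimaxRisk_nonparametric`).

For the Monte Carlo estimator two further lower bounds are needed. The variance is of exact order
`k₁ k₂ / n ^ 3` once both resolutions exceed a large multiple of `n`, because the diagonal of the
projection kernel is bounded below by a multiple of the resolution (`exists_le_integral_estMC`). The
worst-case bias is of exact order: a projection onto a space of dimension `2 ^ (j d)` cannot see all the bumps of level `j + 1`,
so that for suitable signs half of the energy of their sum is orthogonal to it
(`exists_bumpSum_sub_proj`), and the bilinear bias is then large at one of the four laws obtained by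
adding this sum to, or subtracting it from, `p` and `b` (`exists_bias_le_worstRisk_psiMC`).
Balancing `(k₁ ∧ k₂) ^ (-2 (α + β) / d)` against `k₁ k₂ / n ^ 3` gives the rate
`n ^ (-3 (α + β) / (α + β + d))`, which is slower than the minimax rate below the critical
smoothness.
-/

/-! ### Univariate wavelets -/

/-- The normalising factor `2 ^ (j / 2)` of the functions of level `j`. -/
noncomputable def sqrtTwoPow (j : ℕ) : ℝ := (2 : ℝ) ^ ((j : ℝ) / 2)

lemma sqrtTwoPow_pos (j : ℕ) : 0 < sqrtTwoPow j := Real.rpow_pos_of_pos two_pos _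

lemma sqrtTwoPow_mul_self (j : ℕ) : sqrtTwoPow j * sqrtTwoPow j = 2 ^ j := by
  unfold sqrtTwoPow
  rw [← Real.rpow_add two_pos, ← Real.rpow_natCast]
  congr 1; ring

instance : IsProbabilityMeasure unitVol := ⟨by simp [unitVol]⟩

open Classical in
/-- A system of `2 ^ j` functions at each level `j` that are localised at scale `2 ^ (-j)`, with
constant `C` for the sizes and `R` for the supports. -/
structure IsLocalised (F : ∀ j : ℕ, Fin (2 ^ j) → ℝ → ℝ) (C R : ℝ) : Prop where
  meas : ∀ j m, Measurable (F j m)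
  bound : ∀ j m t, |F j m t| ≤ C * sqrtTwoPow j
  supp : ∀ j m, ∃ t₀, ∀ t, F j m t ≠ 0 → |t - t₀| ≤ R / 2 ^ j
  card : ∀ j t, ((Finset.univ.filter fun m => F j m t ≠ 0).card : ℝ) ≤ C
  sum_abs : ∀ j t, ∑ m, |F j m t| ≤ C * sqrtTwoPow j
  integral_abs : ∀ j m, (∫ t, |F j m t| ∂unitVol) * sqrtTwoPow j ≤ C

lemma IsLocalised.mono {F : ∀ j : ℕ, Fin (2 ^ j) → ℝ → ℝ} {C R C' R' : ℝ}
    (h : IsLocalised F C R) (hC : C ≤ C') (hR : R ≤ R') : IsLocalised F C' R' where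
  meas := h.meas
  bound j m t := (h.bound j m t).trans (by gcongr; exact (sqrtTwoPow_pos j).le)
  supp j m := by
    obtain ⟨t₀, ht⟩ := h.supp j m
    exact ⟨t₀, fun t h0 => (ht t h0).trans (by gcongr)⟩
  card j t := (h.card j t).trans hC
  sum_abs j t := (h.sum_abs j t).trans (by gcongr; exact (sqrtTwoPow_pos j).le)
  integral_abs j m := (h.integral_abs j m).trans hC

lemma IsGenerator.exists_const {f : ℝ → ℝ} (hf : IsGenerator f) :
    ∃ K : ℝ, 0 < K ∧ (∀ x, |f x| ≤ K) ∧ ∀ x, f x ≠ 0 → |x| ≤ K := by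
  obtain ⟨-, hs, C, hC⟩ := hf
  obtain ⟨r, hr⟩ := hs.isCompact.isBounded.subset_closedBall (0 : ℝ)
  refine ⟨max 1 (max C r), by positivity, fun x => (hC x).trans (by simp), fun x hx => ?_⟩
  have h1 := hr (subset_tsupport f hx)
  simp only [Metric.mem_closedBall, dist_zero_right, Real.norm_eq_abs] at h1
  exact h1.trans (by simp)

lemma isGenerator_common {S : ℕ} {f : ℝ → ℝ} {fL fR : Fin S → ℝ → ℝ} (hf : IsGenerator f)
    (hL : ∀ i, IsGenerator (fL i)) (hR : ∀ i, IsGenerator (fR i)) :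
    ∃ K : ℝ, 0 < K ∧ ∀ g, (g = f ∨ (∃ i, g = fL i) ∨ ∃ i, g = fR i) →
      (∀ x, |g x| ≤ K) ∧ ∀ x, g x ≠ 0 → |x| ≤ K := by
  obtain ⟨K0, h0, h0a, h0b⟩ := hf.exists_const
  choose KL hL0 hLa hLb using fun i => (hL i).exists_const
  choose KR hR0 hRa hRb using fun i => (hR i).exists_const
  have hLs : ∀ i, KL i ≤ ∑ i, KL i := fun i =>
    Finset.single_le_sum (f := KL) (fun i _ => (hL0 i).le) (Finset.mem_univ i)
  have hRs : ∀ i, KR i ≤ ∑ i, KR i := fun i =>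
    Finset.single_le_sum (f := KR) (fun i _ => (hR0 i).le) (Finset.mem_univ i)
  have hL1 : 0 ≤ ∑ i, KL i := Finset.sum_nonneg fun i _ => (hL0 i).le
  have hR1 : 0 ≤ ∑ i, KR i := Finset.sum_nonneg fun i _ => (hR0 i).le
  refine ⟨K0 + ∑ i, KL i + ∑ i, KR i, by positivity, ?_⟩
  rintro g (rfl | ⟨i, rfl⟩ | ⟨i, rfl⟩)
  · exact ⟨fun x => (h0a x).trans (by linarith), fun x hx => (h0b x hx).trans (by linarith)⟩
  · exact ⟨fun x => (hLa i x).trans (by linarith [hLs i]),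
      fun x hx => (hLb i x hx).trans (by linarith [hLs i])⟩
  · exact ⟨fun x => (hRa i x).trans (by linarith [hRs i]),
      fun x hx => (hRb i x hx).trans (by linarith [hRs i])⟩

lemma levelFun_support {S : ℕ} {f : ℝ → ℝ} {fL fR : Fin S → ℝ → ℝ} {K : ℝ}
    (hK : ∀ g, (g = f ∨ (∃ i, g = fL i) ∨ ∃ i, g = fR i) →
      (∀ x, |g x| ≤ K) ∧ ∀ x, g x ≠ 0 → |x| ≤ K) (j : ℕ) (m : Fin (2 ^ j)) :
    ∃ t₀, ∀ t, levelFun f fL fR j m t ≠ 0 → |t - t₀| ≤ K / 2 ^ j := by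
  have h2 : (0 : ℝ) < 2 ^ j := by positivity
  unfold levelFun
  split_ifs with h h'
  · refine ⟨0, fun t ht => ?_⟩
    have := (hK _ (Or.inr (Or.inl ⟨⟨m.1, h⟩, rfl⟩))).2 _ (right_ne_zero_of_mul ht)
    rw [le_div_iff₀ h2]
    rwa [sub_zero, ← abs_of_pos h2, ← abs_mul, mul_comm]
  · refine ⟨1, fun t ht => ?_⟩
    have := (hK _ (Or.inr (Or.inr ⟨⟨2 ^ j - 1 - m.1, h'⟩, rfl⟩))).2 _ (right_ne_zero_of_mul ht)
    rw [le_div_iff₀ h2]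
    rwa [abs_sub_comm, ← abs_of_pos h2, ← abs_mul, mul_comm]
  · refine ⟨m.1 / 2 ^ j, fun t ht => ?_⟩
    have := (hK _ (Or.inl rfl)).2 _ (right_ne_zero_of_mul ht)
    rw [le_div_iff₀ h2, ← abs_of_pos h2, ← abs_mul, abs_of_pos h2]
    rwa [show (t - m.1 / 2 ^ j) * 2 ^ j = 2 ^ j * t - m.1 by field_simp]

lemma levelFun_abs_le {S : ℕ} {f : ℝ → ℝ} {fL fR : Fin S → ℝ → ℝ} {K : ℝ}
    (hK : ∀ g, (g = f ∨ (∃ i, g = fL i) ∨ ∃ i, g = fR i) →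
      (∀ x, |g x| ≤ K) ∧ ∀ x, g x ≠ 0 → |x| ≤ K) (j : ℕ) (m : Fin (2 ^ j)) (t : ℝ) :
    |levelFun f fL fR j m t| ≤ K * sqrtTwoPow j := by
  unfold levelFun
  rw [abs_mul, abs_of_pos (Real.rpow_pos_of_pos two_pos _), mul_comm]
  refine mul_le_mul_of_nonneg_right ?_ (sqrtTwoPow_pos j).le
  split_ifs with h h'
  · exact (hK _ (Or.inr (Or.inl ⟨⟨m.1, h⟩, rfl⟩))).1 _
  · exact (hK _ (Or.inr (Or.inr ⟨⟨2 ^ j - 1 - m.1, h'⟩, rfl⟩))).1 _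
  · exact (hK _ (Or.inl rfl)).1 _

open Classical in
/-- At each point only boundedly many functions of a level do not vanish. -/
lemma levelFun_card {S : ℕ} {f : ℝ → ℝ} {fL fR : Fin S → ℝ → ℝ} {K : ℝ} (hK0 : 0 < K)
    (hK : ∀ g, (g = f ∨ (∃ i, g = fL i) ∨ ∃ i, g = fR i) →
      (∀ x, |g x| ≤ K) ∧ ∀ x, g x ≠ 0 → |x| ≤ K) (j : ℕ) (t : ℝ) :
    ((Finset.univ.filter fun m : Fin (2 ^ j) => levelFun f fL fR j m t ≠ 0).card : ℝ)
      ≤ 2 * S + 2 * K + 1 := by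
  set s := (2 : ℝ) ^ j * t
  set A : Finset (Fin (2 ^ j)) := Finset.univ.filter fun m => m.1 < S
  set B : Finset (Fin (2 ^ j)) := Finset.univ.filter fun m => 2 ^ j - 1 - m.1 < S
  set D : Finset (Fin (2 ^ j)) := Finset.univ.filter fun m => |s - m.1| ≤ K
  have hsub : (Finset.univ.filter fun m : Fin (2 ^ j) => levelFun f fL fR j m t ≠ 0)
      ⊆ A ∪ B ∪ D := by
    intro m hm
    simp only [Finset.mem_filter, Finset.mem_univ, true_and, Finset.mem_union, A, B, D] at hm ⊢
    by_cases h : m.1 < S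
    · exact Or.inl (Or.inl h)
    by_cases h' : 2 ^ j - 1 - m.1 < S
    · exact Or.inl (Or.inr h')
    · simp only [levelFun, h, h', dif_neg, not_false_eq_true] at hm
      exact Or.inr ((hK _ (Or.inl rfl)).2 _ (right_ne_zero_of_mul hm))
  have hA : A.card ≤ S := by
    have := Finset.card_le_card_of_injOn (s := A) (t := Finset.range S) (fun m => m.1)
      (fun m hm => by simpa [A] using hm) (fun a _ b _ h => Fin.ext h)
    simpa using this
  have hB : B.card ≤ S := by
    have := Finset.card_le_card_of_injOn (s := B) (t := Finset.range S)
      (fun m => 2 ^ j - 1 - m.1)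
      (fun m hm => by simpa [B] using hm) (fun a _ b _ h => Fin.ext (by
        have := a.2; have := b.2; simp only at h; omega))
    simpa using this
  have hD : (D.card : ℝ) ≤ 2 * K + 1 := by
    have h1 := Finset.card_le_card_of_injOn (s := D) (t := Finset.Icc ⌈s - K⌉ ⌊s + K⌋)
      (fun m => (m.1 : ℤ))
      (fun m hm => by
        simp only [D, Finset.coe_filter, Finset.mem_univ, true_and, Set.mem_ofPred_eq, abs_le] at hm
        simp only [Finset.coe_Icc, Set.mem_Icc, Int.ceil_le, Int.le_floor, Int.cast_natCast]
        constructor <;> linarith [hm.1, hm.2])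
      (fun a _ b _ h => Fin.ext (by simpa using h))
    rw [Int.card_Icc] at h1
    have h2 : ((⌊s + K⌋ + 1 - ⌈s - K⌉ : ℤ) : ℝ) ≤ 2 * K + 1 := by
      push_cast
      linarith [Int.floor_le (s + K), Int.le_ceil (s - K)]
    have h3 : (D.card : ℤ) ≤ max (⌊s + K⌋ + 1 - ⌈s - K⌉) 0 := by
      rw [← Int.toNat_eq_max]; exact_mod_cast h1
    have h4 : (D.card : ℝ) ≤ ((max (⌊s + K⌋ + 1 - ⌈s - K⌉) 0 : ℤ) : ℝ) := by exact_mod_cast h3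
    refine h4.trans ?_
    rw [Int.cast_max]
    exact max_le h2 (by simp; positivity)
  have h5 : (Finset.univ.filter fun m : Fin (2 ^ j) => levelFun f fL fR j m t ≠ 0).card
      ≤ S + S + D.card :=
    (Finset.card_le_card hsub).trans ((Finset.card_union_le _ _).trans
      (Nat.add_le_add_right ((Finset.card_union_le _ _).trans (Nat.add_le_add hA hB)) _))
  have h6 : ((Finset.univ.filter fun m : Fin (2 ^ j) => levelFun f fL fR j m t ≠ 0).card : ℝ)
      ≤ S + S + D.card := by exact_mod_cast h5
  linarith

/-- The interior dilates of a compactly supported generator overlap boundedly often, and there are at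
most `2 S` boundary functions at each level. -/
lemma exists_isLocalised_levelFun {S : ℕ} {f : ℝ → ℝ} {fL fR : Fin S → ℝ → ℝ}
    (hf : IsGenerator f) (hL : ∀ i, IsGenerator (fL i)) (hR : ∀ i, IsGenerator (fR i)) :
    ∃ C R : ℝ, 0 < C ∧ 0 < R ∧ IsLocalised (levelFun f fL fR) C R := by
  classical
  obtain ⟨K, hK0, hK⟩ := isGenerator_common hf hL hR
  have hS : (0 : ℝ) ≤ S := by positivity
  have hC1 : K ≤ (K + 1) * (2 * S + 2 * K + 1) := by nlinarith [mul_nonneg hK0.le hS]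
  have hC2 : K * (2 * K) ≤ (K + 1) * (2 * S + 2 * K + 1) := by nlinarith [mul_nonneg hK0.le hS]
  have hC3 : 2 * S + 2 * K + 1 ≤ (K + 1) * (2 * S + 2 * K + 1) := by
    nlinarith [mul_nonneg hK0.le hS]
  have hmeas : ∀ j m, Measurable (levelFun f fL fR j m) := by
    intro j m
    unfold levelFun
    refine Measurable.const_mul ?_ _
    split_ifs with h h'
    · exact (hL _).1.comp (by fun_prop)
    · exact (hR _).1.comp (by fun_prop)
    · exact hf.1.comp (by fun_prop)
  refine ⟨(K + 1) * (2 * S + 2 * K + 1), K, by positivity, hK0, hmeas, fun j m t => ?_,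
    levelFun_support hK, fun j t => ?_, fun j t => ?_, fun j m => ?_⟩
  · exact (levelFun_abs_le hK j m t).trans
      (mul_le_mul_of_nonneg_right hC1 (sqrtTwoPow_pos j).le)
  · refine le_trans ?_ hC3
    convert levelFun_card hK0 hK j t using 2
  · calc ∑ m, |levelFun f fL fR j m t|
        = ∑ m ∈ Finset.univ.filter (fun m => levelFun f fL fR j m t ≠ 0),
            |levelFun f fL fR j m t| := by
          rw [Finset.sum_filter]
          refine Finset.sum_congr rfl fun m _ => ?_
          split_ifs with h
          · rfl
          · rw [not_not.mp h, abs_zero]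
      _ ≤ ∑ m ∈ Finset.univ.filter (fun m => levelFun f fL fR j m t ≠ 0),
            K * sqrtTwoPow j := Finset.sum_le_sum fun m _ => levelFun_abs_le hK j m t
      _ ≤ _ := by
          rw [Finset.sum_const, nsmul_eq_mul]
          have := levelFun_card hK0 hK j t
          have h0 : 0 < K * sqrtTwoPow j := mul_pos hK0 (sqrtTwoPow_pos j)
          nlinarith [mul_le_mul_of_nonneg_right this h0.le, sqrtTwoPow_pos j,
            mul_nonneg hS (sqrtTwoPow_pos j).le, mul_pos hK0 (sqrtTwoPow_pos j)]
  · obtain ⟨t₀, ht⟩ := levelFun_support hK j m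
    have h2 : (0 : ℝ) < 2 ^ j := by positivity
    have h1 : ∫ t, |levelFun f fL fR j m t| ∂unitVol
        ≤ ∫ t, (Metric.closedBall t₀ (K / 2 ^ j)).indicator
            (fun _ => K * sqrtTwoPow j) t ∂unitVol := by
      refine integral_mono_of_nonneg (Filter.Eventually.of_forall fun t => abs_nonneg _)
        ((integrable_const _).indicator measurableSet_closedBall)
        (Filter.Eventually.of_forall fun t => ?_)
      by_cases h : t ∈ Metric.closedBall t₀ (K / 2 ^ j)
      · simp only [Set.indicator_of_mem h]; exact levelFun_abs_le hK j m t
      · simp only [Set.indicator_of_notMem h]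
        by_contra h'
        exact h (ht t (fun h0 => h' (by simp [h0])))
    have h3 : (unitVol (Metric.closedBall t₀ (K / 2 ^ j))).toReal ≤ 2 * K / 2 ^ j := by
      refine ENNReal.toReal_le_of_le_ofReal (by positivity) ?_
      refine (Measure.restrict_apply_le _ _).trans ?_
      rw [Real.volume_closedBall, mul_div_assoc]
    rw [integral_indicator_const _ measurableSet_closedBall, smul_eq_mul] at h1
    have hs := sqrtTwoPow_mul_self j
    have hp := sqrtTwoPow_pos j
    calc (∫ t, |levelFun f fL fR j m t| ∂unitVol) * sqrtTwoPow j
        ≤ (2 * K / 2 ^ j * (K * sqrtTwoPow j)) * sqrtTwoPow j := by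
          gcongr
          exact h1.trans (mul_le_mul_of_nonneg_right h3 (by positivity))
      _ = K * (2 * K) := by
          rw [mul_assoc, mul_assoc, hs]; field_simp
      _ ≤ _ := hC2

namespace BoundaryWavelets.IsCDVBasis

/-- Scaling functions and wavelets are localised with the same constants. -/
lemma exists_isLocalised {S : ℕ} {W : BoundaryWavelets S} {J₀ : ℕ}
    (hW : W.IsCDVBasis J₀) : ∃ C R : ℝ, 1 ≤ C ∧ 0 < R ∧
    IsLocalised W.scal C R ∧ IsLocalised W.wav C R := by
  obtain ⟨C1, R1, h1, h1', H1⟩ := exists_isLocalised_levelFun hW.gen_φ hW.gen_φL hW.gen_φR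
  obtain ⟨C2, R2, h2, h2', H2⟩ := exists_isLocalised_levelFun hW.gen_ψ hW.gen_ψL hW.gen_ψR
  exact ⟨max 1 (max C1 C2), max R1 R2, by simp, by positivity,
    IsLocalised.mono H1 (by simp) (by simp), IsLocalised.mono H2 (by simp) (by simp)⟩

end BoundaryWavelets.IsCDVBasis

/-! ### Bounded measurable functions -/

/-- Bounded measurable real functions; they are integrable for every finite measure. -/
def IsBddMeas {Ω : Type*} [MeasurableSpace Ω] (f : Ω → ℝ) : Prop :=
  Measurable f ∧ ∃ C : ℝ, ∀ x, |f x| ≤ C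

namespace IsBddMeas

variable {Ω Ω' : Type*} [MeasurableSpace Ω] [MeasurableSpace Ω'] {f g : Ω → ℝ}

lemma const (c : ℝ) : IsBddMeas (fun _ : Ω => c) := ⟨measurable_const, |c|, fun _ => le_rfl⟩

lemma add (hf : IsBddMeas f) (hg : IsBddMeas g) : IsBddMeas (fun x => f x + g x) := by
  obtain ⟨hf, C, hC⟩ := hf
  obtain ⟨hg, D, hD⟩ := hg
  exact ⟨hf.add hg, C + D, fun x => (abs_add_le _ _).trans (add_le_add (hC x) (hD x))⟩

lemma neg (hf : IsBddMeas f) : IsBddMeas (fun x => -f x) :=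
  ⟨hf.1.neg, hf.2.imp fun C hC x => by rw [abs_neg]; exact hC x⟩

lemma sub (hf : IsBddMeas f) (hg : IsBddMeas g) : IsBddMeas (fun x => f x - g x) := by
  simpa only [sub_eq_add_neg] using hf.add hg.neg

lemma mul (hf : IsBddMeas f) (hg : IsBddMeas g) : IsBddMeas (fun x => f x * g x) := by
  obtain ⟨hf, C, hC⟩ := hf
  obtain ⟨hg, D, hD⟩ := hg
  refine ⟨hf.mul hg, C * D, fun x => ?_⟩
  rw [abs_mul]
  exact mul_le_mul (hC x) (hD x) (abs_nonneg _) ((abs_nonneg _).trans (hC x))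

lemma const_mul (c : ℝ) (hf : IsBddMeas f) : IsBddMeas (fun x => c * f x) := (const c).mul hf

lemma pow (hf : IsBddMeas f) (n : ℕ) : IsBddMeas (fun x => f x ^ n) := by
  induction n with
  | zero => simpa using const 1
  | succ n ih => simpa only [pow_succ] using ih.mul hf

lemma abs (hf : IsBddMeas f) : IsBddMeas (fun x => |f x|) :=
  ⟨hf.1.abs, hf.2.imp fun C hC x => by rw [abs_abs]; exact hC x⟩

lemma sum {ι : Type*} (s : Finset ι) {F : ι → Ω → ℝ} (h : ∀ i ∈ s, IsBddMeas (F i)) :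
    IsBddMeas (fun x => ∑ i ∈ s, F i x) := by
  classical
  induction s using Finset.induction_on with
  | empty => simpa using const 0
  | insert a s ha ih =>
    simp only [Finset.sum_insert ha]
    exact (h a (by simp)).add (ih fun i hi => h i (by simp [hi]))

lemma prod {ι : Type*} (s : Finset ι) {F : ι → Ω → ℝ} (h : ∀ i ∈ s, IsBddMeas (F i)) :
    IsBddMeas (fun x => ∏ i ∈ s, F i x) := by
  classical
  induction s using Finset.induction_on with
  | empty => simpa using const 1
  | insert a s ha ih =>
    simp only [Finset.prod_insert ha]
    exact (h a (by simp)).mul (ih fun i hi => h i (by simp [hi]))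

lemma comp (hf : IsBddMeas f) {φ : Ω' → Ω} (hφ : Measurable φ) :
    IsBddMeas (fun x => f (φ x)) := ⟨hf.1.comp hφ, hf.2.imp fun _ hC x => hC (φ x)⟩

lemma integrable (hf : IsBddMeas f) (ν : Measure Ω) [IsFiniteMeasure ν] : Integrable f ν := by
  obtain ⟨hm, C, hC⟩ := hf
  exact Integrable.of_bound hm.aestronglyMeasurable C (Filter.Eventually.of_forall hC)

lemma indicator (hf : IsBddMeas f) {s : Set Ω} (hs : MeasurableSet s) :
    IsBddMeas (s.indicator f) := by
  obtain ⟨hm, C, hC⟩ := hf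
  refine ⟨hm.indicator hs, C, fun x => ?_⟩
  by_cases h : x ∈ s
  · simpa [h] using hC x
  · simpa [h] using (abs_nonneg _).trans (hC x)

lemma integral_param {F : Ω → Ω' → ℝ} (hF : IsBddMeas fun z : Ω × Ω' => F z.1 z.2)
    (ν : Measure Ω') [IsProbabilityMeasure ν] : IsBddMeas (fun x => ∫ y, F x y ∂ν) := by
  obtain ⟨hm, C, hC⟩ := hF
  refine ⟨hm.stronglyMeasurable.integral_prod_right.measurable, C, fun x => ?_⟩
  have h : ∀ y, ‖F x y‖ ≤ C := fun y => hC (x, y)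
  exact (norm_integral_le_of_norm_le_const (Filter.Eventually.of_forall h)).trans (by simp)

lemma section_left {F : Ω → Ω' → ℝ} (hF : IsBddMeas fun z : Ω × Ω' => F z.1 z.2) (x : Ω) :
    IsBddMeas (F x) := hF.comp measurable_prodMk_left

lemma section_right {F : Ω → Ω' → ℝ} (hF : IsBddMeas fun z : Ω × Ω' => F z.1 z.2) (y : Ω') :
    IsBddMeas (fun x => F x y) := hF.comp measurable_prodMk_right

lemma swap {F : Ω → Ω' → ℝ} (hF : IsBddMeas fun z : Ω × Ω' => F z.1 z.2) :
    IsBddMeas fun z : Ω' × Ω => F z.2 z.1 := hF.comp measurable_swap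

lemma integral_param_right {F : Ω → Ω' → ℝ} (hF : IsBddMeas fun z : Ω × Ω' => F z.1 z.2)
    (ν : Measure Ω) [IsProbabilityMeasure ν] : IsBddMeas (fun y => ∫ x, F x y ∂ν) :=
  integral_param (F := fun y x => F x y) hF.swap ν

lemma integral_comm {F : Ω → Ω' → ℝ} (hF : IsBddMeas fun z : Ω × Ω' => F z.1 z.2)
    (ν : Measure Ω) (ν' : Measure Ω') [IsProbabilityMeasure ν] [IsProbabilityMeasure ν'] :
    ∫ x, ∫ y, F x y ∂ν' ∂ν = ∫ y, ∫ x, F x y ∂ν ∂ν' :=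
  integral_integral_swap (hF.integrable _)

end IsBddMeas

lemma IsLocalised.isBddMeas {F : ∀ j : ℕ, Fin (2 ^ j) → ℝ → ℝ} {C R : ℝ}
    (h : IsLocalised F C R) (j : ℕ) (m : Fin (2 ^ j)) : IsBddMeas (F j m) :=
  ⟨h.meas j m, _, h.bound j m⟩

/-! ### The multiresolution analysis on the interval -/

namespace BoundaryWavelets.IsCDVBasis

variable {S : ℕ} {W : BoundaryWavelets S} {J₀ : ℕ}

lemma isBddMeas_scal (hW : W.IsCDVBasis J₀) (j : ℕ) (m : Fin (2 ^ j)) :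
    IsBddMeas (W.scal j m) := by
  obtain ⟨C, R, -, -, h, -⟩ := hW.exists_isLocalised
  exact h.isBddMeas j m

lemma isBddMeas_wav (hW : W.IsCDVBasis J₀) (j : ℕ) (m : Fin (2 ^ j)) :
    IsBddMeas (W.wav j m) := by
  obtain ⟨C, R, -, -, -, h⟩ := hW.exists_isLocalised
  exact h.isBddMeas j m

lemma integral_lincomb_mul {N : ℕ} {F : Fin N → ℝ → ℝ} (hF : ∀ i, IsBddMeas (F i))
    {g h : ℝ → ℝ} (hh : IsBddMeas h) {c : Fin N → ℝ}
    (hg : g =ᵐ[unitVol] fun x => ∑ i, c i * F i x) :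
    ∫ x, g x * h x ∂unitVol = ∑ i, c i * ∫ x, F i x * h x ∂unitVol := by
  have : (fun x => g x * h x) =ᵐ[unitVol] fun x => ∑ i, c i * (F i x * h x) := by
    filter_upwards [hg] with x hx
    rw [hx, Finset.sum_mul]
    exact Finset.sum_congr rfl fun i _ => by ring
  rw [integral_congr_ae this, integral_finsetSum _ fun i _ =>
    ((((hF i).mul hh).const_mul (c i)).integrable _)]
  exact Finset.sum_congr rfl fun i _ => integral_const_mul _ _

/-- Wavelets have `S` vanishing moments. -/
lemma integral_pow_mul_wav (hW : W.IsCDVBasis J₀) {l : ℕ} (hl : J₀ ≤ l) (m : Fin (2 ^ l))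
    {r : ℕ} (hr : r < S) : ∫ x, x ^ r * W.wav l m x ∂unitVol = 0 := by
  obtain ⟨c, hc⟩ := hW.poly_mem l hl r hr
  rw [integral_lincomb_mul (hW.isBddMeas_scal l) (hW.isBddMeas_wav l m) hc]
  exact Finset.sum_eq_zero fun i _ => by rw [hW.scal_wav l hl, mul_zero]

lemma scal_mem_of_le (hW : W.IsCDVBasis J₀) {j l : ℕ} (hj : J₀ ≤ j) (hjl : j ≤ l)
    (m : Fin (2 ^ j)) : ∃ c : Fin (2 ^ l) → ℝ,
      W.scal j m =ᵐ[unitVol] fun x => ∑ i, c i * W.scal l i x := by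
  induction l, hjl using Nat.le_induction with
  | base => exact ⟨fun i => if i = m then 1 else 0, by simp⟩
  | succ l hl ih =>
    obtain ⟨c, hc⟩ := ih
    choose b hb using hW.scal_refine l (hj.trans hl)
    refine ⟨fun k => ∑ i, c i * b i k, ?_⟩
    filter_upwards [hc, ae_all_iff.mpr hb] with x hx hbx
    rw [hx]
    simp only [hbx, Finset.mul_sum, Finset.sum_mul, mul_assoc]
    exact Finset.sum_comm

lemma integral_scal_mul_wav (hW : W.IsCDVBasis J₀) {j l : ℕ} (hj : J₀ ≤ j) (hjl : j ≤ l)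
    (m : Fin (2 ^ j)) (m' : Fin (2 ^ l)) : ∫ x, W.scal j m x * W.wav l m' x ∂unitVol = 0 := by
  obtain ⟨c, hc⟩ := hW.scal_mem_of_le hj hjl m
  rw [integral_lincomb_mul (hW.isBddMeas_scal l) (hW.isBddMeas_wav l m') hc]
  exact Finset.sum_eq_zero fun i _ => by rw [hW.scal_wav l (hj.trans hjl), mul_zero]

/-- `V_{l+1} = V_l ⊕ W_l` in terms of the kernels: the `2 ^ (l + 1)` scaling functions and wavelets
of level `l` are orthonormal in the space `V_{l+1}`, which has dimension `2 ^ (l + 1)`, so their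
coefficient matrix is square with orthonormal rows, hence orthogonal. -/
lemma exists_kernel_succ (hW : W.IsCDVBasis J₀) {l : ℕ} (hl : J₀ ≤ l) :
    ∃ G : Set ℝ, (∀ᵐ s ∂unitVol, s ∈ G) ∧ ∀ s ∈ G, ∀ t ∈ G,
      ∑ i, W.scal (l + 1) i s * W.scal (l + 1) i t
        = ∑ m, W.scal l m s * W.scal l m t + ∑ m, W.wav l m s * W.wav l m t := by
  choose b hb using hW.scal_refine l hl
  choose c hc using hW.wav_refine l hl
  refine ⟨{s | (∀ m, W.scal l m s = ∑ i, b m i * W.scal (l + 1) i s) ∧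
    ∀ m, W.wav l m s = ∑ i, c m i * W.scal (l + 1) i s}, ?_, ?_⟩
  · filter_upwards [ae_all_iff.mpr hb, ae_all_iff.mpr hc] with s h1 h2 using ⟨h1, h2⟩
  set B : Matrix (Fin (2 ^ l) ⊕ Fin (2 ^ l)) (Fin (2 ^ (l + 1))) ℝ := fun r i => Sum.elim b c r i
  have hl1 : J₀ ≤ l + 1 := hl.trans (Nat.le_succ l)
  have key : ∀ (f g : ℝ → ℝ) (u v : Fin (2 ^ (l + 1)) → ℝ), IsBddMeas g →
      (f =ᵐ[unitVol] fun x => ∑ i, u i * W.scal (l + 1) i x) →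
      (g =ᵐ[unitVol] fun x => ∑ i, v i * W.scal (l + 1) i x) →
      ∫ x, f x * g x ∂unitVol = ∑ i, u i * v i := by
    intro f g u v hg hf' hg'
    rw [integral_lincomb_mul (hW.isBddMeas_scal _) hg hf']
    refine Finset.sum_congr rfl fun i _ => ?_
    congr 1
    rw [show (fun x => W.scal (l + 1) i x * g x) = fun x => g x * W.scal (l + 1) i x from
      funext fun x => mul_comm _ _,
      integral_lincomb_mul (hW.isBddMeas_scal _) (hW.isBddMeas_scal _ _) hg']
    simp [hW.scal_orthonormal _ hl1]
  have hBB : B * B.transpose = 1 := by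
    ext r r'
    rw [Matrix.mul_apply, Matrix.one_apply]
    simp only [Matrix.transpose_apply]
    simp only [B]
    rcases r with m | m <;> rcases r' with m' | m'
    · simpa [hW.scal_orthonormal l hl] using
        (key _ _ _ _ (hW.isBddMeas_scal l m') (hb m) (hb m')).symm
    · simpa [hW.scal_wav l hl] using (key _ _ _ _ (hW.isBddMeas_wav l m') (hb m) (hc m')).symm
    · have h1 := (key _ _ _ _ (hW.isBddMeas_wav l m) (hb m') (hc m)).symm
      rw [hW.scal_wav l hl] at h1
      simpa [mul_comm] using h1
    · simpa [hW.wav_orthonormal l hl] using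
        (key _ _ _ _ (hW.isBddMeas_wav l m') (hc m) (hc m')).symm
  have hcard : Fintype.card (Fin (2 ^ l) ⊕ Fin (2 ^ l)) = Fintype.card (Fin (2 ^ (l + 1))) := by
    simp [pow_succ, mul_two]
  have hBB' : B.transpose * B = 1 := (Matrix.mul_eq_one_comm_of_card_eq _ _ _ hcard).mp hBB
  rintro s ⟨h1, h2⟩ t ⟨h3, h4⟩
  have hr : ∑ m, W.scal l m s * W.scal l m t + ∑ m, W.wav l m s * W.wav l m t
      = ∑ r, (∑ i, B r i * W.scal (l + 1) i s) * (∑ k, B r k * W.scal (l + 1) k t) := by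
    rw [Fintype.sum_sum_type]
    congr 1
    · exact Finset.sum_congr rfl fun m _ => by rw [h1, h3]; rfl
    · exact Finset.sum_congr rfl fun m _ => by rw [h2, h4]; rfl
  rw [hr]
  have hik : ∀ i k, ∑ r, B r i * B r k = if i = k then 1 else 0 := fun i k => by
    simpa [Matrix.mul_apply, Matrix.one_apply] using congrFun (congrFun hBB' i) k
  calc ∑ i, W.scal (l + 1) i s * W.scal (l + 1) i t
      = ∑ i, ∑ k, (∑ r, B r i * B r k) * (W.scal (l + 1) i s * W.scal (l + 1) k t) := by
        simp [hik]
    _ = ∑ r, ∑ i, ∑ k, B r i * B r k * (W.scal (l + 1) i s * W.scal (l + 1) k t) := by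
        simp only [Finset.sum_mul]
        exact (Finset.sum_congr rfl fun i _ => Finset.sum_comm).trans Finset.sum_comm
    _ = _ := by
        refine Finset.sum_congr rfl fun r _ => ?_
        rw [Finset.sum_mul_sum]
        exact Finset.sum_congr rfl fun i _ => Finset.sum_congr rfl fun k _ => by ring

/-- The projections reproduce constants. -/
lemma ae_sum_integral_scal (hW : W.IsCDVBasis J₀) {j : ℕ} (hj : J₀ ≤ j) :
    ∀ᵐ s ∂unitVol, ∑ m, (∫ t, W.scal j m t ∂unitVol) * W.scal j m s = 1 := by
  obtain ⟨c, hc⟩ := hW.poly_mem j hj 0 hW.one_le_S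
  have h : ∀ m, ∫ t, W.scal j m t ∂unitVol = c m := fun m => by
    have := integral_lincomb_mul (hW.isBddMeas_scal j) (hW.isBddMeas_scal j m) hc
    simpa [hW.scal_orthonormal j hj] using this
  filter_upwards [hc] with s hs
  simp only [h, ← hs, pow_zero]

/-- The projection kernel is of order `2 ^ j` on the diagonal. -/
lemma exists_le_sum_scal_sq (hW : W.IsCDVBasis J₀) : ∃ c : ℝ, 0 < c ∧ ∀ j, J₀ ≤ j →
    ∀ᵐ s ∂unitVol, c * 2 ^ j ≤ ∑ m, W.scal j m s ^ 2 := by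
  classical
  obtain ⟨C, R, hC, hR, h, -⟩ := hW.exists_isLocalised
  have hC0 : 0 < C := by linarith
  refine ⟨1 / C ^ 3, by positivity, fun j hj => ?_⟩
  filter_upwards [hW.ae_sum_integral_scal hj] with s hs
  set T := Finset.univ.filter fun m => W.scal j m s ≠ 0
  have hI : ∀ m, |∫ t, W.scal j m t ∂unitVol| ≤ C / sqrtTwoPow j := fun m => by
    rw [le_div_iff₀ (sqrtTwoPow_pos j)]
    exact (mul_le_mul_of_nonneg_right (abs_integral_le_integral_abs) (sqrtTwoPow_pos j).le).trans
      (h.integral_abs j m)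
  have h1 : ∑ m ∈ T, (∫ t, W.scal j m t ∂unitVol) * W.scal j m s = 1 := by
    rw [← hs, Finset.sum_filter]
    exact Finset.sum_congr rfl fun m _ => by split_ifs with h0 <;> simp_all
  have h2 := Finset.sum_mul_sq_le_sq_mul_sq T (fun m => ∫ t, W.scal j m t ∂unitVol)
    (fun m => W.scal j m s)
  rw [h1, one_pow] at h2
  have h3 : ∑ m ∈ T, (∫ t, W.scal j m t ∂unitVol) ^ 2 ≤ C * (C / sqrtTwoPow j) ^ 2 := by
    refine (Finset.sum_le_card_nsmul T _ ((C / sqrtTwoPow j) ^ 2) fun m _ => ?_).trans ?_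
    · rw [← sq_abs]; gcongr; exact hI m
    · rw [nsmul_eq_mul]
      gcongr
      convert h.card j s using 2
  have h4 : ∑ m ∈ T, W.scal j m s ^ 2 ≤ ∑ m, W.scal j m s ^ 2 :=
    Finset.sum_le_sum_of_subset_of_nonneg (Finset.filter_subset _ _) fun _ _ _ => sq_nonneg _
  have h5 : (1 : ℝ) ≤ C * (C / sqrtTwoPow j) ^ 2 * ∑ m, W.scal j m s ^ 2 :=
    h2.trans (mul_le_mul h3 h4 (Finset.sum_nonneg fun _ _ => sq_nonneg _) (by positivity))
  have h6 : (C / sqrtTwoPow j) ^ 2 = C ^ 2 / 2 ^ j := by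
    rw [div_pow, sq (sqrtTwoPow j), sqrtTwoPow_mul_self]
  rw [h6] at h5
  have h7 : C * (C ^ 2 / 2 ^ j) * ∑ m, W.scal j m s ^ 2
      = C ^ 3 / 2 ^ j * ∑ m, W.scal j m s ^ 2 := by
    ring
  rw [h7, div_mul_eq_mul_div, le_div_iff₀ (by positivity)] at h5
  rw [one_div, inv_mul_le_iff₀ (by positivity)]
  linarith

end BoundaryWavelets.IsCDVBasis

/-! ### Tensor product wavelets and projections on the cube -/

/-- Lebesgue measure on `[0,1]^d`. -/
noncomputable abbrev cubeVol (d : ℕ) : Measure (Fin d → ℝ) := volume.restrict (Icc 0 1)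

lemma cubeVol_eq_pi (d : ℕ) : cubeVol d = Measure.pi fun _ : Fin d => unitVol := by
  rw [cubeVol, ← Set.pi_univ_Icc, volume_pi, Measure.restrict_pi_pi]
  rfl

instance (d : ℕ) : IsProbabilityMeasure (cubeVol d) := by
  rw [cubeVol_eq_pi]; infer_instance

lemma integral_cubeVol_prod {d : ℕ} (f : Fin d → ℝ → ℝ) :
    ∫ x, ∏ i, f i (x i) ∂cubeVol d = ∏ i, ∫ t, f i t ∂unitVol := by
  rw [cubeVol_eq_pi]
  exact integral_fintype_prod_eq_prod f

lemma ae_cubeVol_of_ae {d : ℕ} {p : ℝ → Prop} (h : ∀ᵐ s ∂unitVol, p s) :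
    ∀ᵐ x ∂cubeVol d, ∀ i, p (x i) := by
  rw [cubeVol_eq_pi, ae_all_iff]
  intro i
  exact (measurePreserving_eval (fun _ : Fin d => unitVol) i).quasiMeasurePreserving.ae h

namespace BoundaryWavelets

variable {S : ℕ} (W : BoundaryWavelets S) {d : ℕ}

/-- The univariate factors of the tensor product wavelets. -/
noncomputable def factor (b : Bool) (l : ℕ) (m : Fin (2 ^ l)) (t : ℝ) : ℝ :=
  if b then W.wav l m t else W.scal l m t

lemma Psi_eq_prod (ι : Fin d → Bool) (l : ℕ) (m : Fin d → Fin (2 ^ l)) (x : Fin d → ℝ) :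
    W.Psi ι l m x = ∏ i, W.factor (ι i) l (m i) (x i) := rfl

lemma Phi_eq_Psi (l : ℕ) (m : Fin d → Fin (2 ^ l)) :
    W.Phi l m = W.Psi (fun _ => false) l m := by
  funext x; simp [Phi, Psi]

lemma kernel_comm (j : ℕ) (x y : Fin d → ℝ) : W.kernel j x y = W.kernel j y x :=
  Finset.sum_congr rfl fun _ _ => mul_comm _ _

lemma kernel_eq_prod (j : ℕ) (x y : Fin d → ℝ) :
    W.kernel j x y = ∏ i, ∑ m, W.scal j m (x i) * W.scal j m (y i) := by
  rw [Finset.prod_univ_sum, Fintype.piFinset_univ]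
  simp only [kernel, Phi, Finset.prod_mul_distrib]

lemma sum_Psi_mul_Psi (ι : Fin d → Bool) (l : ℕ) (x y : Fin d → ℝ) :
    ∑ m, W.Psi ι l m x * W.Psi ι l m y
      = ∏ i, ∑ m, W.factor (ι i) l m (x i) * W.factor (ι i) l m (y i) := by
  rw [Finset.prod_univ_sum, Fintype.piFinset_univ]
  simp only [Psi_eq_prod, Finset.prod_mul_distrib]

/-- The projection of `g` onto `V_j`. -/
noncomputable def proj (j : ℕ) (g : (Fin d → ℝ) → ℝ) (x : Fin d → ℝ) : ℝ :=
  ∫ y, g y * W.kernel j y x ∂cubeVol d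

namespace IsCDVBasis

variable {W} {J₀ : ℕ}

lemma exists_isLocalised_factor (hW : W.IsCDVBasis J₀) : ∃ C R : ℝ, 1 ≤ C ∧ 0 < R ∧
    ∀ b, IsLocalised (W.factor b) C R := by
  obtain ⟨C, R, hC, hR, h1, h2⟩ := hW.exists_isLocalised
  refine ⟨C, R, hC, hR, fun b => ?_⟩
  cases b
  · exact (show W.factor false = W.scal by funext l m t; simp [factor]) ▸ h1
  · exact (show W.factor true = W.wav by funext l m t; simp [factor]) ▸ h2

lemma isBddMeas_factor (hW : W.IsCDVBasis J₀) (b : Bool) (l : ℕ) (m : Fin (2 ^ l)) :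
    IsBddMeas (W.factor b l m) := by
  obtain ⟨C, R, -, -, h⟩ := hW.exists_isLocalised_factor
  exact (h b).isBddMeas l m

lemma isBddMeas_Psi (hW : W.IsCDVBasis J₀) (ι : Fin d → Bool) (l : ℕ)
    (m : Fin d → Fin (2 ^ l)) : IsBddMeas (W.Psi ι l m) :=
  IsBddMeas.prod _ fun i _ => (hW.isBddMeas_factor (ι i) l (m i)).comp (measurable_pi_apply i)

lemma isBddMeas_Phi (hW : W.IsCDVBasis J₀) (l : ℕ) (m : Fin d → Fin (2 ^ l)) :
    IsBddMeas (W.Phi l m) := by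
  rw [Phi_eq_Psi]; exact hW.isBddMeas_Psi _ l m

lemma isBddMeas_kernel (hW : W.IsCDVBasis J₀) (j : ℕ) :
    IsBddMeas fun z : (Fin d → ℝ) × (Fin d → ℝ) => W.kernel j z.1 z.2 :=
  IsBddMeas.sum _ fun m _ =>
    ((hW.isBddMeas_Phi j m).comp measurable_fst).mul ((hW.isBddMeas_Phi j m).comp measurable_snd)

lemma integral_Psi_mul_Psi (ι ι' : Fin d → Bool) (l l' : ℕ)
    (m : Fin d → Fin (2 ^ l)) (m' : Fin d → Fin (2 ^ l')) :
    ∫ x, W.Psi ι l m x * W.Psi ι' l' m' x ∂cubeVol d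
      = ∏ i, ∫ t, W.factor (ι i) l (m i) t * W.factor (ι' i) l' (m' i) t ∂unitVol := by
  simp only [Psi_eq_prod, ← Finset.prod_mul_distrib]
  exact integral_cubeVol_prod fun i t => W.factor (ι i) l (m i) t * W.factor (ι' i) l' (m' i) t

lemma integral_Phi_mul_Phi (hW : W.IsCDVBasis J₀) {j : ℕ} (hj : J₀ ≤ j)
    (m m' : Fin d → Fin (2 ^ j)) :
    ∫ x, W.Phi j m x * W.Phi j m' x ∂cubeVol d = if m = m' then 1 else 0 := by
  rw [Phi_eq_Psi, Phi_eq_Psi, integral_Psi_mul_Psi]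
  simp only [factor, Bool.false_eq_true, if_false, hW.scal_orthonormal j hj]
  rw [Finset.prod_ite_zero]
  simp [funext_iff]

lemma integral_Phi_mul_Psi (hW : W.IsCDVBasis J₀) {j l : ℕ} (hj : J₀ ≤ j) (hjl : j ≤ l)
    (m : Fin d → Fin (2 ^ j)) (m' : Fin d → Fin (2 ^ l)) {ι : Fin d → Bool}
    (hι : ∃ i, ι i = true) : ∫ x, W.Phi j m x * W.Psi ι l m' x ∂cubeVol d = 0 := by
  obtain ⟨i, hi⟩ := hι
  rw [Phi_eq_Psi, integral_Psi_mul_Psi]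
  refine Finset.prod_eq_zero (Finset.mem_univ i) ?_
  simpa [factor, hi] using hW.integral_scal_mul_wav hj hjl (m i) (m' i)

/-- The Hölder regularity enters through the size of the wavelet coefficients; this is the bound
on the sum of the wavelets of one level that turns it into a uniform bound. -/
lemma exists_sum_abs_Psi_le (hW : W.IsCDVBasis J₀) (d : ℕ) : ∃ C : ℝ, 1 ≤ C ∧
    (∀ (ι : Fin d → Bool) l x, ∑ m, |W.Psi ι l m x| ≤ C * sqrtTwoPow l ^ d) ∧
    ∀ (ι : Fin d → Bool) l m, (∫ x, |W.Psi ι l m x| ∂cubeVol d) * sqrtTwoPow l ^ d ≤ C := by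
  obtain ⟨C, R, hC, hR, h⟩ := hW.exists_isLocalised_factor
  refine ⟨C ^ d, one_le_pow₀ hC, fun ι l x => ?_, fun ι l m => ?_⟩
  · calc ∑ m, |W.Psi ι l m x| = ∏ i, ∑ m, |W.factor (ι i) l m (x i)| := by
          rw [Finset.prod_univ_sum, Fintype.piFinset_univ]
          simp only [Psi_eq_prod, Finset.abs_prod]
      _ ≤ ∏ _i : Fin d, C * sqrtTwoPow l :=
          Finset.prod_le_prod (fun i _ => Finset.sum_nonneg fun _ _ => abs_nonneg _)
            fun i _ => (h (ι i)).sum_abs l (x i)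
      _ = _ := by simp [mul_pow]
  · simp only [Psi_eq_prod, Finset.abs_prod]
    rw [integral_cubeVol_prod fun i t => |W.factor (ι i) l (m i) t|]
    calc (∏ i, ∫ t, |W.factor (ι i) l (m i) t| ∂unitVol) * sqrtTwoPow l ^ d
        = ∏ i, (∫ t, |W.factor (ι i) l (m i) t| ∂unitVol) * sqrtTwoPow l := by
          simp [Finset.prod_mul_distrib]
      _ ≤ ∏ _i : Fin d, C := Finset.prod_le_prod
            (fun i _ => mul_nonneg (integral_nonneg fun _ => abs_nonneg _) (sqrtTwoPow_pos l).le)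
            fun i _ => (h (ι i)).integral_abs l (m i)
      _ = C ^ d := by simp

lemma sqrtTwoPow_pow_mul_self (j d : ℕ) :
    sqrtTwoPow j ^ d * sqrtTwoPow j ^ d = (2 : ℝ) ^ (j * d) := by
  rw [← mul_pow, sqrtTwoPow_mul_self, pow_mul]

/-- The scaling function kernels are bounded operators on `L^∞`, uniformly in the level. -/
lemma exists_kernel_bounds (hW : W.IsCDVBasis J₀) (d : ℕ) : ∃ C : ℝ, 1 ≤ C ∧
    (∀ j (x y : Fin d → ℝ), |W.kernel j x y| ≤ C * 2 ^ (j * d)) ∧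
    ∀ j (x : Fin d → ℝ), ∫ y, |W.kernel j y x| ∂cubeVol d ≤ C := by
  obtain ⟨C, hC, h1, h2⟩ := hW.exists_sum_abs_Psi_le d
  have hC0 : 0 ≤ C := by linarith
  refine ⟨C * C, by nlinarith, fun j x y => ?_, fun j x => ?_⟩
  · calc |W.kernel j x y| ≤ ∑ m, |W.Phi j m x * W.Phi j m y| := Finset.abs_sum_le_sum_abs _ _
      _ ≤ ∑ m, |W.Phi j m x| * ∑ m', |W.Phi j m' y| := Finset.sum_le_sum fun m _ => by
          rw [abs_mul]
          exact mul_le_mul_of_nonneg_left (Finset.single_le_sum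
            (f := fun m' => |W.Phi j m' y|) (fun _ _ => abs_nonneg _) (Finset.mem_univ m))
            (abs_nonneg _)
      _ = (∑ m, |W.Phi j m x|) * ∑ m', |W.Phi j m' y| := by rw [Finset.sum_mul]
      _ ≤ (C * sqrtTwoPow j ^ d) * (C * sqrtTwoPow j ^ d) := by
          simp only [Phi_eq_Psi]
          exact mul_le_mul (h1 _ j x) (h1 _ j y) (Finset.sum_nonneg fun _ _ => abs_nonneg _)
            (by have := sqrtTwoPow_pos j; positivity)
      _ = _ := by rw [← sqrtTwoPow_pow_mul_self]; ring
  · have hp : 0 < sqrtTwoPow j ^ d := pow_pos (sqrtTwoPow_pos j) d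
    calc ∫ y, |W.kernel j y x| ∂cubeVol d
        ≤ ∫ y, ∑ m, |W.Phi j m y| * |W.Phi j m x| ∂cubeVol d := by
          refine integral_mono ((hW.isBddMeas_kernel j).section_right x |>.abs.integrable _)
            ((IsBddMeas.sum _ fun m _ => (hW.isBddMeas_Phi j m).abs.mul (.const _)).integrable _)
            fun y => ?_
          simp only [← abs_mul]
          exact Finset.abs_sum_le_sum_abs _ _
      _ = ∑ m, (∫ y, |W.Phi j m y| ∂cubeVol d) * |W.Phi j m x| := by
          rw [integral_finsetSum _ fun m _ =>
            ((hW.isBddMeas_Phi j m).abs.mul (.const _)).integrable _]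
          exact Finset.sum_congr rfl fun m _ => integral_mul_const _ _
      _ ≤ ∑ m, C / sqrtTwoPow j ^ d * |W.Phi j m x| := Finset.sum_le_sum fun m _ => by
          refine mul_le_mul_of_nonneg_right ?_ (abs_nonneg _)
          rw [le_div_iff₀ hp, Phi_eq_Psi]
          exact h2 _ j m
      _ = C / sqrtTwoPow j ^ d * ∑ m, |W.Phi j m x| := by rw [Finset.mul_sum]
      _ ≤ C / sqrtTwoPow j ^ d * (C * sqrtTwoPow j ^ d) := by
          simp only [Phi_eq_Psi]
          exact mul_le_mul_of_nonneg_left (h1 _ j x) (by positivity)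
      _ = C * C := by field_simp

lemma integral_kernel_mul_kernel (hW : W.IsCDVBasis J₀) {j : ℕ} (hj : J₀ ≤ j)
    (x y : Fin d → ℝ) :
    ∫ z, W.kernel j x z * W.kernel j z y ∂cubeVol d = W.kernel j x y := by
  have h : ∀ z, W.kernel j x z * W.kernel j z y
      = ∑ m, ∑ m', W.Phi j m x * W.Phi j m' y * (W.Phi j m z * W.Phi j m' z) := fun z => by
    simp only [kernel]
    rw [Finset.sum_mul_sum]
    exact Finset.sum_congr rfl fun m _ => Finset.sum_congr rfl fun m' _ => by ring
  have hb : ∀ m m', IsBddMeas fun z => W.Phi j m x * W.Phi j m' y * (W.Phi j m z * W.Phi j m' z) :=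
    fun m m' => ((hW.isBddMeas_Phi j m).mul (hW.isBddMeas_Phi j m')).const_mul _
  simp only [h]
  rw [integral_finsetSum _ fun m _ => (IsBddMeas.sum _ fun m' _ => hb m m').integrable _]
  refine Finset.sum_congr rfl fun m _ => ?_
  rw [integral_finsetSum _ fun m' _ => (hb m m').integrable _]
  simp only [integral_const_mul, hW.integral_Phi_mul_Phi hj]
  simp

lemma integral_kernel_sq (hW : W.IsCDVBasis J₀) {j : ℕ} (hj : J₀ ≤ j) (x : Fin d → ℝ) :
    ∫ y, W.kernel j y x ^ 2 ∂cubeVol d = W.kernel j x x := by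
  rw [← hW.integral_kernel_mul_kernel hj x x]
  refine integral_congr_ae (Filter.Eventually.of_forall fun y => ?_)
  simp only [sq]
  rw [W.kernel_comm j x y]

lemma exists_le_kernel_diag (hW : W.IsCDVBasis J₀) (d : ℕ) : ∃ c : ℝ, 0 < c ∧ ∀ j, J₀ ≤ j →
    ∀ᵐ x ∂cubeVol d, c * 2 ^ (j * d) ≤ W.kernel j x x := by
  obtain ⟨c, hc, h⟩ := hW.exists_le_sum_scal_sq
  refine ⟨c ^ d, by positivity, fun j hj => ?_⟩
  filter_upwards [ae_cubeVol_of_ae (d := d) (h j hj)] with x hx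
  rw [kernel_eq_prod, pow_mul, ← mul_pow]
  calc (c * 2 ^ j) ^ d = ∏ _i : Fin d, c * 2 ^ j := by simp
    _ ≤ _ := Finset.prod_le_prod (fun _ _ => by positivity) fun i _ => by
      simpa only [sq] using hx i

lemma ae_integral_kernel (hW : W.IsCDVBasis J₀) {j : ℕ} (hj : J₀ ≤ j) :
    ∀ᵐ x ∂cubeVol d, ∫ y, W.kernel j y x ∂cubeVol d = 1 := by
  filter_upwards [ae_cubeVol_of_ae (d := d) (hW.ae_sum_integral_scal hj)] with x hx
  simp only [kernel_eq_prod]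
  rw [integral_cubeVol_prod fun i t => ∑ m, W.scal j m t * W.scal j m (x i)]
  refine Finset.prod_eq_one fun i _ => ?_
  rw [integral_finsetSum _ fun m _ => ((hW.isBddMeas_scal j m).mul (.const _)).integrable _]
  simpa only [integral_mul_const] using hx i

lemma exists_kernel_support (hW : W.IsCDVBasis J₀) : ∃ R : ℝ, 0 < R ∧
    ∀ {d : ℕ} j (x y : Fin d → ℝ), W.kernel j x y ≠ 0 → dist x y ≤ R / 2 ^ j := by
  obtain ⟨C, R, hC, hR, h, -⟩ := hW.exists_isLocalised
  refine ⟨2 * R, by positivity, fun {d} j x y hxy => ?_⟩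
  rw [dist_pi_le_iff (by positivity)]
  intro i
  rw [kernel_eq_prod] at hxy
  have h1 := Finset.prod_ne_zero_iff.mp hxy i (Finset.mem_univ i)
  obtain ⟨m, -, hm⟩ := Finset.exists_ne_zero_of_sum_ne_zero h1
  obtain ⟨t₀, ht⟩ := h.supp j m
  have h2 := ht _ (left_ne_zero_of_mul hm)
  have h3 := ht _ (right_ne_zero_of_mul hm)
  rw [Real.dist_eq]
  calc |x i - y i| = |(x i - t₀) - (y i - t₀)| := by ring_nf
    _ ≤ |x i - t₀| + |y i - t₀| := abs_sub _ _
    _ ≤ R / 2 ^ j + R / 2 ^ j := add_le_add h2 h3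
    _ = 2 * R / 2 ^ j := by ring

/-- The difference of consecutive projection kernels is the kernel of the wavelets of one level. -/
lemma exists_kernel_succ_sub (hW : W.IsCDVBasis J₀) {l : ℕ} (hl : J₀ ≤ l) :
    ∃ G : Set (Fin d → ℝ), (∀ᵐ x ∂cubeVol d, x ∈ G) ∧ ∀ x ∈ G, ∀ y ∈ G,
      W.kernel (l + 1) x y - W.kernel l x y
        = ∑ ι : Fin d → Bool, if ∃ i, ι i = true then ∑ m, W.Psi ι l m x * W.Psi ι l m y
          else 0 := by
  obtain ⟨G, hG, h⟩ := hW.exists_kernel_succ hl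
  refine ⟨{x | ∀ i, x i ∈ G}, ae_cubeVol_of_ae hG, fun x hx y hy => ?_⟩
  have h1 : W.kernel (l + 1) x y = ∑ ι : Fin d → Bool, ∑ m, W.Psi ι l m x * W.Psi ι l m y := by
    rw [kernel_eq_prod]
    calc _ = ∏ i, ∑ b : Bool, ∑ m, W.factor b l m (x i) * W.factor b l m (y i) := by
          refine Finset.prod_congr rfl fun i _ => ?_
          rw [h _ (hx i) _ (hy i), Fintype.sum_bool, add_comm]
          simp [factor]
      _ = _ := by
          rw [Finset.prod_univ_sum, Fintype.piFinset_univ]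
          exact Finset.sum_congr rfl fun ι _ => (W.sum_Psi_mul_Psi ι l x y).symm
  rw [h1, sub_eq_iff_eq_add]
  have h2 : W.kernel l x y = ∑ ι : Fin d → Bool, if ∃ i, ι i = true then 0
      else ∑ m, W.Psi ι l m x * W.Psi ι l m y := by
    rw [Finset.sum_eq_single (fun _ => false)]
    · simp [kernel, Phi_eq_Psi]
    · intro ι _ hι
      rw [if_pos]
      by_contra hcon
      exact hι (funext fun i => by simpa using not_exists.mp hcon i)
    · simp
  rw [h2, ← Finset.sum_add_distrib]
  exact Finset.sum_congr rfl fun ι _ => by split_ifs <;> simp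

end IsCDVBasis

end BoundaryWavelets

/-! ### Approximation by the projections -/

lemma abs_integral_le_of_abs_le {Ω : Type*} [MeasurableSpace Ω] {ν : Measure Ω} {f g : Ω → ℝ}
    (hg : Integrable g ν) (h : ∀ᵐ x ∂ν, |f x| ≤ g x) : |∫ x, f x ∂ν| ≤ ∫ x, g x ∂ν :=
  (Real.norm_eq_abs _).symm.le.trans (norm_integral_le_of_norm_le hg h)

namespace BoundaryWavelets.IsCDVBasis

variable {S : ℕ} {W : BoundaryWavelets S} {J₀ d : ℕ}

lemma isBddMeas_proj (hW : W.IsCDVBasis J₀) (j : ℕ) {g : (Fin d → ℝ) → ℝ} (hg : IsBddMeas g) :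
    IsBddMeas (W.proj j g) :=
  IsBddMeas.integral_param (F := fun x y => g y * W.kernel j y x)
    ((hg.comp measurable_snd).mul (hW.isBddMeas_kernel j).swap) _

lemma exists_abs_proj_le (hW : W.IsCDVBasis J₀) (d : ℕ) : ∃ C : ℝ, 1 ≤ C ∧
    ∀ j (g : (Fin d → ℝ) → ℝ) (B : ℝ), (∀ x, |g x| ≤ B) → ∀ x, |W.proj j g x| ≤ C * B := by
  obtain ⟨C, hC, -, h⟩ := hW.exists_kernel_bounds d
  refine ⟨C, hC, fun j g B hg x => ?_⟩
  have hB : 0 ≤ B := (abs_nonneg _).trans (hg x)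
  calc |W.proj j g x| ≤ ∫ y, B * |W.kernel j y x| ∂cubeVol d := by
        refine abs_integral_le_of_abs_le
          ((((hW.isBddMeas_kernel j).section_right x).abs.const_mul B).integrable (cubeVol d))
          (Filter.Eventually.of_forall fun y => ?_)
        rw [abs_mul]
        exact mul_le_mul_of_nonneg_right (hg y) (abs_nonneg _)
    _ = B * ∫ y, |W.kernel j y x| ∂cubeVol d := integral_const_mul _ _
    _ ≤ C * B := by rw [mul_comm]; exact mul_le_mul_of_nonneg_right (h j x) hB

lemma isBddMeas_mul_kernel (hW : W.IsCDVBasis J₀) (j : ℕ) {g : (Fin d → ℝ) → ℝ}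
    (hg : IsBddMeas g) (x : Fin d → ℝ) : IsBddMeas fun y => g y * W.kernel j y x :=
  hg.mul ((hW.isBddMeas_kernel j).section_right x)

lemma proj_sub (hW : W.IsCDVBasis J₀) (j : ℕ) {g h : (Fin d → ℝ) → ℝ} (hg : IsBddMeas g)
    (hh : IsBddMeas h) (x : Fin d → ℝ) :
    W.proj j (fun y => g y - h y) x = W.proj j g x - W.proj j h x := by
  unfold proj
  rw [← integral_sub ((hW.isBddMeas_mul_kernel j hg x).integrable _)
    ((hW.isBddMeas_mul_kernel j hh x).integrable _)]
  simp only [sub_mul]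

lemma integral_proj_mul (hW : W.IsCDVBasis J₀) (j : ℕ) {g h : (Fin d → ℝ) → ℝ}
    (hg : IsBddMeas g) (hh : IsBddMeas h) :
    ∫ x, W.proj j g x * h x ∂cubeVol d = ∫ x, g x * W.proj j h x ∂cubeVol d := by
  simp only [proj, ← integral_mul_const, ← integral_const_mul]
  rw [IsBddMeas.integral_comm (F := fun x y => g y * W.kernel j y x * h x)]
  · refine integral_congr_ae (Filter.Eventually.of_forall fun y => ?_)
    refine integral_congr_ae (Filter.Eventually.of_forall fun x => ?_)
    change g y * W.kernel j y x * h x = g y * (h x * W.kernel j x y)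
    rw [W.kernel_comm j x y]; ring
  · exact ((hg.comp measurable_snd).mul (hW.isBddMeas_kernel j).swap).mul (hh.comp measurable_fst)

lemma proj_proj (hW : W.IsCDVBasis J₀) {j : ℕ} (hj : J₀ ≤ j) {g : (Fin d → ℝ) → ℝ}
    (hg : IsBddMeas g) (x : Fin d → ℝ) : W.proj j (W.proj j g) x = W.proj j g x := by
  change ∫ y, W.proj j g y * W.kernel j y x ∂cubeVol d = _
  rw [hW.integral_proj_mul j hg ((hW.isBddMeas_kernel j).section_right x)]
  unfold proj
  refine integral_congr_ae (Filter.Eventually.of_forall fun y => ?_)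
  simp only
  rw [← hW.integral_kernel_mul_kernel hj y x]
  congr 1
  refine integral_congr_ae (Filter.Eventually.of_forall fun z => ?_)
  simp only
  rw [W.kernel_comm j y z, mul_comm]

/-- Projections are contractions of `L²`. -/
lemma integral_proj_sq_le (hW : W.IsCDVBasis J₀) {j : ℕ} (hj : J₀ ≤ j) {g : (Fin d → ℝ) → ℝ}
    (hg : IsBddMeas g) : ∫ x, W.proj j g x ^ 2 ∂cubeVol d ≤ ∫ x, g x ^ 2 ∂cubeVol d := by
  have hp := hW.isBddMeas_proj j hg
  have h1 : ∫ x, W.proj j g x ^ 2 ∂cubeVol d = ∫ x, g x * W.proj j g x ∂cubeVol d := by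
    simp only [sq]
    rw [hW.integral_proj_mul j hg hp]
    simp only [hW.proj_proj hj hg]
  have h2 : 0 ≤ ∫ x, (g x - W.proj j g x) ^ 2 ∂cubeVol d := integral_nonneg fun _ => sq_nonneg _
  have h3 : ∫ x, (g x - W.proj j g x) ^ 2 ∂cubeVol d = ∫ x, g x ^ 2 ∂cubeVol d
      - 2 * ∫ x, g x * W.proj j g x ∂cubeVol d + ∫ x, W.proj j g x ^ 2 ∂cubeVol d := by
    rw [← integral_const_mul, ← integral_sub ((hg.pow 2).integrable _)
      (((hg.mul hp).const_mul 2).integrable _), ← integral_add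
      (((hg.pow 2).sub ((hg.mul hp).const_mul 2)).integrable _) ((hp.pow 2).integrable _)]
    refine integral_congr_ae (Filter.Eventually.of_forall fun x => ?_)
    simp only; ring
  linarith

lemma proj_eq_sum (hW : W.IsCDVBasis J₀) (j : ℕ) {g : (Fin d → ℝ) → ℝ} (hg : IsBddMeas g)
    (x : Fin d → ℝ) :
    W.proj j g x = ∑ m, (∫ y, g y * W.Phi j m y ∂cubeVol d) * W.Phi j m x := by
  simp only [proj, kernel, Finset.mul_sum, ← mul_assoc]
  rw [integral_finsetSum _ fun m _ =>
    ((hg.mul (hW.isBddMeas_Phi j m)).mul (.const _)).integrable _]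
  simp only [integral_mul_const]

/-- One step of the wavelet expansion. -/
lemma ae_proj_succ_sub (hW : W.IsCDVBasis J₀) {l : ℕ} (hl : J₀ ≤ l) {g : (Fin d → ℝ) → ℝ}
    (hg : IsBddMeas g) : ∀ᵐ x ∂cubeVol d, W.proj (l + 1) g x - W.proj l g x
      = ∑ ι : Fin d → Bool, if ∃ i, ι i = true then
          ∑ m, (∫ y, g y * W.Psi ι l m y ∂cubeVol d) * W.Psi ι l m x else 0 := by
  obtain ⟨G, hG, h⟩ := hW.exists_kernel_succ_sub (d := d) hl
  filter_upwards [hG] with x hx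
  unfold proj
  rw [← integral_sub ((hW.isBddMeas_mul_kernel _ hg x).integrable _)
    ((hW.isBddMeas_mul_kernel _ hg x).integrable _)]
  have h1 : ∫ y, (g y * W.kernel (l + 1) y x - g y * W.kernel l y x) ∂cubeVol d
      = ∫ y, ∑ ι : Fin d → Bool, (if ∃ i, ι i = true then
          ∑ m, g y * W.Psi ι l m y * W.Psi ι l m x else 0) ∂cubeVol d := by
    refine integral_congr_ae ?_
    filter_upwards [hG] with y hy
    rw [← mul_sub, h y hy x hx, Finset.mul_sum]
    refine Finset.sum_congr rfl fun ι _ => ?_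
    split_ifs
    · rw [Finset.mul_sum]
      exact Finset.sum_congr rfl fun m _ => by ring
    · simp
  have hb : ∀ (ι : Fin d → Bool) m, IsBddMeas fun y => g y * W.Psi ι l m y * W.Psi ι l m x :=
    fun ι m => (hg.mul (hW.isBddMeas_Psi ι l m)).mul (.const _)
  rw [h1, integral_finsetSum]
  · refine Finset.sum_congr rfl fun ι _ => ?_
    split_ifs
    · rw [integral_finsetSum _ fun m _ => (hb ι m).integrable _]
      simp only [integral_mul_const]
    · simp
  · intro ι _
    split_ifs
    · exact (IsBddMeas.sum _ fun m _ => hb ι m).integrable _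
    · exact integrable_zero _ _ _

/-- The spaces are nested: projecting onto a finer one does not change the coefficients at level `j`. -/
lemma integral_Phi_mul_proj (hW : W.IsCDVBasis J₀) {j l : ℕ} (hj : J₀ ≤ j) (hjl : j ≤ l)
    {g : (Fin d → ℝ) → ℝ} (hg : IsBddMeas g) (m : Fin d → Fin (2 ^ j)) :
    ∫ x, W.Phi j m x * W.proj l g x ∂cubeVol d = ∫ x, W.Phi j m x * g x ∂cubeVol d := by
  have hΦ := hW.isBddMeas_Phi (d := d) j m
  induction l, hjl using Nat.le_induction with
  | base =>
    rw [← hW.integral_proj_mul j hΦ hg]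
    refine integral_congr_ae (Filter.Eventually.of_forall fun x => ?_)
    simp only
    rw [hW.proj_eq_sum j hΦ]
    simp [hW.integral_Phi_mul_Phi hj]
  | succ l hl ih =>
    rw [← ih, ← sub_eq_zero, ← integral_sub ((hΦ.mul (hW.isBddMeas_proj _ hg)).integrable _)
      ((hΦ.mul (hW.isBddMeas_proj _ hg)).integrable _)]
    have hb : ∀ (ι : Fin d → Bool) m', IsBddMeas fun x =>
        (∫ y, g y * W.Psi ι l m' y ∂cubeVol d) * (W.Phi j m x * W.Psi ι l m' x) :=
      fun ι m' => (hΦ.mul (hW.isBddMeas_Psi ι l m')).const_mul _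
    have h1 : ∫ x, (W.Phi j m x * W.proj (l + 1) g x - W.Phi j m x * W.proj l g x) ∂cubeVol d
        = ∫ x, ∑ ι : Fin d → Bool, (if ∃ i, ι i = true then
          ∑ m', (∫ y, g y * W.Psi ι l m' y ∂cubeVol d) * (W.Phi j m x * W.Psi ι l m' x)
          else 0) ∂cubeVol d := by
      refine integral_congr_ae ?_
      filter_upwards [hW.ae_proj_succ_sub (hj.trans hl) hg] with x hx
      rw [← mul_sub, hx, Finset.mul_sum]
      refine Finset.sum_congr rfl fun ι _ => ?_
      split_ifs
      · rw [Finset.mul_sum]; exact Finset.sum_congr rfl fun m' _ => by ring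
      · simp
    rw [h1, integral_finsetSum]
    · refine Finset.sum_eq_zero fun ι _ => ?_
      split_ifs with hι
      · rw [integral_finsetSum _ fun m' _ => (hb ι m').integrable _]
        refine Finset.sum_eq_zero fun m' _ => ?_
        rw [integral_const_mul, hW.integral_Phi_mul_Psi hj hl m m' hι, mul_zero]
      · simp
    · intro ι _
      split_ifs
      · exact (IsBddMeas.sum _ fun m' _ => hb ι m').integrable _
      · exact integrable_zero _ _ _

/-- Projections onto nested spaces: the error of the finer one is orthogonal to the coarser
space. -/
lemma integral_proj_mul_sub_proj (hW : W.IsCDVBasis J₀) {j l : ℕ} (hj : J₀ ≤ j) (hjl : j ≤ l)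
    {g h : (Fin d → ℝ) → ℝ} (hg : IsBddMeas g) (hh : IsBddMeas h) :
    ∫ x, W.proj j g x * (h x - W.proj l h x) ∂cubeVol d = 0 := by
  have hd := hh.sub (hW.isBddMeas_proj l hh)
  simp only [hW.proj_eq_sum j hg, Finset.sum_mul, mul_assoc]
  rw [integral_finsetSum _ fun m _ => (((hW.isBddMeas_Phi j m).mul hd).const_mul _).integrable _]
  refine Finset.sum_eq_zero fun m _ => ?_
  rw [integral_const_mul]
  simp only [mul_sub]
  rw [integral_sub (((hW.isBddMeas_Phi j m).mul hh).integrable _)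
    (((hW.isBddMeas_Phi j m).mul (hW.isBddMeas_proj l hh)).integrable _),
    hW.integral_Phi_mul_proj hj hjl hh m, sub_self, mul_zero]

/-- Functions that are uniformly continuous on the cube are the limits of their projections. -/
lemma ae_tendsto_proj (hW : W.IsCDVBasis J₀) {g h : (Fin d → ℝ) → ℝ} (hg : IsBddMeas g)
    (hh : UniformContinuousOn h (Icc 0 1)) (hgh : g =ᵐ[cubeVol d] h) :
    ∀ᵐ x ∂cubeVol d, Filter.Tendsto (fun l => W.proj l g x) Filter.atTop (nhds (g x)) := by
  obtain ⟨C, hC, -, hCk⟩ := hW.exists_kernel_bounds d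
  obtain ⟨R, hR, hRk⟩ := hW.exists_kernel_support
  have h1 : ∀ᵐ x ∂cubeVol d, ∀ j, J₀ ≤ j → ∫ y, W.kernel j y x ∂cubeVol d = 1 := by
    rw [ae_all_iff]; intro j
    by_cases hj : J₀ ≤ j
    · filter_upwards [hW.ae_integral_kernel hj] with x hx _ using hx
    · exact Filter.Eventually.of_forall fun x hx => absurd hx hj
  have hcube : ∀ᵐ x ∂cubeVol d, x ∈ Icc (0 : Fin d → ℝ) 1 :=
    ae_restrict_mem measurableSet_Icc
  filter_upwards [h1, hcube, hgh] with x hx hxc hxe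
  rw [Metric.tendsto_atTop]
  intro ε hε
  obtain ⟨δ, hδ, hu⟩ := Metric.uniformContinuousOn_iff.mp hh (ε / (2 * C)) (by positivity)
  obtain ⟨N, hN⟩ := exists_nat_gt (R / δ)
  refine ⟨max N J₀, fun l hl => ?_⟩
  have hlJ : J₀ ≤ l := (le_max_right _ _).trans hl
  have hRl : R / 2 ^ l < δ := by
    rw [div_lt_iff₀ (by positivity), mul_comm, ← div_lt_iff₀ hδ]
    refine hN.trans_le ?_
    have : (N : ℝ) ≤ l := by exact_mod_cast (le_max_left _ _).trans hl
    exact this.trans (by exact_mod_cast l.lt_two_pow_self.le)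
  have hk := (hW.isBddMeas_kernel (d := d) l).section_right x
  have h2 : W.proj l g x - g x = ∫ y, (g y - g x) * W.kernel l y x ∂cubeVol d := by
    simp only [sub_mul]
    rw [integral_sub ((hg.mul hk).integrable _) ((hk.const_mul _).integrable _),
      integral_const_mul, hx l hlJ, mul_one, proj]
  have h3 : |W.proj l g x - g x| ≤ ∫ y, ε / (2 * C) * |W.kernel l y x| ∂cubeVol d := by
    rw [h2]
    refine abs_integral_le_of_abs_le ((hk.abs.const_mul _).integrable (cubeVol d)) ?_
    filter_upwards [hcube, hgh] with y hyc hye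
    rw [abs_mul]
    by_cases h0 : W.kernel l y x = 0
    · simp [h0]
    · refine mul_le_mul_of_nonneg_right ?_ (abs_nonneg _)
      rw [hxe, hye, ← Real.dist_eq]
      exact (hu y hyc x hxc ((hRk l y x h0).trans_lt hRl)).le
  rw [integral_const_mul] at h3
  rw [Real.dist_eq]
  calc |W.proj l g x - g x| ≤ ε / (2 * C) * C :=
        h3.trans (mul_le_mul_of_nonneg_left (hCk l x) (by positivity))
    _ = ε / 2 := by field_simp
    _ < ε := by linarith

/-- The error of the projection of a function in a Hölder ball, in the uniform norm. -/
lemma exists_abs_sub_proj_le (hW : W.IsCDVBasis J₀) (d : ℕ) {a : ℝ} (ha : 0 < a) (M : ℝ) :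
    ∃ C : ℝ, 0 < C ∧ ∀ (g h : (Fin d → ℝ) → ℝ), IsBddMeas g → h ∈ W.holderBall d J₀ a M →
      g =ᵐ[cubeVol d] h → ∀ j, J₀ ≤ j →
      ∀ᵐ x ∂cubeVol d, |g x - W.proj j g x| ≤ C * (2 : ℝ) ^ (-(a * j)) := by
  obtain ⟨C, hC, hs, -⟩ := hW.exists_sum_abs_Psi_le d
  set r : ℝ := (2 : ℝ) ^ (-a) with hr
  have hr1 : r < 1 := Real.rpow_lt_one_of_one_lt_of_neg one_lt_two (by linarith)
  have hr1' : 0 < 1 - r := by linarith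
  have hr0 : 0 < r := Real.rpow_pos_of_pos two_pos _
  refine ⟨(2 ^ d * C * |M| + 1) / (1 - r), by positivity, fun g h hg hh hgh j hj => ?_⟩
  have hcoef : ∀ l, J₀ ≤ l → ∀ (m : Fin d → Fin (2 ^ l)) (ι : Fin d → Bool), (∃ i, ι i = true) →
      |∫ y, g y * W.Psi ι l m y ∂cubeVol d| ≤ |M| * r ^ l / sqrtTwoPow l ^ d := by
    intro l hl m ι hι
    have h1 := hh.2 (fun _ => ⟨0, by positivity⟩) l hl m ι hι
    have h2 : ∫ y, g y * W.Psi ι l m y ∂cubeVol d = ∫ y in Icc 0 1, h y * W.Psi ι l m y :=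
      integral_congr_ae (by filter_upwards [hgh] with y hy; rw [hy])
    rw [h2]
    have h3 : (2 : ℝ) ^ ((l : ℝ) * (a + d / 2)) = sqrtTwoPow l ^ d / r ^ l := by
      rw [hr, sqrtTwoPow, ← Real.rpow_natCast, ← Real.rpow_mul two_pos.le, ← Real.rpow_natCast,
        ← Real.rpow_mul two_pos.le, ← Real.rpow_sub two_pos]
      congr 1; ring
    rw [h3] at h1
    have h4 : sqrtTwoPow l ^ d / r ^ l * |∫ y in Icc 0 1, h y * W.Psi ι l m y| ≤ |M| :=
      le_trans (le_trans (le_add_of_nonneg_left (by positivity)) h1) (le_abs_self M)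
    have hp : 0 < sqrtTwoPow l ^ d := pow_pos (sqrtTwoPow_pos l) d
    rw [le_div_iff₀ hp]
    rw [div_mul_eq_mul_div, div_le_iff₀ (by positivity)] at h4
    linarith
  have hstep : ∀ᵐ x ∂cubeVol d, ∀ l, J₀ ≤ l →
      |W.proj (l + 1) g x - W.proj l g x| ≤ (2 ^ d * C * |M| + 1) * r ^ l := by
    rw [ae_all_iff]; intro l
    by_cases hl : J₀ ≤ l
    · filter_upwards [hW.ae_proj_succ_sub hl hg] with x hx _
      rw [hx]
      have hp : 0 < sqrtTwoPow l ^ d := pow_pos (sqrtTwoPow_pos l) d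
      have h1 : ∀ ι : Fin d → Bool, |if ∃ i, ι i = true then
          ∑ m, (∫ y, g y * W.Psi ι l m y ∂cubeVol d) * W.Psi ι l m x else 0|
          ≤ C * |M| * r ^ l := by
        intro ι
        split_ifs with hι
        · calc |∑ m, (∫ y, g y * W.Psi ι l m y ∂cubeVol d) * W.Psi ι l m x|
              ≤ ∑ m, |M| * r ^ l / sqrtTwoPow l ^ d * |W.Psi ι l m x| := by
                refine (Finset.abs_sum_le_sum_abs _ _).trans (Finset.sum_le_sum fun m _ => ?_)
                rw [abs_mul]
                exact mul_le_mul_of_nonneg_right (hcoef l hl m ι hι) (abs_nonneg _)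
            _ ≤ |M| * r ^ l / sqrtTwoPow l ^ d * (C * sqrtTwoPow l ^ d) := by
                rw [← Finset.mul_sum]
                exact mul_le_mul_of_nonneg_left (hs ι l x) (by positivity)
            _ = C * |M| * r ^ l := by field_simp
        · rw [abs_zero]; positivity
      calc _ ≤ ∑ _ι : Fin d → Bool, C * |M| * r ^ l :=
            (Finset.abs_sum_le_sum_abs _ _).trans (Finset.sum_le_sum fun ι _ => h1 ι)
        _ = 2 ^ d * C * |M| * r ^ l := by simp; ring
        _ ≤ _ := by nlinarith [pow_pos hr0 l]
    · exact Filter.Eventually.of_forall fun x hx => absurd hx hl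
  filter_upwards [hstep, hW.ae_tendsto_proj hg hh.1 hgh] with x hx ht
  have h1 := dist_le_of_le_geometric_of_tendsto₀ r ((2 ^ d * C * |M| + 1) * r ^ j)
    (f := fun n => W.proj (n + j) g x) (a := g x) hr1 (fun n => by
      rw [dist_comm, Real.dist_eq]
      have := hx (n + j) (by omega)
      rw [show n + 1 + j = n + j + 1 by ring]
      rw [pow_add] at this
      linarith)
    ((Filter.tendsto_add_atTop_iff_nat j).mpr ht)
  rw [dist_comm, Real.dist_eq] at h1
  rw [zero_add] at h1
  refine h1.trans (le_of_eq ?_)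
  rw [hr, ← Real.rpow_natCast _ j, ← Real.rpow_mul two_pos.le, neg_mul]
  ring

/-- The bias of products of projections: only the errors of the finer projection matter. -/
lemma integral_sub_proj_mul_sub_proj (hW : W.IsCDVBasis J₀) {j l : ℕ} (hj : J₀ ≤ j) (hjl : j ≤ l)
    {g h : (Fin d → ℝ) → ℝ} (hg : IsBddMeas g) (hh : IsBddMeas h) :
    ∫ x, (g x - W.proj j g x) * (h x - W.proj l h x) ∂cubeVol d
      = ∫ x, (g x - W.proj l g x) * (h x - W.proj l h x) ∂cubeVol d := by
  have hjg := hW.isBddMeas_proj j hg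
  have hlg := hW.isBddMeas_proj l hg
  have he := hh.sub (hW.isBddMeas_proj l hh)
  have h1 := hW.integral_proj_mul_sub_proj hj hjl hg hh
  have h2 := hW.integral_proj_mul_sub_proj (hj.trans hjl) le_rfl hg hh
  simp only [sub_mul _ _ (h _ - _)]
  rw [integral_sub ((hg.mul he).integrable _) ((hjg.mul he).integrable _),
    integral_sub ((hg.mul he).integrable _) ((hlg.mul he).integrable _), h1, h2]

/-- The bias of a product of projections onto nested spaces is that of the coarser one. -/
lemma integral_mul_sub_integral_proj_mul_proj (hW : W.IsCDVBasis J₀) {j l : ℕ} (hj : J₀ ≤ j)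
    (hjl : j ≤ l) {g h : (Fin d → ℝ) → ℝ} (hg : IsBddMeas g) (hh : IsBddMeas h) :
    ∫ x, g x * h x ∂cubeVol d - ∫ x, W.proj j g x * W.proj l h x ∂cubeVol d
      = ∫ x, (g x - W.proj j g x) * (h x - W.proj j h x) ∂cubeVol d := by
  have hjg := hW.isBddMeas_proj j hg
  have hjh := hW.isBddMeas_proj j hh
  have hlh := hW.isBddMeas_proj l hh
  have h1 := hW.integral_proj_mul_sub_proj hj hjl hg hh
  have h2 := hW.integral_proj_mul_sub_proj hj le_rfl hh hg
  have h3 := hW.integral_proj_mul_sub_proj hj le_rfl hg hh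
  simp only [mul_sub] at h1 h2 h3
  rw [integral_sub ((hjg.mul hh).integrable _) ((hjg.mul hlh).integrable _)] at h1
  rw [integral_sub ((hjh.mul hg).integrable _) ((hjh.mul hjg).integrable _)] at h2
  rw [integral_sub ((hjg.mul hh).integrable _) ((hjg.mul hjh).integrable _)] at h3
  have h4 : ∫ x, (g x - W.proj j g x) * (h x - W.proj j h x) ∂cubeVol d
      = ∫ x, g x * h x ∂cubeVol d - ∫ x, W.proj j h x * g x ∂cubeVol d
        - ∫ x, W.proj j g x * h x ∂cubeVol d + ∫ x, W.proj j h x * W.proj j g x ∂cubeVol d := by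
    rw [← integral_sub ((hg.mul hh).integrable _) ((hjh.mul hg).integrable _),
      ← integral_sub (((hg.mul hh).sub (hjh.mul hg)).integrable _) ((hjg.mul hh).integrable _),
      ← integral_add ((((hg.mul hh).sub (hjh.mul hg)).sub (hjg.mul hh)).integrable _)
        ((hjh.mul hjg).integrable _)]
    refine integral_congr_ae (Filter.Eventually.of_forall fun x => ?_)
    simp only; ring
  rw [h4]
  linarith

end BoundaryWavelets.IsCDVBasis

/-! ### Sample averages and split samples -/

section Sampling

variable {Ω : Type*} [MeasurableSpace Ω]

/-- The law of a sample of size `n`. -/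
noncomputable abbrev sampleLaw (P : Measure Ω) (n : ℕ) : Measure (Fin n → Ω) :=
  Measure.pi fun _ => P

/-- The average of `f` over a sample. -/
noncomputable def sampleMean {n : ℕ} (f : Ω → ℝ) (D : Fin n → Ω) : ℝ :=
  (1 / (n : ℝ)) * ∑ i, f (D i)

lemma IsBddMeas.sampleMean {n : ℕ} {f : Ω → ℝ} (hf : IsBddMeas f) :
    IsBddMeas (sampleMean f : (Fin n → Ω) → ℝ) :=
  (IsBddMeas.sum _ fun i _ => hf.comp (measurable_pi_apply i)).const_mul _

lemma IsBddMeas.memLp {f : Ω → ℝ} (hf : IsBddMeas f) (P : Measure Ω) [IsProbabilityMeasure P] :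
    MemLp f 2 P := by
  obtain ⟨hm, C, hC⟩ := hf
  exact MemLp.of_bound hm.aestronglyMeasurable C (Filter.Eventually.of_forall hC)

lemma integral_sampleMean (P : Measure Ω) [IsProbabilityMeasure P] {n : ℕ} (hn : n ≠ 0)
    {f : Ω → ℝ} (hf : IsBddMeas f) : ∫ D, sampleMean f D ∂sampleLaw P n = ∫ ω, f ω ∂P := by
  unfold sampleMean
  rw [integral_const_mul, integral_finsetSum _ fun i _ =>
    (hf.comp (measurable_pi_apply i)).integrable _]
  have h : ∀ i : Fin n, ∫ D, f (D i) ∂sampleLaw P n = ∫ ω, f ω ∂P := fun i =>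
    integral_comp_eval (μ := fun _ : Fin n => P) hf.1.aestronglyMeasurable
  simp only [h, Finset.sum_const, Finset.card_univ, Fintype.card_fin, nsmul_eq_mul]
  have : (n : ℝ) ≠ 0 := by exact_mod_cast hn
  field_simp

/-- Variance and squared bias of a sample mean. -/
lemma integral_sampleMean_sub_sq (P : Measure Ω) [IsProbabilityMeasure P] {n : ℕ} (hn : n ≠ 0)
    {f : Ω → ℝ} (hf : IsBddMeas f) (c : ℝ) :
    ∫ D, (sampleMean f D - c) ^ 2 ∂sampleLaw P n
      = 1 / n * (∫ ω, f ω ^ 2 ∂P - (∫ ω, f ω ∂P) ^ 2) + (∫ ω, f ω ∂P - c) ^ 2 := by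
  have hn' : (n : ℝ) ≠ 0 := by exact_mod_cast hn
  have hm : IsBddMeas (sampleMean f : (Fin n → Ω) → ℝ) := hf.sampleMean
  have hv := ProbabilityTheory.variance_sum_pi (μ := fun _ : Fin n => P) (X := fun _ => f)
    (fun _ => hf.memLp P)
  have hs : (∑ i : Fin n, fun D : Fin n → Ω => f (D i)) = fun D => n * sampleMean f D := by
    funext D
    simp only [Finset.sum_apply, sampleMean]
    field_simp
  rw [hs, ProbabilityTheory.variance_const_mul, ProbabilityTheory.variance_eq_sub (hm.memLp _),
    ProbabilityTheory.variance_eq_sub (hf.memLp _)] at hv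
  simp only [Pi.pow_apply, Finset.sum_const, Finset.card_univ, Fintype.card_fin,
    nsmul_eq_mul] at hv
  rw [integral_sampleMean P hn hf] at hv
  have h1 : ∫ D, (sampleMean f D - c) ^ 2 ∂sampleLaw P n
      = ∫ D, sampleMean f D ^ 2 ∂sampleLaw P n - 2 * c * ∫ D, sampleMean f D ∂sampleLaw P n
        + c ^ 2 := by
    rw [← integral_const_mul, ← integral_sub ((hm.pow 2).integrable _)
      ((hm.const_mul _).integrable _)]
    have : c ^ 2 = ∫ _D : Fin n → Ω, c ^ 2 ∂sampleLaw P n := by simp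
    rw [this, ← integral_add (((hm.pow 2).sub (hm.const_mul _)).integrable _)
      ((IsBddMeas.const _).integrable _)]
    refine integral_congr_ae (Filter.Eventually.of_forall fun D => ?_)
    simp only; ring
  rw [h1, integral_sampleMean P hn hf]
  have h2 : ∫ D, sampleMean f D ^ 2 ∂sampleLaw P n
      = 1 / n * (∫ ω, f ω ^ 2 ∂P - (∫ ω, f ω ∂P) ^ 2) + (∫ ω, f ω ∂P) ^ 2 := by
    have h3 : (n : ℝ) * (∫ D, sampleMean f D ^ 2 ∂sampleLaw P n)
        = ∫ ω, f ω ^ 2 ∂P - (∫ ω, f ω ∂P) ^ 2 + n * (∫ ω, f ω ∂P) ^ 2 := by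
      have := mul_left_cancel₀ hn' (show (n : ℝ) * (n * (∫ D, sampleMean f D ^ 2 ∂sampleLaw P n
        - (∫ ω, f ω ∂P) ^ 2)) = n * (∫ ω, f ω ^ 2 ∂P - (∫ ω, f ω ∂P) ^ 2) by
          rw [← hv]; ring)
      linarith
    field_simp
    linarith
  rw [h2]; ring

/-- Splitting a sample of size `3 n`; the order of the integrals is the one in which they are
evaluated below. -/
lemma integral_split_three (P : Measure Ω) [IsProbabilityMeasure P] (n : ℕ)
    {F : (Fin n → Ω) → (Fin n → Ω) → (Fin n → Ω) → ℝ}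
    (hF : IsBddMeas fun z : (Fin n → Ω) × (Fin n → Ω) × (Fin n → Ω) => F z.1 z.2.1 z.2.2) :
    ∫ O, F (fun i => O (0, i)) (fun i => O (1, i)) (fun i => O (2, i))
        ∂(Measure.pi fun _ : Fin 3 × Fin n => P)
      = ∫ D₁, ∫ D₂, ∫ D₃, F D₁ D₂ D₃ ∂sampleLaw P n ∂sampleLaw P n ∂sampleLaw P n := by
  set e : (Fin n → Ω) × (Fin n → Ω) × (Fin n → Ω) → Fin 3 × Fin n → Ω :=
    fun z p => (![z.1, z.2.1, z.2.2] : Fin 3 → Fin n → Ω) p.1 p.2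
  have he : Measurable e := by
    refine measurable_pi_iff.mpr fun p => ?_
    obtain ⟨a, i⟩ := p
    fin_cases a <;> simp only [e] <;> first
      | exact (measurable_pi_apply i).comp measurable_fst
      | exact (measurable_pi_apply i).comp (measurable_fst.comp measurable_snd)
      | exact (measurable_pi_apply i).comp (measurable_snd.comp measurable_snd)
  have hmap : (Measure.pi fun _ : Fin 3 × Fin n => P)
      = ((sampleLaw P n).prod ((sampleLaw P n).prod (sampleLaw P n))).map e := by
    refine Measure.pi_eq fun s hs => ?_
    rw [Measure.map_apply he (MeasurableSet.univ_pi hs)]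
    have hpre : e ⁻¹' (univ.pi s) = (univ.pi fun i => s (0, i)) ×ˢ
        ((univ.pi fun i => s (1, i)) ×ˢ (univ.pi fun i => s (2, i))) := by
      ext z
      simp only [mem_preimage, mem_univ_pi, mem_prod, Prod.forall, Fin.forall_fin_succ, e]
      simp
    rw [hpre, Measure.prod_prod, Measure.prod_prod, Measure.pi_pi, Measure.pi_pi, Measure.pi_pi,
      Fintype.prod_prod_type, Fin.prod_univ_three, mul_assoc]
  have hF' : IsBddMeas fun O : Fin 3 × Fin n → Ω =>
      F (fun i => O (0, i)) (fun i => O (1, i)) (fun i => O (2, i)) :=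
    hF.comp (φ := fun O : Fin 3 × Fin n → Ω =>
      ((fun i => O (0, i)), (fun i => O (1, i)), (fun i => O (2, i)))) (by fun_prop)
  rw [hmap, integral_map he.aemeasurable hF'.1.aestronglyMeasurable]
  change ∫ z : (Fin n → Ω) × (Fin n → Ω) × (Fin n → Ω), F z.1 z.2.1 z.2.2
    ∂(sampleLaw P n).prod ((sampleLaw P n).prod (sampleLaw P n)) = _
  rw [integral_prod _ (hF.integrable _)]
  refine integral_congr_ae (Filter.Eventually.of_forall fun D₁ => ?_)
  exact integral_prod (fun z : (Fin n → Ω) × (Fin n → Ω) => F D₁ z.1 z.2)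
    ((hF.section_left (F := fun x (z : (Fin n → Ω) × (Fin n → Ω)) => F x z.1 z.2) D₁).integrable _)

/-- Splitting a sample of size `4 n`. -/
lemma integral_split_four (P : Measure Ω) [IsProbabilityMeasure P] (n : ℕ)
    {F : (Fin n → Ω) → (Fin n → Ω) → (Fin n → Ω) → (Fin n → Ω) → ℝ}
    (hF : IsBddMeas fun z : (Fin n → Ω) × (Fin n → Ω) × (Fin n → Ω) × (Fin n → Ω) =>
      F z.1 z.2.1 z.2.2.1 z.2.2.2) :
    ∫ O, F (fun i => O (0, i)) (fun i => O (1, i)) (fun i => O (2, i)) (fun i => O (3, i))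
        ∂(Measure.pi fun _ : Fin 4 × Fin n => P)
      = ∫ D₁, ∫ D₂, ∫ D₃, ∫ D₄, F D₁ D₂ D₃ D₄
          ∂sampleLaw P n ∂sampleLaw P n ∂sampleLaw P n ∂sampleLaw P n := by
  set e : (Fin n → Ω) × (Fin n → Ω) × (Fin n → Ω) × (Fin n → Ω) → Fin 4 × Fin n → Ω :=
    fun z p => (![z.1, z.2.1, z.2.2.1, z.2.2.2] : Fin 4 → Fin n → Ω) p.1 p.2
  have he : Measurable e := by
    refine measurable_pi_iff.mpr fun p => ?_
    obtain ⟨a, i⟩ := p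
    fin_cases a <;> simp only [e] <;> first
      | exact (measurable_pi_apply i).comp measurable_fst
      | exact (measurable_pi_apply i).comp (measurable_fst.comp measurable_snd)
      | exact (measurable_pi_apply i).comp
          (measurable_fst.comp (measurable_snd.comp measurable_snd))
      | exact (measurable_pi_apply i).comp
          (measurable_snd.comp (measurable_snd.comp measurable_snd))
  have hmap : (Measure.pi fun _ : Fin 4 × Fin n => P)
      = ((sampleLaw P n).prod ((sampleLaw P n).prod
          ((sampleLaw P n).prod (sampleLaw P n)))).map e := by
    refine Measure.pi_eq fun s hs => ?_
    rw [Measure.map_apply he (MeasurableSet.univ_pi hs)]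
    have hpre : e ⁻¹' (univ.pi s) = (univ.pi fun i => s (0, i)) ×ˢ
        ((univ.pi fun i => s (1, i)) ×ˢ ((univ.pi fun i => s (2, i)) ×ˢ
          (univ.pi fun i => s (3, i)))) := by
      ext z
      simp only [mem_preimage, mem_univ_pi, mem_prod, Prod.forall, Fin.forall_fin_succ, e]
      simp
    rw [hpre, Measure.prod_prod, Measure.prod_prod, Measure.prod_prod, Measure.pi_pi,
      Measure.pi_pi, Measure.pi_pi, Measure.pi_pi,
      Fintype.prod_prod_type, Fin.prod_univ_four, mul_assoc, mul_assoc]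
  have hF' : IsBddMeas fun O : Fin 4 × Fin n → Ω =>
      F (fun i => O (0, i)) (fun i => O (1, i)) (fun i => O (2, i)) (fun i => O (3, i)) :=
    hF.comp (φ := fun O : Fin 4 × Fin n → Ω =>
      ((fun i => O (0, i)), (fun i => O (1, i)), (fun i => O (2, i)), (fun i => O (3, i))))
      (by fun_prop)
  rw [hmap, integral_map he.aemeasurable hF'.1.aestronglyMeasurable]
  change ∫ z : (Fin n → Ω) × (Fin n → Ω) × (Fin n → Ω) × (Fin n → Ω), F z.1 z.2.1 z.2.2.1 z.2.2.2
    ∂(sampleLaw P n).prod ((sampleLaw P n).prod ((sampleLaw P n).prod (sampleLaw P n))) = _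
  rw [integral_prod _ (hF.integrable _)]
  refine integral_congr_ae (Filter.Eventually.of_forall fun D₁ => ?_)
  have hF1 : IsBddMeas fun z : (Fin n → Ω) × (Fin n → Ω) × (Fin n → Ω) =>
      F D₁ z.1 z.2.1 z.2.2 :=
    hF.section_left (F := fun x (z : (Fin n → Ω) × (Fin n → Ω) × (Fin n → Ω)) =>
      F x z.1 z.2.1 z.2.2) D₁
  change ∫ z : (Fin n → Ω) × (Fin n → Ω) × (Fin n → Ω), F D₁ z.1 z.2.1 z.2.2
    ∂(sampleLaw P n).prod ((sampleLaw P n).prod (sampleLaw P n)) = _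
  rw [integral_prod _ (hF1.integrable _)]
  refine integral_congr_ae (Filter.Eventually.of_forall fun D₂ => ?_)
  exact integral_prod (fun z : (Fin n → Ω) × (Fin n → Ω) => F D₁ D₂ z.1 z.2)
    ((hF1.section_left (F := fun x (z : (Fin n → Ω) × (Fin n → Ω)) =>
      F D₁ x z.1 z.2) D₂).integrable _)

end Sampling

/-! ### Projection estimators of regression functions -/

section Regression

variable {Ω : Type*} [MeasurableSpace Ω] {S J₀ d n : ℕ} {W : BoundaryWavelets S}

lemma sq_integral_le (P : Measure Ω) [IsProbabilityMeasure P] {f : Ω → ℝ} (hf : IsBddMeas f) :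
    (∫ ω, f ω ∂P) ^ 2 ≤ ∫ ω, f ω ^ 2 ∂P := by
  have h := ProbabilityTheory.variance_nonneg f P
  rw [ProbabilityTheory.variance_eq_sub (hf.memLp P)] at h
  simp only [Pi.pow_apply] at h
  linarith

/-- Under `P` the covariate `X` is uniform on the cube, and `r` is the regression function of the
bounded variable `f` on `X`. -/
structure IsRegression (P : Measure Ω) (X : Ω → Fin d → ℝ) (f : Ω → ℝ) (r : (Fin d → ℝ) → ℝ) :
    Prop where
  meas : Measurable X
  map : P.map X = cubeVol d
  bdd : IsBddMeas f
  bdd_r : IsBddMeas r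
  reg : ∀ g : (Fin d → ℝ) → ℝ, IsBddMeas g →
    ∫ ω, f ω * g (X ω) ∂P = ∫ x, r x * g x ∂cubeVol d

lemma integral_comp_of_map {P : Measure Ω} {X : Ω → Fin d → ℝ} (hX : Measurable X)
    (hm : P.map X = cubeVol d) {g : (Fin d → ℝ) → ℝ} (hg : IsBddMeas g) :
    ∫ ω, g (X ω) ∂P = ∫ x, g x ∂cubeVol d := by
  rw [← hm, integral_map hX.aemeasurable hg.1.aestronglyMeasurable]

/-- The projection estimator of the regression of `f` on `X`. -/
noncomputable def projEst (W : BoundaryWavelets S) (j : ℕ) (X : Ω → Fin d → ℝ) (f : Ω → ℝ)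
    (D : Fin n → Ω) (x : Fin d → ℝ) : ℝ :=
  sampleMean (fun ω => f ω * W.kernel j (X ω) x) D

lemma isBddMeas_projEst (hW : W.IsCDVBasis J₀) (j : ℕ) {X : Ω → Fin d → ℝ} (hX : Measurable X)
    {f : Ω → ℝ} (hf : IsBddMeas f) :
    IsBddMeas fun z : (Fin n → Ω) × (Fin d → ℝ) => projEst W j X f z.1 z.2 := by
  refine (IsBddMeas.sum _ fun i _ => IsBddMeas.mul ?_ ?_).const_mul _
  · exact hf.comp ((measurable_pi_apply i).comp measurable_fst)
  · exact (hW.isBddMeas_kernel j).comp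
      (φ := fun z : (Fin n → Ω) × (Fin d → ℝ) => (X (z.1 i), z.2))
      ((hX.comp ((measurable_pi_apply i).comp measurable_fst)).prodMk measurable_snd)

lemma integral_projEst_mul {Ω : Type*} (hW : W.IsCDVBasis J₀) (j : ℕ) (X : Ω → Fin d → ℝ)
    (f : Ω → ℝ) {g : (Fin d → ℝ) → ℝ} (hg : IsBddMeas g) (D : Fin n → Ω) :
    ∫ x, projEst W j X f D x * g x ∂cubeVol d
      = sampleMean (fun ω => f ω * W.proj j g (X ω)) D := by
  simp only [projEst, sampleMean, mul_assoc]
  rw [integral_const_mul]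
  congr 1
  simp only [Finset.sum_mul]
  rw [integral_finsetSum _ fun i _ =>
    (((hW.isBddMeas_kernel j).section_left (X (D i)) |>.const_mul _).mul hg).integrable _]
  refine Finset.sum_congr rfl fun i _ => ?_
  rw [BoundaryWavelets.proj, ← integral_const_mul]
  refine integral_congr_ae (Filter.Eventually.of_forall fun x => ?_)
  simp only
  rw [W.kernel_comm j (X (D i)) x]; ring

variable {P : Measure Ω} [IsProbabilityMeasure P] {X : Ω → Fin d → ℝ} {f : Ω → ℝ}
  {r : (Fin d → ℝ) → ℝ}

/-- Second moment of a linear functional of the estimation error. -/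
lemma IsRegression.integral_sq_linear (h : IsRegression P X f r) (hW : W.IsCDVBasis J₀) (j : ℕ)
    (hn : n ≠ 0) {u g : (Fin d → ℝ) → ℝ} (hu : IsBddMeas u) (hg : IsBddMeas g) (c : ℝ) :
    ∫ D, (∫ x, (u x - projEst W j X f D x) * g x ∂cubeVol d - c) ^ 2 ∂sampleLaw P n
      = 1 / n * (∫ ω, (f ω * W.proj j g (X ω)) ^ 2 ∂P - (∫ ω, f ω * W.proj j g (X ω) ∂P) ^ 2)
        + (∫ x, (u x - W.proj j r x) * g x ∂cubeVol d - c) ^ 2 := by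
  have hpg := hW.isBddMeas_proj j hg
  have hb : IsBddMeas fun ω => f ω * W.proj j g (X ω) := h.bdd.mul (hpg.comp h.meas)
  have h1 : ∀ D : Fin n → Ω, (∫ x, (u x - projEst W j X f D x) * g x ∂cubeVol d - c) ^ 2
      = (sampleMean (fun ω => f ω * W.proj j g (X ω)) D - (∫ x, u x * g x ∂cubeVol d - c)) ^ 2 := by
    intro D
    simp only [sub_mul]
    rw [integral_sub ((hu.mul hg).integrable _)
      ((((isBddMeas_projEst hW j h.meas h.bdd).section_left D).mul hg).integrable _),
      integral_projEst_mul hW j X f hg D]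
    ring
  simp only [h1]
  rw [integral_sampleMean_sub_sq P hn hb]
  congr 1
  rw [h.reg _ hpg, ← hW.integral_proj_mul j h.bdd_r hg]
  simp only [sub_mul]
  rw [integral_sub ((hu.mul hg).integrable _)
    (((hW.isBddMeas_proj j h.bdd_r).mul hg).integrable _)]
  ring

lemma IsRegression.integral_sq_linear_ge (h : IsRegression P X f r) (hW : W.IsCDVBasis J₀)
    (j : ℕ) (hn : n ≠ 0) {u g : (Fin d → ℝ) → ℝ} (hu : IsBddMeas u) (hg : IsBddMeas g) (c : ℝ) :
    (∫ x, (u x - W.proj j r x) * g x ∂cubeVol d - c) ^ 2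
      ≤ ∫ D, (∫ x, (u x - projEst W j X f D x) * g x ∂cubeVol d - c) ^ 2 ∂sampleLaw P n := by
  rw [h.integral_sq_linear hW j hn hu hg c]
  have hb : IsBddMeas fun ω => f ω * W.proj j g (X ω) :=
    h.bdd.mul ((hW.isBddMeas_proj j hg).comp h.meas)
  have := sq_integral_le P hb
  have : 0 ≤ 1 / (n : ℝ) * (∫ ω, (f ω * W.proj j g (X ω)) ^ 2 ∂P
    - (∫ ω, f ω * W.proj j g (X ω) ∂P) ^ 2) := mul_nonneg (by positivity) (by linarith)
  linarith

lemma IsRegression.integral_sq_linear_le (h : IsRegression P X f r) (hW : W.IsCDVBasis J₀)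
    (j : ℕ) (hn : n ≠ 0) {u g : (Fin d → ℝ) → ℝ} (hu : IsBddMeas u) (hg : IsBddMeas g) (c : ℝ)
    {B : ℝ} (hB : ∀ ω, |f ω| ≤ B) :
    ∫ D, (∫ x, (u x - projEst W j X f D x) * g x ∂cubeVol d - c) ^ 2 ∂sampleLaw P n
      ≤ B ^ 2 / n * ∫ x, W.proj j g x ^ 2 ∂cubeVol d
        + (∫ x, (u x - W.proj j r x) * g x ∂cubeVol d - c) ^ 2 := by
  rw [h.integral_sq_linear hW j hn hu hg c]
  have hpg := hW.isBddMeas_proj j hg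
  have h1 : ∫ ω, (f ω * W.proj j g (X ω)) ^ 2 ∂P ≤ B ^ 2 * ∫ x, W.proj j g x ^ 2 ∂cubeVol d := by
    rw [← integral_comp_of_map h.meas h.map (hpg.pow 2), ← integral_const_mul]
    refine integral_mono (((h.bdd.mul (hpg.comp h.meas)).pow 2).integrable _)
      ((((hpg.pow 2).comp h.meas).const_mul _).integrable _) fun ω => ?_
    simp only
    rw [mul_pow]
    refine mul_le_mul_of_nonneg_right ?_ (sq_nonneg _)
    rw [← sq_abs]
    exact pow_le_pow_left₀ (abs_nonneg _) (hB ω) 2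
  have h2 : 1 / (n : ℝ) * (∫ ω, (f ω * W.proj j g (X ω)) ^ 2 ∂P
      - (∫ ω, f ω * W.proj j g (X ω) ∂P) ^ 2)
      ≤ 1 / n * (B ^ 2 * ∫ x, W.proj j g x ^ 2 ∂cubeVol d) :=
    mul_le_mul_of_nonneg_left (by nlinarith [sq_nonneg (∫ ω, f ω * W.proj j g (X ω) ∂P)])
      (by positivity)
  have h3 : 1 / (n : ℝ) * (B ^ 2 * ∫ x, W.proj j g x ^ 2 ∂cubeVol d)
      = B ^ 2 / n * ∫ x, W.proj j g x ^ 2 ∂cubeVol d := by ring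
  linarith

/-- Pointwise second moment of the estimator. -/
lemma IsRegression.integral_projEst_sq (h : IsRegression P X f r) (hW : W.IsCDVBasis J₀) (j : ℕ)
    (hn : n ≠ 0) (x : Fin d → ℝ) :
    ∫ D : Fin n → Ω, projEst W j X f D x ^ 2 ∂sampleLaw P n
      = 1 / n * (∫ ω, f ω ^ 2 * W.kernel j (X ω) x ^ 2 ∂P - W.proj j r x ^ 2)
        + W.proj j r x ^ 2 := by
  have hk := (hW.isBddMeas_kernel j).section_right x
  have h1 := integral_sampleMean_sub_sq P hn (h.bdd.mul (hk.comp h.meas)) 0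
  simp only [sub_zero] at h1
  rw [h.reg _ hk] at h1
  simp only [mul_pow] at h1
  exact h1

lemma IsRegression.le_integral_projEst_sq (h : IsRegression P X f r) (hW : W.IsCDVBasis J₀)
    (j : ℕ) (hn : n ≠ 0) (x : Fin d → ℝ) :
    1 / n * ∫ ω, f ω ^ 2 * W.kernel j (X ω) x ^ 2 ∂P
      ≤ ∫ D : Fin n → Ω, projEst W j X f D x ^ 2 ∂sampleLaw P n := by
  rw [h.integral_projEst_sq hW j hn x]
  have h1 : (1 : ℝ) ≤ n := by exact_mod_cast Nat.one_le_iff_ne_zero.mpr hn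
  have h2 : 1 / (n : ℝ) ≤ 1 := by rw [div_le_one (by linarith)]; exact h1
  nlinarith [mul_le_mul_of_nonneg_right h2 (sq_nonneg (W.proj j r x))]

variable (d) in
/-- The pointwise second moment of a projection estimator: the kernel is of size `2 ^ (j d)` on a set
of measure `2 ^ (-j d)`, so its square integrates to at most a multiple of the resolution. -/
lemma exists_integral_projEst_sq_le (hW : W.IsCDVBasis J₀) (B : ℝ) : ∃ C : ℝ, 0 < C ∧
    ∀ {Ω : Type} [MeasurableSpace Ω] (P : Measure Ω) [IsProbabilityMeasure P]
      (X : Ω → Fin d → ℝ) (f : Ω → ℝ) (r : (Fin d → ℝ) → ℝ), IsRegression P X f r →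
      (∀ ω, |f ω| ≤ B) → (∀ x, |r x| ≤ B) → ∀ j, J₀ ≤ j → ∀ (n : ℕ), n ≠ 0 → ∀ x,
      ∫ D : Fin n → Ω, projEst W j X f D x ^ 2 ∂sampleLaw P n ≤ C * (1 + 2 ^ (j * d) / n) := by
  obtain ⟨C₁, hC₁, hk, -⟩ := hW.exists_kernel_bounds d
  obtain ⟨C₂, hC₂, hp⟩ := hW.exists_abs_proj_le d
  refine ⟨B ^ 2 * C₁ + (C₂ * B) ^ 2 + 1, by positivity,
    fun P _ X f r h hf hr j hj n hn x => ?_⟩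
  rw [h.integral_projEst_sq hW j hn x]
  have hn0 : (0 : ℝ) < n := by exact_mod_cast Nat.pos_of_ne_zero hn
  have hk2 := ((hW.isBddMeas_kernel j).section_right x).pow 2
  have h1 : ∫ ω, f ω ^ 2 * W.kernel j (X ω) x ^ 2 ∂P ≤ B ^ 2 * (C₁ * 2 ^ (j * d)) := by
    calc _ ≤ ∫ ω, B ^ 2 * W.kernel j (X ω) x ^ 2 ∂P := by
          refine integral_mono (((h.bdd.pow 2).mul (hk2.comp h.meas)).integrable _)
            (((hk2.comp h.meas).const_mul _).integrable _) fun ω => ?_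
          refine mul_le_mul_of_nonneg_right ?_ (sq_nonneg _)
          rw [← sq_abs]
          exact pow_le_pow_left₀ (abs_nonneg _) (hf ω) 2
      _ = B ^ 2 * W.kernel j x x := by
          rw [integral_const_mul, integral_comp_of_map h.meas h.map hk2,
            hW.integral_kernel_sq hj]
      _ ≤ _ := mul_le_mul_of_nonneg_left ((le_abs_self _).trans (hk j x x)) (sq_nonneg _)
  have h2 : W.proj j r x ^ 2 ≤ (C₂ * B) ^ 2 := by
    rw [← sq_abs]
    exact pow_le_pow_left₀ (abs_nonneg _) (hp j r B hr x) 2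
  have h3 : 1 / (n : ℝ) * (∫ ω, f ω ^ 2 * W.kernel j (X ω) x ^ 2 ∂P - W.proj j r x ^ 2)
      ≤ 1 / n * (B ^ 2 * (C₁ * 2 ^ (j * d))) :=
    mul_le_mul_of_nonneg_left (by nlinarith [sq_nonneg (W.proj j r x)]) (by positivity)
  have h4 : 1 / n * (B ^ 2 * (C₁ * 2 ^ (j * d))) = B ^ 2 * C₁ * (2 ^ (j * d) / (n : ℝ)) := by ring
  have h5 : (0 : ℝ) ≤ 2 ^ (j * d) / (n : ℝ) := by positivity
  have h6 : 0 ≤ B ^ 2 * C₁ := by positivity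
  nlinarith [mul_nonneg (sq_nonneg (C₂ * B)) h5]

end Regression

/-! ### Mean squared errors of the estimators under sample splitting -/

/-- Two variables with bounded regression functions on the same uniform covariate. -/
structure IsRegressionPair {Ω : Type} [MeasurableSpace Ω] {d : ℕ} (P : Measure Ω)
    (X : Ω → Fin d → ℝ) (f₁ f₂ : Ω → ℝ) (r₁ r₂ : (Fin d → ℝ) → ℝ) (B : ℝ) : Prop where
  fst : IsRegression P X f₁ r₁
  snd : IsRegression P X f₂ r₂
  abs_f₁ : ∀ ω, |f₁ ω| ≤ B
  abs_f₂ : ∀ ω, |f₂ ω| ≤ B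
  abs_r₁ : ∀ x, |r₁ x| ≤ B
  abs_r₂ : ∀ x, |r₂ x| ≤ B

section Bilinear

variable {Ω : Type} [MeasurableSpace Ω] {S J₀ d n : ℕ} {W : BoundaryWavelets S}
  {P : Measure Ω} {X : Ω → Fin d → ℝ} {f₁ f₂ : Ω → ℝ}
  {r₁ r₂ : (Fin d → ℝ) → ℝ} {B : ℝ}

lemma IsRegressionPair.symm (h : IsRegressionPair P X f₁ f₂ r₁ r₂ B) :
    IsRegressionPair P X f₂ f₁ r₂ r₁ B :=
  ⟨h.snd, h.fst, h.abs_f₂, h.abs_f₁, h.abs_r₂, h.abs_r₁⟩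

lemma isBddMeas_integral_mul_projEst (hW : W.IsCDVBasis J₀) (h₁ : IsRegression P X f₁ r₁)
    (h₂ : IsRegression P X f₂ r₂) (j₁ j₂ : ℕ) {u v : (Fin d → ℝ) → ℝ} (hu : IsBddMeas u)
    (hv : IsBddMeas v) : IsBddMeas fun z : (Fin n → Ω) × (Fin n → Ω) =>
      ∫ x, (u x - projEst W j₁ X f₁ z.1 x) * (v x - projEst W j₂ X f₂ z.2 x) ∂cubeVol d := by
  refine IsBddMeas.integral_param (F := fun (z : (Fin n → Ω) × (Fin n → Ω)) x =>
    (u x - projEst W j₁ X f₁ z.1 x) * (v x - projEst W j₂ X f₂ z.2 x)) ?_ _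
  have e1 := (isBddMeas_projEst (n := n) hW j₁ h₁.meas h₁.bdd).comp
    (φ := fun z : ((Fin n → Ω) × (Fin n → Ω)) × (Fin d → ℝ) => (z.1.1, z.2)) (by fun_prop)
  have e2 := (isBddMeas_projEst (n := n) hW j₂ h₂.meas h₂.bdd).comp
    (φ := fun z : ((Fin n → Ω) × (Fin n → Ω)) × (Fin d → ℝ) => (z.1.2, z.2)) (by fun_prop)
  exact ((hu.comp measurable_snd).sub e1).mul ((hv.comp measurable_snd).sub e2)

variable [IsProbabilityMeasure P]

/-- The bias is a lower bound for the second moment of a bilinear functional of the estimation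
errors. -/
lemma sq_bias_le_integral (hW : W.IsCDVBasis J₀) (h₁ : IsRegression P X f₁ r₁)
    (h₂ : IsRegression P X f₂ r₂) (j₁ j₂ : ℕ) (hn : n ≠ 0) {u v : (Fin d → ℝ) → ℝ}
    (hu : IsBddMeas u) (hv : IsBddMeas v) (c : ℝ) :
    (∫ x, (u x - W.proj j₁ r₁ x) * (v x - W.proj j₂ r₂ x) ∂cubeVol d - c) ^ 2
      ≤ ∫ D₂ : Fin n → Ω, ∫ D₁ : Fin n → Ω, (∫ x, (u x - projEst W j₁ X f₁ D₁ x) *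
          (v x - projEst W j₂ X f₂ D₂ x) ∂cubeVol d - c) ^ 2 ∂sampleLaw P n ∂sampleLaw P n := by
  have hT := ((isBddMeas_integral_mul_projEst (n := n) hW h₁ h₂ j₁ j₂ hu hv).sub (.const c)).pow 2
  have hg := hu.sub (hW.isBddMeas_proj j₁ h₁.bdd_r)
  have hE2 := isBddMeas_projEst (n := n) hW j₂ h₂.meas h₂.bdd
  have hlin : IsBddMeas fun D₂ : Fin n → Ω => (∫ x, (u x - W.proj j₁ r₁ x) *
      (v x - projEst W j₂ X f₂ D₂ x) ∂cubeVol d - c) ^ 2 :=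
    ((IsBddMeas.integral_param (F := fun (D₂ : Fin n → Ω) x => (u x - W.proj j₁ r₁ x) *
      (v x - projEst W j₂ X f₂ D₂ x)) ((hg.comp measurable_snd).mul
      ((hv.comp measurable_snd).sub hE2)) _).sub (.const c)).pow 2
  calc (∫ x, (u x - W.proj j₁ r₁ x) * (v x - W.proj j₂ r₂ x) ∂cubeVol d - c) ^ 2
      ≤ ∫ D₂ : Fin n → Ω, (∫ x, (u x - W.proj j₁ r₁ x) *
          (v x - projEst W j₂ X f₂ D₂ x) ∂cubeVol d - c) ^ 2 ∂sampleLaw P n := by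
        simp only [mul_comm (u _ - _)]
        exact h₂.integral_sq_linear_ge hW j₂ hn hv hg c
    _ ≤ _ := by
        refine integral_mono (hlin.integrable _) ((IsBddMeas.integral_param_right
          (F := fun D₁ D₂ => (∫ x, (u x - projEst W j₁ X f₁ D₁ x) *
          (v x - projEst W j₂ X f₂ D₂ x) ∂cubeVol d - c) ^ 2) hT _).integrable _)
          fun D₂ => ?_
        exact h₁.integral_sq_linear_ge hW j₁ hn hu (hv.sub (hE2.section_left D₂)) c

variable (d) in
/-- The second moment of a bilinear functional of the estimation errors: the variance is governed
by the resolution of one of the estimators, at choice. -/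
lemma exists_integral_bilinear_sq_le (hW : W.IsCDVBasis J₀) (B : ℝ) : ∃ C : ℝ, 0 < C ∧
    ∀ {Ω : Type} [MeasurableSpace Ω] (P : Measure Ω) [IsProbabilityMeasure P]
      (X : Ω → Fin d → ℝ) (f₁ f₂ : Ω → ℝ) (r₁ r₂ : (Fin d → ℝ) → ℝ),
      IsRegressionPair P X f₁ f₂ r₁ r₂ B → ∀ j₁, J₀ ≤ j₁ → ∀ j₂, J₀ ≤ j₂ → ∀ n : ℕ, n ≠ 0 →
      ∀ (u v : (Fin d → ℝ) → ℝ) (c : ℝ), IsBddMeas u → IsBddMeas v → (∀ x, |u x| ≤ B) →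
      (∀ x, |v x| ≤ B) →
      ∫ D₂ : Fin n → Ω, ∫ D₁ : Fin n → Ω, (∫ x, (u x - projEst W j₁ X f₁ D₁ x) *
          (v x - projEst W j₂ X f₂ D₂ x) ∂cubeVol d - c) ^ 2 ∂sampleLaw P n ∂sampleLaw P n
        ≤ C * ((1 + 2 ^ (j₂ * d) / n) / n)
          + (∫ x, (u x - W.proj j₁ r₁ x) * (v x - W.proj j₂ r₂ x) ∂cubeVol d - c) ^ 2 := by
  obtain ⟨C₁, hC₁, hE⟩ := exists_integral_projEst_sq_le d hW B
  obtain ⟨C₂, hC₂, hp⟩ := hW.exists_abs_proj_le d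
  refine ⟨B ^ 2 * (2 * B ^ 2 + 2 * C₁) + B ^ 2 * ((1 + C₂) * B) ^ 2 + 1, by positivity,
    fun {Ω} _ P _ X f₁ f₂ r₁ r₂ h j₁ hj₁ j₂ hj₂ n hn u v c hu hv hub hvb => ?_⟩
  have hn0 : (0 : ℝ) < n := by exact_mod_cast Nat.pos_of_ne_zero hn
  have h₁ := h.fst
  have h₂ := h.snd
  have hT := ((isBddMeas_integral_mul_projEst (n := n) hW h₁ h₂ j₁ j₂ hu hv).sub (.const c)).pow 2
  have hg := hu.sub (hW.isBddMeas_proj j₁ h₁.bdd_r)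
  have hE2 := isBddMeas_projEst (n := n) hW j₂ h₂.meas h₂.bdd
  have hve : IsBddMeas fun z : (Fin n → Ω) × (Fin d → ℝ) =>
      v z.2 - projEst W j₂ X f₂ z.1 z.2 := (hv.comp measurable_snd).sub hE2
  have hlin : IsBddMeas fun D₂ : Fin n → Ω => (∫ x, (u x - W.proj j₁ r₁ x) *
      (v x - projEst W j₂ X f₂ D₂ x) ∂cubeVol d - c) ^ 2 :=
    ((IsBddMeas.integral_param (F := fun (D₂ : Fin n → Ω) x => (u x - W.proj j₁ r₁ x) *
      (v x - projEst W j₂ X f₂ D₂ x)) ((hg.comp measurable_snd).mul hve) _).sub (.const c)).pow 2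
  have hsq : IsBddMeas fun D₂ : Fin n → Ω =>
      ∫ x, (v x - projEst W j₂ X f₂ D₂ x) ^ 2 ∂cubeVol d :=
    IsBddMeas.integral_param (F := fun (D₂ : Fin n → Ω) x =>
      (v x - projEst W j₂ X f₂ D₂ x) ^ 2) (hve.pow 2) _
  -- the estimation error of the second estimator
  have hm : ∫ D₂ : Fin n → Ω, ∫ x, (v x - projEst W j₂ X f₂ D₂ x) ^ 2 ∂cubeVol d ∂sampleLaw P n
      ≤ (2 * B ^ 2 + 2 * C₁) * (1 + 2 ^ (j₂ * d) / n) := by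
    rw [IsBddMeas.integral_comm (F := fun (D₂ : Fin n → Ω) x =>
      (v x - projEst W j₂ X f₂ D₂ x) ^ 2) (hve.pow 2)]
    have hx : ∀ x, ∫ D₂ : Fin n → Ω, (v x - projEst W j₂ X f₂ D₂ x) ^ 2 ∂sampleLaw P n
        ≤ (2 * B ^ 2 + 2 * C₁) * (1 + 2 ^ (j₂ * d) / n) := by
      intro x
      have he := hE2.section_right x
      calc _ ≤ ∫ D₂ : Fin n → Ω, (2 * B ^ 2 + 2 * projEst W j₂ X f₂ D₂ x ^ 2) ∂sampleLaw P n := by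
            refine integral_mono ((((IsBddMeas.const _).sub he).pow 2).integrable _)
              (((IsBddMeas.const _).add ((he.pow 2).const_mul 2)).integrable _) fun D₂ => ?_
            have h1 : v x ^ 2 ≤ B ^ 2 := by
              rw [← sq_abs]; exact pow_le_pow_left₀ (abs_nonneg _) (hvb x) 2
            simp only
            nlinarith [sq_nonneg (v x + projEst W j₂ X f₂ D₂ x)]
        _ = 2 * B ^ 2 + 2 * ∫ D₂ : Fin n → Ω, projEst W j₂ X f₂ D₂ x ^ 2 ∂sampleLaw P n := by
            rw [integral_add ((IsBddMeas.const _).integrable _)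
              (((he.pow 2).const_mul 2).integrable _),
              integral_const_mul 2 fun D₂ : Fin n → Ω => projEst W j₂ X f₂ D₂ x ^ 2]
            simp
        _ ≤ 2 * B ^ 2 + 2 * (C₁ * (1 + 2 ^ (j₂ * d) / n)) := by
            have := hE P X f₂ r₂ h₂ h.abs_f₂ h.abs_r₂ j₂ hj₂ n hn x
            linarith
        _ ≤ _ := by
            have : (0 : ℝ) ≤ 2 ^ (j₂ * d) / (n : ℝ) := by positivity
            nlinarith [mul_nonneg (sq_nonneg B) this]
    refine (integral_mono ((IsBddMeas.integral_param_right (F := fun (D₂ : Fin n → Ω) x =>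
      (v x - projEst W j₂ X f₂ D₂ x) ^ 2) (hve.pow 2) _).integrable _)
      ((IsBddMeas.const _).integrable _) hx).trans ?_
    simp
  have hgB : ∫ x, W.proj j₂ (fun x => u x - W.proj j₁ r₁ x) x ^ 2 ∂cubeVol d
      ≤ ((1 + C₂) * B) ^ 2 := by
    refine (hW.integral_proj_sq_le hj₂ hg).trans ?_
    have hx : ∀ x, (u x - W.proj j₁ r₁ x) ^ 2 ≤ ((1 + C₂) * B) ^ 2 := by
      intro x
      rw [← sq_abs]
      refine pow_le_pow_left₀ (abs_nonneg _) ?_ 2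
      have := abs_sub (u x) (W.proj j₁ r₁ x)
      have := hp j₁ r₁ B h.abs_r₁ x
      have := hub x
      linarith
    refine (integral_mono ((hg.pow 2).integrable _) ((IsBddMeas.const _).integrable _) hx).trans ?_
    simp
  have hstep1 : ∀ D₂ : Fin n → Ω, ∫ D₁ : Fin n → Ω, (∫ x, (u x - projEst W j₁ X f₁ D₁ x) *
        (v x - projEst W j₂ X f₂ D₂ x) ∂cubeVol d - c) ^ 2 ∂sampleLaw P n
      ≤ B ^ 2 / n * ∫ x, (v x - projEst W j₂ X f₂ D₂ x) ^ 2 ∂cubeVol d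
        + (∫ x, (u x - W.proj j₁ r₁ x) * (v x - projEst W j₂ X f₂ D₂ x) ∂cubeVol d - c) ^ 2 := by
    intro D₂
    refine (h₁.integral_sq_linear_le hW j₁ hn hu (hve.section_left
      (F := fun D x => v x - projEst W j₂ X f₂ D x) D₂) c h.abs_f₁).trans ?_
    exact add_le_add_left (mul_le_mul_of_nonneg_left (hW.integral_proj_sq_le hj₁
      (hve.section_left (F := fun D x => v x - projEst W j₂ X f₂ D x) D₂)) (by positivity)) _
  have hstep2 := h₂.integral_sq_linear_le hW j₂ hn hv hg c h.abs_f₂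
  simp only [mul_comm (v _ - _)] at hstep2
  calc _ ≤ ∫ D₂ : Fin n → Ω, (B ^ 2 / n * ∫ x, (v x - projEst W j₂ X f₂ D₂ x) ^ 2 ∂cubeVol d
        + (∫ x, (u x - W.proj j₁ r₁ x) * (v x - projEst W j₂ X f₂ D₂ x) ∂cubeVol d - c) ^ 2)
        ∂sampleLaw P n :=
        integral_mono ((IsBddMeas.integral_param_right
          (F := fun D₁ D₂ => (∫ x, (u x - projEst W j₁ X f₁ D₁ x) *
          (v x - projEst W j₂ X f₂ D₂ x) ∂cubeVol d - c) ^ 2) hT _).integrable _)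
          (((hsq.const_mul _).add hlin).integrable _) hstep1
    _ = B ^ 2 / n * (∫ D₂ : Fin n → Ω, ∫ x, (v x - projEst W j₂ X f₂ D₂ x) ^ 2 ∂cubeVol d
          ∂sampleLaw P n) + ∫ D₂ : Fin n → Ω, (∫ x, (u x - W.proj j₁ r₁ x) *
          (v x - projEst W j₂ X f₂ D₂ x) ∂cubeVol d - c) ^ 2 ∂sampleLaw P n := by
        rw [integral_add ((hsq.const_mul _).integrable _) (hlin.integrable _), integral_const_mul]
    _ ≤ B ^ 2 / n * ((2 * B ^ 2 + 2 * C₁) * (1 + 2 ^ (j₂ * d) / n))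
          + (B ^ 2 / n * ((1 + C₂) * B) ^ 2
          + (∫ x, (u x - W.proj j₁ r₁ x) * (v x - W.proj j₂ r₂ x) ∂cubeVol d - c) ^ 2) := by
        refine add_le_add (mul_le_mul_of_nonneg_left hm (by positivity)) (hstep2.trans ?_)
        exact add_le_add_left (mul_le_mul_of_nonneg_left hgB (by positivity)) _
    _ ≤ _ := by
        rw [← add_assoc]
        refine add_le_add_left ?_ _
        have h0 : (0 : ℝ) ≤ 2 ^ (j₂ * d) / (n : ℝ) := by positivity
        have e1 : B ^ 2 / n * ((2 * B ^ 2 + 2 * C₁) * (1 + 2 ^ (j₂ * d) / n))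
            = (B ^ 2 * (2 * B ^ 2 + 2 * C₁)) * ((1 + 2 ^ (j₂ * d) / n) / n) := by ring
        have e2 : B ^ 2 / n * ((1 + C₂) * B) ^ 2 = (B ^ 2 * ((1 + C₂) * B) ^ 2) * (1 / n) := by ring
        have e3 : 1 / (n : ℝ) ≤ (1 + 2 ^ (j₂ * d) / n) / n := by gcongr; linarith
        have e4 : 0 ≤ 1 / (n : ℝ) := by positivity
        rw [e1, e2]
        nlinarith [mul_le_mul_of_nonneg_left e3
          (show 0 ≤ B ^ 2 * ((1 + C₂) * B) ^ 2 by positivity)]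

/-- Fubini for the variance of the Monte Carlo step and of the bias correction. -/
lemma integral_prod_projEst_sq (hW : W.IsCDVBasis J₀) (h₁ : IsRegression P X f₁ r₁)
    (h₂ : IsRegression P X f₂ r₂) (j₁ j₂ : ℕ) (s : ℝ) :
    ∫ D₁ : Fin n → Ω, ∫ D₂ : Fin n → Ω, ∫ x, (s + projEst W j₁ X f₁ D₁ x ^ 2) *
        (s + projEst W j₂ X f₂ D₂ x ^ 2) ∂cubeVol d ∂sampleLaw P n ∂sampleLaw P n
      = ∫ x, (s + ∫ D₁ : Fin n → Ω, projEst W j₁ X f₁ D₁ x ^ 2 ∂sampleLaw P n) *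
        (s + ∫ D₂ : Fin n → Ω, projEst W j₂ X f₂ D₂ x ^ 2 ∂sampleLaw P n) ∂cubeVol d := by
  have hE1 := ((IsBddMeas.const s).add
    ((isBddMeas_projEst (n := n) hW j₁ h₁.meas h₁.bdd).pow 2))
  have hE2 := ((IsBddMeas.const s).add
    ((isBddMeas_projEst (n := n) hW j₂ h₂.meas h₂.bdd).pow 2))
  have hadd : ∀ (j : ℕ) (f : Ω → ℝ) (x : Fin d → ℝ), IsBddMeas (fun D : Fin n → Ω =>
      projEst W j X f D x ^ 2) → s + ∫ D : Fin n → Ω, projEst W j X f D x ^ 2 ∂sampleLaw P n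
        = ∫ D : Fin n → Ω, (s + projEst W j X f D x ^ 2) ∂sampleLaw P n := by
    intro j f x hb
    rw [integral_add ((IsBddMeas.const _).integrable _) (hb.integrable _)]
    simp
  have h1 : ∀ D₁ : Fin n → Ω, ∫ D₂ : Fin n → Ω, ∫ x, (s + projEst W j₁ X f₁ D₁ x ^ 2) *
        (s + projEst W j₂ X f₂ D₂ x ^ 2) ∂cubeVol d ∂sampleLaw P n
      = ∫ x, (s + projEst W j₁ X f₁ D₁ x ^ 2) *
        (s + ∫ D₂ : Fin n → Ω, projEst W j₂ X f₂ D₂ x ^ 2 ∂sampleLaw P n) ∂cubeVol d := by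
    intro D₁
    rw [IsBddMeas.integral_comm (F := fun (D₂ : Fin n → Ω) x =>
      (s + projEst W j₁ X f₁ D₁ x ^ 2) * (s + projEst W j₂ X f₂ D₂ x ^ 2))
      (((hE1.section_left (F := fun D x => s + projEst W j₁ X f₁ D x ^ 2) D₁).comp
        measurable_snd).mul hE2)]
    refine integral_congr_ae (Filter.Eventually.of_forall fun x => ?_)
    simp only
    rw [integral_const_mul, hadd j₂ f₂ x
      (((isBddMeas_projEst (n := n) hW j₂ h₂.meas h₂.bdd).section_right x).pow 2)]
  simp only [h1]
  have hE2' : IsBddMeas fun x =>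
      s + ∫ D₂ : Fin n → Ω, projEst W j₂ X f₂ D₂ x ^ 2 ∂sampleLaw P n :=
    (IsBddMeas.const s).add (IsBddMeas.integral_param_right (F := fun (D₂ : Fin n → Ω) x =>
      projEst W j₂ X f₂ D₂ x ^ 2)
      ((isBddMeas_projEst (n := n) hW j₂ h₂.meas h₂.bdd).pow 2) _)
  rw [IsBddMeas.integral_comm (F := fun (D₁ : Fin n → Ω) x =>
      (s + projEst W j₁ X f₁ D₁ x ^ 2) *
        (s + ∫ D₂ : Fin n → Ω, projEst W j₂ X f₂ D₂ x ^ 2 ∂sampleLaw P n))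
      (hE1.mul (hE2'.comp measurable_snd))]
  refine integral_congr_ae (Filter.Eventually.of_forall fun x => ?_)
  simp only
  rw [integral_mul_const, hadd j₁ f₁ x
    (((isBddMeas_projEst (n := n) hW j₁ h₁.meas h₁.bdd).section_right x).pow 2)]

end Bilinear

section SplitSample

variable {Ω : Type} [MeasurableSpace Ω] {S J₀ d n : ℕ}

/-- The integral-based estimator of `E[f₁ f₂] - ∫ r₁ r₂`. -/
noncomputable def estINT (W : BoundaryWavelets S) (j₁ j₂ : ℕ) (X : Ω → Fin d → ℝ) (f₁ f₂ : Ω → ℝ)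
    (D₁ D₂ D₃ : Fin n → Ω) : ℝ :=
  sampleMean (fun ω => f₁ ω * f₂ ω) D₃
    - ∫ x, projEst W j₁ X f₁ D₁ x * projEst W j₂ X f₂ D₂ x ∂cubeVol d

/-- The Monte Carlo-based estimator of `E[f₁ f₂] - ∫ r₁ r₂`. -/
noncomputable def estMC (W : BoundaryWavelets S) (j₁ j₂ : ℕ) (X : Ω → Fin d → ℝ) (f₁ f₂ : Ω → ℝ)
    (D₁ D₂ D₃ D₄ : Fin n → Ω) : ℝ :=
  sampleMean (fun ω => f₁ ω * f₂ ω) D₃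
    - sampleMean (fun ω => projEst W j₁ X f₁ D₁ (X ω) * projEst W j₂ X f₂ D₂ (X ω)) D₄

/-- The bias-corrected estimator of `E[f₁ f₂] - ∫ r₁ r₂`. -/
noncomputable def estIF (W : BoundaryWavelets S) (j₁ j₂ : ℕ) (X : Ω → Fin d → ℝ) (f₁ f₂ : Ω → ℝ)
    (D₁ D₂ D₃ : Fin n → Ω) : ℝ :=
  sampleMean (fun ω => (f₁ ω - projEst W j₁ X f₁ D₁ (X ω)) *
    (f₂ ω - projEst W j₂ X f₂ D₂ (X ω))) D₃

/-- The target `E[f₁ f₂] - ∫ r₁ r₂`, which is the expected conditional covariance. -/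
noncomputable def covTarget (P : Measure Ω) (f₁ f₂ : Ω → ℝ) (r₁ r₂ : (Fin d → ℝ) → ℝ) : ℝ :=
  ∫ ω, f₁ ω * f₂ ω ∂P - ∫ x, r₁ x * r₂ x ∂cubeVol d

variable {W : BoundaryWavelets S}
  {P : Measure Ω} {X : Ω → Fin d → ℝ} {f₁ f₂ : Ω → ℝ}
  {r₁ r₂ : (Fin d → ℝ) → ℝ} {B : ℝ}

lemma isBddMeas_estINT (hW : W.IsCDVBasis J₀) (h₁ : IsRegression P X f₁ r₁)
    (h₂ : IsRegression P X f₂ r₂) (j₁ j₂ : ℕ) :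
    IsBddMeas fun z : (Fin n → Ω) × (Fin n → Ω) × (Fin n → Ω) =>
      estINT W j₁ j₂ X f₁ f₂ z.1 z.2.1 z.2.2 := by
  have e1 := (isBddMeas_projEst (n := n) hW j₁ h₁.meas h₁.bdd).comp
    (φ := fun z : ((Fin n → Ω) × (Fin n → Ω)) × (Fin d → ℝ) => (z.1.1, z.2)) (by fun_prop)
  have e2 := (isBddMeas_projEst (n := n) hW j₂ h₂.meas h₂.bdd).comp
    (φ := fun z : ((Fin n → Ω) × (Fin n → Ω)) × (Fin d → ℝ) => (z.1.2, z.2)) (by fun_prop)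
  have e3 := IsBddMeas.integral_param (F := fun (z : (Fin n → Ω) × (Fin n → Ω)) x =>
    projEst W j₁ X f₁ z.1 x * projEst W j₂ X f₂ z.2 x) (e1.mul e2) (cubeVol d)
  exact (((h₁.bdd.mul h₂.bdd).sampleMean (n := n)).comp
      (φ := fun z : (Fin n → Ω) × (Fin n → Ω) × (Fin n → Ω) => z.2.2) (by fun_prop)).sub
    (e3.comp (φ := fun z : (Fin n → Ω) × (Fin n → Ω) × (Fin n → Ω) => (z.1, z.2.1))
      (by fun_prop))

lemma isBddMeas_estMC (hW : W.IsCDVBasis J₀) (h₁ : IsRegression P X f₁ r₁)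
    (h₂ : IsRegression P X f₂ r₂) (j₁ j₂ : ℕ) :
    IsBddMeas fun z : (Fin n → Ω) × (Fin n → Ω) × (Fin n → Ω) × (Fin n → Ω) =>
      estMC W j₁ j₂ X f₁ f₂ z.1 z.2.1 z.2.2.1 z.2.2.2 := by
  have hX := h₁.meas
  refine IsBddMeas.sub (((h₁.bdd.mul h₂.bdd).sampleMean (n := n)).comp
      (φ := fun z : (Fin n → Ω) × (Fin n → Ω) × (Fin n → Ω) × (Fin n → Ω) => z.2.2.1)
      (by fun_prop)) ((IsBddMeas.sum _ fun i _ => ?_).const_mul _)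
  exact ((isBddMeas_projEst (n := n) hW j₁ h₁.meas h₁.bdd).comp
      (φ := fun z : (Fin n → Ω) × (Fin n → Ω) × (Fin n → Ω) × (Fin n → Ω) =>
        (z.1, X (z.2.2.2 i))) (by fun_prop)).mul
    ((isBddMeas_projEst (n := n) hW j₂ h₂.meas h₂.bdd).comp
      (φ := fun z : (Fin n → Ω) × (Fin n → Ω) × (Fin n → Ω) × (Fin n → Ω) =>
        (z.2.1, X (z.2.2.2 i))) (by fun_prop))

lemma isBddMeas_estIF (hW : W.IsCDVBasis J₀) (h₁ : IsRegression P X f₁ r₁)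
    (h₂ : IsRegression P X f₂ r₂) (j₁ j₂ : ℕ) :
    IsBddMeas fun z : (Fin n → Ω) × (Fin n → Ω) × (Fin n → Ω) =>
      estIF W j₁ j₂ X f₁ f₂ z.1 z.2.1 z.2.2 := by
  have hX := h₁.meas
  refine (IsBddMeas.sum _ fun i _ => ?_).const_mul _
  have c1 : Measurable fun z : (Fin n → Ω) × (Fin n → Ω) × (Fin n → Ω) => z.2.2 i := by fun_prop
  exact ((h₁.bdd.comp c1).sub ((isBddMeas_projEst (n := n) hW j₁ h₁.meas h₁.bdd).comp
      (φ := fun z : (Fin n → Ω) × (Fin n → Ω) × (Fin n → Ω) =>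
        (z.1, X (z.2.2 i))) (by fun_prop))).mul
    ((h₂.bdd.comp c1).sub ((isBddMeas_projEst (n := n) hW j₂ h₂.meas h₂.bdd).comp
      (φ := fun z : (Fin n → Ω) × (Fin n → Ω) × (Fin n → Ω) =>
        (z.2.1, X (z.2.2 i))) (by fun_prop)))

variable [IsProbabilityMeasure P]

/-- The risk of the integral estimator splits into the variance of the sample mean of `f₁ f₂` and
the risk of the integrated product of the two projection estimators. -/
lemma integral_estINT_sub_sq (hW : W.IsCDVBasis J₀) (h₁ : IsRegression P X f₁ r₁)
    (h₂ : IsRegression P X f₂ r₂) (j₁ j₂ : ℕ) (hn : n ≠ 0) :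
    ∫ O, (estINT W j₁ j₂ X f₁ f₂ (fun i => O (0, i)) (fun i => O (1, i)) (fun i => O (2, i))
        - covTarget P f₁ f₂ r₁ r₂) ^ 2 ∂(Measure.pi fun _ : Fin 3 × Fin n => P)
      = 1 / n * (∫ ω, (f₁ ω * f₂ ω) ^ 2 ∂P - (∫ ω, f₁ ω * f₂ ω ∂P) ^ 2)
        + ∫ D₂ : Fin n → Ω, ∫ D₁ : Fin n → Ω, (∫ x, (0 - projEst W j₁ X f₁ D₁ x) *
          (0 - projEst W j₂ X f₂ D₂ x) ∂cubeVol d - ∫ x, r₁ x * r₂ x ∂cubeVol d) ^ 2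
          ∂sampleLaw P n ∂sampleLaw P n := by
  have hT := ((isBddMeas_integral_mul_projEst (n := n) hW h₁ h₂ j₁ j₂ (.const 0) (.const 0)).sub
    (.const (∫ x, r₁ x * r₂ x ∂cubeVol d))).pow 2
  rw [integral_split_three P n (F := fun D₁ D₂ D₃ => (estINT W j₁ j₂ X f₁ f₂ D₁ D₂ D₃
    - covTarget P f₁ f₂ r₁ r₂) ^ 2) (((isBddMeas_estINT hW h₁ h₂ j₁ j₂).sub (.const _)).pow 2)]
  have h : ∀ D₁ D₂ : Fin n → Ω, ∫ D₃, (estINT W j₁ j₂ X f₁ f₂ D₁ D₂ D₃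
      - covTarget P f₁ f₂ r₁ r₂) ^ 2 ∂sampleLaw P n
      = 1 / n * (∫ ω, (f₁ ω * f₂ ω) ^ 2 ∂P - (∫ ω, f₁ ω * f₂ ω ∂P) ^ 2)
        + (∫ x, (0 - projEst W j₁ X f₁ D₁ x) *
          (0 - projEst W j₂ X f₂ D₂ x) ∂cubeVol d - ∫ x, r₁ x * r₂ x ∂cubeVol d) ^ 2 := by
    intro D₁ D₂
    have := integral_sampleMean_sub_sq P hn (h₁.bdd.mul h₂.bdd)
      (∫ x, projEst W j₁ X f₁ D₁ x * projEst W j₂ X f₂ D₂ x ∂cubeVol d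
        + covTarget P f₁ f₂ r₁ r₂)
    simp only [estINT, sub_sub, zero_sub, neg_mul_neg]
    rw [this]
    congr 1
    unfold covTarget
    ring
  simp only [h]
  rw [IsBddMeas.integral_comm (F := fun (D₁ D₂ : Fin n → Ω) => 1 / (n : ℝ) *
    (∫ ω, (f₁ ω * f₂ ω) ^ 2 ∂P - (∫ ω, f₁ ω * f₂ ω ∂P) ^ 2)
        + (∫ x, (0 - projEst W j₁ X f₁ D₁ x) *
          (0 - projEst W j₂ X f₂ D₂ x) ∂cubeVol d - ∫ x, r₁ x * r₂ x ∂cubeVol d) ^ 2)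
    ((IsBddMeas.const _).add hT)]
  have hT1 : ∀ D₂, IsBddMeas fun D₁ => (∫ x, (0 - projEst W j₁ X f₁ D₁ x) *
      (0 - projEst W j₂ X f₂ D₂ x) ∂cubeVol d - ∫ x, r₁ x * r₂ x ∂cubeVol d) ^ 2 :=
    fun D₂ => hT.section_right (F := fun D₁ D₂ => (∫ x, (0 - projEst W j₁ X f₁ D₁ x) *
      (0 - projEst W j₂ X f₂ D₂ x) ∂cubeVol d - ∫ x, r₁ x * r₂ x ∂cubeVol d) ^ 2) D₂
  have h' : ∀ D₂ : Fin n → Ω, ∫ D₁ : Fin n → Ω, (1 / (n : ℝ) *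
      (∫ ω, (f₁ ω * f₂ ω) ^ 2 ∂P - (∫ ω, f₁ ω * f₂ ω ∂P) ^ 2)
        + (∫ x, (0 - projEst W j₁ X f₁ D₁ x) *
          (0 - projEst W j₂ X f₂ D₂ x) ∂cubeVol d - ∫ x, r₁ x * r₂ x ∂cubeVol d) ^ 2) ∂sampleLaw P n
      = 1 / (n : ℝ) * (∫ ω, (f₁ ω * f₂ ω) ^ 2 ∂P - (∫ ω, f₁ ω * f₂ ω ∂P) ^ 2)
        + ∫ D₁ : Fin n → Ω, (∫ x, (0 - projEst W j₁ X f₁ D₁ x) *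
          (0 - projEst W j₂ X f₂ D₂ x) ∂cubeVol d - ∫ x, r₁ x * r₂ x ∂cubeVol d) ^ 2
          ∂sampleLaw P n := by
    intro D₂
    rw [integral_add ((IsBddMeas.const _).integrable _) ((hT1 D₂).integrable _)]
    simp
  simp only [h']
  rw [integral_add ((IsBddMeas.const _).integrable _)
    ((IsBddMeas.integral_param_right (F := fun D₁ D₂ => (∫ x, (0 - projEst W j₁ X f₁ D₁ x) *
      (0 - projEst W j₂ X f₂ D₂ x) ∂cubeVol d - ∫ x, r₁ x * r₂ x ∂cubeVol d) ^ 2) hT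
      _).integrable _)]
  simp

/-- The Monte Carlo step adds the variance of the integrand to the mean squared error. -/
lemma integral_estMC_sub_sq (hW : W.IsCDVBasis J₀) (h₁ : IsRegression P X f₁ r₁)
    (h₂ : IsRegression P X f₂ r₂) (j₁ j₂ : ℕ) (hn : n ≠ 0) :
    ∫ O, (estMC W j₁ j₂ X f₁ f₂ (fun i => O (0, i)) (fun i => O (1, i)) (fun i => O (2, i))
        (fun i => O (3, i)) - covTarget P f₁ f₂ r₁ r₂) ^ 2 ∂(Measure.pi fun _ : Fin 4 × Fin n => P)
      = ∫ D₁ : Fin n → Ω, ∫ D₂ : Fin n → Ω, 1 / n *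
          (∫ x, (projEst W j₁ X f₁ D₁ x * projEst W j₂ X f₂ D₂ x) ^ 2 ∂cubeVol d
            - (∫ x, projEst W j₁ X f₁ D₁ x * projEst W j₂ X f₂ D₂ x ∂cubeVol d) ^ 2)
          ∂sampleLaw P n ∂sampleLaw P n
        + ∫ O, (estINT W j₁ j₂ X f₁ f₂ (fun i => O (0, i)) (fun i => O (1, i)) (fun i => O (2, i))
        - covTarget P f₁ f₂ r₁ r₂) ^ 2 ∂(Measure.pi fun _ : Fin 3 × Fin n => P) := by
  have hINT := ((isBddMeas_estINT (n := n) hW h₁ h₂ j₁ j₂).sub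
    (.const (covTarget P f₁ f₂ r₁ r₂))).pow 2
  rw [integral_split_four P n (F := fun D₁ D₂ D₃ D₄ => (estMC W j₁ j₂ X f₁ f₂ D₁ D₂ D₃ D₄
    - covTarget P f₁ f₂ r₁ r₂) ^ 2) (((isBddMeas_estMC hW h₁ h₂ j₁ j₂).sub (.const _)).pow 2),
    integral_split_three P n (F := fun D₁ D₂ D₃ => (estINT W j₁ j₂ X f₁ f₂ D₁ D₂ D₃
    - covTarget P f₁ f₂ r₁ r₂) ^ 2) hINT]
  have hE1 := isBddMeas_projEst (n := n) hW j₁ h₁.meas h₁.bdd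
  have hE2 := isBddMeas_projEst (n := n) hW j₂ h₂.meas h₂.bdd
  have e1 := hE1.comp
    (φ := fun z : ((Fin n → Ω) × (Fin n → Ω)) × (Fin d → ℝ) => (z.1.1, z.2)) (by fun_prop)
  have e2 := hE2.comp
    (φ := fun z : ((Fin n → Ω) × (Fin n → Ω)) × (Fin d → ℝ) => (z.1.2, z.2)) (by fun_prop)
  have e3 := IsBddMeas.integral_param (F := fun (z : (Fin n → Ω) × (Fin n → Ω)) x =>
    projEst W j₁ X f₁ z.1 x * projEst W j₂ X f₂ z.2 x) (e1.mul e2) (cubeVol d)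
  have e4 := IsBddMeas.integral_param (F := fun (z : (Fin n → Ω) × (Fin n → Ω)) x =>
    (projEst W j₁ X f₁ z.1 x * projEst W j₂ X f₂ z.2 x) ^ 2) ((e1.mul e2).pow 2) (cubeVol d)
  have hV : IsBddMeas fun z : (Fin n → Ω) × (Fin n → Ω) => 1 / (n : ℝ) *
      (∫ x, (projEst W j₁ X f₁ z.1 x * projEst W j₂ X f₂ z.2 x) ^ 2 ∂cubeVol d
        - (∫ x, projEst W j₁ X f₁ z.1 x * projEst W j₂ X f₂ z.2 x ∂cubeVol d) ^ 2) :=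
    (e4.sub (e3.pow 2)).const_mul _
  have hI3 : IsBddMeas fun z : (Fin n → Ω) × (Fin n → Ω) => ∫ D₃,
      (estINT W j₁ j₂ X f₁ f₂ z.1 z.2 D₃ - covTarget P f₁ f₂ r₁ r₂) ^ 2 ∂sampleLaw P n :=
    IsBddMeas.integral_param (F := fun (z : (Fin n → Ω) × (Fin n → Ω)) D₃ =>
      (estINT W j₁ j₂ X f₁ f₂ z.1 z.2 D₃ - covTarget P f₁ f₂ r₁ r₂) ^ 2)
      (hINT.comp (φ := fun z : ((Fin n → Ω) × (Fin n → Ω)) × (Fin n → Ω) => (z.1.1, z.1.2, z.2))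
        (by fun_prop)) _
  rw [← integral_add ((IsBddMeas.integral_param (F := fun D₁ D₂ : Fin n → Ω => 1 / (n : ℝ) *
      (∫ x, (projEst W j₁ X f₁ D₁ x * projEst W j₂ X f₂ D₂ x) ^ 2 ∂cubeVol d
        - (∫ x, projEst W j₁ X f₁ D₁ x * projEst W j₂ X f₂ D₂ x ∂cubeVol d) ^ 2)) hV
      _).integrable _)
    ((IsBddMeas.integral_param (F := fun D₁ D₂ : Fin n → Ω => ∫ D₃,
      (estINT W j₁ j₂ X f₁ f₂ D₁ D₂ D₃ - covTarget P f₁ f₂ r₁ r₂) ^ 2 ∂sampleLaw P n)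
      hI3 _).integrable _)]
  refine integral_congr_ae (Filter.Eventually.of_forall fun D₁ => ?_)
  simp only
  rw [← integral_add ((hV.section_left (F := fun D₁ D₂ : Fin n → Ω => 1 / (n : ℝ) *
      (∫ x, (projEst W j₁ X f₁ D₁ x * projEst W j₂ X f₂ D₂ x) ^ 2 ∂cubeVol d
        - (∫ x, projEst W j₁ X f₁ D₁ x * projEst W j₂ X f₂ D₂ x ∂cubeVol d) ^ 2)) D₁).integrable _)
    ((hI3.section_left (F := fun D₁ D₂ : Fin n → Ω => ∫ D₃,
      (estINT W j₁ j₂ X f₁ f₂ D₁ D₂ D₃ - covTarget P f₁ f₂ r₁ r₂) ^ 2 ∂sampleLaw P n)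
      D₁).integrable _)]
  refine integral_congr_ae (Filter.Eventually.of_forall fun D₂ => ?_)
  simp only
  have hg := (hE1.section_left D₁).mul (hE2.section_left D₂)
  have hD3 : IsBddMeas fun D₃ : Fin n → Ω =>
      (estINT W j₁ j₂ X f₁ f₂ D₁ D₂ D₃ - covTarget P f₁ f₂ r₁ r₂) ^ 2 :=
    hINT.comp (φ := fun D₃ : Fin n → Ω => (D₁, D₂, D₃)) (by fun_prop)
  have h4 : ∀ D₃ : Fin n → Ω, ∫ D₄, (estMC W j₁ j₂ X f₁ f₂ D₁ D₂ D₃ D₄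
      - covTarget P f₁ f₂ r₁ r₂) ^ 2 ∂sampleLaw P n
      = 1 / n * (∫ x, (projEst W j₁ X f₁ D₁ x * projEst W j₂ X f₂ D₂ x) ^ 2 ∂cubeVol d
        - (∫ x, projEst W j₁ X f₁ D₁ x * projEst W j₂ X f₂ D₂ x ∂cubeVol d) ^ 2)
        + (estINT W j₁ j₂ X f₁ f₂ D₁ D₂ D₃ - covTarget P f₁ f₂ r₁ r₂) ^ 2 := by
    intro D₃
    have := integral_sampleMean_sub_sq P hn (hg.comp h₁.meas)
      (sampleMean (fun ω => f₁ ω * f₂ ω) D₃ - covTarget P f₁ f₂ r₁ r₂)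
    rw [integral_comp_of_map h₁.meas h₁.map hg, integral_comp_of_map h₁.meas h₁.map (hg.pow 2)]
      at this
    have h5 : ∀ D₄ : Fin n → Ω, (estMC W j₁ j₂ X f₁ f₂ D₁ D₂ D₃ D₄
        - covTarget P f₁ f₂ r₁ r₂) ^ 2
        = (sampleMean (fun ω => projEst W j₁ X f₁ D₁ (X ω) * projEst W j₂ X f₂ D₂ (X ω)) D₄
          - (sampleMean (fun ω => f₁ ω * f₂ ω) D₃ - covTarget P f₁ f₂ r₁ r₂)) ^ 2 := by
      intro D₄; unfold estMC; ring
    simp only [h5]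
    rw [this]
    unfold estINT
    ring
  simp only [h4]
  rw [integral_add ((IsBddMeas.const _).integrable _) (hD3.integrable _)]
  simp

/-- The mean squared error of the bias-corrected estimator: the bias is bilinear in the estimation
errors. -/
lemma integral_estIF_sub_sq (hW : W.IsCDVBasis J₀) (h₁ : IsRegression P X f₁ r₁)
    (h₂ : IsRegression P X f₂ r₂) (j₁ j₂ : ℕ) (hn : n ≠ 0) (D₁ D₂ : Fin n → Ω) :
    ∫ D₃, (estIF W j₁ j₂ X f₁ f₂ D₁ D₂ D₃ - covTarget P f₁ f₂ r₁ r₂) ^ 2 ∂sampleLaw P n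
      ≤ 1 / n * ∫ ω, ((f₁ ω - projEst W j₁ X f₁ D₁ (X ω)) *
          (f₂ ω - projEst W j₂ X f₂ D₂ (X ω))) ^ 2 ∂P
        + (∫ x, (r₁ x - projEst W j₁ X f₁ D₁ x) * (r₂ x - projEst W j₂ X f₂ D₂ x) ∂cubeVol d) ^ 2
      := by
  have hE1 := (isBddMeas_projEst (n := n) hW j₁ h₁.meas h₁.bdd).section_left D₁
  have hE2 := (isBddMeas_projEst (n := n) hW j₂ h₂.meas h₂.bdd).section_left D₂
  have hE1X := hE1.comp h₁.meas
  have hE2X := hE2.comp h₁.meas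
  have hg := (h₁.bdd.sub hE1X).mul (h₂.bdd.sub hE2X)
  have := integral_sampleMean_sub_sq P hn hg (covTarget P f₁ f₂ r₁ r₂)
  unfold estIF
  rw [this]
  have hmean : ∫ ω, (f₁ ω - projEst W j₁ X f₁ D₁ (X ω)) * (f₂ ω - projEst W j₂ X f₂ D₂ (X ω)) ∂P
      - covTarget P f₁ f₂ r₁ r₂
      = ∫ x, (r₁ x - projEst W j₁ X f₁ D₁ x) * (r₂ x - projEst W j₂ X f₂ D₂ x) ∂cubeVol d := by
    have e1 : ∫ ω, (f₁ ω - projEst W j₁ X f₁ D₁ (X ω)) * (f₂ ω - projEst W j₂ X f₂ D₂ (X ω)) ∂P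
        = ∫ ω, f₁ ω * f₂ ω ∂P - ∫ ω, f₁ ω * projEst W j₂ X f₂ D₂ (X ω) ∂P
          - ∫ ω, f₂ ω * projEst W j₁ X f₁ D₁ (X ω) ∂P
          + ∫ ω, projEst W j₁ X f₁ D₁ (X ω) * projEst W j₂ X f₂ D₂ (X ω) ∂P := by
      rw [← integral_sub ((h₁.bdd.mul h₂.bdd).integrable _) ((h₁.bdd.mul hE2X).integrable _),
        ← integral_sub (((h₁.bdd.mul h₂.bdd).sub (h₁.bdd.mul hE2X)).integrable _)
          ((h₂.bdd.mul hE1X).integrable _),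
        ← integral_add ((((h₁.bdd.mul h₂.bdd).sub (h₁.bdd.mul hE2X)).sub
          (h₂.bdd.mul hE1X)).integrable _) ((hE1X.mul hE2X).integrable _)]
      refine integral_congr_ae (Filter.Eventually.of_forall fun ω => ?_)
      simp only; ring
    have e2 : ∫ x, (r₁ x - projEst W j₁ X f₁ D₁ x) * (r₂ x - projEst W j₂ X f₂ D₂ x) ∂cubeVol d
        = ∫ x, r₁ x * r₂ x ∂cubeVol d - ∫ x, r₁ x * projEst W j₂ X f₂ D₂ x ∂cubeVol d
          - ∫ x, r₂ x * projEst W j₁ X f₁ D₁ x ∂cubeVol d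
          + ∫ x, projEst W j₁ X f₁ D₁ x * projEst W j₂ X f₂ D₂ x ∂cubeVol d := by
      have b1 := h₁.bdd_r
      have b2 := h₂.bdd_r
      rw [← integral_sub ((b1.mul b2).integrable _) ((b1.mul hE2).integrable _),
        ← integral_sub (((b1.mul b2).sub (b1.mul hE2)).integrable _)
          ((b2.mul hE1).integrable _),
        ← integral_add ((((b1.mul b2).sub (b1.mul hE2)).sub
          (b2.mul hE1)).integrable _) ((hE1.mul hE2).integrable _)]
      refine integral_congr_ae (Filter.Eventually.of_forall fun ω => ?_)
      simp only; ring
    rw [e1, e2, h₁.reg _ hE2, h₂.reg _ hE1,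
      integral_comp_of_map h₁.meas h₁.map (hE1.mul hE2)]
    unfold covTarget
    ring
  rw [hmean]
  gcongr
  linarith [sq_nonneg (∫ ω, (f₁ ω - projEst W j₁ X f₁ D₁ (X ω)) *
    (f₂ ω - projEst W j₂ X f₂ D₂ (X ω)) ∂P)]

end SplitSample

section MSEBounds

variable {S J₀ : ℕ} {W : BoundaryWavelets S}

/-- The squared bias of a plug-in estimator is a lower bound for its mean squared error. -/
lemma sq_bias_le_integral_estINT {Ω : Type} [MeasurableSpace Ω] {d n : ℕ} {P : Measure Ω}
    [IsProbabilityMeasure P] {X : Ω → Fin d → ℝ} {f₁ f₂ : Ω → ℝ} {r₁ r₂ : (Fin d → ℝ) → ℝ}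
    (hW : W.IsCDVBasis J₀) (h₁ : IsRegression P X f₁ r₁)
    (h₂ : IsRegression P X f₂ r₂) (j₁ j₂ : ℕ) (hn : n ≠ 0) :
    (∫ x, r₁ x * r₂ x ∂cubeVol d - ∫ x, W.proj j₁ r₁ x * W.proj j₂ r₂ x ∂cubeVol d) ^ 2
      ≤ ∫ O, (estINT W j₁ j₂ X f₁ f₂ (fun i => O (0, i)) (fun i => O (1, i)) (fun i => O (2, i))
        - covTarget P f₁ f₂ r₁ r₂) ^ 2 ∂(Measure.pi fun _ : Fin 3 × Fin n => P) := by
  rw [integral_estINT_sub_sq hW h₁ h₂ j₁ j₂ hn]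
  have h := sq_bias_le_integral hW h₁ h₂ j₁ j₂ hn (.const 0) (.const 0)
    (∫ x, r₁ x * r₂ x ∂cubeVol d)
  have hv := sq_integral_le P (h₁.bdd.mul h₂.bdd)
  have hv' : 0 ≤ 1 / (n : ℝ) * (∫ ω, (f₁ ω * f₂ ω) ^ 2 ∂P - (∫ ω, f₁ ω * f₂ ω ∂P) ^ 2) :=
    mul_nonneg (by positivity) (by linarith)
  have e : ∫ x, (0 - W.proj j₁ r₁ x) * (0 - W.proj j₂ r₂ x) ∂cubeVol d
      = ∫ x, W.proj j₁ r₁ x * W.proj j₂ r₂ x ∂cubeVol d := by simp only [zero_sub, neg_mul_neg]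
  rw [e] at h
  have e' : (∫ x, r₁ x * r₂ x ∂cubeVol d - ∫ x, W.proj j₁ r₁ x * W.proj j₂ r₂ x ∂cubeVol d) ^ 2
      = (∫ x, W.proj j₁ r₁ x * W.proj j₂ r₂ x ∂cubeVol d - ∫ x, r₁ x * r₂ x ∂cubeVol d) ^ 2 := by
    ring
  rw [e']
  linarith

/-- The bound for the bilinear functional holds with the two samples in either order, and so with the
smaller of the two resolutions. -/
lemma exists_integral_estINT_le (d : ℕ) (hW : W.IsCDVBasis J₀) (B : ℝ) : ∃ C : ℝ, 0 < C ∧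
    ∀ {Ω : Type} [MeasurableSpace Ω] (P : Measure Ω) [IsProbabilityMeasure P]
      (X : Ω → Fin d → ℝ) (f₁ f₂ : Ω → ℝ) (r₁ r₂ : (Fin d → ℝ) → ℝ),
      IsRegressionPair P X f₁ f₂ r₁ r₂ B → ∀ j₁, J₀ ≤ j₁ → ∀ j₂, J₀ ≤ j₂ → ∀ n : ℕ, n ≠ 0 →
      ∫ O, (estINT W j₁ j₂ X f₁ f₂ (fun i => O (0, i)) (fun i => O (1, i)) (fun i => O (2, i))
        - covTarget P f₁ f₂ r₁ r₂) ^ 2 ∂(Measure.pi fun _ : Fin 3 × Fin n => P)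
      ≤ C * ((1 + 2 ^ (min j₁ j₂ * d) / n) / n)
        + (∫ x, r₁ x * r₂ x ∂cubeVol d
          - ∫ x, W.proj j₁ r₁ x * W.proj j₂ r₂ x ∂cubeVol d) ^ 2 := by
  obtain ⟨C, hC, hbil⟩ := exists_integral_bilinear_sq_le d hW B
  refine ⟨C + B ^ 4, by positivity, fun {Ω} _ P _ X f₁ f₂ r₁ r₂ h j₁ hj₁ j₂ hj₂ n hn => ?_⟩
  have hn0 : (0 : ℝ) < n := by exact_mod_cast Nat.pos_of_ne_zero hn
  have hB : 0 ≤ B := (abs_nonneg _).trans (h.abs_r₁ 0)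
  have h₁ := h.fst
  have h₂ := h.snd
  rw [integral_estINT_sub_sq hW h₁ h₂ j₁ j₂ hn]
  have hV : 1 / (n : ℝ) * (∫ ω, (f₁ ω * f₂ ω) ^ 2 ∂P - (∫ ω, f₁ ω * f₂ ω ∂P) ^ 2)
      ≤ B ^ 4 * (1 / n) := by
    have hx : ∀ ω, (f₁ ω * f₂ ω) ^ 2 ≤ B ^ 4 := by
      intro ω
      rw [mul_pow, show B ^ 4 = B ^ 2 * B ^ 2 by ring, ← sq_abs (f₁ ω), ← sq_abs (f₂ ω)]
      have a1 := h.abs_f₁ ω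
      have a2 := h.abs_f₂ ω
      gcongr
    have := integral_mono (((h₁.bdd.mul h₂.bdd).pow 2).integrable P)
      ((IsBddMeas.const (B ^ 4)).integrable P) hx
    simp only [integral_const, probReal_univ, one_smul] at this
    rw [mul_comm]
    gcongr
    linarith [sq_nonneg (∫ ω, f₁ ω * f₂ ω ∂P)]
  have e : ∫ x, (0 - W.proj j₁ r₁ x) * (0 - W.proj j₂ r₂ x) ∂cubeVol d
      = ∫ x, W.proj j₁ r₁ x * W.proj j₂ r₂ x ∂cubeVol d := by simp only [zero_sub, neg_mul_neg]
  have e' : (∫ x, r₁ x * r₂ x ∂cubeVol d - ∫ x, W.proj j₁ r₁ x * W.proj j₂ r₂ x ∂cubeVol d) ^ 2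
      = (∫ x, W.proj j₁ r₁ x * W.proj j₂ r₂ x ∂cubeVol d - ∫ x, r₁ x * r₂ x ∂cubeVol d) ^ 2 := by
    ring
  have hT := ((isBddMeas_integral_mul_projEst (n := n) hW h₁ h₂ j₁ j₂ (.const 0) (.const 0)).sub
    (.const (∫ x, r₁ x * r₂ x ∂cubeVol d))).pow 2
  have b2 := hbil P X f₁ f₂ r₁ r₂ h j₁ hj₁ j₂ hj₂ n hn (fun _ => 0) (fun _ => 0)
    (∫ x, r₁ x * r₂ x ∂cubeVol d) (.const 0) (.const 0) (by simp [hB]) (by simp [hB])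
  have b1 := hbil P X f₂ f₁ r₂ r₁ h.symm j₂ hj₂ j₁ hj₁ n hn (fun _ => 0) (fun _ => 0)
    (∫ x, r₁ x * r₂ x ∂cubeVol d) (.const 0) (.const 0) (by simp [hB]) (by simp [hB])
  rw [IsBddMeas.integral_comm (F := fun (D₁ D₂ : Fin n → Ω) =>
    (∫ x, (0 - projEst W j₂ X f₂ D₂ x) * (0 - projEst W j₁ X f₁ D₁ x) ∂cubeVol d
      - ∫ x, r₁ x * r₂ x ∂cubeVol d) ^ 2) (by simpa only [mul_comm] using hT)] at b1
  have e1 : ∀ (D₁ D₂ : Fin n → Ω) (x : Fin d → ℝ),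
      (0 - projEst W j₂ X f₂ D₂ x) * (0 - projEst W j₁ X f₁ D₁ x)
        = (0 - projEst W j₁ X f₁ D₁ x) * (0 - projEst W j₂ X f₂ D₂ x) :=
    fun _ _ _ => mul_comm _ _
  simp only [e1, mul_comm (0 - W.proj j₂ r₂ _)] at b1
  rw [e] at b1 b2
  rw [e']
  have hk : ∀ j : ℕ, 1 / (n : ℝ) ≤ (1 + 2 ^ (j * d) / n) / n := fun j => by
    gcongr
    have : (0 : ℝ) ≤ 2 ^ (j * d) / (n : ℝ) := by positivity
    linarith
  have hB4 : 0 ≤ B ^ 4 := by positivity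
  rcases min_choice j₁ j₂ with hmin | hmin <;> rw [hmin]
  · nlinarith [mul_le_mul_of_nonneg_left (hk j₁) hB4]
  · nlinarith [mul_le_mul_of_nonneg_left (hk j₂) hB4]

/-- Evaluating the two estimators at the points of a further sample adds the second moment of their
product, which factorises by independence, to the risk of the integral estimator. -/
lemma exists_integral_estMC_le (d : ℕ) (hW : W.IsCDVBasis J₀) (B : ℝ) : ∃ C : ℝ, 0 < C ∧
    ∀ {Ω : Type} [MeasurableSpace Ω] (P : Measure Ω) [IsProbabilityMeasure P]
      (X : Ω → Fin d → ℝ) (f₁ f₂ : Ω → ℝ) (r₁ r₂ : (Fin d → ℝ) → ℝ),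
      IsRegressionPair P X f₁ f₂ r₁ r₂ B → ∀ j₁, J₀ ≤ j₁ → ∀ j₂, J₀ ≤ j₂ → ∀ n : ℕ, n ≠ 0 →
      ∫ O, (estMC W j₁ j₂ X f₁ f₂ (fun i => O (0, i)) (fun i => O (1, i)) (fun i => O (2, i))
        (fun i => O (3, i)) - covTarget P f₁ f₂ r₁ r₂) ^ 2 ∂(Measure.pi fun _ : Fin 4 × Fin n => P)
      ≤ C * ((1 + 2 ^ (j₁ * d) / n) * (1 + 2 ^ (j₂ * d) / n) / n)
        + (∫ x, r₁ x * r₂ x ∂cubeVol d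
          - ∫ x, W.proj j₁ r₁ x * W.proj j₂ r₂ x ∂cubeVol d) ^ 2 := by
  obtain ⟨C, hC, hINT⟩ := exists_integral_estINT_le d hW B
  obtain ⟨C₁, hC₁, hE⟩ := exists_integral_projEst_sq_le d hW B
  refine ⟨C + C₁ ^ 2, by positivity, fun {Ω} _ P _ X f₁ f₂ r₁ r₂ h j₁ hj₁ j₂ hj₂ n hn => ?_⟩
  have hn0 : (0 : ℝ) < n := by exact_mod_cast Nat.pos_of_ne_zero hn
  have h₁ := h.fst
  have h₂ := h.snd
  rw [integral_estMC_sub_sq hW h₁ h₂ j₁ j₂ hn]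
  have hI := hINT P X f₁ f₂ r₁ r₂ h j₁ hj₁ j₂ hj₂ n hn
  have hE1 := isBddMeas_projEst (n := n) hW j₁ h₁.meas h₁.bdd
  have hE2 := isBddMeas_projEst (n := n) hW j₂ h₂.meas h₂.bdd
  have e1 := hE1.comp
    (φ := fun z : ((Fin n → Ω) × (Fin n → Ω)) × (Fin d → ℝ) => (z.1.1, z.2)) (by fun_prop)
  have e2 := hE2.comp
    (φ := fun z : ((Fin n → Ω) × (Fin n → Ω)) × (Fin d → ℝ) => (z.1.2, z.2)) (by fun_prop)
  have e3 := IsBddMeas.integral_param (F := fun (z : (Fin n → Ω) × (Fin n → Ω)) x =>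
    projEst W j₁ X f₁ z.1 x * projEst W j₂ X f₂ z.2 x) (e1.mul e2) (cubeVol d)
  have e4 := IsBddMeas.integral_param (F := fun (z : (Fin n → Ω) × (Fin n → Ω)) x =>
    (projEst W j₁ X f₁ z.1 x * projEst W j₂ X f₂ z.2 x) ^ 2) ((e1.mul e2).pow 2) (cubeVol d)
  have hV : IsBddMeas fun z : (Fin n → Ω) × (Fin n → Ω) => 1 / (n : ℝ) *
      (∫ x, (projEst W j₁ X f₁ z.1 x * projEst W j₂ X f₂ z.2 x) ^ 2 ∂cubeVol d
        - (∫ x, projEst W j₁ X f₁ z.1 x * projEst W j₂ X f₂ z.2 x ∂cubeVol d) ^ 2) :=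
    (e4.sub (e3.pow 2)).const_mul _
  have hV' : IsBddMeas fun z : (Fin n → Ω) × (Fin n → Ω) => 1 / (n : ℝ) *
      ∫ x, (projEst W j₁ X f₁ z.1 x * projEst W j₂ X f₂ z.2 x) ^ 2 ∂cubeVol d := e4.const_mul _
  have hvar : ∫ D₁ : Fin n → Ω, ∫ D₂ : Fin n → Ω, 1 / n *
          (∫ x, (projEst W j₁ X f₁ D₁ x * projEst W j₂ X f₂ D₂ x) ^ 2 ∂cubeVol d
            - (∫ x, projEst W j₁ X f₁ D₁ x * projEst W j₂ X f₂ D₂ x ∂cubeVol d) ^ 2)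
          ∂sampleLaw P n ∂sampleLaw P n
      ≤ 1 / n * (C₁ ^ 2 * ((1 + 2 ^ (j₁ * d) / n) * (1 + 2 ^ (j₂ * d) / n))) := by
    calc _ ≤ ∫ D₁ : Fin n → Ω, ∫ D₂ : Fin n → Ω, 1 / n *
          ∫ x, (projEst W j₁ X f₁ D₁ x * projEst W j₂ X f₂ D₂ x) ^ 2 ∂cubeVol d
          ∂sampleLaw P n ∂sampleLaw P n := by
          refine integral_mono ((IsBddMeas.integral_param (F := fun D₁ D₂ : Fin n → Ω =>
            1 / (n : ℝ) * (∫ x, (projEst W j₁ X f₁ D₁ x * projEst W j₂ X f₂ D₂ x) ^ 2 ∂cubeVol d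
            - (∫ x, projEst W j₁ X f₁ D₁ x * projEst W j₂ X f₂ D₂ x ∂cubeVol d) ^ 2))
              hV _).integrable _)
            ((IsBddMeas.integral_param (F := fun D₁ D₂ : Fin n → Ω => 1 / (n : ℝ) *
              ∫ x, (projEst W j₁ X f₁ D₁ x * projEst W j₂ X f₂ D₂ x) ^ 2 ∂cubeVol d)
              hV' _).integrable _) fun D₁ => ?_
          refine integral_mono ((hV.section_left (F := fun D₁ D₂ : Fin n → Ω =>
            1 / (n : ℝ) * (∫ x, (projEst W j₁ X f₁ D₁ x * projEst W j₂ X f₂ D₂ x) ^ 2 ∂cubeVol d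
            - (∫ x, projEst W j₁ X f₁ D₁ x * projEst W j₂ X f₂ D₂ x ∂cubeVol d) ^ 2))
              D₁).integrable _)
            ((hV'.section_left (F := fun D₁ D₂ : Fin n → Ω => 1 / (n : ℝ) *
              ∫ x, (projEst W j₁ X f₁ D₁ x * projEst W j₂ X f₂ D₂ x) ^ 2 ∂cubeVol d)
              D₁).integrable _) fun D₂ => ?_
          refine mul_le_mul_of_nonneg_left ?_ (by positivity)
          linarith [sq_nonneg (∫ x, projEst W j₁ X f₁ D₁ x * projEst W j₂ X f₂ D₂ x ∂cubeVol d)]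
      _ = 1 / n * ∫ x, (∫ D₁ : Fin n → Ω, projEst W j₁ X f₁ D₁ x ^ 2 ∂sampleLaw P n) *
          (∫ D₂ : Fin n → Ω, projEst W j₂ X f₂ D₂ x ^ 2 ∂sampleLaw P n) ∂cubeVol d := by
          simp only [integral_const_mul]
          have := integral_prod_projEst_sq (n := n) hW h₁ h₂ j₁ j₂ 0
          simp only [zero_add] at this
          rw [← this]
          simp only [mul_pow]
      _ ≤ _ := by
          refine mul_le_mul_of_nonneg_left ?_ (by positivity)
          have q1 := IsBddMeas.integral_param_right (F := fun (D : Fin n → Ω) x =>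
            projEst W j₁ X f₁ D x ^ 2) (hE1.pow 2) (sampleLaw P n)
          have q2 := IsBddMeas.integral_param_right (F := fun (D : Fin n → Ω) x =>
            projEst W j₂ X f₂ D x ^ 2) (hE2.pow 2) (sampleLaw P n)
          refine (integral_mono ((q1.mul q2).integrable _) ((IsBddMeas.const _).integrable _)
            fun x => mul_le_mul (hE P X f₁ r₁ h₁ h.abs_f₁ h.abs_r₁ j₁ hj₁ n hn x)
              (hE P X f₂ r₂ h₂ h.abs_f₂ h.abs_r₂ j₂ hj₂ n hn x)
              (integral_nonneg fun _ => sq_nonneg _) (by positivity)).trans (le_of_eq ?_)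
          simp only [integral_const, probReal_univ, one_smul]
          ring
  have hmin : (1 + 2 ^ (min j₁ j₂ * d) / (n : ℝ)) / n
      ≤ (1 + 2 ^ (j₁ * d) / n) * (1 + 2 ^ (j₂ * d) / n) / n := by
    have h1 : (0 : ℝ) ≤ 2 ^ (j₁ * d) / (n : ℝ) := by positivity
    have h2 : (0 : ℝ) ≤ 2 ^ (j₂ * d) / (n : ℝ) := by positivity
    gcongr
    rcases min_choice j₁ j₂ with hmin | hmin <;> rw [hmin] <;> nlinarith [mul_nonneg h1 h2]
  have e5 : 1 / (n : ℝ) * (C₁ ^ 2 * ((1 + 2 ^ (j₁ * d) / n) * (1 + 2 ^ (j₂ * d) / n)))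
      = C₁ ^ 2 * ((1 + 2 ^ (j₁ * d) / n) * (1 + 2 ^ (j₂ * d) / n) / n) := by ring
  nlinarith [mul_le_mul_of_nonneg_left hmin hC.le]

/-- The corrected estimator has the bilinear bias of the two estimation errors; the second moment of
the product of the residuals involves both resolutions. -/
lemma exists_integral_estIF_le (d : ℕ) (hW : W.IsCDVBasis J₀) (B : ℝ) : ∃ C : ℝ, 0 < C ∧
    ∀ {Ω : Type} [MeasurableSpace Ω] (P : Measure Ω) [IsProbabilityMeasure P]
      (X : Ω → Fin d → ℝ) (f₁ f₂ : Ω → ℝ) (r₁ r₂ : (Fin d → ℝ) → ℝ),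
      IsRegressionPair P X f₁ f₂ r₁ r₂ B → ∀ j₁, J₀ ≤ j₁ → ∀ j₂, J₀ ≤ j₂ → ∀ n : ℕ, n ≠ 0 →
      ∫ O, (estIF W j₁ j₂ X f₁ f₂ (fun i => O (0, i)) (fun i => O (1, i)) (fun i => O (2, i))
        - covTarget P f₁ f₂ r₁ r₂) ^ 2 ∂(Measure.pi fun _ : Fin 3 × Fin n => P)
      ≤ C * ((1 + 2 ^ (j₁ * d) / n) * (1 + 2 ^ (j₂ * d) / n) / n)
        + (∫ x, (r₁ x - W.proj j₁ r₁ x) * (r₂ x - W.proj j₂ r₂ x) ∂cubeVol d) ^ 2 := by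
  obtain ⟨C, hC, hbil⟩ := exists_integral_bilinear_sq_le d hW B
  obtain ⟨C₁, hC₁, hE⟩ := exists_integral_projEst_sq_le d hW B
  refine ⟨C + 4 * (B ^ 2 + C₁) ^ 2, by positivity,
    fun {Ω} _ P _ X f₁ f₂ r₁ r₂ h j₁ hj₁ j₂ hj₂ n hn => ?_⟩
  have hn0 : (0 : ℝ) < n := by exact_mod_cast Nat.pos_of_ne_zero hn
  have h₁ := h.fst
  have h₂ := h.snd
  have hIF := ((isBddMeas_estIF (n := n) hW h₁ h₂ j₁ j₂).sub
    (.const (covTarget P f₁ f₂ r₁ r₂))).pow 2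
  rw [integral_split_three P n (F := fun D₁ D₂ D₃ => (estIF W j₁ j₂ X f₁ f₂ D₁ D₂ D₃
    - covTarget P f₁ f₂ r₁ r₂) ^ 2) hIF]
  have hE1 := isBddMeas_projEst (n := n) hW j₁ h₁.meas h₁.bdd
  have hE2 := isBddMeas_projEst (n := n) hW j₂ h₂.meas h₂.bdd
  have e1 := hE1.comp
    (φ := fun z : ((Fin n → Ω) × (Fin n → Ω)) × (Fin d → ℝ) => (z.1.1, z.2)) (by fun_prop)
  have e2 := hE2.comp
    (φ := fun z : ((Fin n → Ω) × (Fin n → Ω)) × (Fin d → ℝ) => (z.1.2, z.2)) (by fun_prop)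
  have hQ : IsBddMeas fun z : (Fin n → Ω) × (Fin n → Ω) =>
      ∫ x, (B ^ 2 + projEst W j₁ X f₁ z.1 x ^ 2) * (B ^ 2 + projEst W j₂ X f₂ z.2 x ^ 2)
        ∂cubeVol d :=
    IsBddMeas.integral_param (F := fun (z : (Fin n → Ω) × (Fin n → Ω)) x =>
      (B ^ 2 + projEst W j₁ X f₁ z.1 x ^ 2) * (B ^ 2 + projEst W j₂ X f₂ z.2 x ^ 2))
      (((IsBddMeas.const _).add (e1.pow 2)).mul ((IsBddMeas.const _).add (e2.pow 2))) (cubeVol d)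
  have hT := (isBddMeas_integral_mul_projEst (n := n) hW h₁ h₂ j₁ j₂ h₁.bdd_r h₂.bdd_r).pow 2
  have hU : IsBddMeas fun z : (Fin n → Ω) × (Fin n → Ω) => 4 / (n : ℝ) *
      (∫ x, (B ^ 2 + projEst W j₁ X f₁ z.1 x ^ 2) * (B ^ 2 + projEst W j₂ X f₂ z.2 x ^ 2)
        ∂cubeVol d)
      + (∫ x, (r₁ x - projEst W j₁ X f₁ z.1 x) * (r₂ x - projEst W j₂ X f₂ z.2 x)
        ∂cubeVol d) ^ 2 := (hQ.const_mul _).add hT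
  have hI3 : IsBddMeas fun z : (Fin n → Ω) × (Fin n → Ω) => ∫ D₃,
      (estIF W j₁ j₂ X f₁ f₂ z.1 z.2 D₃ - covTarget P f₁ f₂ r₁ r₂) ^ 2 ∂sampleLaw P n :=
    IsBddMeas.integral_param (F := fun (z : (Fin n → Ω) × (Fin n → Ω)) D₃ =>
      (estIF W j₁ j₂ X f₁ f₂ z.1 z.2 D₃ - covTarget P f₁ f₂ r₁ r₂) ^ 2)
      (hIF.comp (φ := fun z : ((Fin n → Ω) × (Fin n → Ω)) × (Fin n → Ω) => (z.1.1, z.1.2, z.2))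
        (by fun_prop)) _
  have hsq : ∀ (f e : ℝ), |f| ≤ B → (f - e) ^ 2 ≤ 2 * (B ^ 2 + e ^ 2) := by
    intro f e hf
    have : f ^ 2 ≤ B ^ 2 := by rw [← sq_abs]; exact pow_le_pow_left₀ (abs_nonneg _) hf 2
    nlinarith [sq_nonneg (f + e)]
  have hstep : ∀ D₁ D₂ : Fin n → Ω, ∫ D₃, (estIF W j₁ j₂ X f₁ f₂ D₁ D₂ D₃
        - covTarget P f₁ f₂ r₁ r₂) ^ 2 ∂sampleLaw P n
      ≤ 4 / (n : ℝ) *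
      (∫ x, (B ^ 2 + projEst W j₁ X f₁ D₁ x ^ 2) * (B ^ 2 + projEst W j₂ X f₂ D₂ x ^ 2)
        ∂cubeVol d)
      + (∫ x, (r₁ x - projEst W j₁ X f₁ D₁ x) * (r₂ x - projEst W j₂ X f₂ D₂ x)
        ∂cubeVol d) ^ 2 := by
    intro D₁ D₂
    refine (integral_estIF_sub_sq hW h₁ h₂ j₁ j₂ hn D₁ D₂).trans (add_le_add_left ?_ _)
    have b1 := hE1.section_left D₁
    have b2 := hE2.section_left D₂
    have b := ((IsBddMeas.const (B ^ 2)).add (b1.pow 2)).mul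
      ((IsBddMeas.const (B ^ 2)).add (b2.pow 2))
    rw [← integral_comp_of_map h₁.meas h₁.map b, show (4 : ℝ) / n = 1 / n * 4 by ring, mul_assoc]
    refine mul_le_mul_of_nonneg_left ?_ (by positivity)
    rw [← integral_const_mul]
    refine integral_mono ((((h₁.bdd.sub (b1.comp h₁.meas)).mul
      (h₂.bdd.sub (b2.comp h₁.meas))).pow 2).integrable _)
      (((b.comp h₁.meas).const_mul 4).integrable _) fun ω => ?_
    simp only
    rw [mul_pow]
    have a1 := hsq _ (projEst W j₁ X f₁ D₁ (X ω)) (h.abs_f₁ ω)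
    have a2 := hsq _ (projEst W j₂ X f₂ D₂ (X ω)) (h.abs_f₂ ω)
    calc _ ≤ (2 * (B ^ 2 + projEst W j₁ X f₁ D₁ (X ω) ^ 2)) *
          (2 * (B ^ 2 + projEst W j₂ X f₂ D₂ (X ω) ^ 2)) :=
          mul_le_mul a1 a2 (sq_nonneg _) (by positivity)
      _ = _ := by ring
  have hb := hbil P X f₁ f₂ r₁ r₂ h j₁ hj₁ j₂ hj₂ n hn r₁ r₂ 0 h₁.bdd_r h₂.bdd_r h.abs_r₁ h.abs_r₂
  simp only [sub_zero] at hb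
  rw [← IsBddMeas.integral_comm (F := fun (D₁ D₂ : Fin n → Ω) =>
    (∫ x, (r₁ x - projEst W j₁ X f₁ D₁ x) * (r₂ x - projEst W j₂ X f₂ D₂ x)
        ∂cubeVol d) ^ 2) hT] at hb
  have hmom : ∫ D₁ : Fin n → Ω, ∫ D₂ : Fin n → Ω, ∫ x, (B ^ 2 + projEst W j₁ X f₁ D₁ x ^ 2) *
        (B ^ 2 + projEst W j₂ X f₂ D₂ x ^ 2) ∂cubeVol d ∂sampleLaw P n ∂sampleLaw P n
      ≤ (B ^ 2 + C₁) ^ 2 * ((1 + 2 ^ (j₁ * d) / n) * (1 + 2 ^ (j₂ * d) / n)) := by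
    rw [integral_prod_projEst_sq hW h₁ h₂ j₁ j₂]
    have q1 := (IsBddMeas.const (B ^ 2)).add (IsBddMeas.integral_param_right
      (F := fun (D : Fin n → Ω) x => projEst W j₁ X f₁ D x ^ 2) (hE1.pow 2) (sampleLaw P n))
    have q2 := (IsBddMeas.const (B ^ 2)).add (IsBddMeas.integral_param_right
      (F := fun (D : Fin n → Ω) x => projEst W j₂ X f₂ D x ^ 2) (hE2.pow 2) (sampleLaw P n))
    have hk : ∀ j : ℕ, B ^ 2 + C₁ * (1 + 2 ^ (j * d) / (n : ℝ))
        ≤ (B ^ 2 + C₁) * (1 + 2 ^ (j * d) / n) := fun j => by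
      have : (0 : ℝ) ≤ 2 ^ (j * d) / (n : ℝ) := by positivity
      nlinarith [mul_nonneg (sq_nonneg B) this]
    refine (integral_mono ((q1.mul q2).integrable _) ((IsBddMeas.const _).integrable _)
      fun x => mul_le_mul ((add_le_add le_rfl
          (hE P X f₁ r₁ h₁ h.abs_f₁ h.abs_r₁ j₁ hj₁ n hn x)).trans (hk j₁))
        ((add_le_add le_rfl
          (hE P X f₂ r₂ h₂ h.abs_f₂ h.abs_r₂ j₂ hj₂ n hn x)).trans (hk j₂))
        (add_nonneg (sq_nonneg _) (integral_nonneg fun _ => sq_nonneg _))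
        (by positivity)).trans (le_of_eq ?_)
    simp only [integral_const, probReal_univ, one_smul]
    ring
  have hmain : ∫ D₁ : Fin n → Ω, ∫ D₂ : Fin n → Ω, ∫ D₃, (estIF W j₁ j₂ X f₁ f₂ D₁ D₂ D₃
        - covTarget P f₁ f₂ r₁ r₂) ^ 2 ∂sampleLaw P n ∂sampleLaw P n ∂sampleLaw P n
      ≤ 4 / n * ((B ^ 2 + C₁) ^ 2 * ((1 + 2 ^ (j₁ * d) / n) * (1 + 2 ^ (j₂ * d) / n)))
        + (C * ((1 + 2 ^ (j₂ * d) / n) / n)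
        + (∫ x, (r₁ x - W.proj j₁ r₁ x) * (r₂ x - W.proj j₂ r₂ x) ∂cubeVol d) ^ 2) := by
    calc _ ≤ ∫ D₁ : Fin n → Ω, ∫ D₂ : Fin n → Ω, (4 / (n : ℝ) *
          (∫ x, (B ^ 2 + projEst W j₁ X f₁ D₁ x ^ 2) * (B ^ 2 + projEst W j₂ X f₂ D₂ x ^ 2)
            ∂cubeVol d)
          + (∫ x, (r₁ x - projEst W j₁ X f₁ D₁ x) * (r₂ x - projEst W j₂ X f₂ D₂ x)
            ∂cubeVol d) ^ 2) ∂sampleLaw P n ∂sampleLaw P n := by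
          refine integral_mono ((IsBddMeas.integral_param (F := fun D₁ D₂ : Fin n → Ω => ∫ D₃,
            (estIF W j₁ j₂ X f₁ f₂ D₁ D₂ D₃ - covTarget P f₁ f₂ r₁ r₂) ^ 2 ∂sampleLaw P n)
            hI3 _).integrable _) ((IsBddMeas.integral_param (F := fun D₁ D₂ : Fin n → Ω =>
            4 / (n : ℝ) * (∫ x, (B ^ 2 + projEst W j₁ X f₁ D₁ x ^ 2) *
              (B ^ 2 + projEst W j₂ X f₂ D₂ x ^ 2) ∂cubeVol d)
            + (∫ x, (r₁ x - projEst W j₁ X f₁ D₁ x) * (r₂ x - projEst W j₂ X f₂ D₂ x)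
              ∂cubeVol d) ^ 2) hU _).integrable _) fun D₁ => ?_
          exact integral_mono ((hI3.section_left (F := fun D₁ D₂ : Fin n → Ω => ∫ D₃,
            (estIF W j₁ j₂ X f₁ f₂ D₁ D₂ D₃ - covTarget P f₁ f₂ r₁ r₂) ^ 2 ∂sampleLaw P n)
            D₁).integrable _) ((hU.section_left (F := fun D₁ D₂ : Fin n → Ω =>
            4 / (n : ℝ) * (∫ x, (B ^ 2 + projEst W j₁ X f₁ D₁ x ^ 2) *
              (B ^ 2 + projEst W j₂ X f₂ D₂ x ^ 2) ∂cubeVol d)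
            + (∫ x, (r₁ x - projEst W j₁ X f₁ D₁ x) * (r₂ x - projEst W j₂ X f₂ D₂ x)
              ∂cubeVol d) ^ 2) D₁).integrable _) fun D₂ => hstep D₁ D₂
      _ = 4 / (n : ℝ) * (∫ D₁ : Fin n → Ω, ∫ D₂ : Fin n → Ω,
          ∫ x, (B ^ 2 + projEst W j₁ X f₁ D₁ x ^ 2) *
          (B ^ 2 + projEst W j₂ X f₂ D₂ x ^ 2) ∂cubeVol d ∂sampleLaw P n ∂sampleLaw P n)
          + ∫ D₁ : Fin n → Ω, ∫ D₂ : Fin n → Ω, (∫ x, (r₁ x - projEst W j₁ X f₁ D₁ x) *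
            (r₂ x - projEst W j₂ X f₂ D₂ x) ∂cubeVol d) ^ 2 ∂sampleLaw P n ∂sampleLaw P n := by
          have hQ' := IsBddMeas.integral_param (F := fun D₁ D₂ : Fin n → Ω =>
            ∫ x, (B ^ 2 + projEst W j₁ X f₁ D₁ x ^ 2) *
              (B ^ 2 + projEst W j₂ X f₂ D₂ x ^ 2) ∂cubeVol d) hQ (sampleLaw P n)
          have hT' := IsBddMeas.integral_param (F := fun D₁ D₂ : Fin n → Ω =>
            (∫ x, (r₁ x - projEst W j₁ X f₁ D₁ x) * (r₂ x - projEst W j₂ X f₂ D₂ x)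
              ∂cubeVol d) ^ 2) hT (sampleLaw P n)
          rw [← integral_const_mul, ← integral_add ((hQ'.const_mul _).integrable _)
            (hT'.integrable _)]
          refine integral_congr_ae (Filter.Eventually.of_forall fun D₁ => ?_)
          simp only
          rw [← integral_const_mul, ← integral_add
            (((hQ.section_left (F := fun D₁ D₂ : Fin n → Ω =>
              ∫ x, (B ^ 2 + projEst W j₁ X f₁ D₁ x ^ 2) *
              (B ^ 2 + projEst W j₂ X f₂ D₂ x ^ 2) ∂cubeVol d) D₁).const_mul _).integrable _)
            ((hT.section_left (F := fun D₁ D₂ : Fin n → Ω =>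
              (∫ x, (r₁ x - projEst W j₁ X f₁ D₁ x) * (r₂ x - projEst W j₂ X f₂ D₂ x)
              ∂cubeVol d) ^ 2) D₁).integrable _)]
      _ ≤ _ := add_le_add (mul_le_mul_of_nonneg_left hmom (by positivity)) hb
  refine hmain.trans ?_
  have h1 : (0 : ℝ) ≤ 2 ^ (j₁ * d) / (n : ℝ) := by positivity
  have h2 : (0 : ℝ) ≤ 2 ^ (j₂ * d) / (n : ℝ) := by positivity
  have h3 : (1 + 2 ^ (j₂ * d) / (n : ℝ)) / n
      ≤ (1 + 2 ^ (j₁ * d) / n) * (1 + 2 ^ (j₂ * d) / n) / n := by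
    gcongr
    nlinarith [mul_nonneg h1 h2]
  have e5 : 4 / (n : ℝ) * ((B ^ 2 + C₁) ^ 2 * ((1 + 2 ^ (j₁ * d) / n) * (1 + 2 ^ (j₂ * d) / n)))
      = 4 * (B ^ 2 + C₁) ^ 2 * ((1 + 2 ^ (j₁ * d) / n) * (1 + 2 ^ (j₂ * d) / n) / n) := by ring
  nlinarith [mul_le_mul_of_nonneg_left h3 hC.le]

end MSEBounds

section MCLower

variable {S J₀ : ℕ} {W : BoundaryWavelets S}

/-- The variance of the Monte Carlo step is of order at least `k₁ k₂ / n³` when the conditional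
second moments of the variables are bounded from below. -/
lemma exists_le_integral_estMC (d : ℕ) (hW : W.IsCDVBasis J₀) (B : ℝ) {c₀ : ℝ} (hc₀ : 0 < c₀) :
    ∃ c C : ℝ, 0 < c ∧ 0 < C ∧
    ∀ {Ω : Type} [MeasurableSpace Ω] (P : Measure Ω) [IsProbabilityMeasure P]
      (X : Ω → Fin d → ℝ) (f₁ f₂ : Ω → ℝ) (r₁ r₂ : (Fin d → ℝ) → ℝ),
      IsRegressionPair P X f₁ f₂ r₁ r₂ B →
      (∀ g : (Fin d → ℝ) → ℝ, IsBddMeas g → (∀ x, 0 ≤ g x) →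
        c₀ * ∫ x, g x ∂cubeVol d ≤ ∫ ω, f₁ ω ^ 2 * g (X ω) ∂P) →
      (∀ g : (Fin d → ℝ) → ℝ, IsBddMeas g → (∀ x, 0 ≤ g x) →
        c₀ * ∫ x, g x ∂cubeVol d ≤ ∫ ω, f₂ ω ^ 2 * g (X ω) ∂P) →
      ∀ j₁, J₀ ≤ j₁ → ∀ j₂, J₀ ≤ j₂ → ∀ n : ℕ, n ≠ 0 →
      1 / n * (c * (2 ^ (j₁ * d) / n * (2 ^ (j₂ * d) / n)) - C * (1 + 2 ^ (j₂ * d) / n))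
      ≤ ∫ O, (estMC W j₁ j₂ X f₁ f₂ (fun i => O (0, i)) (fun i => O (1, i)) (fun i => O (2, i))
        (fun i => O (3, i)) - covTarget P f₁ f₂ r₁ r₂) ^ 2
          ∂(Measure.pi fun _ : Fin 4 × Fin n => P) := by
  obtain ⟨c, hc, hdiag⟩ := hW.exists_le_kernel_diag d
  obtain ⟨C, hC, hbil⟩ := exists_integral_bilinear_sq_le d hW B
  obtain ⟨C₂, hC₂, hp⟩ := hW.exists_abs_proj_le d
  refine ⟨(c₀ * c) ^ 2, C + (C₂ * B) ^ 4, by positivity, by positivity,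
    fun {Ω} _ P _ X f₁ f₂ r₁ r₂ h hl₁ hl₂ j₁ hj₁ j₂ hj₂ n hn => ?_⟩
  have hn1 : (1 : ℝ) ≤ n := by exact_mod_cast Nat.one_le_iff_ne_zero.mpr hn
  have hn0 : (0 : ℝ) < n := by linarith
  have hB : 0 ≤ B := (abs_nonneg _).trans (h.abs_r₁ 0)
  have h₁ := h.fst
  have h₂ := h.snd
  rw [integral_estMC_sub_sq hW h₁ h₂ j₁ j₂ hn]
  have hnn : 0 ≤ ∫ O, (estINT W j₁ j₂ X f₁ f₂ (fun i => O (0, i)) (fun i => O (1, i))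
      (fun i => O (2, i)) - covTarget P f₁ f₂ r₁ r₂) ^ 2
      ∂(Measure.pi fun _ : Fin 3 × Fin n => P) := integral_nonneg fun _ => sq_nonneg _
  refine le_trans ?_ (le_add_of_nonneg_right hnn)
  have hE1 := isBddMeas_projEst (n := n) hW j₁ h₁.meas h₁.bdd
  have hE2 := isBddMeas_projEst (n := n) hW j₂ h₂.meas h₂.bdd
  have e1 := hE1.comp
    (φ := fun z : ((Fin n → Ω) × (Fin n → Ω)) × (Fin d → ℝ) => (z.1.1, z.2)) (by fun_prop)
  have e2 := hE2.comp
    (φ := fun z : ((Fin n → Ω) × (Fin n → Ω)) × (Fin d → ℝ) => (z.1.2, z.2)) (by fun_prop)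
  have e3 := (IsBddMeas.integral_param (F := fun (z : (Fin n → Ω) × (Fin n → Ω)) x =>
    projEst W j₁ X f₁ z.1 x * projEst W j₂ X f₂ z.2 x) (e1.mul e2) (cubeVol d)).pow 2
  have e4 := IsBddMeas.integral_param (F := fun (z : (Fin n → Ω) × (Fin n → Ω)) x =>
    (projEst W j₁ X f₁ z.1 x * projEst W j₂ X f₂ z.2 x) ^ 2) ((e1.mul e2).pow 2) (cubeVol d)
  have hsplit : ∫ D₁ : Fin n → Ω, ∫ D₂ : Fin n → Ω, 1 / n *
          (∫ x, (projEst W j₁ X f₁ D₁ x * projEst W j₂ X f₂ D₂ x) ^ 2 ∂cubeVol d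
            - (∫ x, projEst W j₁ X f₁ D₁ x * projEst W j₂ X f₂ D₂ x ∂cubeVol d) ^ 2)
          ∂sampleLaw P n ∂sampleLaw P n
      = 1 / n * (∫ D₁ : Fin n → Ω, ∫ D₂ : Fin n → Ω,
          ∫ x, (projEst W j₁ X f₁ D₁ x * projEst W j₂ X f₂ D₂ x) ^ 2 ∂cubeVol d
          ∂sampleLaw P n ∂sampleLaw P n - ∫ D₁ : Fin n → Ω, ∫ D₂ : Fin n → Ω,
          (∫ x, projEst W j₁ X f₁ D₁ x * projEst W j₂ X f₂ D₂ x ∂cubeVol d) ^ 2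
          ∂sampleLaw P n ∂sampleLaw P n) := by
    simp only [integral_const_mul]
    congr 1
    rw [← integral_sub ((IsBddMeas.integral_param (F := fun D₁ D₂ : Fin n → Ω =>
        ∫ x, (projEst W j₁ X f₁ D₁ x * projEst W j₂ X f₂ D₂ x) ^ 2 ∂cubeVol d) e4 _).integrable _)
      ((IsBddMeas.integral_param (F := fun D₁ D₂ : Fin n → Ω =>
        (∫ x, projEst W j₁ X f₁ D₁ x * projEst W j₂ X f₂ D₂ x ∂cubeVol d) ^ 2) e3 _).integrable _)]
    refine integral_congr_ae (Filter.Eventually.of_forall fun D₁ => ?_)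
    exact integral_sub ((e4.section_left (F := fun D₁ D₂ : Fin n → Ω =>
        ∫ x, (projEst W j₁ X f₁ D₁ x * projEst W j₂ X f₂ D₂ x) ^ 2 ∂cubeVol d) D₁).integrable _)
      ((e3.section_left (F := fun D₁ D₂ : Fin n → Ω =>
        (∫ x, projEst W j₁ X f₁ D₁ x * projEst W j₂ X f₂ D₂ x ∂cubeVol d) ^ 2) D₁).integrable _)
  rw [hsplit]
  refine mul_le_mul_of_nonneg_left (sub_le_sub ?_ ?_) (by positivity)
  · have hprod := integral_prod_projEst_sq (n := n) hW h₁ h₂ j₁ j₂ 0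
    simp only [zero_add] at hprod
    simp only [mul_pow]
    rw [hprod]
    have hlow : ∀ (f : Ω → ℝ) (r : (Fin d → ℝ) → ℝ), IsRegression P X f r →
        (∀ g : (Fin d → ℝ) → ℝ, IsBddMeas g → (∀ x, 0 ≤ g x) →
          c₀ * ∫ x, g x ∂cubeVol d ≤ ∫ ω, f ω ^ 2 * g (X ω) ∂P) → ∀ j, J₀ ≤ j →
        ∀ᵐ x ∂cubeVol d, c₀ * c * (2 ^ (j * d) / n)
          ≤ ∫ D : Fin n → Ω, projEst W j X f D x ^ 2 ∂sampleLaw P n := by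
      intro f r hr hl j hj
      filter_upwards [hdiag j hj] with x hx
      refine le_trans ?_ (hr.le_integral_projEst_sq hW j hn x)
      have h3 := hl (fun y => W.kernel j y x ^ 2)
        (((hW.isBddMeas_kernel j).section_right x).pow 2) fun _ => sq_nonneg _
      rw [hW.integral_kernel_sq hj] at h3
      have h4 : c₀ * (c * 2 ^ (j * d)) ≤ ∫ ω, f ω ^ 2 * W.kernel j (X ω) x ^ 2 ∂P :=
        (mul_le_mul_of_nonneg_left hx hc₀.le).trans h3
      calc c₀ * c * (2 ^ (j * d) / n) = 1 / n * (c₀ * (c * 2 ^ (j * d))) := by ring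
        _ ≤ _ := mul_le_mul_of_nonneg_left h4 (by positivity)
    have q1 := IsBddMeas.integral_param_right (F := fun (D : Fin n → Ω) x =>
      projEst W j₁ X f₁ D x ^ 2) (hE1.pow 2) (sampleLaw P n)
    have q2 := IsBddMeas.integral_param_right (F := fun (D : Fin n → Ω) x =>
      projEst W j₂ X f₂ D x ^ 2) (hE2.pow 2) (sampleLaw P n)
    have hint : ∫ _x, (c₀ * c) ^ 2 * (2 ^ (j₁ * d) / (n : ℝ) * (2 ^ (j₂ * d) / n)) ∂cubeVol d
        ≤ ∫ x, (∫ D₁ : Fin n → Ω, projEst W j₁ X f₁ D₁ x ^ 2 ∂sampleLaw P n) *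
          (∫ D₂ : Fin n → Ω, projEst W j₂ X f₂ D₂ x ^ 2 ∂sampleLaw P n) ∂cubeVol d := by
      refine integral_mono_ae ((IsBddMeas.const _).integrable _) ((q1.mul q2).integrable _) ?_
      filter_upwards [hlow f₁ r₁ h₁ hl₁ j₁ hj₁, hlow f₂ r₂ h₂ hl₂ j₂ hj₂] with x hx1 hx2
      calc (c₀ * c) ^ 2 * (2 ^ (j₁ * d) / (n : ℝ) * (2 ^ (j₂ * d) / n))
          = (c₀ * c * (2 ^ (j₁ * d) / n)) * (c₀ * c * (2 ^ (j₂ * d) / n)) := by ring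
        _ ≤ _ := mul_le_mul hx1 hx2 (by positivity) (integral_nonneg fun _ => sq_nonneg _)
    rwa [integral_const, probReal_univ, one_smul, mul_pow c₀ c] at hint
  · have hT := (isBddMeas_integral_mul_projEst (n := n) hW h₁ h₂ j₁ j₂
      (.const 0) (.const 0)).pow 2
    have hb := hbil P X f₁ f₂ r₁ r₂ h j₁ hj₁ j₂ hj₂ n hn (fun _ => 0) (fun _ => 0) 0 (.const 0)
      (.const 0) (by simp [hB]) (by simp [hB])
    simp only [sub_zero] at hb
    rw [← IsBddMeas.integral_comm (F := fun (D₁ D₂ : Fin n → Ω) =>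
      (∫ x, (0 - projEst W j₁ X f₁ D₁ x) * (0 - projEst W j₂ X f₂ D₂ x) ∂cubeVol d) ^ 2) hT] at hb
    simp only [zero_sub, neg_mul_neg] at hb
    refine hb.trans ?_
    have hpp : (∫ x, W.proj j₁ r₁ x * W.proj j₂ r₂ x ∂cubeVol d) ^ 2 ≤ (C₂ * B) ^ 4 := by
      have p1 := hW.isBddMeas_proj j₁ h₁.bdd_r
      have p2 := hW.isBddMeas_proj j₂ h₂.bdd_r
      refine (sq_integral_le _ (p1.mul p2)).trans ?_
      refine (integral_mono (((p1.mul p2).pow 2).integrable _)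
        ((IsBddMeas.const ((C₂ * B) ^ 4)).integrable _) fun x => ?_).trans (by simp)
      simp only
      rw [mul_pow, show (C₂ * B) ^ 4 = (C₂ * B) ^ 2 * (C₂ * B) ^ 2 by ring, ← sq_abs,
        ← sq_abs (W.proj j₂ r₂ x)]
      have a1 := hp j₁ r₁ B h.abs_r₁ x
      have a2 := hp j₂ r₂ B h.abs_r₂ x
      gcongr
    have h2 : (0 : ℝ) ≤ 2 ^ (j₂ * d) / (n : ℝ) := by positivity
    have h3 : (1 + 2 ^ (j₂ * d) / (n : ℝ)) / n ≤ 1 + 2 ^ (j₂ * d) / n :=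
      div_le_self (by linarith) hn1
    have h4 : 0 ≤ (C₂ * B) ^ 4 := by positivity
    nlinarith [mul_le_mul_of_nonneg_left h3 hC.le, mul_nonneg h4 h2]

end MCLower

/-! ### Laws of the model -/

section Model

variable {d : ℕ}

lemma sigmaX_le : sigmaX d ≤ (inferInstance : MeasurableSpace (Obs d)) :=
  measurable_fst.comap_le

variable {P : ProbabilityMeasure (Obs d)}

lemma stronglyMeasurable_comp_fst {g : (Fin d → ℝ) → ℝ} (hg : Measurable g) :
    StronglyMeasurable[sigmaX d] fun o : Obs d => g o.1 :=
  (hg.comp (comap_measurable _)).stronglyMeasurable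

/-- A version of the conditional expectation that is a bounded function of the covariate is a
regression function. -/
lemma isRegression_of_condExp
    (hX : (P : Measure (Obs d)).map (fun o => o.1) = cubeVol d) {f h : Obs d → ℝ}
    {r : (Fin d → ℝ) → ℝ} (hf : IsBddMeas f) (hr : IsBddMeas r)
    (hfh : h =ᵐ[(P : Measure (Obs d))] f)
    (hc : condExp (sigmaX d) (P : Measure (Obs d)) h =ᵐ[(P : Measure (Obs d))] fun o => r o.1) :
    IsRegression (P : Measure (Obs d)) (fun o => o.1) f r where
  meas := measurable_fst
  map := hX
  bdd := hf
  bdd_r := hr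
  reg g hg := by
    have hgX := hg.comp (φ := fun o : Obs d => o.1) measurable_fst
    have h1 := condExp_mul_of_stronglyMeasurable_right (μ := (P : Measure (Obs d)))
      (stronglyMeasurable_comp_fst hg.1) ((hf.mul hgX).integrable _) (hf.integrable _)
    rw [← integral_comp_of_map measurable_fst hX (hr.mul hg)]
    have h2 := integral_condExp (μ := (P : Measure (Obs d))) (sigmaX_le (d := d))
      (f := f * fun o : Obs d => g o.1)
    change ∫ o : Obs d, (f * fun o : Obs d => g o.1) o ∂(P : Measure (Obs d)) = _
    rw [← h2]
    refine integral_congr_ae ?_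
    filter_upwards [h1, hc, condExp_congr_ae (m := sigmaX d) hfh] with o ho1 ho2 ho3
    rw [ho1, Pi.mul_apply, ← ho3, ho2]

lemma condExp_of_isRegression {f h : Obs d → ℝ} {r : (Fin d → ℝ) → ℝ}
    (H : IsRegression (P : Measure (Obs d)) (fun o => o.1) f r)
    (hfh : h =ᵐ[(P : Measure (Obs d))] f) :
    condExp (sigmaX d) (P : Measure (Obs d)) h =ᵐ[(P : Measure (Obs d))] fun o => r o.1 := by
  have hrX := H.bdd_r.comp (φ := fun o : Obs d => o.1) measurable_fst
  refine (condExp_congr_ae hfh).trans (Filter.EventuallyEq.symm ?_)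
  refine ae_eq_condExp_of_forall_setIntegral_eq sigmaX_le (H.bdd.integrable _)
    (fun s _ _ => (hrX.integrable _).integrableOn) (fun s hs _ => ?_)
    (stronglyMeasurable_comp_fst H.bdd_r.1).aestronglyMeasurable
  obtain ⟨t, ht, rfl⟩ := hs
  have hg : IsBddMeas (t.indicator fun _ : Fin d → ℝ => (1 : ℝ)) := (IsBddMeas.const 1).indicator ht
  have h1 := H.reg _ hg
  rw [← integral_comp_of_map measurable_fst H.map (H.bdd_r.mul hg)] at h1
  rw [← integral_indicator (measurable_fst ht), ← integral_indicator (measurable_fst ht)]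
  have h2 : ∀ k : Obs d → ℝ, ((fun o : Obs d => o.1) ⁻¹' t).indicator k
      = fun o => k o * t.indicator (fun _ : Fin d → ℝ => (1 : ℝ)) o.1 := by
    intro k
    funext o
    by_cases ho : o.1 ∈ t
    · rw [indicator_of_mem (show o ∈ (fun o : Obs d => o.1) ⁻¹' t from ho), indicator_of_mem ho,
        mul_one]
    · rw [indicator_of_notMem (show o ∉ (fun o : Obs d => o.1) ⁻¹' t from ho),
        indicator_of_notMem ho, mul_zero]
  rw [h2, h2]
  exact h1.symm

/-- Covariances can be computed from bounded versions of `A`, `Y` and of their regression functions. -/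
lemma psi_eq_covTarget {f₁ f₂ : Obs d → ℝ} {r₁ r₂ : (Fin d → ℝ) → ℝ}
    (h₁ : IsRegression (P : Measure (Obs d)) (fun o => o.1) f₁ r₁)
    (h₂ : IsRegression (P : Measure (Obs d)) (fun o => o.1) f₂ r₂)
    (hA : (fun o => o.2.1) =ᵐ[(P : Measure (Obs d))] f₁)
    (hY : (fun o => o.2.2) =ᵐ[(P : Measure (Obs d))] f₂) :
    psi P = covTarget (P : Measure (Obs d)) f₁ f₂ r₁ r₂ := by
  have hX : Measurable fun o : Obs d => o.1 := measurable_fst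
  have b1 := h₁.bdd_r.comp hX
  have b2 := h₂.bdd_r.comp hX
  unfold psi condCov
  rw [integral_condExp sigmaX_le]
  have e : ∫ o, (o.2.1 - condA P o) * (o.2.2 - condY P o) ∂(P : Measure (Obs d))
      = ∫ o, (f₁ o * f₂ o - f₁ o * r₂ o.1 - f₂ o * r₁ o.1 + r₁ o.1 * r₂ o.1)
        ∂(P : Measure (Obs d)) := by
    refine integral_congr_ae ?_
    filter_upwards [condExp_of_isRegression h₁ hA, condExp_of_isRegression h₂ hY, hA, hY]
      with o o1 o2 o3 o4
    unfold condA condY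
    rw [o1, o2, o3, o4]; ring
  rw [e, integral_add ((((h₁.bdd.mul h₂.bdd).sub (h₁.bdd.mul b2)).sub
      (h₂.bdd.mul b1)).integrable _) ((b1.mul b2).integrable _),
    integral_sub (((h₁.bdd.mul h₂.bdd).sub (h₁.bdd.mul b2)).integrable _)
      ((h₂.bdd.mul b1).integrable _),
    integral_sub ((h₁.bdd.mul h₂.bdd).integrable _) ((h₁.bdd.mul b2).integrable _),
    h₁.reg _ h₂.bdd_r, h₂.reg _ h₁.bdd_r,
    integral_comp_of_map hX h₁.map (h₁.bdd_r.mul h₂.bdd_r)]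
  unfold covTarget
  simp only [mul_comm (r₂ _)]
  ring

/-- Truncation to the interval `[C₁, C₂]`. -/
noncomputable def clampTo (C₁ C₂ t : ℝ) : ℝ := max C₁ (min C₂ t)

lemma clampTo_eq {C₁ C₂ t : ℝ} (h : t ∈ Icc C₁ C₂) : clampTo C₁ C₂ t = t := by
  simp [clampTo, h.1, h.2]

lemma clampTo_mem {C₁ C₂ : ℝ} (h : C₁ ≤ C₂) (t : ℝ) : clampTo C₁ C₂ t ∈ Icc C₁ C₂ :=
  ⟨le_max_left _ _, max_le h (min_le_left _ _)⟩

lemma abs_clampTo_le {C₁ C₂ : ℝ} (h : C₁ ≤ C₂) (t : ℝ) : |clampTo C₁ C₂ t| ≤ max |C₁| |C₂| :=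
  abs_le_max_abs_abs (clampTo_mem h t).1 (clampTo_mem h t).2

lemma measurable_clampTo (C₁ C₂ : ℝ) : Measurable (clampTo C₁ C₂) := by
  unfold clampTo; fun_prop

lemma isBddMeas_clampTo {Ω : Type*} [MeasurableSpace Ω] {C₁ C₂ : ℝ} (h : C₁ ≤ C₂) {f : Ω → ℝ}
    (hf : Measurable f) : IsBddMeas fun ω => clampTo C₁ C₂ (f ω) :=
  ⟨(measurable_clampTo C₁ C₂).comp hf, _, fun _ => abs_clampTo_le h _⟩

/-- Outside null sets a member of the model has `A` (or `Y`) and its regression function with values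
in `[C₁, C₂]`; clamping them makes this hold everywhere. -/
lemma exists_isRegression_of_condExp {C₁ C₂ : ℝ} (hC : C₁ ≤ C₂)
    (hX : (P : Measure (Obs d)).map (fun o => o.1) = cubeVol d) {f : Obs d → ℝ}
    {h : (Fin d → ℝ) → ℝ} (hfm : Measurable f)
    (hf : ∀ᵐ o ∂(P : Measure (Obs d)), f o ∈ Icc C₁ C₂)
    (hh : ContinuousOn h (Icc 0 1))
    (hc : condExp (sigmaX d) (P : Measure (Obs d)) f =ᵐ[(P : Measure (Obs d))] fun o => h o.1) :
    ∃ r : (Fin d → ℝ) → ℝ, (∀ x, r x ∈ Icc C₁ C₂) ∧ r =ᵐ[cubeVol d] h ∧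
      IsRegression (P : Measure (Obs d)) (fun o => o.1) (fun o => clampTo C₁ C₂ (f o)) r := by
  have hXm : Measurable fun o : Obs d => o.1 := measurable_fst
  set g : (Fin d → ℝ) → ℝ := (Icc (0 : Fin d → ℝ) 1).indicator h
  have hg : Measurable g := by
    classical
    have h1 := hh.measurable_piecewise (s := Icc (0 : Fin d → ℝ) 1) (g := fun _ => (0 : ℝ))
      continuousOn_const measurableSet_Icc
    have h2 : (Icc (0 : Fin d → ℝ) 1).piecewise h (fun _ => 0) = g := Set.piecewise_eq_indicator
    rwa [h2] at h1
  have hgh : g =ᵐ[cubeVol d] h := by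
    filter_upwards [ae_restrict_mem measurableSet_Icc] with x hx
    exact indicator_of_mem hx _
  have hcub : ∀ᵐ o ∂(P : Measure (Obs d)), o.1 ∈ Icc (0 : Fin d → ℝ) 1 := by
    refine ae_of_ae_map hXm.aemeasurable ?_
    rw [hX]
    exact ae_restrict_mem measurableSet_Icc
  have hfc : (f : Obs d → ℝ) =ᵐ[(P : Measure (Obs d))] fun o => clampTo C₁ C₂ (f o) := by
    filter_upwards [hf] with o ho using (clampTo_eq ho).symm
  have hfi : Integrable f (P : Measure (Obs d)) :=
    ((isBddMeas_clampTo hC hfm).integrable _).congr hfc.symm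
  have hle1 := condExp_mono (m := sigmaX d) (integrable_const C₁) hfi (hf.mono fun o ho => ho.1)
  have hle2 := condExp_mono (m := sigmaX d) hfi (integrable_const C₂) (hf.mono fun o ho => ho.2)
  rw [condExp_const sigmaX_le] at hle1 hle2
  have hgI : ∀ᵐ o ∂(P : Measure (Obs d)), g o.1 ∈ Icc C₁ C₂ := by
    filter_upwards [hcub, hle1, hle2, hc] with o h0 h1 h2 h3
    simp only [g, indicator_of_mem h0]
    rw [h3] at h1 h2
    exact ⟨h1, h2⟩
  have hgI' : ∀ᵐ x ∂cubeVol d, g x ∈ Icc C₁ C₂ := by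
    rw [← hX]
    exact (ae_map_iff hXm.aemeasurable (hg measurableSet_Icc)).mpr hgI
  refine ⟨fun x => clampTo C₁ C₂ (g x), fun x => clampTo_mem hC _, ?_, ?_⟩
  · filter_upwards [hgI', hgh] with x h1 h2
    rw [clampTo_eq h1, h2]
  · refine isRegression_of_condExp hX (isBddMeas_clampTo hC hfm) (isBddMeas_clampTo hC hg) hfc ?_
    filter_upwards [hc, hgI, hcub] with o h1 h2 h3
    rw [h1, clampTo_eq h2]
    exact (indicator_of_mem h3 _).symm

/-- The structure of the laws of the model. -/
lemma exists_isRegressionPair_of_mem_model {S : ℕ} {W : BoundaryWavelets S} {J₀ : ℕ}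
    {α β M C₁ C₂ : ℝ} (hC : C₁ ≤ C₂) (hP : P ∈ model W d J₀ α β M C₁ C₂) :
    ∃ r₁ r₂ : (Fin d → ℝ) → ℝ,
      IsRegressionPair (P : Measure (Obs d)) (fun o => o.1) (fun o => clampTo C₁ C₂ o.2.1)
        (fun o => clampTo C₁ C₂ o.2.2) r₁ r₂ (max |C₁| |C₂|) ∧
      (∀ x, r₁ x ∈ Icc C₁ C₂) ∧ (∀ x, r₂ x ∈ Icc C₁ C₂) ∧
      (∃ h ∈ W.holderBall d J₀ α M, r₁ =ᵐ[cubeVol d] h) ∧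
      (∃ h ∈ W.holderBall d J₀ β M, r₂ =ᵐ[cubeVol d] h) ∧
      psi P = covTarget (P : Measure (Obs d)) (fun o => clampTo C₁ C₂ o.2.1)
        (fun o => clampTo C₁ C₂ o.2.2) r₁ r₂ := by
  obtain ⟨hX, hAY, ⟨p, hp, hpc⟩, b, hb, hbc⟩ := hP
  obtain ⟨r₁, m1, e1, R1⟩ := exists_isRegression_of_condExp hC hX (f := fun o => o.2.1)
    (by fun_prop) (hAY.mono fun o ho => ho.1) hp.1.continuousOn hpc
  obtain ⟨r₂, m2, e2, R2⟩ := exists_isRegression_of_condExp hC hX (f := fun o => o.2.2)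
    (by fun_prop) (hAY.mono fun o ho => ho.2) hb.1.continuousOn hbc
  refine ⟨r₁, r₂, ⟨R1, R2, fun o => abs_clampTo_le hC _, fun o => abs_clampTo_le hC _,
    fun x => abs_le_max_abs_abs (m1 x).1 (m1 x).2, fun x => abs_le_max_abs_abs (m2 x).1 (m2 x).2⟩,
    m1, m2, ⟨p, hp, e1⟩, ⟨b, hb, e2⟩, psi_eq_covTarget R1 R2 ?_ ?_⟩
  · filter_upwards [hAY] with o ho using (clampTo_eq ho.1).symm
  · filter_upwards [hAY] with o ho using (clampTo_eq ho.2).symm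

end Model

section TwoPointLaws

/-- The sign of an observed value of a variable with values in `{C₁, C₂}`: `-1` at `C₁`. -/
noncomputable def signOf (C₁ a : ℝ) : ℝ := by
  classical exact if a = C₁ then -1 else 1

lemma signOf_self (C₁ : ℝ) : signOf C₁ C₁ = -1 := by simp [signOf]

lemma signOf_of_ne {C₁ a : ℝ} (h : a ≠ C₁) : signOf C₁ a = 1 := by simp [signOf, h]

lemma signOf_eq_or (C₁ a : ℝ) : signOf C₁ a = 1 ∨ signOf C₁ a = -1 := by
  unfold signOf; split_ifs <;> simp

lemma abs_signOf (C₁ a : ℝ) : |signOf C₁ a| = 1 := by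
  rcases signOf_eq_or C₁ a with h | h <;> simp [h]

lemma isBddMeas_signOf (C₁ : ℝ) : IsBddMeas (signOf C₁) := by
  refine ⟨?_, 1, fun a => (abs_signOf C₁ a).le⟩
  classical
  unfold signOf
  exact Measurable.ite (measurableSet_singleton C₁) measurable_const measurable_const

/-- The uniform distribution on `{C₁, C₂}`. -/
noncomputable def unifTwo (C₁ C₂ : ℝ) : Measure ℝ :=
  (2⁻¹ : ℝ≥0∞) • Measure.dirac C₁ + (2⁻¹ : ℝ≥0∞) • Measure.dirac C₂

instance (C₁ C₂ : ℝ) : IsProbabilityMeasure (unifTwo C₁ C₂) :=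
  ⟨by simp [unifTwo, ENNReal.inv_two_add_inv_two]⟩

lemma integral_unifTwo (C₁ C₂ : ℝ) {f : ℝ → ℝ} (hf : IsBddMeas f) :
    ∫ a, f a ∂unifTwo C₁ C₂ = (f C₁ + f C₂) / 2 := by
  have h : ∀ c : ℝ, Integrable f ((2⁻¹ : ℝ≥0∞) • Measure.dirac c) := fun c =>
    (hf.integrable (Measure.dirac c)).smul_measure (by simp)
  rw [unifTwo, integral_add_measure (h C₁) (h C₂), integral_smul_measure, integral_smul_measure,
    integral_dirac, integral_dirac]
  simp; ring

variable {d : ℕ}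

/-- The law under which `X`, `A`, `Y` are independent, `X` is uniform on the cube, and `A`, `Y` are
uniform on `{C₁, C₂}`. -/
noncomputable def refLaw (d : ℕ) (C₁ C₂ : ℝ) : Measure (Obs d) :=
  (cubeVol d).prod ((unifTwo C₁ C₂).prod (unifTwo C₁ C₂))

instance (C₁ C₂ : ℝ) : IsProbabilityMeasure (refLaw d C₁ C₂) := by
  unfold refLaw; infer_instance

lemma integral_refLaw (C₁ C₂ : ℝ) {F : Obs d → ℝ} (hF : IsBddMeas F) :
    ∫ o, F o ∂refLaw d C₁ C₂ = ∫ x, (F (x, C₁, C₁) + F (x, C₁, C₂) + F (x, C₂, C₁)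
      + F (x, C₂, C₂)) / 4 ∂cubeVol d := by
  unfold refLaw
  rw [integral_prod _ (hF.integrable _)]
  refine integral_congr_ae (Filter.Eventually.of_forall fun x => ?_)
  have h1 : IsBddMeas fun z : ℝ × ℝ => F (x, z) := hF.comp (by fun_prop)
  simp only
  rw [integral_prod _ (h1.integrable _)]
  have h2 : ∀ a, ∫ y, F (x, a, y) ∂unifTwo C₁ C₂ = (F (x, a, C₁) + F (x, a, C₂)) / 2 := fun a =>
    integral_unifTwo C₁ C₂ (h1.comp (φ := fun y => (a, y)) (by fun_prop))
  simp only [h2]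
  rw [integral_unifTwo C₁ C₂]
  · ring
  · have := ((h1.comp (φ := fun a => (a, C₁)) (by fun_prop)).add
      (h1.comp (φ := fun a => (a, C₂)) (by fun_prop))).const_mul (1 / 2)
    convert this using 2
    ring

/-- The density, relative to `refLaw`, of the law for which the conditional means given `X` of the
signs of `A`, of `Y` and of their product are `p`, `b` and `θ`. -/
noncomputable def signDensity (C₁ : ℝ) (p b θ : (Fin d → ℝ) → ℝ) (o : Obs d) : ℝ :=
  1 + signOf C₁ o.2.1 * p o.1 + signOf C₁ o.2.2 * b o.1
    + signOf C₁ o.2.1 * signOf C₁ o.2.2 * θ o.1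

/-- Bounded functions `p`, `b`, `θ` which are the conditional means of two signs and their
product. -/
structure IsSignMeans (C₁ : ℝ) (p b θ : (Fin d → ℝ) → ℝ) : Prop where
  bdd_p : IsBddMeas p
  bdd_b : IsBddMeas b
  bdd_θ : IsBddMeas θ
  nonneg : ∀ o, 0 ≤ signDensity C₁ p b θ o

variable {C₁ C₂ : ℝ} {p b θ : (Fin d → ℝ) → ℝ}

lemma isBddMeas_sign_fst (C₁ : ℝ) : IsBddMeas fun o : Obs d => signOf C₁ o.2.1 :=
  (isBddMeas_signOf C₁).comp (φ := fun o : Obs d => o.2.1) (by fun_prop)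

lemma isBddMeas_sign_snd (C₁ : ℝ) : IsBddMeas fun o : Obs d => signOf C₁ o.2.2 :=
  (isBddMeas_signOf C₁).comp (φ := fun o : Obs d => o.2.2) (by fun_prop)

lemma IsSignMeans.isBddMeas (h : IsSignMeans C₁ p b θ) : IsBddMeas (signDensity C₁ p b θ) := by
  have hX : Measurable fun o : Obs d => o.1 := measurable_fst
  have h1 := isBddMeas_sign_fst (d := d) C₁
  have h2 := isBddMeas_sign_snd (d := d) C₁
  exact ((((IsBddMeas.const 1).add (h1.mul (h.bdd_p.comp hX))).add
    (h2.mul (h.bdd_b.comp hX))).add ((h1.mul h2).mul (h.bdd_θ.comp hX)))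

lemma integral_mul_signDensity (hC : C₁ < C₂) (h : IsSignMeans C₁ p b θ) {F : Obs d → ℝ}
    (hF : IsBddMeas F) :
    ∫ o, F o * signDensity C₁ p b θ o ∂refLaw d C₁ C₂
      = ∫ x, (F (x, C₁, C₁) * (1 - p x - b x + θ x) + F (x, C₁, C₂) * (1 - p x + b x - θ x)
        + F (x, C₂, C₁) * (1 + p x - b x - θ x) + F (x, C₂, C₂) * (1 + p x + b x + θ x)) / 4
        ∂cubeVol d := by
  rw [integral_refLaw C₁ C₂ (hF.mul h.isBddMeas)]
  refine integral_congr_ae (Filter.Eventually.of_forall fun x => ?_)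
  simp only [signDensity, signOf_self, signOf_of_ne hC.ne']
  ring

lemma integral_signDensity (hC : C₁ < C₂) (h : IsSignMeans C₁ p b θ) :
    ∫ o, signDensity C₁ p b θ o ∂refLaw d C₁ C₂ = 1 := by
  have h1 := integral_mul_signDensity hC h (F := fun _ => 1) (.const 1)
  simp only [one_mul] at h1
  rw [h1]
  have : ∀ x, (1 - p x - b x + θ x + (1 - p x + b x - θ x) + (1 + p x - b x - θ x)
      + (1 + p x + b x + θ x)) / 4 = 1 := fun x => by ring
  simp only [this, integral_const, probReal_univ, one_smul]

lemma isProbabilityMeasure_withDensity_signDensity (hC : C₁ < C₂) (h : IsSignMeans C₁ p b θ) :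
    IsProbabilityMeasure
      ((refLaw d C₁ C₂).withDensity fun o => ENNReal.ofReal (signDensity C₁ p b θ o)) := by
  constructor
  rw [withDensity_apply _ MeasurableSet.univ, Measure.restrict_univ,
    ← ofReal_integral_eq_lintegral_ofReal (h.isBddMeas.integrable _)
      (Filter.Eventually.of_forall h.nonneg), integral_signDensity hC h, ENNReal.ofReal_one]

/-- The law on `[0,1]^d × {C₁, C₂}²` with uniform covariate and conditional means `p`, `b`, `θ` of
the signs of `A`, of `Y` and of their product. -/
noncomputable def signLaw (hC : C₁ < C₂) (h : IsSignMeans C₁ p b θ) : ProbabilityMeasure (Obs d) :=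
  ⟨(refLaw d C₁ C₂).withDensity fun o => ENNReal.ofReal (signDensity C₁ p b θ o),
    isProbabilityMeasure_withDensity_signDensity hC h⟩

lemma coe_signLaw (hC : C₁ < C₂) (h : IsSignMeans C₁ p b θ) :
    (signLaw hC h : Measure (Obs d))
      = (refLaw d C₁ C₂).withDensity fun o => ENNReal.ofReal (signDensity C₁ p b θ o) := rfl

lemma integral_signLaw (hC : C₁ < C₂) (h : IsSignMeans C₁ p b θ) (F : Obs d → ℝ) :
    ∫ o, F o ∂(signLaw hC h : Measure (Obs d))
      = ∫ o, F o * signDensity C₁ p b θ o ∂refLaw d C₁ C₂ := by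
  rw [coe_signLaw, integral_withDensity_eq_integral_toReal_smul₀
    h.isBddMeas.1.ennreal_ofReal.aemeasurable (by simp)]
  refine integral_congr_ae (Filter.Eventually.of_forall fun o => ?_)
  simp only [ENNReal.toReal_ofReal (h.nonneg o), smul_eq_mul, mul_comm]

lemma ae_refLaw_mem (C₁ C₂ : ℝ) : ∀ᵐ o ∂refLaw d C₁ C₂,
    (o.2.1 = C₁ ∨ o.2.1 = C₂) ∧ (o.2.2 = C₁ ∨ o.2.2 = C₂) := by
  have h : ∀ᵐ a ∂unifTwo C₁ C₂, a = C₁ ∨ a = C₂ := by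
    rw [unifTwo, ae_add_measure_iff]
    constructor
    · exact Measure.ae_smul_measure (by simp [ae_dirac_eq]) _
    · exact Measure.ae_smul_measure (by simp [ae_dirac_eq]) _
  have h1 : ∀ᵐ o ∂refLaw d C₁ C₂, o.2.1 = C₁ ∨ o.2.1 = C₂ := by
    have q1 := (Measure.quasiMeasurePreserving_snd (μ := cubeVol d)
      (ν := (unifTwo C₁ C₂).prod (unifTwo C₁ C₂))).ae
      ((Measure.quasiMeasurePreserving_fst (μ := unifTwo C₁ C₂) (ν := unifTwo C₁ C₂)).ae h)
    exact q1
  have h2 : ∀ᵐ o ∂refLaw d C₁ C₂, o.2.2 = C₁ ∨ o.2.2 = C₂ := by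
    have q1 := (Measure.quasiMeasurePreserving_snd (μ := cubeVol d)
      (ν := (unifTwo C₁ C₂).prod (unifTwo C₁ C₂))).ae
      ((Measure.quasiMeasurePreserving_snd (μ := unifTwo C₁ C₂) (ν := unifTwo C₁ C₂)).ae h)
    exact q1
  filter_upwards [h1, h2] with o a b using ⟨a, b⟩

lemma ae_signLaw_mem (hC : C₁ < C₂) (h : IsSignMeans C₁ p b θ) :
    ∀ᵐ o ∂(signLaw hC h : Measure (Obs d)),
      (o.2.1 = C₁ ∨ o.2.1 = C₂) ∧ (o.2.2 = C₁ ∨ o.2.2 = C₂) :=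
  (withDensity_absolutelyContinuous _ _).ae_le (ae_refLaw_mem C₁ C₂)

/-- The value in `{C₁, C₂}` with a given sign. -/
noncomputable def ofSign (C₁ C₂ s : ℝ) : ℝ := (C₁ + C₂) / 2 + (C₂ - C₁) / 2 * s

lemma ofSign_signOf (hC : C₁ < C₂) {a : ℝ} (h : a = C₁ ∨ a = C₂) :
    ofSign C₁ C₂ (signOf C₁ a) = a := by
  rcases h with rfl | rfl
  · rw [signOf_self]; unfold ofSign; ring
  · rw [signOf_of_ne hC.ne']; unfold ofSign; ring

lemma IsBddMeas.ofSign {Ω : Type*} [MeasurableSpace Ω] {f : Ω → ℝ} (hf : IsBddMeas f)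
    (C₁ C₂ : ℝ) : IsBddMeas fun ω => ofSign C₁ C₂ (f ω) :=
  (IsBddMeas.const _).add (hf.const_mul _)

lemma map_signLaw (hC : C₁ < C₂) (h : IsSignMeans C₁ p b θ) :
    (signLaw hC h : Measure (Obs d)).map (fun o => o.1) = cubeVol d := by
  have hX : Measurable fun o : Obs d => o.1 := measurable_fst
  refine Measure.ext fun s hs => ?_
  have hg : IsBddMeas (s.indicator fun _ : Fin d → ℝ => (1 : ℝ)) := (IsBddMeas.const 1).indicator hs
  have h1 := integral_signLaw hC h fun o => s.indicator (fun _ : Fin d → ℝ => (1 : ℝ)) o.1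
  rw [integral_mul_signDensity hC h (hg.comp hX)] at h1
  have h2 : ∀ x, (s.indicator (fun _ : Fin d → ℝ => (1 : ℝ)) x * (1 - p x - b x + θ x)
      + s.indicator (fun _ => 1) x * (1 - p x + b x - θ x)
      + s.indicator (fun _ => 1) x * (1 + p x - b x - θ x)
      + s.indicator (fun _ => 1) x * (1 + p x + b x + θ x)) / 4
      = s.indicator (fun _ : Fin d → ℝ => (1 : ℝ)) x := fun x => by ring
  simp only [h2] at h1
  have h3 : (fun o : Obs d => s.indicator (fun _ : Fin d → ℝ => (1 : ℝ)) o.1)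
      = ((fun o : Obs d => o.1) ⁻¹' s).indicator 1 := rfl
  rw [h3, integral_indicator_one (hX hs)] at h1
  change _ = ∫ x, s.indicator 1 x ∂cubeVol d at h1
  rw [integral_indicator_one hs] at h1
  rw [Measure.map_apply hX hs]
  exact (measureReal_eq_measureReal_iff).mp h1

lemma isRegression_signLaw_fst (hC : C₁ < C₂) (h : IsSignMeans C₁ p b θ) :
    IsRegression (signLaw hC h : Measure (Obs d)) (fun o => o.1)
      (fun o => ofSign C₁ C₂ (signOf C₁ o.2.1)) (fun x => ofSign C₁ C₂ (p x)) where
  meas := measurable_fst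
  map := map_signLaw hC h
  bdd := (isBddMeas_sign_fst C₁).ofSign C₁ C₂
  bdd_r := h.bdd_p.ofSign C₁ C₂
  reg g hg := by
    have hX : Measurable fun o : Obs d => o.1 := measurable_fst
    rw [integral_signLaw, integral_mul_signDensity hC h
      (((isBddMeas_sign_fst C₁).ofSign C₁ C₂).mul (hg.comp hX))]
    refine integral_congr_ae (Filter.Eventually.of_forall fun x => ?_)
    simp only [signOf_self, signOf_of_ne hC.ne', ofSign]
    ring

lemma isRegression_signLaw_snd (hC : C₁ < C₂) (h : IsSignMeans C₁ p b θ) :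
    IsRegression (signLaw hC h : Measure (Obs d)) (fun o => o.1)
      (fun o => ofSign C₁ C₂ (signOf C₁ o.2.2)) (fun x => ofSign C₁ C₂ (b x)) where
  meas := measurable_fst
  map := map_signLaw hC h
  bdd := (isBddMeas_sign_snd C₁).ofSign C₁ C₂
  bdd_r := h.bdd_b.ofSign C₁ C₂
  reg g hg := by
    have hX : Measurable fun o : Obs d => o.1 := measurable_fst
    rw [integral_signLaw, integral_mul_signDensity hC h
      (((isBddMeas_sign_snd C₁).ofSign C₁ C₂).mul (hg.comp hX))]
    refine integral_congr_ae (Filter.Eventually.of_forall fun x => ?_)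
    simp only [signOf_self, signOf_of_ne hC.ne', ofSign]
    ring

lemma ae_signLaw_fst (hC : C₁ < C₂) (h : IsSignMeans C₁ p b θ) :
    (fun o => o.2.1) =ᵐ[(signLaw hC h : Measure (Obs d))]
      fun o => ofSign C₁ C₂ (signOf C₁ o.2.1) := by
  filter_upwards [ae_signLaw_mem hC h] with o ho using (ofSign_signOf hC ho.1).symm

lemma ae_signLaw_snd (hC : C₁ < C₂) (h : IsSignMeans C₁ p b θ) :
    (fun o => o.2.2) =ᵐ[(signLaw hC h : Measure (Obs d))]
      fun o => ofSign C₁ C₂ (signOf C₁ o.2.2) := by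
  filter_upwards [ae_signLaw_mem hC h] with o ho using (ofSign_signOf hC ho.2).symm

lemma psi_signLaw (hC : C₁ < C₂) (h : IsSignMeans C₁ p b θ) :
    psi (signLaw hC h) = ((C₂ - C₁) / 2) ^ 2 * ∫ x, (θ x - p x * b x) ∂cubeVol d := by
  have R1 := isRegression_signLaw_fst hC h
  have R2 := isRegression_signLaw_snd hC h
  rw [psi_eq_covTarget R1 R2 (ae_signLaw_fst hC h) (ae_signLaw_snd hC h), covTarget,
    integral_signLaw, integral_mul_signDensity hC h (R1.bdd.mul R2.bdd), ← integral_const_mul,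
    ← integral_sub]
  · refine integral_congr_ae (Filter.Eventually.of_forall fun x => ?_)
    simp only [signOf_self, signOf_of_ne hC.ne', ofSign]
    ring
  · have hp := h.bdd_p
    have hb := h.bdd_b
    have hθ := h.bdd_θ
    simp only [div_eq_mul_inv _ (4 : ℝ)]
    refine Integrable.mul_const ?_ _
    exact ((((((((IsBddMeas.const 1).sub hp).sub hb).add hθ).const_mul _).add
      (((((IsBddMeas.const 1).sub hp).add hb).sub hθ).const_mul _)).add
      (((((IsBddMeas.const 1).add hp).sub hb).sub hθ).const_mul _)).add
      (((((IsBddMeas.const 1).add hp).add hb).add hθ).const_mul _)).integrable _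
  · exact (R1.bdd_r.mul R2.bdd_r).integrable _

lemma signLaw_mem_model (hC : C₁ < C₂) (h : IsSignMeans C₁ p b θ) {S : ℕ}
    {W : BoundaryWavelets S} {J₀ : ℕ} {α β M : ℝ}
    (hp : ∃ f ∈ W.holderBall d J₀ α M, (fun x => ofSign C₁ C₂ (p x)) =ᵐ[cubeVol d] f)
    (hb : ∃ f ∈ W.holderBall d J₀ β M, (fun x => ofSign C₁ C₂ (b x)) =ᵐ[cubeVol d] f) :
    signLaw hC h ∈ model W d J₀ α β M C₁ C₂ := by
  obtain ⟨f, hf, hpf⟩ := hp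
  obtain ⟨g, hg, hbg⟩ := hb
  have hX : Measurable fun o : Obs d => o.1 := measurable_fst
  have hmap := map_signLaw hC h
  refine ⟨hmap, ?_, ⟨f, hf, ?_⟩, g, hg, ?_⟩
  · filter_upwards [ae_signLaw_mem hC h] with o ho
    rcases ho with ⟨h1 | h1, h2 | h2⟩ <;> rw [h1, h2] <;> simp [hC.le]
  · refine (condExp_of_isRegression (isRegression_signLaw_fst hC h) (ae_signLaw_fst hC h)).trans ?_
    rw [← hmap] at hpf
    exact ae_of_ae_map hX.aemeasurable hpf
  · refine (condExp_of_isRegression (isRegression_signLaw_snd hC h) (ae_signLaw_snd hC h)).trans ?_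
    rw [← hmap] at hbg
    exact ae_of_ae_map hX.aemeasurable hbg

lemma isRegressionPair_signLaw (hC : C₁ < C₂) (h : IsSignMeans C₁ p b θ) (hp : ∀ x, |p x| ≤ 1)
    (hb : ∀ x, |b x| ≤ 1) :
    IsRegressionPair (signLaw hC h : Measure (Obs d)) (fun o => o.1)
      (fun o => ofSign C₁ C₂ (signOf C₁ o.2.1)) (fun o => ofSign C₁ C₂ (signOf C₁ o.2.2))
      (fun x => ofSign C₁ C₂ (p x)) (fun x => ofSign C₁ C₂ (b x)) (max |C₁| |C₂|) := by
  have hr : ∀ s : ℝ, |s| ≤ 1 → |ofSign C₁ C₂ s| ≤ max |C₁| |C₂| := by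
    intro s hs
    obtain ⟨h1, h2⟩ := abs_le.mp hs
    refine abs_le_max_abs_abs ?_ ?_ <;> unfold ofSign <;> nlinarith
  exact ⟨isRegression_signLaw_fst hC h, isRegression_signLaw_snd hC h,
    fun o => hr _ (abs_signOf _ _).le, fun o => hr _ (abs_signOf _ _).le, fun x => hr _ (hp x),
    fun x => hr _ (hb x)⟩

/-- The conditional second moment is at least the conditional variance, which is
`((C₂ - C₁) / 2)² (1 - p²)`. -/
lemma le_integral_sq_signLaw_fst (hC : C₁ < C₂) (h : IsSignMeans C₁ p b θ) {ε : ℝ}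
    (hp : ∀ x, p x ^ 2 ≤ 1 - ε) {g : (Fin d → ℝ) → ℝ} (hg : IsBddMeas g) (hg0 : ∀ x, 0 ≤ g x) :
    ((C₂ - C₁) / 2) ^ 2 * ε * ∫ x, g x ∂cubeVol d
      ≤ ∫ o, ofSign C₁ C₂ (signOf C₁ o.2.1) ^ 2 * g o.1 ∂(signLaw hC h : Measure (Obs d)) := by
  have R := isRegression_signLaw_fst hC h
  have hgX := hg.comp (φ := fun o : Obs d => o.1) measurable_fst
  rw [integral_signLaw, integral_mul_signDensity hC h ((R.bdd.pow 2).mul hgX),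
    ← integral_const_mul]
  have hp' := h.bdd_p
  have hb' := h.bdd_b
  have hθ := h.bdd_θ
  refine integral_mono ((hg.const_mul _).integrable _) ?_ fun x => ?_
  · simp only [div_eq_mul_inv _ (4 : ℝ)]
    refine Integrable.mul_const ?_ _
    have k : ∀ c : ℝ, IsBddMeas fun x => c * g x := fun c => hg.const_mul c
    exact (((((k _).mul ((((IsBddMeas.const 1).sub hp').sub hb').add hθ)).add
      ((k _).mul ((((IsBddMeas.const 1).sub hp').add hb').sub hθ))).add
      ((k _).mul ((((IsBddMeas.const 1).add hp').sub hb').sub hθ))).add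
      ((k _).mul ((((IsBddMeas.const 1).add hp').add hb').add hθ))).integrable _
  · simp only [signOf_self, signOf_of_ne hC.ne', ofSign]
    have h1 : 0 ≤ ((C₂ - C₁) / 2) ^ 2 * (1 - p x ^ 2 - ε) * g x :=
      mul_nonneg (mul_nonneg (sq_nonneg _) (by linarith [hp x])) (hg0 x)
    have h2 : 0 ≤ ((C₁ + C₂) / 2 + (C₂ - C₁) / 2 * p x) ^ 2 * g x :=
      mul_nonneg (sq_nonneg _) (hg0 x)
    nlinarith [h1, h2]

lemma le_integral_sq_signLaw_snd (hC : C₁ < C₂) (h : IsSignMeans C₁ p b θ) {ε : ℝ}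
    (hb : ∀ x, b x ^ 2 ≤ 1 - ε) {g : (Fin d → ℝ) → ℝ} (hg : IsBddMeas g) (hg0 : ∀ x, 0 ≤ g x) :
    ((C₂ - C₁) / 2) ^ 2 * ε * ∫ x, g x ∂cubeVol d
      ≤ ∫ o, ofSign C₁ C₂ (signOf C₁ o.2.2) ^ 2 * g o.1 ∂(signLaw hC h : Measure (Obs d)) := by
  have R := isRegression_signLaw_snd hC h
  have hgX := hg.comp (φ := fun o : Obs d => o.1) measurable_fst
  rw [integral_signLaw, integral_mul_signDensity hC h ((R.bdd.pow 2).mul hgX),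
    ← integral_const_mul]
  have hp' := h.bdd_p
  have hb' := h.bdd_b
  have hθ := h.bdd_θ
  refine integral_mono ((hg.const_mul _).integrable _) ?_ fun x => ?_
  · simp only [div_eq_mul_inv _ (4 : ℝ)]
    refine Integrable.mul_const ?_ _
    have k : ∀ c : ℝ, IsBddMeas fun x => c * g x := fun c => hg.const_mul c
    exact (((((k _).mul ((((IsBddMeas.const 1).sub hp').sub hb').add hθ)).add
      ((k _).mul ((((IsBddMeas.const 1).sub hp').add hb').sub hθ))).add
      ((k _).mul ((((IsBddMeas.const 1).add hp').sub hb').sub hθ))).add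
      ((k _).mul ((((IsBddMeas.const 1).add hp').add hb').add hθ))).integrable _
  · simp only [signOf_self, signOf_of_ne hC.ne', ofSign]
    have h1 : 0 ≤ ((C₂ - C₁) / 2) ^ 2 * (1 - b x ^ 2 - ε) * g x :=
      mul_nonneg (mul_nonneg (sq_nonneg _) (by linarith [hb x])) (hg0 x)
    have h2 : 0 ≤ ((C₁ + C₂) / 2 + (C₂ - C₁) / 2 * b x) ^ 2 * g x :=
      mul_nonneg (sq_nonneg _) (hg0 x)
    nlinarith [h1, h2]

end TwoPointLaws

/-! ### Bumps and their wavelet coefficients -/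

section Univariate

variable {S J₀ : ℕ} {W : BoundaryWavelets S}

namespace BoundaryWavelets.IsCDVBasis

lemma integral_sub_pow_mul_wav (hW : W.IsCDVBasis J₀) {l : ℕ} (hl : J₀ ≤ l) (m : Fin (2 ^ l))
    (a : ℝ) {r : ℕ} (hr : r < S) : ∫ x, (x - a) ^ r * W.wav l m x ∂unitVol = 0 := by
  have h1 : ∀ x, (x - a) ^ r * W.wav l m x = ∑ k ∈ Finset.range (r + 1),
      ((-a) ^ (r - k) * (r.choose k : ℝ)) * (x ^ k * W.wav l m x) := by
    intro x
    rw [sub_eq_add_neg, add_pow, Finset.sum_mul]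
    exact Finset.sum_congr rfl fun k _ => by ring
  have hb : ∀ k : ℕ, Integrable (fun x => x ^ k * W.wav l m x) unitVol := by
    intro k
    refine Integrable.mul_bdd (c := (hW.isBddMeas_wav l m).2.choose) ?_
      (hW.isBddMeas_wav l m).1.aestronglyMeasurable
      (Filter.Eventually.of_forall (hW.isBddMeas_wav l m).2.choose_spec)
    exact (continuous_pow k).continuousOn.integrableOn_compact isCompact_Icc
  simp only [h1]
  rw [integral_finsetSum _ fun k _ => (hb k).const_mul _]
  refine Finset.sum_eq_zero fun k hk => ?_
  rw [integral_const_mul, hW.integral_pow_mul_wav hl m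
    (by have := Finset.mem_range.mp hk; omega), mul_zero]

/-- The wavelet coefficients of a smooth function, by Taylor expansion and the vanishing
moments. -/
lemma abs_integral_mul_wav_le (hW : W.IsCDVBasis J₀) {C R : ℝ} (hR : 0 < R)
    (hloc : IsLocalised W.wav C R) {l : ℕ} (hl : J₀ ≤ l) (m : Fin (2 ^ l)) {f : ℝ → ℝ}
    (hf : ContDiff ℝ S f) (hfb : IsBddMeas f) {D : ℝ} (hD : ∀ x, |iteratedDeriv S f x| ≤ D) :
    |∫ x, f x * W.wav l m x ∂unitVol| ≤ D * (2 * R / 2 ^ l) ^ S * (C / sqrtTwoPow l) := by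
  obtain ⟨t₀, ht₀⟩ := hloc.supp l m
  obtain ⟨n, rfl⟩ : ∃ n, S = n + 1 := ⟨S - 1, by have := hW.one_le_S; omega⟩
  have hwb := hW.isBddMeas_wav l m
  set ρ : ℝ := R / 2 ^ l
  have hρ : 0 < ρ := by positivity
  set a := t₀ - ρ
  have hD0 : 0 ≤ D := (abs_nonneg _).trans (hD 0)
  have hab : a < t₀ + ρ := by simp only [a]; linarith
  set T : ℝ → ℝ := fun x => taylorWithinEval f n (Icc a (t₀ + ρ)) a x
  have hTdef : ∀ x, T x = ∑ k ∈ Finset.range (n + 1),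
      (((k.factorial : ℝ)⁻¹ * iteratedDerivWithin k f (Icc a (t₀ + ρ)) a) * (x - a) ^ k) := by
    intro x
    simp only [T]
    rw [taylor_within_apply]
    exact Finset.sum_congr rfl fun k _ => by rw [smul_eq_mul]; ring
  have hb : ∀ k : ℕ, Integrable (fun x => (x - a) ^ k * W.wav l m x) unitVol := by
    intro k
    refine Integrable.mul_bdd (c := hwb.2.choose) ?_ hwb.1.aestronglyMeasurable
      (Filter.Eventually.of_forall hwb.2.choose_spec)
    exact ((continuous_id.sub continuous_const).pow k).continuousOn.integrableOn_compact
      isCompact_Icc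
  have hTsum : ∀ x, T x * W.wav l m x = ∑ k ∈ Finset.range (n + 1),
      ((k.factorial : ℝ)⁻¹ * iteratedDerivWithin k f (Icc a (t₀ + ρ)) a) *
        ((x - a) ^ k * W.wav l m x) := by
    intro x
    rw [hTdef, Finset.sum_mul]
    exact Finset.sum_congr rfl fun k _ => by ring
  have hTint : Integrable (fun x => T x * W.wav l m x) unitVol := by
    simp only [hTsum]
    exact integrable_finsetSum _ fun k _ => (hb k).const_mul _
  have hT0 : ∫ x, T x * W.wav l m x ∂unitVol = 0 := by
    simp only [hTsum]
    rw [integral_finsetSum _ fun k _ => (hb k).const_mul _]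
    refine Finset.sum_eq_zero fun k hk => ?_
    rw [integral_const_mul, hW.integral_sub_pow_mul_wav hl m a (Finset.mem_range.mp hk), mul_zero]
  have hfint : Integrable (fun x => f x * W.wav l m x) unitVol := (hfb.mul hwb).integrable _
  have hsub : ∫ x, f x * W.wav l m x ∂unitVol
      = ∫ x, (f x * W.wav l m x - T x * W.wav l m x) ∂unitVol := by
    rw [integral_sub hfint hTint, hT0, sub_zero]
  have hpt : ∀ x, |f x * W.wav l m x - T x * W.wav l m x|
      ≤ D * (2 * R / 2 ^ l) ^ (n + 1) * |W.wav l m x| := by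
    intro x
    rw [← sub_mul, abs_mul]
    by_cases h0 : W.wav l m x = 0
    · simp [h0]
    have hx := abs_le.mp (ht₀ x h0)
    have hxI : x ∈ Icc a (t₀ + ρ) := ⟨by simp only [a]; linarith [hx.1], by linarith [hx.2]⟩
    refine mul_le_mul_of_nonneg_right ?_ (abs_nonneg _)
    have h1 := taylor_mean_remainder_bound (n := n) (C := D) hab.le
      (hf.contDiffOn (s := Icc a (t₀ + ρ))) hxI fun y hy => by
        rw [iteratedDerivWithin_eq_iteratedDeriv (uniqueDiffOn_Icc hab) hf.contDiffAt hy]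
        exact hD y
    refine h1.trans ?_
    have h2 : x - a ≤ 2 * R / 2 ^ l := by
      have : 2 * R / 2 ^ l = 2 * ρ := by simp only [ρ]; ring
      rw [this]; simp only [a]; linarith [hx.2]
    have h3 : 0 ≤ x - a := by linarith [hxI.1]
    calc D * (x - a) ^ (n + 1) / (n.factorial : ℝ) ≤ D * (x - a) ^ (n + 1) :=
          div_le_self (by positivity) (by exact_mod_cast n.factorial_pos)
      _ ≤ _ := by gcongr
  rw [hsub]
  refine (abs_integral_le_of_abs_le ((hwb.abs.const_mul _).integrable _)
    (Filter.Eventually.of_forall hpt)).trans ?_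
  rw [integral_const_mul]
  refine mul_le_mul_of_nonneg_left ?_ (by positivity)
  rw [le_div_iff₀ (sqrtTwoPow_pos l)]
  exact hloc.integral_abs l m

end BoundaryWavelets.IsCDVBasis

/-- A smooth bump supported in `[1/4, 3/4]`. -/
noncomputable def unitBump : ContDiffBump (1 / 2 : ℝ) where
  rIn := 1 / 8
  rOut := 1 / 4
  rIn_pos := by norm_num
  rIn_lt_rOut := by norm_num

lemma unitBump_ne_zero {t : ℝ} (h : unitBump t ≠ 0) : 0 < t ∧ t < 1 := by
  have h1 : t ∈ Function.support unitBump := h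
  rw [ContDiffBump.support_eq, Metric.mem_ball, Real.dist_eq] at h1
  have h2 : |t - 1 / 2| < 1 / 4 := h1
  obtain ⟨h3, h4⟩ := abs_lt.mp h2
  constructor <;> linarith

lemma iteratedDeriv_unitBump_ne_zero {n : ℕ} {t : ℝ} (h : iteratedDeriv n unitBump t ≠ 0) :
    0 < t ∧ t < 1 := by
  have h1 : t ∈ tsupport unitBump := by
    by_contra hc
    refine h ?_
    have h2 : unitBump =ᶠ[nhds t] (fun _ => (0 : ℝ)) := by
      filter_upwards [(isClosed_tsupport _).isOpen_compl.mem_nhds hc] with s hs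
      exact image_eq_zero_of_notMem_tsupport hs
    rw [h2.iteratedDeriv_eq n]
    simp
  rw [ContDiffBump.tsupport_eq, Metric.mem_closedBall, Real.dist_eq] at h1
  have h2 : |t - 1 / 2| ≤ 1 / 4 := h1
  obtain ⟨h3, h4⟩ := abs_le.mp h2
  constructor <;> linarith

lemma exists_abs_iteratedDeriv_unitBump_le (n : ℕ) :
    ∃ K : ℝ, 1 ≤ K ∧ ∀ t, |iteratedDeriv n unitBump t| ≤ K := by
  have hc : Continuous (iteratedDeriv n unitBump) :=
    (unitBump.contDiff (n := n)).continuous_iteratedDeriv n le_rfl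
  have hs : HasCompactSupport (iteratedDeriv n unitBump) := by
    refine HasCompactSupport.intro (isCompact_Icc (a := (0 : ℝ)) (b := 1)) fun t ht => ?_
    by_contra h
    have := iteratedDeriv_unitBump_ne_zero h
    exact ht ⟨this.1.le, this.2.le⟩
  obtain ⟨K, hK⟩ := hs.exists_bound_of_continuous hc
  exact ⟨max 1 K, le_max_left _ _, fun t => (hK t).trans (le_max_right _ _)⟩

/-- The bump of the dyadic interval `[q, q + 1] / 2 ^ j`. -/
noncomputable def dyadicBump (j : ℕ) (q : Fin (2 ^ j)) (t : ℝ) : ℝ := unitBump (2 ^ j * t - q.1)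

lemma dyadicBump_nonneg (j : ℕ) (q : Fin (2 ^ j)) (t : ℝ) : 0 ≤ dyadicBump j q t :=
  unitBump.nonneg

lemma dyadicBump_le_one (j : ℕ) (q : Fin (2 ^ j)) (t : ℝ) : dyadicBump j q t ≤ 1 :=
  unitBump.le_one

lemma contDiff_dyadicBump {n : ℕ} (j : ℕ) (q : Fin (2 ^ j)) : ContDiff ℝ n (dyadicBump j q) :=
  unitBump.contDiff.comp (by fun_prop)

lemma isBddMeas_dyadicBump (j : ℕ) (q : Fin (2 ^ j)) : IsBddMeas (dyadicBump j q) :=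
  ⟨(contDiff_dyadicBump (n := 0) j q).continuous.measurable, 1, fun t => by
    rw [abs_of_nonneg (dyadicBump_nonneg j q t)]; exact dyadicBump_le_one j q t⟩

/-- The index of the dyadic interval of level `j` that contains `t`. -/
noncomputable def dyadicIndex (j : ℕ) (t : ℝ) : Fin (2 ^ j) :=
  ⟨min ⌊2 ^ j * t⌋₊ (2 ^ j - 1), by have : 0 < 2 ^ j := by positivity
                                    omega⟩

lemma dyadicIndex_eq {j : ℕ} {q : Fin (2 ^ j)} {t : ℝ} (h0 : 0 ≤ 2 ^ j * t - q.1)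
    (h1 : 2 ^ j * t - q.1 < 1) : dyadicIndex j t = q := by
  have hf : ⌊2 ^ j * t⌋₊ = q.1 := by
    rw [Nat.floor_eq_iff (by have := (Nat.cast_nonneg q.1 : (0 : ℝ) ≤ q.1); linarith)]
    constructor <;> linarith
  ext
  have := q.2
  simp only [dyadicIndex, hf]
  omega

lemma dyadicIndex_eq_of_bump_ne_zero {j : ℕ} {q : Fin (2 ^ j)} {t : ℝ}
    (h : dyadicBump j q t ≠ 0) : dyadicIndex j t = q :=
  have h1 := unitBump_ne_zero h
  dyadicIndex_eq h1.1.le h1.2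

lemma measurable_dyadicIndex (j : ℕ) : Measurable (dyadicIndex j) := by
  have h : Measurable fun t : ℝ => min ⌊2 ^ j * t⌋₊ (2 ^ j - 1) :=
    ((Nat.measurable_floor).comp (measurable_const.mul measurable_id)).min measurable_const
  refine measurable_to_countable' fun q => ?_
  have : dyadicIndex j ⁻¹' {q} = (fun t : ℝ => min ⌊2 ^ j * t⌋₊ (2 ^ j - 1)) ⁻¹' {q.1} := by
    ext t; simp [dyadicIndex, Fin.ext_iff]
  rw [this]
  exact h (measurableSet_singleton _)

lemma iteratedDeriv_dyadicBump (n j : ℕ) (q : Fin (2 ^ j)) (t : ℝ) :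
    iteratedDeriv n (dyadicBump j q) t
      = (2 ^ j) ^ n * iteratedDeriv n unitBump (2 ^ j * t - q.1) := by
  have h1 : dyadicBump j q = fun t => (fun y => unitBump (y - q.1)) (2 ^ j * t) := rfl
  rw [h1, iteratedDeriv_comp_const_mul (f := fun y : ℝ => unitBump (y - q.1))
    (unitBump.contDiff.comp (by fun_prop)) (2 ^ j : ℝ)]
  simp only
  rw [iteratedDeriv_comp_sub_const]

lemma integral_dyadicBump_sq (j : ℕ) (q : Fin (2 ^ j)) :
    ∫ t, dyadicBump j q t ^ 2 ∂unitVol = (∫ y, unitBump y ^ 2) / 2 ^ j := by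
  have h1 : ∫ t, dyadicBump j q t ^ 2 ∂unitVol = ∫ t, dyadicBump j q t ^ 2 := by
    refine setIntegral_eq_integral_of_forall_compl_eq_zero fun t ht => ?_
    by_contra h
    have h2 := unitBump_ne_zero (t := 2 ^ j * t - q.1) fun h0 => h (by simp [dyadicBump, h0])
    have h3 : (0 : ℝ) < 2 ^ j := by positivity
    have h4 : (q.1 : ℝ) + 1 ≤ 2 ^ j := by exact_mod_cast q.2
    have h5 := (Nat.cast_nonneg q.1 : (0 : ℝ) ≤ q.1)
    refine ht ⟨?_, ?_⟩
    · by_contra hc; push Not at hc; nlinarith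
    · by_contra hc; push Not at hc; nlinarith
  rw [h1]
  have h2 := Measure.integral_comp_mul_left (fun y => unitBump (y - q.1) ^ 2) (2 ^ j : ℝ)
  simp only [dyadicBump]
  rw [h2, integral_sub_right_eq_self (fun y => unitBump y ^ 2), abs_of_pos (by positivity),
    smul_eq_mul]
  ring

lemma integral_unitBump_sq_pos : 0 < ∫ y, unitBump y ^ 2 := by
  have hc : Continuous fun y => unitBump y ^ 2 := unitBump.continuous.pow 2
  refine hc.integral_pos_of_hasCompactSupport_nonneg_nonzero (x := 1 / 2) ?_
    (fun _ => sq_nonneg _) ?_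
  · refine HasCompactSupport.intro (isCompact_Icc (a := (0 : ℝ)) (b := 1)) fun t ht => ?_
    by_contra h
    have := unitBump_ne_zero (t := t) fun h0 => h (by simp [h0])
    exact ht ⟨this.1.le, this.2.le⟩
  · have : unitBump (1 / 2) = 1 :=
      unitBump.one_of_mem_closedBall (Metric.mem_closedBall_self (by norm_num [unitBump]))
    rw [this]; norm_num

lemma sum_eq_of_dyadicIndex {j : ℕ} {t : ℝ} {F : Fin (2 ^ j) → ℝ}
    (h : ∀ q, F q ≠ 0 → dyadicIndex j t = q) : ∑ q, F q = F (dyadicIndex j t) :=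
  Finset.sum_eq_single _ (fun q _ hq => by by_contra h0; exact hq (h q h0).symm) (by simp)

/-- The sum over the bumps of one level of the absolute values of their wavelet coefficients. -/
lemma sum_abs_integral_dyadicBump_mul_wav_le (hW : W.IsCDVBasis J₀) {C R K : ℝ} (hR : 0 < R)
    (hloc : IsLocalised W.wav C R) (hK : ∀ t, |iteratedDeriv S unitBump t| ≤ K) (j : ℕ) {l : ℕ}
    (hl : J₀ ≤ l) (m : Fin (2 ^ l)) :
    ∑ q, |∫ t, dyadicBump j q t * W.wav l m t ∂unitVol|
      ≤ (2 ^ j) ^ S * K * (2 * R / 2 ^ l) ^ S * (C / sqrtTwoPow l) := by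
  have hwb := hW.isBddMeas_wav l m
  set s : Fin (2 ^ j) → ℝ := fun q =>
    if 0 ≤ ∫ t, dyadicBump j q t * W.wav l m t ∂unitVol then 1 else -1
  have hs : ∀ q, |s q| = 1 := by intro q; simp only [s]; split_ifs <;> simp
  have hint : ∫ t, (∑ q, s q * dyadicBump j q t) * W.wav l m t ∂unitVol
      = ∑ q, |∫ t, dyadicBump j q t * W.wav l m t ∂unitVol| := by
    simp only [Finset.sum_mul, mul_assoc]
    rw [integral_finsetSum _ fun q _ =>
      (((isBddMeas_dyadicBump j q).mul hwb).const_mul _).integrable _]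
    refine Finset.sum_congr rfl fun q _ => ?_
    rw [integral_const_mul]
    simp only [s]
    split_ifs with h
    · rw [one_mul, abs_of_nonneg h]
    · rw [abs_of_neg (not_le.mp h)]; ring
  rw [← hint]
  refine (le_abs_self _).trans (hW.abs_integral_mul_wav_le hR hloc hl m
    (f := fun t => ∑ q, s q * dyadicBump j q t)
    (ContDiff.sum fun q _ => contDiff_const.mul (contDiff_dyadicBump j q))
    (IsBddMeas.sum _ fun q _ => (isBddMeas_dyadicBump j q).const_mul _) fun t => ?_)
  rw [iteratedDeriv_fun_sum fun q _ =>
    (contDiff_const.mul (contDiff_dyadicBump j q)).contDiffAt]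
  rw [sum_eq_of_dyadicIndex (t := t)]
  · rw [iteratedDeriv_const_mul_field, iteratedDeriv_dyadicBump, abs_mul, hs, one_mul, abs_mul,
      abs_of_nonneg (by positivity)]
    gcongr
    exact hK _
  · intro q hq
    rw [iteratedDeriv_const_mul_field, iteratedDeriv_dyadicBump] at hq
    have := iteratedDeriv_unitBump_ne_zero (right_ne_zero_of_mul (right_ne_zero_of_mul hq))
    exact dyadicIndex_eq this.1.le this.2

/-- The bumps of one level, being disjoint, have coefficients whose absolute values sum to at most
the `L¹` norm. -/
lemma sum_abs_integral_dyadicBump_mul_le (j : ℕ) {f : ℝ → ℝ} (hf : IsBddMeas f) :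
    ∑ q, |∫ t, dyadicBump j q t * f t ∂unitVol| ≤ ∫ t, |f t| ∂unitVol := by
  have h1 : ∀ q, |∫ t, dyadicBump j q t * f t ∂unitVol|
      ≤ ∫ t, dyadicBump j q t * |f t| ∂unitVol := fun q =>
    abs_integral_le_of_abs_le (((isBddMeas_dyadicBump j q).mul hf.abs).integrable _)
      (Filter.Eventually.of_forall fun t => by
        rw [abs_mul, abs_of_nonneg (dyadicBump_nonneg j q t)])
  refine (Finset.sum_le_sum fun q _ => h1 q).trans ?_
  rw [← integral_finsetSum _ fun q _ => ((isBddMeas_dyadicBump j q).mul hf.abs).integrable _]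
  refine integral_mono ((IsBddMeas.sum _ fun q _ =>
    (isBddMeas_dyadicBump j q).mul hf.abs).integrable _) (hf.abs.integrable _) fun t => ?_
  simp only
  rw [sum_eq_of_dyadicIndex (t := t) fun q hq =>
    dyadicIndex_eq_of_bump_ne_zero (left_ne_zero_of_mul hq)]
  exact mul_le_of_le_one_left (abs_nonneg _) (dyadicBump_le_one _ _ _)

end Univariate

section Tensor

variable {d : ℕ}

/-- The bump of a dyadic cube of side `2 ^ (-j)`. -/
noncomputable def cubeBump (j : ℕ) (q : Fin d → Fin (2 ^ j)) (x : Fin d → ℝ) : ℝ :=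
  ∏ i, dyadicBump j (q i) (x i)

/-- The index of the dyadic cube of level `j` that contains `x`. -/
noncomputable def cubeIndex (j : ℕ) (x : Fin d → ℝ) : Fin d → Fin (2 ^ j) :=
  fun i => dyadicIndex j (x i)

/-- The linear combination of the bumps of the dyadic cubes of level `j` with coefficients `c`. -/
noncomputable def bumpSum (j : ℕ) (c : (Fin d → Fin (2 ^ j)) → ℝ) (x : Fin d → ℝ) : ℝ :=
  ∑ q, c q * cubeBump j q x

lemma cubeBump_nonneg (j : ℕ) (q : Fin d → Fin (2 ^ j)) (x : Fin d → ℝ) : 0 ≤ cubeBump j q x :=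
  Finset.prod_nonneg fun _ _ => dyadicBump_nonneg _ _ _

lemma cubeBump_le_one (j : ℕ) (q : Fin d → Fin (2 ^ j)) (x : Fin d → ℝ) : cubeBump j q x ≤ 1 :=
  Finset.prod_le_one (fun _ _ => dyadicBump_nonneg _ _ _) fun _ _ => dyadicBump_le_one _ _ _

lemma continuous_cubeBump (j : ℕ) (q : Fin d → Fin (2 ^ j)) : Continuous (cubeBump j q) :=
  continuous_finsetProd _ fun i _ =>
    (contDiff_dyadicBump (n := 0) j (q i)).continuous.comp (continuous_apply i)

lemma isBddMeas_cubeBump (j : ℕ) (q : Fin d → Fin (2 ^ j)) : IsBddMeas (cubeBump j q) :=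
  IsBddMeas.prod _ fun i _ => (isBddMeas_dyadicBump j (q i)).comp (measurable_pi_apply i)

lemma continuous_bumpSum (j : ℕ) (c : (Fin d → Fin (2 ^ j)) → ℝ) : Continuous (bumpSum j c) :=
  continuous_finsetSum _ fun q _ => continuous_const.mul (continuous_cubeBump j q)

lemma isBddMeas_bumpSum (j : ℕ) (c : (Fin d → Fin (2 ^ j)) → ℝ) : IsBddMeas (bumpSum j c) :=
  IsBddMeas.sum _ fun q _ => (isBddMeas_cubeBump j q).const_mul _

lemma cubeIndex_eq_of_bump_ne_zero {j : ℕ} {q : Fin d → Fin (2 ^ j)} {x : Fin d → ℝ}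
    (h : cubeBump j q x ≠ 0) : cubeIndex j x = q :=
  funext fun i => dyadicIndex_eq_of_bump_ne_zero
    (Finset.prod_ne_zero_iff.mp h i (Finset.mem_univ i))

lemma measurable_cubeIndex (j : ℕ) : Measurable (cubeIndex (d := d) j) :=
  measurable_pi_iff.mpr fun i => (measurable_dyadicIndex j).comp (measurable_pi_apply i)

lemma sum_eq_of_cubeIndex {j : ℕ} {x : Fin d → ℝ} {F : (Fin d → Fin (2 ^ j)) → ℝ}
    (h : ∀ q, F q ≠ 0 → cubeIndex j x = q) : ∑ q, F q = F (cubeIndex j x) :=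
  Finset.sum_eq_single _ (fun q _ hq => by by_contra h0; exact hq (h q h0).symm) (by simp)

lemma bumpSum_eq (j : ℕ) (c : (Fin d → Fin (2 ^ j)) → ℝ) (x : Fin d → ℝ) :
    bumpSum j c x = c (cubeIndex j x) * cubeBump j (cubeIndex j x) x :=
  sum_eq_of_cubeIndex fun _ hq => cubeIndex_eq_of_bump_ne_zero (right_ne_zero_of_mul hq)

lemma abs_bumpSum_le {j : ℕ} {c : (Fin d → Fin (2 ^ j)) → ℝ} (hc : ∀ q, |c q| ≤ 1)
    (x : Fin d → ℝ) : |bumpSum j c x| ≤ 1 := by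
  rw [bumpSum_eq, abs_mul, abs_of_nonneg (cubeBump_nonneg _ _ _)]
  exact mul_le_one₀ (hc _) (cubeBump_nonneg _ _ _) (cubeBump_le_one _ _ _)

lemma bumpSum_mul_bumpSum (j : ℕ) (c c' : (Fin d → Fin (2 ^ j)) → ℝ) (x : Fin d → ℝ) :
    bumpSum j c x * bumpSum j c' x = ∑ q, c q * c' q * cubeBump j q x ^ 2 := by
  rw [bumpSum_eq, bumpSum_eq, sum_eq_of_cubeIndex (x := x)]
  · ring
  · intro q hq
    exact cubeIndex_eq_of_bump_ne_zero fun h => hq (by rw [h]; ring)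

/-- The common squared norm of the bumps of level `j`. -/
noncomputable def bumpMass (d j : ℕ) : ℝ := ((∫ y, unitBump y ^ 2) / 2 ^ j) ^ d

lemma bumpMass_pos (d j : ℕ) : 0 < bumpMass d j :=
  pow_pos (div_pos integral_unitBump_sq_pos (by positivity)) _

lemma integral_cubeBump_sq (j : ℕ) (q : Fin d → Fin (2 ^ j)) :
    ∫ x, cubeBump j q x ^ 2 ∂cubeVol d = bumpMass d j := by
  simp only [cubeBump, ← Finset.prod_pow]
  rw [integral_cubeVol_prod fun i t => dyadicBump j (q i) t ^ 2]
  simp only [integral_dyadicBump_sq, Finset.prod_const, Finset.card_univ, Fintype.card_fin,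
    bumpMass]

lemma integral_bumpSum_mul_bumpSum (j : ℕ) (c c' : (Fin d → Fin (2 ^ j)) → ℝ) :
    ∫ x, bumpSum j c x * bumpSum j c' x ∂cubeVol d = (∑ q, c q * c' q) * bumpMass d j := by
  simp only [bumpSum_mul_bumpSum]
  rw [integral_finsetSum _ fun q _ => (((isBddMeas_cubeBump j q).pow 2).const_mul _).integrable _,
    Finset.sum_mul]
  exact Finset.sum_congr rfl fun q _ => by rw [integral_const_mul, integral_cubeBump_sq]

lemma card_mul_bumpMass (d j : ℕ) :
    (2 : ℝ) ^ (j * d) * bumpMass d j = (∫ y, unitBump y ^ 2) ^ d := by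
  have : (2 : ℝ) ^ j ≠ 0 := by positivity
  rw [bumpMass, pow_mul, ← mul_pow]
  congr 1
  field_simp

lemma card_cubes (d j : ℕ) : Fintype.card (Fin d → Fin (2 ^ j)) = 2 ^ (j * d) := by
  rw [Fintype.card_fun, Fintype.card_fin, Fintype.card_fin, pow_mul]

lemma measureReal_dyadicIndex_le (j : ℕ) (q : Fin (2 ^ j)) :
    unitVol.real (dyadicIndex j ⁻¹' {q}) ≤ 1 / 2 ^ j := by
  have h2 : (0 : ℝ) < 2 ^ j := by positivity
  have hsub : dyadicIndex j ⁻¹' {q} ∩ Icc 0 1 ⊆ Icc ((q.1 : ℝ) / 2 ^ j) ((q.1 + 1) / 2 ^ j) := by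
    rintro t ⟨ht, h0, h1⟩
    have hq : min ⌊2 ^ j * t⌋₊ (2 ^ j - 1) = q.1 := congrArg Fin.val ht
    have hq2 := q.2
    have h3 : 0 ≤ 2 ^ j * t := by positivity
    constructor
    · rw [div_le_iff₀ h2]
      have h4 : (q.1 : ℝ) ≤ (⌊2 ^ j * t⌋₊ : ℝ) := by
        exact_mod_cast hq ▸ min_le_left _ _
      linarith [Nat.floor_le h3]
    · rw [le_div_iff₀ h2]
      rcases le_total ⌊2 ^ j * t⌋₊ (2 ^ j - 1) with h | h
      · rw [min_eq_left h] at hq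
        have := Nat.lt_floor_add_one (2 ^ j * t)
        rw [hq] at this
        linarith
      · rw [min_eq_right h] at hq
        have h5 : (q.1 : ℝ) + 1 = 2 ^ j := by
          have : q.1 + 1 = 2 ^ j := by omega
          exact_mod_cast this
        rw [h5]
        nlinarith
  rw [measureReal_restrict_apply (measurable_dyadicIndex j (measurableSet_singleton q))]
  refine (measureReal_mono hsub (by simp)).trans ?_
  rw [measureReal_def, Real.volume_Icc, ENNReal.toReal_ofReal]
  · apply le_of_eq; ring
  · have : (q.1 : ℝ) / 2 ^ j ≤ (q.1 + 1) / 2 ^ j := by gcongr; linarith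
    linarith

lemma measureReal_cubeIndex_le (j : ℕ) (q : Fin d → Fin (2 ^ j)) :
    (cubeVol d).real (cubeIndex j ⁻¹' {q}) ≤ 1 / 2 ^ (j * d) := by
  have h1 : (cubeIndex j ⁻¹' {q} : Set (Fin d → ℝ))
      = Set.pi univ fun i => dyadicIndex j ⁻¹' {q i} := by
    ext x; simp [cubeIndex, funext_iff]
  rw [h1, cubeVol_eq_pi, measureReal_def, Measure.pi_pi, ENNReal.toReal_prod]
  refine (Finset.prod_le_prod (fun _ _ => ENNReal.toReal_nonneg)
    fun i _ => measureReal_dyadicIndex_le j (q i)).trans ?_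
  simp [pow_mul]

end Tensor

/-! ### Hölder balls -/

namespace BoundaryWavelets

variable {S J₀ d : ℕ} {W : BoundaryWavelets S}

lemma IsCDVBasis.integrable_mul_Psi (hW : W.IsCDVBasis J₀) {h : (Fin d → ℝ) → ℝ}
    (hh : UniformContinuousOn h (Icc 0 1)) (ι : Fin d → Bool) (l : ℕ)
    (m : Fin d → Fin (2 ^ l)) : Integrable (fun x => h x * W.Psi ι l m x) (cubeVol d) := by
  obtain ⟨hm, C, hC⟩ := hW.isBddMeas_Psi ι l m
  exact Integrable.mul_bdd (c := C) (hh.continuousOn.integrableOn_compact isCompact_Icc)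
    hm.aestronglyMeasurable (Filter.Eventually.of_forall hC)

lemma IsCDVBasis.holderBall_add (hW : W.IsCDVBasis J₀) {a M₁ M₂ : ℝ} {h₁ h₂ : (Fin d → ℝ) → ℝ}
    (H₁ : h₁ ∈ W.holderBall d J₀ a M₁) (H₂ : h₂ ∈ W.holderBall d J₀ a M₂) :
    (fun x => h₁ x + h₂ x) ∈ W.holderBall d J₀ a (M₁ + M₂) := by
  refine ⟨isCompact_Icc.uniformContinuousOn_of_continuous
    (H₁.1.continuousOn.add H₂.1.continuousOn), fun m₀ l hl m ι hι => ?_⟩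
  have e1 := H₁.2 m₀ l hl m ι hι
  have e2 := H₂.2 m₀ l hl m ι hι
  simp only [add_mul]
  rw [integral_add (hW.integrable_mul_Psi H₁.1 ι l m) (hW.integrable_mul_Psi H₂.1 ι l m)]
  simp only [Phi_eq_Psi] at e1 e2 ⊢
  rw [integral_add (hW.integrable_mul_Psi H₁.1 _ J₀ m₀) (hW.integrable_mul_Psi H₂.1 _ J₀ m₀)]
  have p1 : (0 : ℝ) ≤ 2 ^ ((J₀ : ℝ) * (a + d / 2)) := by positivity
  have p2 : (0 : ℝ) ≤ 2 ^ ((l : ℝ) * (a + d / 2)) := by positivity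
  refine (add_le_add (mul_le_mul_of_nonneg_left (abs_add_le _ _) p1)
    (mul_le_mul_of_nonneg_left (abs_add_le _ _) p2)).trans ?_
  linarith

lemma holderBall_const_mul {a M : ℝ} {h : (Fin d → ℝ) → ℝ} (H : h ∈ W.holderBall d J₀ a M)
    (c : ℝ) : (fun x => c * h x) ∈ W.holderBall d J₀ a (|c| * M) := by
  refine ⟨isCompact_Icc.uniformContinuousOn_of_continuous 
    (continuousOn_const.mul H.1.continuousOn), fun m₀ l hl m ι hι => ?_⟩
  have e1 := mul_le_mul_of_nonneg_left (H.2 m₀ l hl m ι hι) (abs_nonneg c)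
  simp only [mul_assoc c, integral_const_mul, abs_mul]
  linarith

lemma holderBall_mono {a M M' : ℝ} (hM : M ≤ M') :
    W.holderBall d J₀ a M ⊆ W.holderBall d J₀ a M' :=
  fun _ h => ⟨h.1, fun m₀ l hl m ι hι => (h.2 m₀ l hl m ι hι).trans hM⟩

lemma two_rpow_mul_add (l : ℕ) (a : ℝ) (d : ℕ) :
    (2 : ℝ) ^ ((l : ℝ) * (a + d / 2)) = 2 ^ (l * a) * sqrtTwoPow l ^ d := by
  rw [sqrtTwoPow, ← Real.rpow_mul_natCast two_pos.le, ← Real.rpow_add two_pos]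
  congr 1; ring

lemma IsCDVBasis.exists_const_mem_holderBall (hW : W.IsCDVBasis J₀) (d : ℕ) (a : ℝ) :
    ∃ K : ℝ, 0 < K ∧ ∀ c : ℝ, (fun _ => c) ∈ W.holderBall d J₀ a (|c| * K) := by
  obtain ⟨C, hC, -, hC2⟩ := hW.exists_sum_abs_Psi_le d
  have h1 : (fun _ => (1 : ℝ)) ∈ W.holderBall d J₀ a (2 ^ ((J₀ : ℝ) * a) * C) := by
    refine ⟨isCompact_Icc.uniformContinuousOn_of_continuous continuousOn_const,
      fun m₀ l hl m ι hι => ?_⟩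
    simp only [one_mul]
    have hz : ∫ x, W.Psi ι l m x ∂cubeVol d = 0 := by
      obtain ⟨i, hi⟩ := hι
      simp only [Psi_eq_prod]
      rw [integral_cubeVol_prod fun i t => W.factor (ι i) l (m i) t]
      refine Finset.prod_eq_zero (Finset.mem_univ i) ?_
      have := hW.integral_pow_mul_wav hl (m i) (r := 0) hW.one_le_S
      simpa [factor, hi] using this
    rw [hz, abs_zero, mul_zero, add_zero, two_rpow_mul_add, mul_assoc, Phi_eq_Psi]
    refine mul_le_mul_of_nonneg_left ?_ (by positivity)
    rw [mul_comm]
    refine le_trans (mul_le_mul_of_nonneg_right abs_integral_le_integral_abs ?_) (hC2 _ J₀ m₀)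
    exact pow_nonneg (sqrtTwoPow_pos _).le _
  refine ⟨2 ^ ((J₀ : ℝ) * a) * C, by positivity, fun c => ?_⟩
  simpa using holderBall_const_mul h1 c

lemma IsCDVBasis.abs_integral_bumpSum_mul_Psi_le (hW : W.IsCDVBasis J₀) {j : ℕ}
    {c : (Fin d → Fin (2 ^ j)) → ℝ} (hc : ∀ q, |c q| ≤ 1) (ι : Fin d → Bool) (l : ℕ)
    (m : Fin d → Fin (2 ^ l)) :
    |∫ x, bumpSum j c x * W.Psi ι l m x ∂cubeVol d|
      ≤ ∏ i, ∑ q, |∫ t, dyadicBump j q t * W.factor (ι i) l (m i) t ∂unitVol| := by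
  simp only [bumpSum, Finset.sum_mul, mul_assoc]
  rw [integral_finsetSum _ fun q _ =>
    (((isBddMeas_cubeBump j q).mul (hW.isBddMeas_Psi ι l m)).const_mul _).integrable _,
    Finset.prod_univ_sum, Fintype.piFinset_univ]
  refine (Finset.abs_sum_le_sum_abs _ _).trans (Finset.sum_le_sum fun q _ => ?_)
  rw [integral_const_mul, abs_mul, ← Finset.abs_prod]
  refine (mul_le_of_le_one_left (abs_nonneg _) (hc q)).trans (le_of_eq ?_)
  congr 1
  simp only [cubeBump, Psi_eq_prod, ← Finset.prod_mul_distrib]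
  exact integral_cubeVol_prod fun i t => dyadicBump j (q i) t * W.factor (ι i) l (m i) t

/-- Combinations of bumps of level `j` with coefficients at most one have wavelet coefficients of
Hölder order `a < S` and size `2 ^ (a j)`: those of levels `l ≤ j` by the size and disjointness of
the bumps, those of levels `l > j` by their smoothness. -/
lemma IsCDVBasis.exists_bumpSum_mem_holderBall (hW : W.IsCDVBasis J₀) (d : ℕ) {a : ℝ} (ha : 0 < a)
    (haS : a < S) : ∃ K : ℝ, 0 < K ∧ ∀ (j : ℕ) (c : (Fin d → Fin (2 ^ j)) → ℝ), (∀ q, |c q| ≤ 1) →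
      (fun x => (2 : ℝ) ^ (-(a * j)) * bumpSum j c x) ∈ W.holderBall d J₀ a K := by
  obtain ⟨C, R, hC, hR, hloc⟩ := hW.exists_isLocalised_factor
  obtain ⟨K, hK1, hK⟩ := exists_abs_iteratedDeriv_unitBump_le S
  have hlocw : IsLocalised W.wav C R := hloc true
  set K' : ℝ := max 1 (K * (2 * R) ^ S)
  have hK' : 1 ≤ K' := le_max_left _ _
  refine ⟨2 ^ ((J₀ : ℝ) * a) * C ^ d + C ^ d * K', by positivity, fun j c hc =>
    ⟨isCompact_Icc.uniformContinuousOn_of_continuous 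
      (continuous_const.mul (continuous_bumpSum j c)).continuousOn, fun m₀ l hl m ι hι => ?_⟩⟩
  have hsum : ∀ b l (m : Fin (2 ^ l)), ∑ q, |∫ t, dyadicBump j q t * W.factor b l m t ∂unitVol|
      ≤ C / sqrtTwoPow l := by
    intro b l m
    refine (sum_abs_integral_dyadicBump_mul_le j (hW.isBddMeas_factor b l m)).trans ?_
    rw [le_div_iff₀ (sqrtTwoPow_pos l)]
    exact (hloc b).integral_abs l m
  have hpos : (0 : ℝ) < 2 ^ (-(a * j)) := by positivity
  simp only [mul_assoc, integral_const_mul, abs_mul, abs_of_pos hpos]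
  refine add_le_add ?_ ?_
  · -- the coarsest level
    have h1 : |∫ x, bumpSum j c x * W.Phi J₀ m₀ x ∂cubeVol d| ≤ (C / sqrtTwoPow J₀) ^ d := by
      rw [Phi_eq_Psi]
      refine (hW.abs_integral_bumpSum_mul_Psi_le hc _ J₀ m₀).trans ?_
      refine (Finset.prod_le_prod (fun _ _ => Finset.sum_nonneg fun _ _ => abs_nonneg _)
        fun i _ => hsum _ J₀ (m₀ i)).trans (by simp [div_pow])
    have h2 : (2 : ℝ) ^ (-(a * j)) ≤ 1 :=
      Real.rpow_le_one_of_one_le_of_nonpos one_le_two (by have := ha.le; simp; positivity)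
    rw [two_rpow_mul_add]
    have hs := pow_pos (sqrtTwoPow_pos J₀) d
    calc 2 ^ ((J₀ : ℝ) * a) * sqrtTwoPow J₀ ^ d *
          (2 ^ (-(a * (j : ℝ))) * |∫ x, bumpSum j c x * W.Phi J₀ m₀ x ∂cubeVol d|)
        ≤ 2 ^ ((J₀ : ℝ) * a) * sqrtTwoPow J₀ ^ d * (1 * (C / sqrtTwoPow J₀) ^ d) := by gcongr
      _ = 2 ^ ((J₀ : ℝ) * a) * C ^ d := by rw [div_pow]; field_simp
  · obtain ⟨i₀, hi₀⟩ := hι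
    have hs := pow_pos (sqrtTwoPow_pos l) d
    -- a bound for the sum in the coordinate of a wavelet factor, by either argument
    have key : ∀ θ : ℝ, 0 ≤ θ →
        (∑ q, |∫ t, dyadicBump j q t * W.factor (ι i₀) l (m i₀) t ∂unitVol|
          ≤ θ * (C / sqrtTwoPow l)) →
        |∫ x, bumpSum j c x * W.Psi ι l m x ∂cubeVol d| ≤ θ * (C / sqrtTwoPow l) ^ d := by
      intro θ hθ h
      refine (hW.abs_integral_bumpSum_mul_Psi_le hc ι l m).trans ?_
      have h1 : ∀ i, ∑ q, |∫ t, dyadicBump j q t * W.factor (ι i) l (m i) t ∂unitVol|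
          ≤ (if i = i₀ then θ else 1) * (C / sqrtTwoPow l) := by
        intro i
        split_ifs with hi
        · subst hi; exact h
        · rw [one_mul]; exact hsum _ _ _
      refine (Finset.prod_le_prod (fun _ _ => Finset.sum_nonneg fun _ _ => abs_nonneg _)
        fun i _ => h1 i).trans (le_of_eq ?_)
      rw [Finset.prod_mul_distrib, Finset.prod_ite_eq']
      simp [div_pow]
    rw [two_rpow_mul_add]
    rcases le_or_gt l j with hlj | hlj
    · have h1 := key 1 zero_le_one (by rw [one_mul]; exact hsum _ _ _)
      have h2 : (2 : ℝ) ^ ((l : ℝ) * a) * 2 ^ (-(a * j)) ≤ 1 := by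
        rw [← Real.rpow_add two_pos]
        refine Real.rpow_le_one_of_one_le_of_nonpos one_le_two ?_
        have : (l : ℝ) ≤ j := by exact_mod_cast hlj
        nlinarith
      calc 2 ^ ((l : ℝ) * a) * sqrtTwoPow l ^ d *
            (2 ^ (-(a * (j : ℝ))) * |∫ x, bumpSum j c x * W.Psi ι l m x ∂cubeVol d|)
          ≤ 2 ^ ((l : ℝ) * a) * sqrtTwoPow l ^ d *
            (2 ^ (-(a * (j : ℝ))) * (1 * (C / sqrtTwoPow l) ^ d)) := by gcongr
        _ = (2 ^ ((l : ℝ) * a) * 2 ^ (-(a * (j : ℝ)))) * C ^ d := by rw [div_pow]; field_simp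
        _ ≤ 1 * C ^ d := by gcongr
        _ ≤ C ^ d * K' := by rw [mul_comm]; gcongr
    · have h1 := key (((2 ^ j : ℝ) / 2 ^ l) ^ S * (K * (2 * R) ^ S)) (by positivity) (by
        have h0 : ∀ q, ∫ t, dyadicBump j q t * W.factor (ι i₀) l (m i₀) t ∂unitVol
            = ∫ t, dyadicBump j q t * W.wav l (m i₀) t ∂unitVol := by simp [factor, hi₀]
        simp only [h0]
        refine (sum_abs_integral_dyadicBump_mul_wav_le hW hR hlocw hK j hl (m i₀)).trans
          (le_of_eq ?_)
        rw [div_pow, div_pow]; ring)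
      have h3 : ((2 ^ j : ℝ) / 2 ^ l) ^ S = 2 ^ (((j : ℝ) - l) * S) := by
        rw [Real.rpow_mul_natCast two_pos.le, Real.rpow_sub two_pos, Real.rpow_natCast,
          Real.rpow_natCast]
      have h2 : (2 : ℝ) ^ ((l : ℝ) * a) * 2 ^ (-(a * j)) * ((2 ^ j : ℝ) / 2 ^ l) ^ S ≤ 1 := by
        rw [h3, ← Real.rpow_add two_pos, ← Real.rpow_add two_pos]
        refine Real.rpow_le_one_of_one_le_of_nonpos one_le_two ?_
        have : (j : ℝ) ≤ l := by exact_mod_cast hlj.le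
        nlinarith
      calc 2 ^ ((l : ℝ) * a) * sqrtTwoPow l ^ d *
            (2 ^ (-(a * (j : ℝ))) * |∫ x, bumpSum j c x * W.Psi ι l m x ∂cubeVol d|)
          ≤ 2 ^ ((l : ℝ) * a) * sqrtTwoPow l ^ d * (2 ^ (-(a * (j : ℝ))) *
            (((2 ^ j : ℝ) / 2 ^ l) ^ S * (K * (2 * R) ^ S) * (C / sqrtTwoPow l) ^ d)) := by gcongr
        _ = (2 ^ ((l : ℝ) * a) * 2 ^ (-(a * (j : ℝ))) * ((2 ^ j : ℝ) / 2 ^ l) ^ S) *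
            (C ^ d * (K * (2 * R) ^ S)) := by
            rw [div_pow C]; field_simp
        _ ≤ 1 * (C ^ d * (K * (2 * R) ^ S)) := by gcongr
        _ ≤ C ^ d * K' := by rw [one_mul]; gcongr; exact le_max_right _ _

end BoundaryWavelets

/-! ### Perturbations of a law inside the model -/

section Perturbation

variable {S J₀ d : ℕ} {W : BoundaryWavelets S}

/-- A function of the smaller ball, shrunk towards the centre `(C₁ + C₂) / 2`, can be perturbed
by bumps within the larger ball. -/
lemma exists_shrink_mem_holderBall (hW : W.IsCDVBasis J₀) {a M M' C₁ C₂ : ℝ}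
    (ha : 0 < a) (haS : a < S) (hC : C₁ < C₂) (hM' : 0 ≤ M') (hM : M' < M)
    {r h : (Fin d → ℝ) → ℝ} (hrm : IsBddMeas r) (hr : ∀ x, r x ∈ Icc C₁ C₂)
    (hh : h ∈ W.holderBall d J₀ a M') (hrh : r =ᵐ[cubeVol d] h) :
    ∃ ε₀ : ℝ, 0 < ε₀ ∧ ∀ ε, 0 < ε → ε ≤ ε₀ → ε ≤ 1 → ∃ (p : (Fin d → ℝ) → ℝ) (δ₀ : ℝ),
      IsBddMeas p ∧ (∀ x, |p x| ≤ 1 - ε) ∧ 0 < δ₀ ∧ ∀ δ, 0 < δ → δ ≤ δ₀ →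
      ∀ (j : ℕ) (c : (Fin d → Fin (2 ^ j)) → ℝ), (∀ q, |c q| ≤ 1) →
        ∃ f ∈ W.holderBall d J₀ a M,
          (fun x => ofSign C₁ C₂ (p x + δ * (2 ^ (-(a * j)) * bumpSum j c x)))
            =ᵐ[cubeVol d] f := by
  obtain ⟨K₀, hK₀, hconst⟩ := hW.exists_const_mem_holderBall d a
  obtain ⟨K, hK, hbump⟩ := hW.exists_bumpSum_mem_holderBall d ha haS
  set m := (C₁ + C₂) / 2 with hm
  set w := (C₂ - C₁) / 2 with hw
  have hw0 : 0 < w := by rw [hw]; linarith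
  have hden : 0 < 2 * (|m| * K₀ + 1) := by positivity
  refine ⟨(M - M') / (2 * (|m| * K₀ + 1)), div_pos (by linarith) hden, fun ε hε hε₀ hε1 => ?_⟩
  refine ⟨fun x => (1 - ε) / w * (r x - m), (M - M') / (2 * (w * K + 1)),
    (hrm.sub (.const _)).const_mul _, fun x => ?_, div_pos (by linarith) (by positivity),
    fun δ hδ hδ₀ j c hc => ?_⟩
  · have h1 : |r x - m| ≤ w := by
      have := hr x
      rw [abs_le, hm, hw]
      constructor <;> linarith [this.1, this.2]
    rw [abs_mul, abs_of_nonneg (div_nonneg (by linarith) hw0.le)]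
    calc (1 - ε) / w * |r x - m| ≤ (1 - ε) / w * w :=
          mul_le_mul_of_nonneg_left h1 (div_nonneg (by linarith) hw0.le)
      _ = 1 - ε := by field_simp
  · refine ⟨_, W.holderBall_mono ?_ (hW.holderBall_add (hW.holderBall_add
      (W.holderBall_const_mul hh (1 - ε)) (hconst (ε * m)))
      (W.holderBall_const_mul (hbump j c hc) (w * δ))), ?_⟩
    · rw [abs_of_nonneg (by linarith : (0 : ℝ) ≤ 1 - ε), abs_mul, abs_of_pos hε, abs_mul,
        abs_of_pos hw0, abs_of_pos hδ]
      rw [le_div_iff₀ hden] at hε₀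
      rw [le_div_iff₀ (by positivity)] at hδ₀
      nlinarith [mul_nonneg hε.le hM']
    · filter_upwards [hrh] with x hx
      simp only [ofSign, ← hm, ← hw]
      rw [hx]
      field_simp
      ring

/-- Around some law of the model with independent signs given the covariate, both regression
functions can be perturbed by bumps within the model. -/
lemma exists_perturbable (hW : W.IsCDVBasis J₀) {α β M C₁ C₂ : ℝ} (hα : 0 < α) (hβ : 0 < β)
    (hαS : α < S) (hβS : β < S) (hM : 0 < M) (hC : C₁ < C₂)
    (hne : ∃ M' < M, (model W d J₀ α β M' C₁ C₂).Nonempty) :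
    ∃ (p b : (Fin d → ℝ) → ℝ) (ε δ : ℝ), IsBddMeas p ∧ IsBddMeas b ∧ 0 < ε ∧ ε ≤ 1 ∧
      (∀ x, |p x| ≤ 1 - ε) ∧ (∀ x, |b x| ≤ 1 - ε) ∧ 0 < δ ∧ δ ≤ ε / 4 ∧
      (∀ (j : ℕ) (c : (Fin d → Fin (2 ^ j)) → ℝ), (∀ q, |c q| ≤ 1) →
        ∃ f ∈ W.holderBall d J₀ α M,
          (fun x => ofSign C₁ C₂ (p x + δ * (2 ^ (-(α * j)) * bumpSum j c x)))
            =ᵐ[cubeVol d] f) ∧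
      ∀ (j : ℕ) (c : (Fin d → Fin (2 ^ j)) → ℝ), (∀ q, |c q| ≤ 1) →
        ∃ f ∈ W.holderBall d J₀ β M,
          (fun x => ofSign C₁ C₂ (b x + δ * (2 ^ (-(β * j)) * bumpSum j c x)))
            =ᵐ[cubeVol d] f := by
  obtain ⟨M', hM', P, hP⟩ := hne
  obtain ⟨r₁, r₂, hreg, m1, m2, ⟨h₁, hh₁, e1⟩, ⟨h₂, hh₂, e2⟩, -⟩ :=
    exists_isRegressionPair_of_mem_model hC.le hP
  have hM0 : max M' 0 < M := max_lt hM' hM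
  obtain ⟨ε₁, hε₁, H₁⟩ := exists_shrink_mem_holderBall hW hα hαS hC (le_max_right _ _) hM0
    hreg.fst.bdd_r m1 (W.holderBall_mono (le_max_left _ _) hh₁) e1
  obtain ⟨ε₂, hε₂, H₂⟩ := exists_shrink_mem_holderBall hW hβ hβS hC (le_max_right _ _) hM0
    hreg.snd.bdd_r m2 (W.holderBall_mono (le_max_left _ _) hh₂) e2
  set ε := min 1 (min ε₁ ε₂)
  have hε : 0 < ε := by positivity
  obtain ⟨p, δ₁, hpm, hp, hδ₁, Hp⟩ := H₁ ε hε ((min_le_right _ _).trans (min_le_left _ _))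
    (min_le_left _ _)
  obtain ⟨b, δ₂, hbm, hb, hδ₂, Hb⟩ := H₂ ε hε ((min_le_right _ _).trans (min_le_right _ _))
    (min_le_left _ _)
  refine ⟨p, b, ε, min (ε / 4) (min δ₁ δ₂), hpm, hbm, hε, min_le_left _ _, hp, hb, by positivity,
    min_le_left _ _, ?_, ?_⟩
  · exact Hp _ (by positivity) ((min_le_right _ _).trans (min_le_left _ _))
  · exact Hb _ (by positivity) ((min_le_right _ _).trans (min_le_right _ _))

/-- Perturbing independent signs: the density stays bounded away from zero, and it is affine in
each of the two perturbations. -/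
lemma le_signDensity_perturbed (C₁ : ℝ) {p b u v : (Fin d → ℝ) → ℝ} {ε : ℝ} (hε : 0 < ε)
    (hp : ∀ x, |p x| ≤ 1 - ε) (hb : ∀ x, |b x| ≤ 1 - ε) (hu : ∀ x, |u x| ≤ ε / 4)
    (hv : ∀ x, |v x| ≤ ε / 4) (o : Obs d) :
    ε ^ 2 / 8 ≤ signDensity C₁ (fun x => p x + u x) (fun x => b x + v x)
      (fun x => p x * b x + p x * v x + b x * u x) o := by
  have key : signDensity C₁ (fun x => p x + u x) (fun x => b x + v x)
      (fun x => p x * b x + p x * v x + b x * u x) o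
      = (1 + signOf C₁ o.2.1 * (p o.1 + u o.1)) * (1 + signOf C₁ o.2.2 * (b o.1 + v o.1))
        - signOf C₁ o.2.1 * signOf C₁ o.2.2 * (u o.1 * v o.1) := by
    unfold signDensity; ring
  rw [key]
  have hone : ∀ (s f g : ℝ), |s| = 1 → |f| ≤ 1 - ε → |g| ≤ ε / 4 → 3 * ε / 4 ≤ 1 + s * (f + g) := by
    intro s f g hs hf hg
    have h1 : |s * (f + g)| ≤ 1 - ε + ε / 4 := by
      rw [abs_mul, hs, one_mul]; exact (abs_add_le _ _).trans (add_le_add hf hg)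
    linarith [neg_le_of_abs_le h1]
  have h1 := hone _ _ _ (abs_signOf C₁ o.2.1) (hp o.1) (hu o.1)
  have h2 := hone _ _ _ (abs_signOf C₁ o.2.2) (hb o.1) (hv o.1)
  have h3 : |signOf C₁ o.2.1 * signOf C₁ o.2.2 * (u o.1 * v o.1)| ≤ ε / 4 * (ε / 4) := by
    rw [abs_mul, abs_mul, abs_signOf, abs_signOf, one_mul, one_mul, abs_mul]
    exact mul_le_mul (hu _) (hv _) (abs_nonneg _) (by positivity)
  have h4 := le_of_abs_le h3
  nlinarith [mul_le_mul h1 h2 (by positivity) (by linarith)]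

lemma isSignMeans_perturbed (C₁ : ℝ) {p b u v : (Fin d → ℝ) → ℝ} {ε : ℝ} (hε : 0 < ε)
    (hp : ∀ x, |p x| ≤ 1 - ε) (hb : ∀ x, |b x| ≤ 1 - ε) (hu : ∀ x, |u x| ≤ ε / 4)
    (hv : ∀ x, |v x| ≤ ε / 4) (hpm : IsBddMeas p) (hbm : IsBddMeas b) (hum : IsBddMeas u)
    (hvm : IsBddMeas v) : IsSignMeans C₁ (fun x => p x + u x) (fun x => b x + v x)
      (fun x => p x * b x + p x * v x + b x * u x) where
  bdd_p := hpm.add hum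
  bdd_b := hbm.add hvm
  bdd_θ := ((hpm.mul hbm).add (hpm.mul hvm)).add (hbm.mul hum)
  nonneg o := le_trans (by positivity) (le_signDensity_perturbed C₁ hε hp hb hu hv o)

end Perturbation

/-! ### Minimax lower bounds from two mixtures -/

section Mixtures

variable {Ω : Type} [MeasurableSpace Ω] {I : Type} [Fintype I]

/-- The density of an i.i.d. sample is the product of the densities. -/
lemma pi_withDensity_ofReal (ν : Measure Ω) [IsProbabilityMeasure ν] {q : Ω → ℝ}
    (hq : IsBddMeas q) (h0 : ∀ ω, 0 ≤ q ω) :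
    Measure.pi (fun _ : I => ν.withDensity fun ω => ENNReal.ofReal (q ω))
      = (Measure.pi fun _ : I => ν).withDensity fun o => ENNReal.ofReal (∏ i, q (o i)) := by
  have : IsFiniteMeasure (ν.withDensity fun ω => ENNReal.ofReal (q ω)) :=
    isFiniteMeasure_withDensity_ofReal (hq.integrable ν).2
  refine Measure.pi_eq fun s hs => ?_
  have hP : IsBddMeas fun o : I → Ω => ∏ i, q (o i) :=
    IsBddMeas.prod _ fun i _ => hq.comp (measurable_pi_apply i)
  rw [withDensity_apply _ (MeasurableSet.univ_pi hs),
    ← ofReal_integral_eq_lintegral_ofReal (hP.integrable _).integrableOn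
      (Filter.Eventually.of_forall fun o => Finset.prod_nonneg fun i _ => h0 _),
    ← integral_indicator (MeasurableSet.univ_pi hs)]
  have h1 : ∀ o : I → Ω, (Set.pi univ s).indicator (fun o => ∏ i, q (o i)) o
      = ∏ i, (s i).indicator q (o i) := by
    intro o
    by_cases ho : o ∈ Set.pi univ s
    · rw [indicator_of_mem ho]
      exact Finset.prod_congr rfl fun i _ => (indicator_of_mem (ho i (mem_univ i)) _).symm
    · rw [indicator_of_notMem ho]
      obtain ⟨i, hi⟩ : ∃ i, o i ∉ s i := by simpa [Set.mem_pi] using ho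
      exact (Finset.prod_eq_zero (Finset.mem_univ i) (indicator_of_notMem hi _)).symm
  simp only [h1]
  rw [integral_fintype_prod_eq_prod fun i => (s i).indicator q,
    ENNReal.ofReal_prod_of_nonneg fun i _ =>
      integral_nonneg fun ω => indicator_nonneg (fun ω _ => h0 ω) ω]
  refine Finset.prod_congr rfl fun i _ => ?_
  rw [withDensity_apply _ (hs i), integral_indicator (hs i),
    ofReal_integral_eq_lintegral_ofReal (hq.integrable ν).integrableOn
      (Filter.Eventually.of_forall h0)]

lemma ofReal_integral_le_lintegral {ν : Measure Ω} {f : Ω → ℝ} (hf : Integrable f ν) :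
    ENNReal.ofReal (∫ ω, f ω ∂ν) ≤ ∫⁻ ω, ENNReal.ofReal (f ω) ∂ν := by
  have h1 : ∫ ω, f ω ∂ν ≤ ∫ ω, max (f ω) 0 ∂ν :=
    integral_mono hf hf.pos_part fun ω => le_max_left _ _
  refine (ENNReal.ofReal_le_ofReal h1).trans (le_of_eq ?_)
  rw [ofReal_integral_eq_lintegral_ofReal hf.pos_part
    (Filter.Eventually.of_forall fun ω => le_max_right _ _)]
  refine lintegral_congr fun ω => ?_
  rcases le_total (f ω) 0 with h | h
  · rw [max_eq_right h, ENNReal.ofReal_zero, ENNReal.ofReal_of_nonpos h]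
  · rw [max_eq_left h]

lemma one_sub_sum_le_prod {ι : Type*} (s : Finset ι) {x : ι → ℝ} (h0 : ∀ i ∈ s, 0 ≤ x i)
    (h1 : ∀ i ∈ s, x i ≤ 1) : 1 - ∑ i ∈ s, x i ≤ ∏ i ∈ s, (1 - x i) := by
  classical
  induction s using Finset.induction_on with
  | empty => simp
  | insert a s ha ih =>
    rw [Finset.sum_insert ha, Finset.prod_insert ha]
    have ih' := ih (fun i hi => h0 i (Finset.mem_insert_of_mem hi))
      fun i hi => h1 i (Finset.mem_insert_of_mem hi)
    have ha0 := h0 a (Finset.mem_insert_self a s)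
    have ha1 := h1 a (Finset.mem_insert_self a s)
    have hs : 0 ≤ ∑ i ∈ s, x i := Finset.sum_nonneg fun i hi =>
      h0 i (Finset.mem_insert_of_mem hi)
    nlinarith [mul_le_mul_of_nonneg_left ih' (by linarith : (0 : ℝ) ≤ 1 - x a),
      mul_nonneg ha0 hs]

/-- A two-point bound for likelihoods `∏ F m` and `∏ G m` of product form, from a comparison of the
geometric and the arithmetic means of the factors. -/
lemma two_point_le {ι : Type*} [Fintype ι] {F G x : ι → ℝ} (hF : ∀ m, 0 ≤ F m)
    (hG : ∀ m, 0 ≤ G m) (hx : ∀ m, 0 ≤ x m)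
    (hFG : ∀ m, ((F m + G m) / 2) ^ 2 * (1 - x m) ≤ F m * G m) (a b t : ℝ) :
    (a - b) ^ 2 * ((∏ m, (F m + G m) / 2) * (1 - ∑ m, x m) - (∏ m, F m + ∏ m, G m) / 4)
      ≤ (t - a) ^ 2 * ∏ m, F m + (t - b) ^ 2 * ∏ m, G m := by
  have hF0 : 0 ≤ ∏ m, F m := Finset.prod_nonneg fun m _ => hF m
  have hG0 : 0 ≤ ∏ m, G m := Finset.prod_nonneg fun m _ => hG m
  have hS0 : 0 ≤ ∏ m, (F m + G m) / 2 :=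
    Finset.prod_nonneg fun m _ => by linarith [hF m, hG m]
  have hX0 : 0 ≤ ∑ m, x m := Finset.sum_nonneg fun m _ => hx m
  have hrhs : 0 ≤ (t - a) ^ 2 * ∏ m, F m + (t - b) ^ 2 * ∏ m, G m := by positivity
  rcases le_or_gt 1 (∑ m, x m) with h1 | h1
  · refine le_trans (mul_nonpos_of_nonneg_of_nonpos (sq_nonneg _) ?_) hrhs
    nlinarith
  have hx1 : ∀ m ∈ Finset.univ, x m ≤ 1 := fun m hm =>
    (Finset.single_le_sum (f := x) (fun i _ => hx i) hm).trans h1.le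
  have hprod : (∏ m, (F m + G m) / 2) ^ 2 * (1 - ∑ m, x m) ≤ (∏ m, F m) * ∏ m, G m := by
    calc (∏ m, (F m + G m) / 2) ^ 2 * (1 - ∑ m, x m)
        ≤ (∏ m, (F m + G m) / 2) ^ 2 * ∏ m, (1 - x m) :=
          mul_le_mul_of_nonneg_left (one_sub_sum_le_prod _ (fun m _ => hx m) hx1) (sq_nonneg _)
      _ = ∏ m, ((F m + G m) / 2) ^ 2 * (1 - x m) := by
          rw [Finset.prod_mul_distrib, Finset.prod_pow]
      _ ≤ ∏ m, F m * G m := Finset.prod_le_prod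
          (fun m hm => mul_nonneg (sq_nonneg _) (by linarith [hx1 m hm])) fun m _ => hFG m
      _ = _ := Finset.prod_mul_distrib
  set f := ∏ m, F m
  set g := ∏ m, G m
  set s := ∏ m, (F m + G m) / 2
  set y := 1 - ∑ m, x m
  have hy0 : 0 < y := by simp only [y]; linarith
  have hy1 : y ≤ 1 := by simp only [y]; linarith
  rcases eq_or_lt_of_le (add_nonneg hF0 hG0) with h0 | h0
  · have hf : f = 0 := by linarith
    have hs : s = 0 := by
      by_contra hs
      have : 0 < s ^ 2 * y := by positivity
      rw [hf] at hprod; linarith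
    rw [hs, ← h0]; simpa using hrhs
  · -- the minimum over `t` is `(a - b)² f g / (f + g)`
    have h2 : (a - b) ^ 2 * (f * g) ≤ ((t - a) ^ 2 * f + (t - b) ^ 2 * g) * (f + g) := by
      nlinarith [sq_nonneg ((t - a) * f + (t - b) * g)]
    have h3 : (s * y - (f + g) / 4) * (f + g) ≤ f * g := by
      nlinarith [sq_nonneg (s * y - (f + g) / 2), mul_nonneg (mul_nonneg (sq_nonneg s) hy0.le)
        (by linarith : (0 : ℝ) ≤ 1 - y)]
    refine le_of_mul_le_mul_right ?_ h0
    calc (a - b) ^ 2 * (s * y - (f + g) / 4) * (f + g)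
        = (a - b) ^ 2 * ((s * y - (f + g) / 4) * (f + g)) := by ring
      _ ≤ (a - b) ^ 2 * (f * g) := mul_le_mul_of_nonneg_left h3 (sq_nonneg _)
      _ ≤ _ := h2

variable {d : ℕ}

lemma risk_eq_of_density {ν : Measure (Obs d)} [IsProbabilityMeasure ν] {q : Obs d → ℝ}
    (hq : IsBddMeas q) (h0 : ∀ ω, 0 ≤ q ω) {P : ProbabilityMeasure (Obs d)}
    (hP : (P : Measure (Obs d)) = ν.withDensity fun ω => ENNReal.ofReal (q ω))
    {T : (I → Obs d) → ℝ} (hT : Measurable T) :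
    risk T P = ∫⁻ o, ENNReal.ofReal ((T o - psi P) ^ 2 * ∏ i, q (o i))
      ∂(Measure.pi fun _ : I => ν) := by
  have hm : Measurable fun o : I → Obs d => ENNReal.ofReal (∏ i, q (o i)) :=
    (IsBddMeas.prod _ fun i _ => hq.comp (measurable_pi_apply i)).1.ennreal_ofReal
  unfold risk
  rw [hP, pi_withDensity_ofReal ν hq h0, lintegral_withDensity_eq_lintegral_mul _ hm
    ((hT.sub_const _).pow_const 2).ennreal_ofReal]
  refine lintegral_congr fun o => ?_
  rw [Pi.mul_apply, mul_comm, ENNReal.ofReal_mul (sq_nonneg _)]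

/-- If the functional has the value `a` for all laws `P k` and the value `b` for all laws `P' k`,
and the likelihoods of the two mixtures factor with comparable factors, then no estimator has a
worst-case risk below a multiple of `(a - b)²`. -/
lemma le_minimaxRisk_of_mixtures {ν : Measure (Obs d)} [IsProbabilityMeasure ν]
    {Q : Set (ProbabilityMeasure (Obs d))} {K ι : Type*} [Fintype K] [Nonempty K] [Fintype ι]
    {q q' : K → Obs d → ℝ} (hq : ∀ k, IsBddMeas (q k)) (hq' : ∀ k, IsBddMeas (q' k))
    (h0 : ∀ k ω, 0 ≤ q k ω) (h0' : ∀ k ω, 0 ≤ q' k ω)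
    {P P' : K → ProbabilityMeasure (Obs d)} (hPQ : ∀ k, P k ∈ Q) (hPQ' : ∀ k, P' k ∈ Q)
    (hP : ∀ k, (P k : Measure (Obs d)) = ν.withDensity fun ω => ENNReal.ofReal (q k ω))
    (hP' : ∀ k, (P' k : Measure (Obs d)) = ν.withDensity fun ω => ENNReal.ofReal (q' k ω))
    {a b : ℝ} (ha : ∀ k, psi (P k) = a) (hb : ∀ k, psi (P' k) = b)
    {F G x : ι → (I → Obs d) → ℝ} (hF : ∀ m o, 0 ≤ F m o) (hG : ∀ m o, 0 ≤ G m o)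
    (hx : ∀ m o, 0 ≤ x m o)
    (hFG : ∀ m o, ((F m o + G m o) / 2) ^ 2 * (1 - x m o) ≤ F m o * G m o)
    (hFq : ∀ o, ∏ m, F m o = ∑ k, ∏ i, q k (o i)) (hGq : ∀ o, ∏ m, G m o = ∑ k, ∏ i, q' k (o i))
    (hSm : IsBddMeas fun o => ∏ m, (F m o + G m o) / 2) (hxm : IsBddMeas fun o => ∑ m, x m o)
    (hS : ∫ o, ∏ m, (F m o + G m o) / 2 ∂(Measure.pi fun _ : I => ν) = Fintype.card K)
    (hSx : ∫ o, (∏ m, (F m o + G m o) / 2) * ∑ m, x m o ∂(Measure.pi fun _ : I => ν)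
      ≤ Fintype.card K / 4) :
    ENNReal.ofReal ((a - b) ^ 2 / 8) ≤ minimaxRisk Q I := by
  set π : Measure (I → Obs d) := Measure.pi fun _ : I => ν
  have hK : (0 : ℝ) < Fintype.card K := by exact_mod_cast Fintype.card_pos
  have hprod : ∀ {r : K → Obs d → ℝ}, (∀ k, IsBddMeas (r k)) →
      IsBddMeas fun o : I → Obs d => ∑ k, ∏ i, r k (o i) := fun hr =>
    IsBddMeas.sum _ fun k _ => IsBddMeas.prod _ fun i _ => (hr k).comp (measurable_pi_apply i)
  have hone : ∀ {r : K → Obs d → ℝ}, (∀ k, IsBddMeas (r k)) → (∀ k ω, 0 ≤ r k ω) →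
      ∀ {R : K → ProbabilityMeasure (Obs d)},
      (∀ k, (R k : Measure (Obs d)) = ν.withDensity fun ω => ENNReal.ofReal (r k ω)) →
      ∫ o, ∑ k, ∏ i, r k (o i) ∂π = Fintype.card K := by
    intro r hr hr0 R hR
    rw [integral_finsetSum _ fun k _ => (IsBddMeas.prod _ fun i _ =>
      (hr k).comp (measurable_pi_apply i)).integrable _]
    have : ∀ k, ∫ o, ∏ i, r k (o i) ∂π = 1 := by
      intro k
      rw [integral_fintype_prod_eq_pow (fun ω => r k ω)]
      have h1 : (R k : Measure (Obs d)) univ = 1 := measure_univ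
      rw [hR k, withDensity_apply _ MeasurableSet.univ, Measure.restrict_univ,
        ← ofReal_integral_eq_lintegral_ofReal ((hr k).integrable _)
          (Filter.Eventually.of_forall (hr0 k)), ENNReal.ofReal_eq_one] at h1
      rw [h1, one_pow]
    simp [this]
  unfold minimaxRisk
  refine le_iInf fun T => le_iInf fun hT => ?_
  set L : (I → Obs d) → ℝ := fun o => (a - b) ^ 2 * ((∏ m, (F m o + G m o) / 2)
    * (1 - ∑ m, x m o) - (∑ k, ∏ i, q k (o i) + ∑ k, ∏ i, q' k (o i)) / 4) with hL
  have hLm : IsBddMeas L := by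
    have h1 := ((hprod hq).add (hprod hq')).const_mul (1 / 4)
    have h2 := ((hSm.mul ((IsBddMeas.const 1).sub hxm)).sub h1).const_mul ((a - b) ^ 2)
    convert h2 using 3
    ring
  have hLint : (Fintype.card K : ℝ) * ((a - b) ^ 2 / 4) ≤ ∫ o, L o ∂π := by
    have e1 : ∫ o, L o ∂π = (a - b) ^ 2 * ((∫ o, ∏ m, (F m o + G m o) / 2 ∂π
        - ∫ o, (∏ m, (F m o + G m o) / 2) * ∑ m, x m o ∂π)
        - (∫ o, ∑ k, ∏ i, q k (o i) ∂π + ∫ o, ∑ k, ∏ i, q' k (o i) ∂π) / 4) := by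
      rw [← integral_add ((hprod hq).integrable _) ((hprod hq').integrable _),
        ← integral_sub (hSm.integrable _) ((hSm.mul hxm).integrable _), ← integral_div,
        ← integral_sub (((hSm.sub (hSm.mul hxm))).integrable _)
          ((((hprod hq).add (hprod hq')).integrable _).div_const _), ← integral_const_mul]
      refine integral_congr_ae (Filter.Eventually.of_forall fun o => ?_)
      simp only [hL]; ring
    rw [e1, hS, hone hq h0 hP, hone hq' h0' hP']
    nlinarith [mul_nonneg (sq_nonneg (a - b)) (sub_nonneg.mpr hSx)]
  have hpt : ∀ o, L o ≤ ∑ k, ((T o - a) ^ 2 * ∏ i, q k (o i)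
      + (T o - b) ^ 2 * ∏ i, q' k (o i)) := by
    intro o
    have := two_point_le (fun m => hF m o) (fun m => hG m o) (fun m => hx m o)
      (fun m => hFG m o) a b (T o)
    rw [hFq, hGq] at this
    rw [Finset.sum_add_distrib, ← Finset.mul_sum, ← Finset.mul_sum]
    exact this
  have hrisk : ∀ {r : K → Obs d → ℝ}, (∀ k, IsBddMeas (r k)) → ∀ {c : ℝ} k,
      Measurable fun o : I → Obs d => ENNReal.ofReal ((T o - c) ^ 2 * ∏ i, r k (o i)) :=
    fun hr c k => ((((hT.sub_const _).pow_const 2).mul (IsBddMeas.prod _ fun i _ =>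
      (hr k).comp (measurable_pi_apply i)).1)).ennreal_ofReal
  have hsum : ENNReal.ofReal ((Fintype.card K : ℝ) * ((a - b) ^ 2 / 4))
      ≤ ∑ k, (risk T (P k) + risk T (P' k)) := by
    refine ((ENNReal.ofReal_le_ofReal hLint).trans
      (ofReal_integral_le_lintegral (hLm.integrable π))).trans ?_
    refine (lintegral_mono fun o => ENNReal.ofReal_le_ofReal (hpt o)).trans (le_of_eq ?_)
    have e1 : ∀ k, risk T (P k) + risk T (P' k) = ∫⁻ o, (ENNReal.ofReal ((T o - a) ^ 2
        * ∏ i, q k (o i)) + ENNReal.ofReal ((T o - b) ^ 2 * ∏ i, q' k (o i))) ∂π := by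
      intro k
      rw [risk_eq_of_density (hq k) (h0 k) (hP k) hT,
        risk_eq_of_density (hq' k) (h0' k) (hP' k) hT, ha, hb, lintegral_add_left (hrisk hq k)]
    simp only [e1]
    refine Eq.trans (lintegral_congr fun o => ?_)
      (lintegral_finsetSum _ fun k _ => (hrisk hq (c := a) k).add (hrisk hq' (c := b) k))
    have n1 : ∀ k, 0 ≤ (T o - a) ^ 2 * ∏ i, q k (o i) := fun k =>
      mul_nonneg (sq_nonneg _) (Finset.prod_nonneg fun i _ => h0 k _)
    have n2 : ∀ k, 0 ≤ (T o - b) ^ 2 * ∏ i, q' k (o i) := fun k =>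
      mul_nonneg (sq_nonneg _) (Finset.prod_nonneg fun i _ => h0' k _)
    rw [ENNReal.ofReal_sum_of_nonneg fun k _ => add_nonneg (n1 k) (n2 k)]
    exact Finset.sum_congr rfl fun k _ => ENNReal.ofReal_add (n1 k) (n2 k)
  have hle : ∀ k, risk T (P k) + risk T (P' k) ≤ 2 * worstRisk Q T := by
    intro k
    rw [two_mul]
    exact add_le_add (le_iSup₂ (f := fun P (_ : P ∈ Q) => risk T P) (P k) (hPQ k))
      (le_iSup₂ (f := fun P (_ : P ∈ Q) => risk T P) (P' k) (hPQ' k))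
  have h3 := hsum.trans (Finset.sum_le_sum fun k _ => hle k)
  rw [Finset.sum_const, Finset.card_univ, nsmul_eq_mul, ← mul_assoc] at h3
  have h4 : ENNReal.ofReal ((Fintype.card K : ℝ) * ((a - b) ^ 2 / 4))
      = (Fintype.card K * 2 : ℝ≥0∞) * ENNReal.ofReal ((a - b) ^ 2 / 8) := by
    rw [show (Fintype.card K : ℝ) * ((a - b) ^ 2 / 4)
        = (Fintype.card K * 2 : ℝ) * ((a - b) ^ 2 / 8) by ring,
      ENNReal.ofReal_mul (by positivity), ENNReal.ofReal_mul (by positivity)]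
    simp
  rw [h4] at h3
  exact (ENNReal.mul_le_mul_iff_right (by simp) (ENNReal.mul_ne_top (by simp) (by simp))).mp h3

end Mixtures

section ParametricLower

variable {S J₀ d : ℕ} {W : BoundaryWavelets S}

lemma signDensity_indep (C₁ : ℝ) (p b : (Fin d → ℝ) → ℝ) (τ : ℝ) (o : Obs d) :
    signDensity C₁ p b (fun x => p x * b x + τ) o
      = (1 + signOf C₁ o.2.1 * p o.1) * (1 + signOf C₁ o.2.2 * b o.1)
        + signOf C₁ o.2.1 * signOf C₁ o.2.2 * τ := by
  unfold signDensity; ring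

lemma le_one_add_sign_mul {s f ε : ℝ} (hs : |s| = 1) (hf : |f| ≤ 1 - ε) : ε ≤ 1 + s * f := by
  have h1 : |s * f| ≤ 1 - ε := by rw [abs_mul, hs, one_mul]; exact hf
  linarith [neg_le_of_abs_le h1]

lemma sq_le_indepDensity (C₁ : ℝ) {p b : (Fin d → ℝ) → ℝ} {ε : ℝ} (hε : 0 < ε)
    (hp : ∀ x, |p x| ≤ 1 - ε) (hb : ∀ x, |b x| ≤ 1 - ε) (o : Obs d) :
    ε ^ 2 ≤ (1 + signOf C₁ o.2.1 * p o.1) * (1 + signOf C₁ o.2.2 * b o.1) := by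
  have h1 := le_one_add_sign_mul (abs_signOf C₁ o.2.1) (hp o.1)
  have h2 := le_one_add_sign_mul (abs_signOf C₁ o.2.2) (hb o.1)
  rw [sq]
  exact mul_le_mul h1 h2 hε.le (hε.le.trans h1)

/-- The parametric lower bound, from two laws with the same regression functions and conditional
covariances that differ by a constant of order `card I ^ (-1 / 2)`. -/
lemma exists_le_minimaxRisk_parametric (hW : W.IsCDVBasis J₀) {α β M C₁ C₂ : ℝ} (hα : 0 < α)
    (hβ : 0 < β) (hαS : α < S) (hβS : β < S) (hM : 0 < M) (hC : C₁ < C₂)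
    (hne : ∃ M' < M, (model W d J₀ α β M' C₁ C₂).Nonempty) :
    ∃ c : ℝ, 0 < c ∧ ∀ (I : Type) [Fintype I] [Nonempty I],
      ENNReal.ofReal (c / Fintype.card I) ≤ minimaxRisk (model W d J₀ α β M C₁ C₂) I := by
  obtain ⟨p, b, ε, δ, hpm, hbm, hε, hε1, hp, hb, hδ, -, Hp, Hb⟩ :=
    exists_perturbable hW hα hβ hαS hβS hM hC hne
  set w := (C₂ - C₁) / 2 with hw
  have hw0 : 0 < w := by rw [hw]; linarith
  refine ⟨w ^ 4 * ε ^ 4 / 32, by positivity, fun I _ _ => ?_⟩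
  have hN : (1 : ℝ) ≤ Fintype.card I := by exact_mod_cast Fintype.card_pos (α := I)
  set N : ℝ := ((Fintype.card I : ℕ) : ℝ)
  set τ := ε ^ 2 / (2 * Real.sqrt N) with hτ
  have hsq : 1 ≤ Real.sqrt N := Real.one_le_sqrt.mpr hN
  have hτ0 : 0 < τ := by positivity
  have hτ1 : τ ≤ ε ^ 2 / 2 := by
    rw [hτ]; exact div_le_div_of_nonneg_left (by positivity) two_pos (by linarith)
  have hτN : τ ^ 2 = ε ^ 4 / (4 * N) := by
    rw [hτ, div_pow, mul_pow, Real.sq_sqrt (by linarith)]; ring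
  have hmeans : ∀ t, |t| ≤ ε ^ 2 / 2 → IsSignMeans C₁ p b fun x => p x * b x + t := by
    intro t ht
    refine ⟨hpm, hbm, (hpm.mul hbm).add (.const t), fun o => ?_⟩
    rw [signDensity_indep]
    have h1 := sq_le_indepDensity C₁ hε hp hb o
    have h2 : |signOf C₁ o.2.1 * signOf C₁ o.2.2 * t| ≤ ε ^ 2 / 2 := by
      rw [abs_mul, abs_mul, abs_signOf, abs_signOf, one_mul, one_mul]; exact ht
    have h3 := neg_le_of_abs_le h2
    have h4 : 0 < ε ^ 2 := by positivity
    linarith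
  have h0 := hmeans 0 (by simp; positivity)
  have h1 := hmeans τ (by rwa [abs_of_pos hτ0])
  have hmem : ∀ t (ht : IsSignMeans C₁ p b fun x => p x * b x + t),
      signLaw hC ht ∈ model W d J₀ α β M C₁ C₂ := by
    intro t ht
    obtain ⟨f, hf, hf'⟩ := Hp 0 0 (by simp)
    obtain ⟨g, hg, hg'⟩ := Hb 0 0 (by simp)
    exact signLaw_mem_model hC ht ⟨f, hf, by simpa [bumpSum] using hf'⟩
      ⟨g, hg, by simpa [bumpSum] using hg'⟩
  have hlow : ∀ (o : Obs d), (ε ^ 2 / 2) ≤ (signDensity C₁ p b (fun x => p x * b x + 0) o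
      + signDensity C₁ p b (fun x => p x * b x + τ) o) / 2 := by
    intro o
    rw [signDensity_indep, signDensity_indep]
    have h1 := sq_le_indepDensity C₁ hε hp hb o
    have h2 : |signOf C₁ o.2.1 * signOf C₁ o.2.2 * τ| ≤ ε ^ 2 / 2 := by
      rw [abs_mul, abs_mul, abs_signOf, abs_signOf, one_mul, one_mul, abs_of_pos hτ0]; exact hτ1
    have h3 := neg_le_of_abs_le h2
    have h4 : 0 < ε ^ 2 := by positivity
    linarith
  have hSb := (h0.isBddMeas.add h1.isBddMeas).const_mul (1 / 2)
  have hSint : ∫ o : I → Obs d, ∏ i, (signDensity C₁ p b (fun x => p x * b x + 0) (o i)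
      + signDensity C₁ p b (fun x => p x * b x + τ) (o i)) / 2
      ∂(Measure.pi fun _ : I => refLaw d C₁ C₂) = 1 := by
    rw [integral_fintype_prod_eq_pow (fun o : Obs d =>
      (signDensity C₁ p b (fun x => p x * b x + 0) o
        + signDensity C₁ p b (fun x => p x * b x + τ) o) / 2), integral_div,
      integral_add (h0.isBddMeas.integrable _) (h1.isBddMeas.integrable _),
      integral_signDensity hC h0, integral_signDensity hC h1]
    norm_num
  have key := le_minimaxRisk_of_mixtures (I := I) (K := Unit) (ι := I) (ν := refLaw d C₁ C₂)
    (Q := model W d J₀ α β M C₁ C₂)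
    (q := fun _ => signDensity C₁ p b fun x => p x * b x + 0)
    (q' := fun _ => signDensity C₁ p b fun x => p x * b x + τ)
    (fun _ => h0.isBddMeas) (fun _ => h1.isBddMeas) (fun _ => h0.nonneg) (fun _ => h1.nonneg)
    (P := fun _ => signLaw hC h0) (P' := fun _ => signLaw hC h1)
    (fun _ => hmem 0 h0) (fun _ => hmem τ h1) (fun _ => rfl) (fun _ => rfl)
    (fun _ => psi_signLaw hC h0) (fun _ => psi_signLaw hC h1)
    (F := fun i o => signDensity C₁ p b (fun x => p x * b x + 0) (o i))
    (G := fun i o => signDensity C₁ p b (fun x => p x * b x + τ) (o i))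
    (x := fun _ _ => 1 / (4 * N))
    (fun i o => h0.nonneg _) (fun i o => h1.nonneg _) (fun _ _ => by positivity)
    (fun i o => ?_) (fun o => by simp) (fun o => by simp)
    (IsBddMeas.prod _ fun i _ => ?_) (.const _) (by rw [hSint]; simp) ?_
  · refine le_trans (le_of_eq ?_) key
    congr 1
    simp only [add_zero, sub_self, add_sub_cancel_left, integral_zero, integral_const,
      probReal_univ, smul_eq_mul, one_mul, mul_zero, zero_sub, neg_sq, ← hw]
    rw [mul_pow, hτN]
    field_simp
    ring
  · have h2 := hlow (o i)
    set F := signDensity C₁ p b (fun x => p x * b x + 0) (o i) with hF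
    set G := signDensity C₁ p b (fun x => p x * b x + τ) (o i) with hG
    have h3 : (G - F) ^ 2 = τ ^ 2 := by
      rw [hF, hG, signDensity_indep, signDensity_indep, mul_zero, add_zero, add_sub_cancel_left,
        mul_pow, mul_pow, ← sq_abs, abs_signOf, ← sq_abs (signOf C₁ (o i).2.2), abs_signOf]
      ring
    have h4 : (ε ^ 2 / 2) ^ 2 ≤ ((F + G) / 2) ^ 2 := pow_le_pow_left₀ (by positivity) h2 2
    have h5 : τ ^ 2 / 4 ≤ ((F + G) / 2) ^ 2 * (1 / (4 * N)) := by
      calc τ ^ 2 / 4 = (ε ^ 2 / 2) ^ 2 * (1 / (4 * N)) := by rw [hτN]; field_simp; ring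
        _ ≤ _ := by gcongr
    nlinarith
  · have h5 := hSb.comp (measurable_pi_apply (X := fun _ : I => Obs d) i)
    convert h5 using 2
    ring
  · rw [integral_mul_const, hSint]
    simp only [Finset.sum_const, Finset.card_univ, nsmul_eq_mul, Fintype.card_unit, one_mul]
    change N * (1 / (4 * N)) ≤ _
    apply le_of_eq
    field_simp
    simp

end ParametricLower

section Occupancy

variable {Ω : Type} {I : Type} [Fintype I]

open Classical in
/-- The indices of the observations in `A`. -/
noncomputable def occupants (A : Set Ω) (o : I → Ω) : Finset I :=
  Finset.univ.filter fun i => o i ∈ A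

lemma mem_occupants {A : Set Ω} {o : I → Ω} {i : I} : i ∈ occupants A o ↔ o i ∈ A := by
  simp [occupants]

/-- The number of observations in `A`, which is binomial. -/
noncomputable def occupancy (A : Set Ω) (o : I → Ω) : ℕ := (occupants A o).card

lemma pow_occupancy (c : ℝ) (A : Set Ω) (o : I → Ω) :
    c ^ occupancy A o = ∏ i, (1 + (c - 1) * A.indicator 1 (o i)) := by
  classical
  rw [occupancy, occupants, ← Finset.prod_const, Finset.prod_filter]
  refine Finset.prod_congr rfl fun i _ => ?_
  by_cases h : o i ∈ A <;> simp [h]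

lemma occupancy_eq_sum (A : Set Ω) (o : I → Ω) :
    (occupancy A o : ℝ) = ∑ i, A.indicator 1 (o i) := by
  classical
  rw [occupancy, occupants, Finset.card_eq_sum_ones, Finset.sum_filter]
  push_cast
  refine Finset.sum_congr rfl fun i _ => ?_
  by_cases h : o i ∈ A <;> simp [h]

variable [MeasurableSpace Ω]

lemma integral_pi_of_density (ν : Measure Ω) [IsProbabilityMeasure ν] {q : Ω → ℝ}
    (hq : IsBddMeas q) (h0 : ∀ ω, 0 ≤ q ω) (f : (I → Ω) → ℝ) :
    ∫ o, (∏ i, q (o i)) * f o ∂(Measure.pi fun _ : I => ν)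
      = ∫ o, f o ∂(Measure.pi fun _ : I => ν.withDensity fun ω => ENNReal.ofReal (q ω)) := by
  have hP : IsBddMeas fun o : I → Ω => ∏ i, q (o i) :=
    IsBddMeas.prod _ fun i _ => hq.comp (measurable_pi_apply i)
  rw [pi_withDensity_ofReal ν hq h0, integral_withDensity_eq_integral_toReal_smul₀
    hP.1.ennreal_ofReal.aemeasurable (by simp)]
  refine integral_congr_ae (Filter.Eventually.of_forall fun o => ?_)
  simp only [ENNReal.toReal_ofReal (Finset.prod_nonneg fun i _ => h0 (o i)), smul_eq_mul]

lemma isBddMeas_occupancy {A : Set Ω} (hA : MeasurableSet A) (c : ℝ) :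
    IsBddMeas fun o : I → Ω => c ^ occupancy A o - 1 - (c - 1) * occupancy A o := by
  have h1 : IsBddMeas (A.indicator (1 : Ω → ℝ)) := (IsBddMeas.const 1).indicator hA
  have h2 : ∀ i : I, IsBddMeas fun o : I → Ω => A.indicator (1 : Ω → ℝ) (o i) :=
    fun i => h1.comp (measurable_pi_apply i)
  simp only [pow_occupancy, occupancy_eq_sum]
  exact ((IsBddMeas.prod _ fun i _ => (IsBddMeas.const 1).add ((h2 i).const_mul _)).sub
    (.const 1)).sub ((IsBddMeas.sum _ fun i _ => h2 i).const_mul _)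

/-- Two observations in the same small set are rare. -/
lemma integral_occupancy_le (P : Measure Ω) [IsProbabilityMeasure P] {A : Set Ω}
    (hA : MeasurableSet A) {c π : ℝ} (hc : 1 ≤ c) (hπ : P.real A ≤ π)
    (h1 : (c - 1) * (Fintype.card I * π) ≤ 1) :
    ∫ o, (c ^ occupancy A o - 1 - (c - 1) * occupancy A o) ∂(Measure.pi fun _ : I => P)
      ≤ ((c - 1) * (Fintype.card I * π)) ^ 2 := by
  have hb : IsBddMeas (A.indicator (1 : Ω → ℝ)) := (IsBddMeas.const 1).indicator hA
  have h2 : ∀ i : I, IsBddMeas fun o : I → Ω => A.indicator (1 : Ω → ℝ) (o i) :=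
    fun i => hb.comp (measurable_pi_apply i)
  have e0 : ∫ ω, A.indicator (1 : Ω → ℝ) ω ∂P = P.real A := integral_indicator_one hA
  have e1 : ∫ o : I → Ω, ∏ i, (1 + (c - 1) * A.indicator (1 : Ω → ℝ) (o i))
      ∂(Measure.pi fun _ : I => P) = (1 + (c - 1) * P.real A) ^ Fintype.card I := by
    rw [integral_fintype_prod_eq_pow fun ω => 1 + (c - 1) * A.indicator (1 : Ω → ℝ) ω,
      integral_add (integrable_const _) ((hb.const_mul _).integrable _), integral_const_mul, e0]
    simp
  have e2 : ∫ o : I → Ω, ∑ i, A.indicator (1 : Ω → ℝ) (o i) ∂(Measure.pi fun _ : I => P)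
      = Fintype.card I * P.real A := by
    rw [integral_finsetSum _ fun i _ => (h2 i).integrable _]
    have : ∀ i : I, ∫ o : I → Ω, A.indicator (1 : Ω → ℝ) (o i) ∂(Measure.pi fun _ : I => P)
        = P.real A := fun i => by
      rw [← e0]
      exact integral_comp_eval (μ := fun _ : I => P) hb.1.aestronglyMeasurable
    simp [this]
  simp only [pow_occupancy, occupancy_eq_sum]
  have b1 : IsBddMeas fun o : I → Ω => ∏ i, (1 + (c - 1) * A.indicator (1 : Ω → ℝ) (o i)) :=
    IsBddMeas.prod _ fun i _ => (IsBddMeas.const 1).add ((h2 i).const_mul _)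
  rw [integral_sub ((b1.sub (.const 1)).integrable _)
    (((IsBddMeas.sum _ fun i _ => h2 i).const_mul _).integrable _),
    integral_sub (b1.integrable _) (integrable_const _), integral_const_mul, e1, e2]
  simp only [integral_const, probReal_univ, one_smul]
  set N := Fintype.card I
  set y := (c - 1) * (N * P.real A) with hy
  have hP0 : 0 ≤ P.real A := measureReal_nonneg
  have hc0 : 0 ≤ c - 1 := by linarith
  have hy0 : 0 ≤ y := by positivity
  have hyle : y ≤ (c - 1) * (N * π) := by rw [hy]; gcongr
  have h3 : (1 + (c - 1) * P.real A) ^ N ≤ Real.exp y := by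
    calc (1 + (c - 1) * P.real A) ^ N ≤ Real.exp ((c - 1) * P.real A) ^ N := by
          refine pow_le_pow_left₀ (by positivity) ?_ _
          rw [add_comm]; exact Real.add_one_le_exp _
      _ = Real.exp y := by rw [← Real.exp_nat_mul, hy]; congr 1; ring
  have h4 := le_of_abs_le (Real.abs_exp_sub_one_sub_id_le
    (by rw [abs_of_nonneg hy0]; exact hyle.trans h1))
  have h5 : y ^ 2 ≤ ((c - 1) * (N * π)) ^ 2 := pow_le_pow_left₀ hy0 hyle 2
  linarith

end Occupancy

section SignProducts

/-- The interaction of two signs in a product of affine functions of them is of second order. -/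
lemma exists_sign_expansion {ι : Type*} (s : Finset ι) {U V : ι → ℝ} {a b : ℝ} (ha : 0 ≤ a)
    (ha1 : a ≤ 1) (hb : 0 ≤ b) (hb1 : b ≤ 1) (hU : ∀ i, |U i| ≤ a) (hV : ∀ i, |V i| ≤ b) :
    ∃ Z A B D : ℝ, (∀ x y : ℝ, x * x = 1 → y * y = 1 →
        ∏ i ∈ s, (1 + x * U i + y * V i) = Z + x * A + y * B + x * y * D) ∧
      |Z| ≤ 3 ^ s.card ∧ |A| ≤ 3 ^ s.card * a ∧ |B| ≤ 3 ^ s.card * b ∧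
      |D| ≤ 3 ^ s.card * (a * b) ∧ (s.card = 0 → A = 0 ∧ B = 0) ∧ (s.card ≤ 1 → D = 0) := by
  classical
  induction s using Finset.induction_on with
  | empty => exact ⟨1, 0, 0, 0, by simp, by simp, by simpa, by simpa, by simp; positivity,
      by simp, by simp⟩
  | insert i s hi ih =>
    obtain ⟨Z, A, B, D, h, hZ, hA, hB, hD, h0, h1⟩ := ih
    have hUi := hU i
    have hVi := hV i
    have t : (0 : ℝ) ≤ 3 ^ s.card := by positivity
    have mulb : ∀ {x y u v : ℝ}, |x| ≤ u → |y| ≤ v → |x * y| ≤ u * v := fun {x y u v} hx hy => by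
      rw [abs_mul]; exact mul_le_mul hx hy (abs_nonneg _) ((abs_nonneg _).trans hx)
    have hab : a * b ≤ 1 := mul_le_one₀ ha1 hb hb1
    have three : ∀ {x y z u : ℝ}, |x| ≤ u → |y| ≤ u → |z| ≤ u → |x + y + z| ≤ 3 * u :=
      fun {x y z u} hx hy hz => by linarith [abs_add_three x y z]
    refine ⟨Z + A * U i + B * V i, A + U i * Z + V i * D, B + V i * Z + U i * D,
      D + A * V i + B * U i, ?_, ?_, ?_, ?_, ?_, ?_, ?_⟩
    · intro x y hx hy
      rw [Finset.prod_insert hi, h x y hx hy]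
      linear_combination (A * U i + y * D * U i) * hx + (B * V i + x * D * V i) * hy
    all_goals rw [Finset.card_insert_of_notMem hi]
    · rw [pow_succ, mul_comm (3 ^ s.card)]
      refine three hZ ((mulb hA hUi).trans ?_) ((mulb hB hVi).trans ?_) <;> rw [mul_assoc]
      · exact mul_le_of_le_one_right t (mul_le_one₀ ha1 ha ha1)
      · exact mul_le_of_le_one_right t (mul_le_one₀ hb1 hb hb1)
    · rw [pow_succ, mul_comm (3 ^ s.card), mul_assoc]
      refine three hA ((mulb hUi hZ).trans (by linarith)) ((mulb hVi hD).trans ?_)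
      nlinarith [mul_nonneg t ha, mul_nonneg (mul_nonneg t ha) hb]
    · rw [pow_succ, mul_comm (3 ^ s.card), mul_assoc]
      refine three hB ((mulb hVi hZ).trans (by linarith)) ((mulb hUi hD).trans ?_)
      nlinarith [mul_nonneg t hb, mul_nonneg (mul_nonneg t ha) hb]
    · rw [pow_succ, mul_comm (3 ^ s.card), mul_assoc]
      exact three hD ((mulb hA hVi).trans (by linarith)) ((mulb hB hUi).trans (by linarith))
    · omega
    · intro hc
      have hs : s.card = 0 := by omega
      rw [h1 (by omega), (h0 hs).1, (h0 hs).2]; ring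

/-- Averaging over equal signs or over opposite signs makes a difference only if there are at least
two factors: a comparison of geometric and arithmetic means. -/
lemma sign_mixture_le {ι : Type*} (s : Finset ι) {E U V : ι → ℝ} {a b : ℝ} (ha : 0 ≤ a)
    (ha1 : a ≤ 1 / 4) (hb : 0 ≤ b) (hb1 : b ≤ 1 / 4) (hU : ∀ i, |U i| ≤ a) (hV : ∀ i, |V i| ≤ b)
    {F G : ℝ} (hF : F = ∏ i ∈ s, (E i * (1 + 1 * U i + 1 * V i))
      + ∏ i ∈ s, (E i * (1 + -1 * U i + -1 * V i)))
    (hG : G = ∏ i ∈ s, (E i * (1 + 1 * U i + -1 * V i))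
      + ∏ i ∈ s, (E i * (1 + -1 * U i + 1 * V i))) :
    ((F + G) / 2) ^ 2 * (1 - 2 * (a * b) ^ 2 * (36 ^ s.card - 1 - (36 - 1) * s.card))
      ≤ F * G := by
  obtain ⟨Z, A, B, D, h, -, -, -, hD, -, h1⟩ := exists_sign_expansion s ha (by linarith) hb
    (by linarith) hU hV
  simp only [Finset.prod_mul_distrib] at hF hG
  have hlow : ∀ x y : ℝ, |x| = 1 → |y| = 1 → (1 / 2 : ℝ) ^ s.card
      ≤ ∏ i ∈ s, (1 + x * U i + y * V i) := by
    intro x y hx hy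
    rw [← Finset.prod_const]
    refine Finset.prod_le_prod (fun _ _ => by norm_num) fun i _ => ?_
    have h1 : |x * U i| ≤ a := by rw [abs_mul, hx, one_mul]; exact hU i
    have h2 : |y * V i| ≤ b := by rw [abs_mul, hy, one_mul]; exact hV i
    linarith [neg_le_of_abs_le h1, neg_le_of_abs_le h2]
  have l1 := hlow 1 1 (by simp) (by simp)
  have l2 := hlow 1 (-1) (by simp) (by simp)
  have l3 := hlow (-1) 1 (by simp) (by simp)
  have l4 := hlow (-1) (-1) (by simp) (by simp)
  rw [h 1 1 (by norm_num) (by norm_num)] at l1 hF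
  rw [h (-1) (-1) (by norm_num) (by norm_num)] at l4 hF
  rw [h 1 (-1) (by norm_num) (by norm_num)] at l2 hG
  rw [h (-1) 1 (by norm_num) (by norm_num)] at l3 hG
  set r := s.card
  set e := ∏ i ∈ s, E i
  have hF' : F = e * (2 * Z + 2 * D) := by rw [hF]; ring
  have hG' : G = e * (2 * Z - 2 * D) := by rw [hG]; ring
  have hZ : (1 / 2 : ℝ) ^ r ≤ Z := by linarith
  set y := 2 * (a * b) ^ 2 * ((36 : ℝ) ^ r - 1 - (36 - 1) * r) with hy
  -- it remains to bound the square of `D`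
  suffices hmain : D ^ 2 ≤ Z ^ 2 * y by
    rw [hF', hG']
    nlinarith [mul_nonneg (sq_nonneg e) (sub_nonneg.mpr hmain)]
  rcases le_or_gt r 1 with hr | hr
  · rw [h1 hr]
    have hr' : y = 0 := by
      rw [hy]
      interval_cases r <;> norm_num
    rw [hr']; norm_num
  · have hexp : (36 : ℝ) ^ r ≤ 2 * ((36 : ℝ) ^ r - 1 - (36 - 1) * r) := by
      have : ∀ n : ℕ, (2 + 70 * ((n + 2 : ℕ) : ℝ)) ≤ 36 ^ (n + 2) := by
        intro n
        induction n with
        | zero => norm_num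
        | succ n ih =>
          rw [show n + 1 + 2 = (n + 2) + 1 by ring, pow_succ]
          push_cast at ih ⊢
          have hn := (Nat.cast_nonneg n : (0 : ℝ) ≤ n)
          linarith
      obtain ⟨n, hn⟩ : ∃ n, r = n + 2 := ⟨r - 2, by omega⟩
      have := this n
      rw [← hn] at this
      linarith
    have hD2 : D ^ 2 ≤ (3 ^ r * (a * b)) ^ 2 := by
      rw [← sq_abs]; exact pow_le_pow_left₀ (abs_nonneg _) hD 2
    have hZ2 : ((1 / 2 : ℝ) ^ r) ^ 2 ≤ Z ^ 2 := pow_le_pow_left₀ (by positivity) hZ 2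
    calc D ^ 2 ≤ (3 ^ r * (a * b)) ^ 2 := hD2
      _ = ((1 / 2 : ℝ) ^ r) ^ 2 * ((a * b) ^ 2 * 36 ^ r) := by
          have : (36 : ℝ) ^ r = (2 ^ r) ^ 2 * (3 ^ r) ^ 2 := by
            rw [← mul_pow, ← mul_pow, ← pow_mul, mul_comm r 2, pow_mul]; norm_num
          rw [this, one_div, inv_pow]
          have h2 : (2 : ℝ) ^ r ≠ 0 := by positivity
          field_simp
      _ ≤ Z ^ 2 * ((a * b) ^ 2 * (2 * ((36 : ℝ) ^ r - 1 - (36 - 1) * r))) := by gcongr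
      _ = Z ^ 2 * y := by rw [hy]; ring

end SignProducts

section NonparametricLower

variable {S J₀ d : ℕ} {W : BoundaryWavelets S}

/-- The sign `±1` encoded by a Boolean. -/
def boolSign (s : Bool) : ℝ := if s then 1 else -1

lemma abs_boolSign (s : Bool) : |boolSign s| = 1 := by cases s <;> simp [boolSign]

lemma boolSign_mul_self (s : Bool) : boolSign s * boolSign s = 1 := by
  cases s <;> simp [boolSign]

lemma boolSign_not (s : Bool) : boolSign (!s) = -boolSign s := by cases s <;> simp [boolSign]

lemma measurable_cell (j : ℕ) : Measurable fun o : Obs d => cubeIndex j o.1 :=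
  (measurable_cubeIndex j).comp measurable_fst

set_option maxHeartbeats 400000 in
/-- The nonparametric lower bound. Both regression functions are perturbed by bumps on the
`2 ^ (j d)` cubes of level `j`, with random signs that are equal in one mixture and opposite in the
other one. The values of the functional differ, but the mixtures can be told apart only by cubes
that contain at least two observations, of which there are few. -/
lemma exists_le_minimaxRisk_nonparametric (hW : W.IsCDVBasis J₀) {α β M C₁ C₂ : ℝ} (hα : 0 < α)
    (hβ : 0 < β) (hαS : α < S) (hβS : β < S) (hM : 0 < M) (hC : C₁ < C₂)
    (hne : ∃ M' < M, (model W d J₀ α β M' C₁ C₂).Nonempty) :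
    ∃ c : ℝ, 0 < c ∧ ∀ (I : Type) [Fintype I] (j : ℕ),
      35 * (Fintype.card I : ℝ) ≤ 2 ^ (j * d) →
      39 * (Fintype.card I : ℝ) ^ 2 ≤ 2 ^ (j * d) * 2 ^ (2 * (α + β) * j) →
      ENNReal.ofReal (c * 2 ^ (-(2 * (α + β) * j))) ≤ minimaxRisk (model W d J₀ α β M C₁ C₂) I := by
  obtain ⟨p, b, ε, δ, hpm, hbm, hε, hε1, hp, hb, hδ, hδε, Hp, Hb⟩ :=
    exists_perturbable hW hα hβ hαS hβS hM hC hne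
  set w := (C₂ - C₁) / 2 with hw
  have hw0 : 0 < w := by rw [hw]; linarith
  set κ : ℝ := (∫ y, unitBump y ^ 2) ^ d
  have hκ : 0 < κ := pow_pos integral_unitBump_sq_pos _
  refine ⟨w ^ 4 * δ ^ 4 * κ ^ 2 / 2, by positivity, fun I _ j hN1 hN2 => ?_⟩
  classical
  set N : ℝ := ((Fintype.card I : ℕ) : ℝ)
  -- `p` and `b` are perturbed with the amplitudes `δ 2 ^ (-α j)` and `δ 2 ^ (-β j)`, for which the
  -- sums of bumps stay in the Hölder balls
  have hamp : ∀ a : ℝ, 0 < a → (2 : ℝ) ^ (-(a * j)) ≤ 1 := fun a ha =>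
    Real.rpow_le_one_of_one_le_of_nonpos one_le_two (by
      have : (0 : ℝ) ≤ j := Nat.cast_nonneg j
      nlinarith)
  set A₀ : ℝ := 2 ^ (-(α * j)) with hA₀
  set B₀ : ℝ := 2 ^ (-(β * j)) with hB₀
  have hA0 : 0 < A₀ := by positivity
  have hB0 : 0 < B₀ := by positivity
  have hA1 : A₀ ≤ 1 := hamp α hα
  have hB1 : B₀ ≤ 1 := hamp β hβ
  have hAB : (A₀ * B₀) ^ 2 = 2 ^ (-(2 * (α + β) * j)) := by
    rw [hA₀, hB₀, ← Real.rpow_add two_pos, ← Real.rpow_mul_natCast two_pos.le]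
    congr 1; push_cast; ring
  -- the conditional mean `θ` is perturbed to first order only, so that each density is affine in the
  -- signs
  let K := (Fin d → Fin (2 ^ j)) → Bool
  let u : K → (Fin d → ℝ) → ℝ := fun k x => δ * (A₀ * bumpSum j (fun q => boolSign (k q)) x)
  let v : K → (Fin d → ℝ) → ℝ := fun k x => δ * (B₀ * bumpSum j (fun q => boolSign (k q)) x)
  have hsign : ∀ (k : K) q, |boolSign (k q)| ≤ 1 := fun k q => (abs_boolSign _).le
  have hu : ∀ (k : K) x, |u k x| ≤ ε / 4 := by
    intro k x
    simp only [u]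
    rw [abs_mul, abs_mul, abs_of_pos hδ, abs_of_pos hA0]
    calc δ * (A₀ * |bumpSum j (fun q => boolSign (k q)) x|) ≤ δ * (1 * 1) := by
          gcongr; exact abs_bumpSum_le (hsign k) x
      _ ≤ ε / 4 := by linarith
  have hv : ∀ (k : K) x, |v k x| ≤ ε / 4 := by
    intro k x
    simp only [v]
    rw [abs_mul, abs_mul, abs_of_pos hδ, abs_of_pos hB0]
    calc δ * (B₀ * |bumpSum j (fun q => boolSign (k q)) x|) ≤ δ * (1 * 1) := by
          gcongr; exact abs_bumpSum_le (hsign k) x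
      _ ≤ ε / 4 := by linarith
  have hum : ∀ k, IsBddMeas (u k) := fun k => ((isBddMeas_bumpSum j _).const_mul _).const_mul _
  have hvm : ∀ k, IsBddMeas (v k) := fun k => ((isBddMeas_bumpSum j _).const_mul _).const_mul _
  have hmeans : ∀ k l : K, IsSignMeans C₁ (fun x => p x + u k x) (fun x => b x + v l x)
      (fun x => p x * b x + p x * v l x + b x * u k x) := fun k l =>
    isSignMeans_perturbed C₁ hε hp hb (hu k) (hv l) hpm hbm (hum k) (hvm l)
  have hmem : ∀ k l, signLaw hC (hmeans k l) ∈ model W d J₀ α β M C₁ C₂ := fun k l =>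
    signLaw_mem_model hC _ (Hp j _ (hsign k)) (Hb j _ (hsign l))
  have hpsi : ∀ k l, psi (signLaw hC (hmeans k l))
      = -(w ^ 2 * δ ^ 2 * (A₀ * B₀) * bumpMass d j) * ∑ q, boolSign (k q) * boolSign (l q) := by
    intro k l
    rw [psi_signLaw, ← hw]
    have e : ∀ x, p x * b x + p x * v l x + b x * u k x - (p x + u k x) * (b x + v l x)
        = -(δ ^ 2 * (A₀ * B₀)) * (bumpSum j (fun q => boolSign (k q)) x
          * bumpSum j (fun q => boolSign (l q)) x) := by
      intro x; simp only [u, v]; ring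
    simp only [e]
    rw [integral_const_mul, integral_bumpSum_mul_bumpSum]
    ring
  have hcard : ∑ _q : Fin d → Fin (2 ^ j), (1 : ℝ) = 2 ^ (j * d) := by
    rw [Finset.sum_const, Finset.card_univ, card_cubes]; simp
  have hmass := card_mul_bumpMass d j
  -- the density at an observation depends on the signs of its own cube only
  let dens : K → K → Obs d → ℝ := fun k l => signDensity C₁ (fun x => p x + u k x)
    (fun x => b x + v l x) (fun x => p x * b x + p x * v l x + b x * u k x)
  let cell : Obs d → Fin d → Fin (2 ^ j) := fun o => cubeIndex j o.1
  let E : Obs d → ℝ := fun o =>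
    (1 + signOf C₁ o.2.1 * p o.1) * (1 + signOf C₁ o.2.2 * b o.1)
  let U : Obs d → ℝ := fun o => signOf C₁ o.2.1 * (δ * A₀ * cubeBump j (cell o) o.1)
    / (1 + signOf C₁ o.2.1 * p o.1)
  let V : Obs d → ℝ := fun o => signOf C₁ o.2.2 * (δ * B₀ * cubeBump j (cell o) o.1)
    / (1 + signOf C₁ o.2.2 * b o.1)
  have hdens : ∀ k l o, dens k l o
      = E o * (1 + boolSign (k (cell o)) * U o + boolSign (l (cell o)) * V o) := by
    intro k l o
    have h1 := hε.trans_le (le_one_add_sign_mul (abs_signOf C₁ o.2.1) (hp o.1))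
    have h2 := hε.trans_le (le_one_add_sign_mul (abs_signOf C₁ o.2.2) (hb o.1))
    simp only [dens, signDensity, u, v, E, U, V, cell, bumpSum_eq]
    field_simp
    ring
  set a' := A₀ / 4 with ha'
  set b' := B₀ / 4 with hb'
  have hUV : ∀ (s f : ℝ) (o : Obs d) (A : ℝ), |s| = 1 → |f| ≤ 1 - ε → 0 < A →
      |s * (δ * A * cubeBump j (cell o) o.1) / (1 + s * f)| ≤ A / 4 := by
    intro s f o A hs hf hA
    have h1 := le_one_add_sign_mul hs hf
    have h2 := hε.trans_le h1
    rw [abs_div, abs_mul, hs, one_mul, abs_of_pos h2, div_le_iff₀ h2, abs_of_nonneg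
      (mul_nonneg (by positivity) (cubeBump_nonneg _ _ _))]
    calc δ * A * cubeBump j (cell o) o.1 ≤ ε / 4 * A * 1 :=
          mul_le_mul (mul_le_mul_of_nonneg_right hδε hA.le) (cubeBump_le_one _ _ _)
            (cubeBump_nonneg _ _ _) (by positivity)
      _ = A / 4 * ε := by ring
      _ ≤ A / 4 * (1 + s * f) := by gcongr
  have hU : ∀ o, |U o| ≤ a' := fun o => hUV _ _ o A₀ (abs_signOf _ _) (hp _) hA0
  have hV : ∀ o, |V o| ≤ b' := fun o => hUV _ _ o B₀ (abs_signOf _ _) (hb _) hB0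
  have ha0 : 0 ≤ a' := by positivity
  have hb0 : 0 ≤ b' := by positivity
  have ha1 : a' ≤ 1 / 4 := by rw [ha']; linarith
  have hb1 : b' ≤ 1 / 4 := by rw [hb']; linarith
  let C : (Fin d → Fin (2 ^ j)) → Set (Obs d) := fun m => {o | cell o = m}
  have hCm : ∀ m, MeasurableSet (C m) := fun m => measurable_cell j (measurableSet_singleton m)
  let loc : (Fin d → Fin (2 ^ j)) → ℝ → ℝ → (I → Obs d) → ℝ := fun m x y o =>
    ∏ i ∈ occupants (C m) o, (E (o i) * (1 + x * U (o i) + y * V (o i)))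
  have hloc : ∀ (k l : K) o, ∏ m, loc m (boolSign (k m)) (boolSign (l m)) o
      = ∏ i, dens k l (o i) := by
    intro k l o
    rw [← Finset.prod_fiberwise (s := Finset.univ) (g := fun i => cell (o i))]
    refine Finset.prod_congr rfl fun m _ => Finset.prod_congr ?_ fun i hi => ?_
    · ext i; rw [mem_occupants, Finset.mem_filter]; exact (and_iff_right (Finset.mem_univ i)).symm
    · have : cell (o i) = m := (Finset.mem_filter.mp hi).2
      rw [hdens, this]
  have hloc0 : ∀ m s t o, 0 ≤ loc m (boolSign s) (boolSign t) o := by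
    intro m s t o
    refine Finset.prod_nonneg fun i _ => ?_
    have := (hmeans (fun _ => s) fun _ => t).nonneg (o i)
    have h2 := hdens (fun _ => s) (fun _ => t) (o i)
    simp only [dens] at h2
    rwa [h2] at this
  let F : (Fin d → Fin (2 ^ j)) → (I → Obs d) → ℝ := fun m o => loc m 1 1 o + loc m (-1) (-1) o
  let G : (Fin d → Fin (2 ^ j)) → (I → Obs d) → ℝ := fun m o => loc m 1 (-1) o + loc m (-1) 1 o
  let x : (Fin d → Fin (2 ^ j)) → (I → Obs d) → ℝ := fun m o =>
    2 * (a' * b') ^ 2 * (36 ^ occupancy (C m) o - 1 - (36 - 1) * occupancy (C m) o)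
  have hFq : ∀ o, ∏ m, F m o = ∑ k : K, ∏ i, dens k k (o i) := by
    intro o
    have : ∀ m, F m o = ∑ s : Bool, loc m (boolSign s) (boolSign s) o := by
      intro m; simp [F, boolSign]
    simp only [this]
    rw [Finset.prod_univ_sum, Fintype.piFinset_univ]
    exact Finset.sum_congr rfl fun k _ => hloc k k o
  have hGq : ∀ o, ∏ m, G m o = ∑ k : K, ∏ i, dens k (fun q => !k q) (o i) := by
    intro o
    have : ∀ m, G m o = ∑ s : Bool, loc m (boolSign s) (boolSign (!s)) o := by
      intro m; simp [G, boolSign]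
    simp only [this]
    rw [Finset.prod_univ_sum, Fintype.piFinset_univ]
    exact Finset.sum_congr rfl fun k _ => hloc k (fun q => !k q) o
  set n := Fintype.card (Fin d → Fin (2 ^ j))
  have hSq : ∀ o, ∏ m, (F m o + G m o) / 2 = ∑ k : (Fin d → Fin (2 ^ j)) → Bool × Bool,
      (1 / 2) ^ n * ∏ i, dens (fun q => (k q).1) (fun q => (k q).2) (o i) := by
    intro o
    have : ∀ m, (F m o + G m o) / 2
        = ∑ s : Bool × Bool, 1 / 2 * loc m (boolSign s.1) (boolSign s.2) o := by
      intro m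
      rw [Fintype.sum_prod_type]
      simp [F, G, boolSign]; ring
    simp only [this]
    rw [Finset.prod_univ_sum, Fintype.piFinset_univ]
    refine Finset.sum_congr rfl fun k _ => ?_
    rw [Finset.prod_mul_distrib, ← hloc (fun q => (k q).1) (fun q => (k q).2) o,
      Finset.prod_const, Finset.card_univ]
  have hdm : ∀ k l, IsBddMeas fun o : I → Obs d => ∏ i, dens k l (o i) := fun k l =>
    IsBddMeas.prod _ fun i _ => (hmeans k l).isBddMeas.comp (measurable_pi_apply i)
  have hxm : ∀ m, IsBddMeas (x m) := fun m => (isBddMeas_occupancy (hCm m) 36).const_mul _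
  have hcards : (Fintype.card ((Fin d → Fin (2 ^ j)) → Bool × Bool) : ℝ) * (1 / 2) ^ n
      = Fintype.card K := by
    have e1 : Fintype.card ((Fin d → Fin (2 ^ j)) → Bool × Bool) = 4 ^ n := Fintype.card_fun
    have e2 : Fintype.card K = 2 ^ n := Fintype.card_fun
    rw [e1, e2]
    push_cast
    rw [← mul_pow]; norm_num
  have hint1 : ∀ k l, ∫ o, ∏ i, dens k l (o i)
      ∂(Measure.pi fun _ : I => refLaw d C₁ C₂) = 1 := by
    intro k l
    rw [integral_fintype_prod_eq_pow (dens k l), integral_signDensity hC (hmeans k l), one_pow]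
  have hxint : ∀ k l m, ∫ o, (∏ i, dens k l (o i)) * x m o
      ∂(Measure.pi fun _ : I => refLaw d C₁ C₂)
      ≤ 2 * (a' * b') ^ 2 * ((36 - 1) * (N * (1 / 2 ^ (j * d)))) ^ 2 := by
    intro k l m
    rw [integral_pi_of_density _ (hmeans k l).isBddMeas (hmeans k l).nonneg]
    simp only [x]
    rw [integral_const_mul]
    refine mul_le_mul_of_nonneg_left ?_ (by positivity)
    refine integral_occupancy_le (signLaw hC (hmeans k l) : Measure (Obs d)) (hCm m) (by norm_num)
      ?_ ?_
    · have := measureReal_cubeIndex_le j m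
      rw [← map_signLaw hC (hmeans k l), map_measureReal_apply measurable_fst
        (measurable_cubeIndex j (measurableSet_singleton m))] at this
      exact this
    · rw [mul_one_div, mul_div_assoc', div_le_one (by positivity)]
      change (36 - 1) * N ≤ _
      linarith
  have key := le_minimaxRisk_of_mixtures (I := I) (K := K) (ι := Fin d → Fin (2 ^ j))
    (ν := refLaw d C₁ C₂) (Q := model W d J₀ α β M C₁ C₂)
    (q := fun k => dens k k) (q' := fun k => dens k fun q => !k q)
    (fun k => (hmeans _ _).isBddMeas) (fun k => (hmeans _ _).isBddMeas)
    (fun k => (hmeans _ _).nonneg) (fun k => (hmeans _ _).nonneg)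
    (P := fun k => signLaw hC (hmeans k k)) (P' := fun k => signLaw hC (hmeans k fun q => !k q))
    (fun k => hmem _ _) (fun k => hmem _ _) (fun k => rfl) (fun k => rfl)
    (a := -(w ^ 2 * δ ^ 2 * (A₀ * B₀) * κ)) (b := w ^ 2 * δ ^ 2 * (A₀ * B₀) * κ)
    (fun k => ?_) (fun k => ?_) (F := F) (G := G) (x := x)
    (fun m o => add_nonneg (by simpa [boolSign] using hloc0 m true true o)
      (by simpa [boolSign] using hloc0 m false false o))
    (fun m o => add_nonneg (by simpa [boolSign] using hloc0 m true false o)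
      (by simpa [boolSign] using hloc0 m false true o))
    (fun m o => mul_nonneg (by positivity) ?_) (fun m o => ?_) hFq hGq ?_ ?_ ?_ ?_
  · refine le_trans (le_of_eq ?_) key
    congr 1
    rw [← hAB]; ring
  · rw [hpsi]
    simp only [boolSign_mul_self]
    rw [hcard]
    linear_combination -(w ^ 2 * δ ^ 2 * (A₀ * B₀)) * hmass
  · rw [hpsi]
    simp only [boolSign_not, mul_neg, boolSign_mul_self, Finset.sum_neg_distrib]
    rw [hcard]
    linear_combination (w ^ 2 * δ ^ 2 * (A₀ * B₀)) * hmass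
  · have := one_add_mul_le_pow (a := (35 : ℝ)) (by norm_num) (occupancy (C m) o)
    norm_num at this ⊢
    linarith
  · exact sign_mixture_le (occupants (C m) o) (E := fun i => E (o i)) (U := fun i => U (o i))
      (V := fun i => V (o i)) (F := F m o) (G := G m o) ha0 ha1 hb0 hb1 (fun i => hU _)
      (fun i => hV _) (by simp only [F, loc]) (by simp only [G, loc])
  · simp only [hSq]
    exact IsBddMeas.sum _ fun k _ => (hdm _ _).const_mul _
  · exact IsBddMeas.sum _ fun m _ => hxm m
  · simp only [hSq]
    rw [integral_finsetSum _ fun k _ => ((hdm _ _).const_mul _).integrable _]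
    simp only [integral_const_mul, hint1, mul_one, Finset.sum_const, Finset.card_univ,
      nsmul_eq_mul]
    exact hcards
  · simp only [hSq, Finset.sum_mul]
    simp only [Finset.mul_sum, mul_assoc]
    rw [integral_finsetSum _ fun k _ => integrable_finsetSum _ fun m _ =>
      (((hdm _ _).mul (hxm m)).const_mul _).integrable _]
    have h1 : ∀ k : (Fin d → Fin (2 ^ j)) → Bool × Bool,
        ∫ o, ∑ m, (1 / 2) ^ n * ((∏ i, dens (fun q => (k q).1) (fun q => (k q).2) (o i)) * x m o)
          ∂(Measure.pi fun _ : I => refLaw d C₁ C₂) ≤ (1 / 2) ^ n * (1 / 4) := by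
      intro k
      rw [integral_finsetSum _ fun m _ => (((hdm _ _).mul (hxm m)).const_mul _).integrable _]
      simp only [integral_const_mul]
      rw [← Finset.mul_sum]
      refine mul_le_mul_of_nonneg_left ?_ (by positivity)
      refine (Finset.sum_le_sum fun m _ => hxint _ _ m).trans ?_
      rw [Finset.sum_const, Finset.card_univ, card_cubes, nsmul_eq_mul]
      push_cast
      have hT : (0 : ℝ) < 2 ^ (j * d) := by positivity
      have hab2 : (a' * b') ^ 2 = 2 ^ (-(2 * (α + β) * j)) / 256 := by
        rw [← hAB, ha', hb']; ring
      rw [hab2, Real.rpow_neg two_pos.le]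
      set T : ℝ := 2 ^ (j * d)
      have hR : (0 : ℝ) < 2 ^ (2 * (α + β) * j) := by positivity
      set R : ℝ := 2 ^ (2 * (α + β) * j)
      have e : T * (2 * (R⁻¹ / 256) * ((36 - 1) * (N * (1 / T))) ^ 2)
          = (2 * 35 ^ 2 / 256 * N ^ 2) / (T * R) := by
        field_simp
        ring
      rw [e, div_le_iff₀ (by positivity)]
      nlinarith [sq_nonneg N]
    refine (Finset.sum_le_sum fun k _ => h1 k).trans ?_
    rw [Finset.sum_const, Finset.card_univ, nsmul_eq_mul, ← mul_assoc, hcards]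
    linarith

end NonparametricLower

/-! ### Worst-case risk of the estimators: upper bounds -/

section RiskUpper

variable {d n S J₀ : ℕ} {W : BoundaryWavelets S}

lemma measurable_kernel_comp (hW : W.IsCDVBasis J₀) (j : ℕ) {Z : Type*} [MeasurableSpace Z]
    {x y : Z → Fin d → ℝ} (hx : Measurable x) (hy : Measurable y) :
    Measurable fun z => W.kernel j (x z) (y z) := by
  have h := ((hW.isBddMeas_kernel (d := d) j).comp (φ := fun z => (x z, y z)) (hx.prodMk hy)).1
  exact h

lemma measurable_projEst_param (hW : W.IsCDVBasis J₀) (j : ℕ) {Ω Z : Type*} [MeasurableSpace Ω]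
    [MeasurableSpace Z] {X : Ω → Fin d → ℝ} (hX : Measurable X) {f : Ω → ℝ} (hf : Measurable f)
    {D : Z → Fin n → Ω} (hD : Measurable D) {x : Z → Fin d → ℝ} (hx : Measurable x) :
    Measurable fun z => projEst W j X f (D z) (x z) := by
  have hDi : ∀ i, Measurable fun z => D z i := fun i => (measurable_pi_apply i).comp hD
  have h : ∀ i, Measurable fun z => f (D z i) * W.kernel j (X (D z i)) (x z) := fun i =>
    (hf.comp (hDi i)).mul (measurable_kernel_comp hW j (hX.comp (hDi i)) hx)
  exact (Finset.measurable_fun_sum Finset.univ fun i _ => h i).const_mul (1 / (n : ℝ))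

lemma measurable_fst_obs : Measurable fun o : Obs d => o.2.1 := by fun_prop

lemma measurable_snd_obs : Measurable fun o : Obs d => o.2.2 := by fun_prop

lemma measurable_fibre {s n : ℕ} {Ω : Type*} [MeasurableSpace Ω] (a : Fin s) :
    Measurable fun (O : Fin s × Fin n → Ω) (i : Fin n) => O (a, i) := by fun_prop

lemma measurable_psiINT (hW : W.IsCDVBasis J₀) (j₁ j₂ n : ℕ) :
    Measurable (W.psiINT j₁ j₂ n : (Fin 3 × Fin n → Obs d) → ℝ) := by
  refine Measurable.sub (by fun_prop) ?_
  have h := ((measurable_projEst_param hW j₁ measurable_fst measurable_fst_obs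
    ((measurable_fibre (0 : Fin 3)).comp measurable_fst)
    (measurable_snd (α := Fin 3 × Fin n → Obs d) (β := Fin d → ℝ))).mul
    (measurable_projEst_param hW j₂ measurable_fst measurable_snd_obs
    ((measurable_fibre (1 : Fin 3)).comp measurable_fst)
    (measurable_snd (α := Fin 3 × Fin n → Obs d) (β := Fin d → ℝ))))
  exact (h.stronglyMeasurable.integral_prod_right (ν := cubeVol d)).measurable

lemma ae_forall_eval {I Ω : Type*} [Fintype I] [MeasurableSpace Ω] {P : Measure Ω}
    [IsProbabilityMeasure P] {p : Ω → Prop} (h : ∀ᵐ ω ∂P, p ω) :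
    ∀ᵐ O ∂(Measure.pi fun _ : I => P), ∀ i, p (O i) :=
  ae_all_iff.mpr fun i =>
    (measurePreserving_eval (fun _ : I => P) i).quasiMeasurePreserving.ae h

/-- The risk as a Bochner integral, when the estimator is almost surely equal to a bounded one. -/
lemma risk_eq_ofReal_integral {I : Type} [Fintype I] {P : ProbabilityMeasure (Obs d)}
    {T T' : (I → Obs d) → ℝ} {t : ℝ} (ht : psi P = t) (hT' : IsBddMeas T')
    (h : T =ᵐ[Measure.pi fun _ : I => (P : Measure (Obs d))] T') :
    risk T P = ENNReal.ofReal
      (∫ O, (T' O - t) ^ 2 ∂(Measure.pi fun _ : I => (P : Measure (Obs d)))) := by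
  rw [ofReal_integral_eq_lintegral_ofReal (((hT'.sub (.const t)).pow 2).integrable _)
    (Filter.Eventually.of_forall fun O => sq_nonneg _)]
  unfold risk
  refine lintegral_congr_ae ?_
  filter_upwards [h] with O hO
  rw [hO, ht]

variable {P : ProbabilityMeasure (Obs d)} {f₁ f₂ : Obs d → ℝ} {r₁ r₂ : (Fin d → ℝ) → ℝ}

lemma risk_psiINT (hW : W.IsCDVBasis J₀)
    (h₁ : IsRegression (P : Measure (Obs d)) (fun o => o.1) f₁ r₁)
    (h₂ : IsRegression (P : Measure (Obs d)) (fun o => o.1) f₂ r₂)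
    (hA : (fun o => o.2.1) =ᵐ[(P : Measure (Obs d))] f₁)
    (hY : (fun o => o.2.2) =ᵐ[(P : Measure (Obs d))] f₂) (j₁ j₂ n : ℕ) :
    risk (W.psiINT j₁ j₂ n) P = ENNReal.ofReal
      (∫ O, (estINT W j₁ j₂ (fun o => o.1) f₁ f₂ (fun i => O (0, i)) (fun i => O (1, i))
        (fun i => O (2, i)) - covTarget (P : Measure (Obs d)) f₁ f₂ r₁ r₂) ^ 2
        ∂(Measure.pi fun _ : Fin 3 × Fin n => (P : Measure (Obs d)))) := by
  refine risk_eq_ofReal_integral (psi_eq_covTarget h₁ h₂ hA hY)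
    ((isBddMeas_estINT hW h₁ h₂ j₁ j₂).comp (φ := fun O : Fin 3 × Fin n → Obs d =>
      ((fun i => O (0, i)), (fun i => O (1, i)), (fun i => O (2, i)))) (by fun_prop)) ?_
  filter_upwards [ae_forall_eval hA, ae_forall_eval hY] with O hO1 hO2
  change estINT W j₁ j₂ (fun o => o.1) (fun o => o.2.1) (fun o => o.2.2) (fun i => O (0, i))
    (fun i => O (1, i)) (fun i => O (2, i)) = _
  simp only [estINT, projEst, sampleMean, hO1, hO2]

lemma risk_psiMC (hW : W.IsCDVBasis J₀)
    (h₁ : IsRegression (P : Measure (Obs d)) (fun o => o.1) f₁ r₁)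
    (h₂ : IsRegression (P : Measure (Obs d)) (fun o => o.1) f₂ r₂)
    (hA : (fun o => o.2.1) =ᵐ[(P : Measure (Obs d))] f₁)
    (hY : (fun o => o.2.2) =ᵐ[(P : Measure (Obs d))] f₂) (j₁ j₂ n : ℕ) :
    risk (W.psiMC j₁ j₂ n) P = ENNReal.ofReal
      (∫ O, (estMC W j₁ j₂ (fun o => o.1) f₁ f₂ (fun i => O (0, i)) (fun i => O (1, i))
        (fun i => O (2, i)) (fun i => O (3, i))
        - covTarget (P : Measure (Obs d)) f₁ f₂ r₁ r₂) ^ 2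
        ∂(Measure.pi fun _ : Fin 4 × Fin n => (P : Measure (Obs d)))) := by
  refine risk_eq_ofReal_integral (psi_eq_covTarget h₁ h₂ hA hY)
    ((isBddMeas_estMC hW h₁ h₂ j₁ j₂).comp (φ := fun O : Fin 4 × Fin n → Obs d =>
      ((fun i => O (0, i)), (fun i => O (1, i)), (fun i => O (2, i)), (fun i => O (3, i))))
      (by fun_prop)) ?_
  filter_upwards [ae_forall_eval hA, ae_forall_eval hY] with O hO1 hO2
  change estMC W j₁ j₂ (fun o => o.1) (fun o => o.2.1) (fun o => o.2.2) (fun i => O (0, i))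
    (fun i => O (1, i)) (fun i => O (2, i)) (fun i => O (3, i)) = _
  simp only [estMC, projEst, sampleMean, hO1, hO2]

lemma risk_psiIF (hW : W.IsCDVBasis J₀)
    (h₁ : IsRegression (P : Measure (Obs d)) (fun o => o.1) f₁ r₁)
    (h₂ : IsRegression (P : Measure (Obs d)) (fun o => o.1) f₂ r₂)
    (hA : (fun o => o.2.1) =ᵐ[(P : Measure (Obs d))] f₁)
    (hY : (fun o => o.2.2) =ᵐ[(P : Measure (Obs d))] f₂) (j₁ j₂ n : ℕ) :
    risk (W.psiIF j₁ j₂ n) P = ENNReal.ofReal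
      (∫ O, (estIF W j₁ j₂ (fun o => o.1) f₁ f₂ (fun i => O (0, i)) (fun i => O (1, i))
        (fun i => O (2, i)) - covTarget (P : Measure (Obs d)) f₁ f₂ r₁ r₂) ^ 2
        ∂(Measure.pi fun _ : Fin 3 × Fin n => (P : Measure (Obs d)))) := by
  refine risk_eq_ofReal_integral (psi_eq_covTarget h₁ h₂ hA hY)
    ((isBddMeas_estIF hW h₁ h₂ j₁ j₂).comp (φ := fun O : Fin 3 × Fin n → Obs d =>
      ((fun i => O (0, i)), (fun i => O (1, i)), (fun i => O (2, i)))) (by fun_prop)) ?_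
  filter_upwards [ae_forall_eval hA, ae_forall_eval hY] with O hO1 hO2
  change estIF W j₁ j₂ (fun o => o.1) (fun o => o.2.1) (fun o => o.2.2) (fun i => O (0, i))
    (fun i => O (1, i)) (fun i => O (2, i)) = _
  simp only [estIF, projEst, sampleMean, hO1, hO2]

lemma abs_integral_mul_le {Ω : Type*} [MeasurableSpace Ω] {ν : Measure Ω} [IsProbabilityMeasure ν]
    {f g : Ω → ℝ} {a b : ℝ} (hf : ∀ᵐ x ∂ν, |f x| ≤ a) (hg : ∀ᵐ x ∂ν, |g x| ≤ b) :
    |∫ x, f x * g x ∂ν| ≤ a * b := by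
  have h := norm_integral_le_of_norm_le_const (μ := ν) (f := fun x => f x * g x) (C := a * b) (by
    filter_upwards [hf, hg] with x h1 h2
    rw [Real.norm_eq_abs, abs_mul]
    exact mul_le_mul h1 h2 (abs_nonneg _) ((abs_nonneg _).trans h1))
  simpa using h

lemma sq_two_rpow_neg (C a : ℝ) : (C * (2 : ℝ) ^ (-a)) ^ 2 = C ^ 2 * (2 : ℝ) ^ (-(2 * a)) := by
  rw [mul_pow, ← Real.rpow_natCast ((2 : ℝ) ^ (-a)), ← Real.rpow_mul two_pos.le]
  congr 2
  push_cast
  ring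

/-- The approximation error of the two regression functions multiplies: the coarser level governs
the bias of the plug-in estimators and the finer level that of the corrected one. -/
lemma exists_sq_bias_le (hW : W.IsCDVBasis J₀) (d : ℕ) {α β : ℝ} (hα : 0 < α) (hβ : 0 < β) (M : ℝ) :
    ∃ C : ℝ, 0 < C ∧ ∀ r₁ r₂ h₁ h₂ : (Fin d → ℝ) → ℝ, IsBddMeas r₁ → IsBddMeas r₂ →
      h₁ ∈ W.holderBall d J₀ α M → h₂ ∈ W.holderBall d J₀ β M → r₁ =ᵐ[cubeVol d] h₁ →
      r₂ =ᵐ[cubeVol d] h₂ → ∀ j₁, J₀ ≤ j₁ → ∀ j₂, J₀ ≤ j₂ →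
      (∫ x, r₁ x * r₂ x ∂cubeVol d - ∫ x, W.proj j₁ r₁ x * W.proj j₂ r₂ x ∂cubeVol d) ^ 2
        ≤ C * (2 : ℝ) ^ (-(2 * ((α + β) * (min j₁ j₂ : ℕ)))) ∧
      (∫ x, (r₁ x - W.proj j₁ r₁ x) * (r₂ x - W.proj j₂ r₂ x) ∂cubeVol d) ^ 2
        ≤ C * (2 : ℝ) ^ (-(2 * ((α + β) * (max j₁ j₂ : ℕ)))) := by
  obtain ⟨Ca, hCa, ha⟩ := hW.exists_abs_sub_proj_le d hα M
  obtain ⟨Cb, hCb, hb⟩ := hW.exists_abs_sub_proj_le d hβ M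
  refine ⟨(Ca * Cb) ^ 2, by positivity, fun r₁ r₂ h₁ h₂ m1 m2 hh1 hh2 e1 e2 => ?_⟩
  have key : ∀ j, J₀ ≤ j →
      (∫ x, (r₁ x - W.proj j r₁ x) * (r₂ x - W.proj j r₂ x) ∂cubeVol d) ^ 2
        ≤ (Ca * Cb) ^ 2 * (2 : ℝ) ^ (-(2 * ((α + β) * (j : ℕ)))) := by
    intro j hj
    have h := abs_integral_mul_le (ha r₁ h₁ m1 hh1 e1 j hj) (hb r₂ h₂ m2 hh2 e2 j hj)
    rw [← sq_two_rpow_neg]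
    refine sq_le_sq' ?_ ?_ <;> [have := neg_le_of_abs_le h; have := le_of_abs_le h] <;>
    · have e : Ca * (2 : ℝ) ^ (-(α * j)) * (Cb * 2 ^ (-(β * j)))
          = Ca * Cb * 2 ^ (-((α + β) * j)) := by
        rw [mul_mul_mul_comm, ← Real.rpow_add two_pos]
        congr 2
        ring
      rw [e] at this
      linarith
  intro j₁ hj₁ j₂ hj₂
  rcases le_total j₁ j₂ with h | h
  · rw [min_eq_left h, max_eq_right h,
      hW.integral_mul_sub_integral_proj_mul_proj hj₁ h m1 m2,
      hW.integral_sub_proj_mul_sub_proj hj₁ h m1 m2]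
    exact ⟨key j₁ hj₁, key j₂ hj₂⟩
  · have e1 := hW.integral_mul_sub_integral_proj_mul_proj hj₂ h m2 m1
    have e2 := hW.integral_sub_proj_mul_sub_proj hj₂ h m2 m1
    rw [min_eq_right h, max_eq_left h]
    constructor
    · rw [show ∫ x, r₁ x * r₂ x ∂cubeVol d - ∫ x, W.proj j₁ r₁ x * W.proj j₂ r₂ x ∂cubeVol d
        = ∫ x, (r₁ x - W.proj j₂ r₁ x) * (r₂ x - W.proj j₂ r₂ x) ∂cubeVol d by
          simpa only [mul_comm] using e1]
      exact key j₂ hj₂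
    · rw [show ∫ x, (r₁ x - W.proj j₁ r₁ x) * (r₂ x - W.proj j₂ r₂ x) ∂cubeVol d
        = ∫ x, (r₁ x - W.proj j₁ r₁ x) * (r₂ x - W.proj j₁ r₂ x) ∂cubeVol d by
          simpa only [mul_comm] using e2]
      exact key j₁ hj₁

variable {α β M C₁ C₂ : ℝ}

/-- Upper bounds for the worst-case risks of the three estimators. -/
lemma exists_worstRisk_le (hW : W.IsCDVBasis J₀) (d : ℕ) (hα : 0 < α) (hβ : 0 < β) (M : ℝ)
    (hC : C₁ ≤ C₂) : ∃ C : ℝ, 0 < C ∧ ∀ j₁, J₀ ≤ j₁ → ∀ j₂, J₀ ≤ j₂ → ∀ n : ℕ, n ≠ 0 →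
      worstRisk (model W d J₀ α β M C₁ C₂) (W.psiINT j₁ j₂ n) ≤ ENNReal.ofReal
        (C * ((1 + 2 ^ (min j₁ j₂ * d) / n) / n + 2 ^ (-(2 * ((α + β) * (min j₁ j₂ : ℕ)))))) ∧
      worstRisk (model W d J₀ α β M C₁ C₂) (W.psiMC j₁ j₂ n) ≤ ENNReal.ofReal
        (C * ((1 + 2 ^ (j₁ * d) / n) * (1 + 2 ^ (j₂ * d) / n) / n
          + 2 ^ (-(2 * ((α + β) * (min j₁ j₂ : ℕ)))))) ∧
      worstRisk (model W d J₀ α β M C₁ C₂) (W.psiIF j₁ j₂ n) ≤ ENNReal.ofReal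
        (C * ((1 + 2 ^ (j₁ * d) / n) * (1 + 2 ^ (j₂ * d) / n) / n
          + 2 ^ (-(2 * ((α + β) * (max j₁ j₂ : ℕ)))))) := by
  obtain ⟨K1, hK1, H1⟩ := exists_integral_estINT_le d hW (max |C₁| |C₂|)
  obtain ⟨K2, hK2, H2⟩ := exists_integral_estMC_le d hW (max |C₁| |C₂|)
  obtain ⟨K3, hK3, H3⟩ := exists_integral_estIF_le d hW (max |C₁| |C₂|)
  obtain ⟨K, hK, H⟩ := exists_sq_bias_le hW d hα hβ M
  have aux : ∀ {k v w b : ℝ}, 0 ≤ v → 0 ≤ w → 0 ≤ k → k ≤ K1 + K2 + K3 → b ≤ K * w →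
      k * v + b ≤ (K1 + K2 + K3 + K) * (v + w) := by
    intro k v w b hv hw hk hk' hb
    nlinarith [mul_le_mul_of_nonneg_right hk' hv, mul_nonneg hK.le hv,
      mul_nonneg (by positivity : 0 ≤ K1 + K2 + K3) hw]
  refine ⟨K1 + K2 + K3 + K, by positivity, fun j₁ hj₁ j₂ hj₂ n hn => ⟨?_, ?_, ?_⟩⟩ <;>
    refine iSup₂_le fun P hP => ?_ <;>
    obtain ⟨r₁, r₂, hR, -, -, ⟨h₁, hh1, e1⟩, ⟨h₂, hh2, e2⟩, -⟩ :=
      exists_isRegressionPair_of_mem_model hC hP <;>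
    obtain ⟨b1, b2⟩ := H r₁ r₂ h₁ h₂ hR.fst.bdd_r hR.snd.bdd_r hh1 hh2 e1 e2 j₁ hj₁ j₂ hj₂ <;>
    have hA : (fun o => o.2.1) =ᵐ[(P : Measure (Obs d))] fun o => clampTo C₁ C₂ o.2.1 :=
      hP.2.1.mono fun o ho => (clampTo_eq ho.1).symm
  · rw [risk_psiINT hW hR.fst hR.snd hA (hP.2.1.mono fun o ho => (clampTo_eq ho.2).symm)]
    exact ENNReal.ofReal_le_ofReal ((H1 _ _ _ _ _ _ hR j₁ hj₁ j₂ hj₂ n hn).trans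
      (aux (by positivity) (by positivity) hK1.le (by linarith) b1))
  · rw [risk_psiMC hW hR.fst hR.snd hA (hP.2.1.mono fun o ho => (clampTo_eq ho.2).symm)]
    exact ENNReal.ofReal_le_ofReal ((H2 _ _ _ _ _ _ hR j₁ hj₁ j₂ hj₂ n hn).trans
      (aux (by positivity) (by positivity) hK2.le (by linarith) b1))
  · rw [risk_psiIF hW hR.fst hR.snd hA (hP.2.1.mono fun o ho => (clampTo_eq ho.2).symm)]
    exact ENNReal.ofReal_le_ofReal ((H3 _ _ _ _ _ _ hR j₁ hj₁ j₂ hj₂ n hn).trans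
      (aux (by positivity) (by positivity) hK3.le (by linarith) b2))

end RiskUpper

/-! ### The bias of the plug-in estimators: lower bound -/

section BiasLower

/-- Signs can be chosen, one after the other, such that no cross term contributes. -/
lemma exists_signs_sum_sq_le {ι κ : Type*} [Fintype κ] (s : Finset ι) (a : ι → κ → ℝ) :
    ∃ c : ι → ℝ, (∀ i, c i * c i = 1) ∧
      ∑ m, (∑ i ∈ s, c i * a i m) ^ 2 ≤ ∑ i ∈ s, ∑ m, a i m ^ 2 := by
  classical
  induction s using Finset.induction_on with
  | empty => exact ⟨fun _ => 1, fun _ => by norm_num, by simp⟩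
  | insert i₀ s hi ih =>
    obtain ⟨c, hc, h⟩ := ih
    set X := ∑ m, (∑ i ∈ s, c i * a i m) * a i₀ m with hX
    obtain ⟨σ, hσ, hσX⟩ : ∃ σ : ℝ, σ * σ = 1 ∧ σ * X ≤ 0 := by
      rcases le_total X 0 with h0 | h0
      · exact ⟨1, by norm_num, by linarith⟩
      · exact ⟨-1, by norm_num, by linarith⟩
    refine ⟨Function.update c i₀ σ, fun i => ?_, ?_⟩
    · by_cases h' : i = i₀
      · subst h'; simpa using hσ
      · simpa [h'] using hc i
    · have e : ∀ m, ∑ i ∈ insert i₀ s, Function.update c i₀ σ i * a i m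
          = σ * a i₀ m + ∑ i ∈ s, c i * a i m := by
        intro m
        rw [Finset.sum_insert hi, Function.update_self]
        congr 1
        refine Finset.sum_congr rfl fun i his => ?_
        have hne : i ≠ i₀ := by rintro rfl; exact hi his
        rw [Function.update_of_ne hne]
      simp only [e]
      rw [Finset.sum_insert hi]
      have e2 : ∑ m, (σ * a i₀ m + ∑ i ∈ s, c i * a i m) ^ 2
          = ∑ m, a i₀ m ^ 2 + 2 * (σ * X) + ∑ m, (∑ i ∈ s, c i * a i m) ^ 2 := by
        rw [hX, Finset.mul_sum, Finset.mul_sum, ← Finset.sum_add_distrib,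
          ← Finset.sum_add_distrib]
        refine Finset.sum_congr rfl fun m _ => ?_
        linear_combination a i₀ m ^ 2 * hσ
      rw [e2]
      linarith

variable {d S J₀ : ℕ} {W : BoundaryWavelets S}

lemma integral_proj_sq_eq_sum (hW : W.IsCDVBasis J₀) {j : ℕ} (hj : J₀ ≤ j) {g : (Fin d → ℝ) → ℝ}
    (hg : IsBddMeas g) :
    ∫ x, W.proj j g x ^ 2 ∂cubeVol d = ∑ m, (∫ x, g x * W.Phi j m x ∂cubeVol d) ^ 2 := by
  have hp := hW.isBddMeas_proj j hg
  simp only [sq (W.proj j g _)]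
  rw [hW.integral_proj_mul j hg hp]
  simp only [hW.proj_proj hj hg, hW.proj_eq_sum j hg, Finset.mul_sum]
  rw [integral_finsetSum _ fun m _ => (hg.mul ((hW.isBddMeas_Phi j m).const_mul _)).integrable _]
  refine Finset.sum_congr rfl fun m _ => ?_
  rw [sq, ← integral_const_mul]
  refine integral_congr_ae (Filter.Eventually.of_forall fun x => ?_)
  simp only; ring

/-- Bessel's inequality for the bumps of one level. -/
lemma sum_sq_integral_cubeBump_le (l : ℕ) {f : (Fin d → ℝ) → ℝ} (hf : IsBddMeas f) :
    ∑ q, (∫ x, cubeBump l q x * f x ∂cubeVol d) ^ 2 ≤ bumpMass d l * ∫ x, f x ^ 2 ∂cubeVol d := by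
  set a : (Fin d → Fin (2 ^ l)) → ℝ := fun q => ∫ x, cubeBump l q x * f x ∂cubeVol d with ha
  have hw := isBddMeas_bumpSum l a
  have hμ := bumpMass_pos d l
  set μ := bumpMass d l
  have h1 : ∫ x, f x * bumpSum l a x ∂cubeVol d = ∑ q, a q ^ 2 := by
    simp only [bumpSum, Finset.mul_sum]
    rw [integral_finsetSum _ fun q _ =>
      (hf.mul ((isBddMeas_cubeBump l q).const_mul _)).integrable _]
    refine Finset.sum_congr rfl fun q _ => ?_
    rw [sq]
    nth_rewrite 3 [ha]
    rw [← integral_const_mul]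
    refine integral_congr_ae (Filter.Eventually.of_forall fun x => ?_)
    simp only; ring
  have h2 : ∫ x, bumpSum l a x * bumpSum l a x ∂cubeVol d = (∑ q, a q ^ 2) * μ := by
    rw [integral_bumpSum_mul_bumpSum]; simp only [sq]; rfl
  have h3 : 0 ≤ ∫ x, (μ * f x - bumpSum l a x) ^ 2 ∂cubeVol d :=
    integral_nonneg fun _ => sq_nonneg _
  have h4 : ∫ x, (μ * f x - bumpSum l a x) ^ 2 ∂cubeVol d
      = μ ^ 2 * ∫ x, f x ^ 2 ∂cubeVol d - 2 * μ * ∫ x, f x * bumpSum l a x ∂cubeVol d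
        + ∫ x, bumpSum l a x * bumpSum l a x ∂cubeVol d := by
    rw [← integral_const_mul, ← integral_const_mul, ← integral_sub
      (((hf.pow 2).const_mul _).integrable _) (((hf.mul hw).const_mul _).integrable _),
      ← integral_add ((((hf.pow 2).const_mul _).sub ((hf.mul hw).const_mul _)).integrable _)
        ((hw.mul hw).integrable _)]
    refine integral_congr_ae (Filter.Eventually.of_forall fun x => ?_)
    simp only; ring
  rw [h4, h1, h2] at h3
  have h5 : μ * ∑ q, a q ^ 2 ≤ μ * (μ * ∫ x, f x ^ 2 ∂cubeVol d) := by nlinarith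
  exact le_of_mul_le_mul_left h5 hμ

/-- A signed sum of bumps of level `j + 1`, half of whose energy is lost by the projection of
level `j`: the projection has too small a dimension to see all the bumps. -/
lemma exists_bumpSum_sub_proj (hW : W.IsCDVBasis J₀) (hd : 0 < d) {j : ℕ} (hj : J₀ ≤ j) :
    ∃ c : (Fin d → Fin (2 ^ (j + 1))) → ℝ, (∀ q, c q * c q = 1) ∧
      (∫ y, unitBump y ^ 2) ^ d / 2
        ≤ ∫ x, (bumpSum (j + 1) c x - W.proj j (bumpSum (j + 1) c) x) *
          (bumpSum (j + 1) c x - W.proj j (bumpSum (j + 1) c) x) ∂cubeVol d := by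
  obtain ⟨c, hc, h⟩ := exists_signs_sum_sq_le (Finset.univ : Finset (Fin d → Fin (2 ^ (j + 1))))
    fun q (m : Fin d → Fin (2 ^ j)) => ∫ x, cubeBump (j + 1) q x * W.Phi j m x ∂cubeVol d
  refine ⟨c, hc, ?_⟩
  set w := bumpSum (j + 1) c with hwdef
  have hw : IsBddMeas w := isBddMeas_bumpSum _ _
  have hp := hW.isBddMeas_proj j hw
  have e1 : ∀ m : Fin d → Fin (2 ^ j), ∑ q, c q * ∫ x, cubeBump (j + 1) q x * W.Phi j m x ∂cubeVol d
      = ∫ x, w x * W.Phi j m x ∂cubeVol d := by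
    intro m
    simp only [hwdef, bumpSum, Finset.sum_mul, mul_assoc]
    rw [integral_finsetSum _ fun q _ =>
      (((isBddMeas_cubeBump (j + 1) q).mul (hW.isBddMeas_Phi j m)).const_mul _).integrable _]
    simp only [integral_const_mul]
  simp only [e1] at h
  rw [← integral_proj_sq_eq_sum hW hj hw, Finset.sum_comm] at h
  have hB : ∑ m : Fin d → Fin (2 ^ j), ∑ q,
      (∫ x, cubeBump (j + 1) q x * W.Phi j m x ∂cubeVol d) ^ 2
      ≤ 2 ^ (j * d) * bumpMass d (j + 1) := by
    refine (Finset.sum_le_sum fun m _ =>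
      sum_sq_integral_cubeBump_le (j + 1) (hW.isBddMeas_Phi j m)).trans ?_
    have e2 : ∀ m : Fin d → Fin (2 ^ j), ∫ x, W.Phi j m x ^ 2 ∂cubeVol d = 1 := by
      intro m
      simp only [sq]
      rw [hW.integral_Phi_mul_Phi hj, if_pos rfl]
    simp only [e2, mul_one, Finset.sum_const, Finset.card_univ, card_cubes, nsmul_eq_mul]
    push_cast
    exact le_rfl
  have hmass := card_mul_bumpMass d (j + 1)
  have h2 : (2 : ℝ) ^ (j * d) * 2 ≤ 2 ^ ((j + 1) * d) := by
    rw [← pow_succ]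
    exact pow_le_pow_right₀ one_le_two (by nlinarith)
  have hw2 : ∫ x, w x ^ 2 ∂cubeVol d = (∫ y, unitBump y ^ 2) ^ d := by
    simp only [hwdef, sq (bumpSum _ _ _)]
    rw [integral_bumpSum_mul_bumpSum, ← hmass]
    simp only [hc, Finset.sum_const, Finset.card_univ, card_cubes, nsmul_eq_mul, mul_one]
    push_cast
    rfl
  have hμ := bumpMass_pos d (j + 1)
  have h3 : ∫ x, (w x - W.proj j w x) * (w x - W.proj j w x) ∂cubeVol d
      = ∫ x, w x ^ 2 ∂cubeVol d - ∫ x, W.proj j w x ^ 2 ∂cubeVol d := by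
    have e := hW.integral_mul_sub_integral_proj_mul_proj hj le_rfl hw hw
    rw [← e]
    simp only [sq]
  rw [h3, hw2]
  nlinarith

/-- The bias of the plug-in estimators for equal levels. -/
noncomputable def projCov (W : BoundaryWavelets S) (j : ℕ) (g h : (Fin d → ℝ) → ℝ) : ℝ :=
  ∫ x, (g x - W.proj j g x) * (h x - W.proj j h x) ∂cubeVol d

lemma projCov_sub_left (hW : W.IsCDVBasis J₀) (j : ℕ) {g g' h : (Fin d → ℝ) → ℝ}
    (hg : IsBddMeas g) (hg' : IsBddMeas g') (hh : IsBddMeas h) :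
    projCov W j (fun x => g x - g' x) h = projCov W j g h - projCov W j g' h := by
  have a1 := hg.sub (hW.isBddMeas_proj j hg)
  have a2 := hg'.sub (hW.isBddMeas_proj j hg')
  have a3 := hh.sub (hW.isBddMeas_proj j hh)
  unfold projCov
  rw [← integral_sub ((a1.mul a3).integrable _) ((a2.mul a3).integrable _)]
  simp only [hW.proj_sub j hg hg']
  refine integral_congr_ae (Filter.Eventually.of_forall fun x => ?_)
  simp only; ring

lemma projCov_comm (j : ℕ) (g h : (Fin d → ℝ) → ℝ) : projCov W j g h = projCov W j h g := by
  unfold projCov; simp only [mul_comm]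

lemma projCov_const_mul (j : ℕ) (a b : ℝ) (g h : (Fin d → ℝ) → ℝ) :
    projCov W j (fun x => a * g x) (fun x => b * h x) = a * b * projCov W j g h := by
  have e : ∀ (c : ℝ) (k : (Fin d → ℝ) → ℝ) x, W.proj j (fun x => c * k x) x = c * W.proj j k x := by
    intro c k x
    unfold BoundaryWavelets.proj
    rw [← integral_const_mul]
    simp only [mul_assoc]
  unfold projCov
  rw [← integral_const_mul]
  simp only [e]
  refine integral_congr_ae (Filter.Eventually.of_forall fun x => ?_)
  simp only; ring

/-- The four-point formula: a bilinear form that is small at four corners is small on the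
differences. -/
lemma exists_le_abs_projCov (hW : W.IsCDVBasis J₀) (j : ℕ) {g g' h h' : (Fin d → ℝ) → ℝ}
    (hg : IsBddMeas g) (hg' : IsBddMeas g') (hh : IsBddMeas h) (hh' : IsBddMeas h') {t : ℝ}
    (h1 : |projCov W j g h| ≤ t) (h2 : |projCov W j g' h| ≤ t) (h3 : |projCov W j g h'| ≤ t)
    (h4 : |projCov W j g' h'| ≤ t) :
    projCov W j (fun x => g x - g' x) (fun x => h x - h' x) ≤ 4 * t := by
  rw [projCov_sub_left hW j hg hg' (hh.sub hh'), projCov_comm, projCov_comm j g',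
    projCov_sub_left hW j hh hh' hg, projCov_sub_left hW j hh hh' hg', projCov_comm j h,
    projCov_comm j h', projCov_comm j h, projCov_comm j h']
  rw [abs_le] at h1 h2 h3 h4
  linarith [h1.1, h1.2, h2.1, h2.2, h3.1, h3.2, h4.1, h4.2]

lemma bias_eq_projCov (hW : W.IsCDVBasis J₀) {j₁ j₂ : ℕ} (hj₁ : J₀ ≤ j₁) (hj₂ : J₀ ≤ j₂)
    {g h : (Fin d → ℝ) → ℝ} (hg : IsBddMeas g) (hh : IsBddMeas h) :
    ∫ x, g x * h x ∂cubeVol d - ∫ x, W.proj j₁ g x * W.proj j₂ h x ∂cubeVol d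
      = projCov W (min j₁ j₂) g h := by
  rcases le_total j₁ j₂ with h12 | h12
  · rw [min_eq_left h12]
    exact hW.integral_mul_sub_integral_proj_mul_proj hj₁ h12 hg hh
  · rw [min_eq_right h12, projCov_comm]
    simpa only [mul_comm, projCov] using
      hW.integral_mul_sub_integral_proj_mul_proj hj₂ h12 hh hg

/-- The squared bias bounds the risk of the Monte Carlo estimator from below. -/
lemma sq_projCov_le_risk_psiMC (hW : W.IsCDVBasis J₀) {P : ProbabilityMeasure (Obs d)}
    {f₁ f₂ : Obs d → ℝ} {r₁ r₂ : (Fin d → ℝ) → ℝ}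
    (h₁ : IsRegression (P : Measure (Obs d)) (fun o => o.1) f₁ r₁)
    (h₂ : IsRegression (P : Measure (Obs d)) (fun o => o.1) f₂ r₂)
    (hA : (fun o => o.2.1) =ᵐ[(P : Measure (Obs d))] f₁)
    (hY : (fun o => o.2.2) =ᵐ[(P : Measure (Obs d))] f₂) {j₁ j₂ n : ℕ} (hj₁ : J₀ ≤ j₁)
    (hj₂ : J₀ ≤ j₂) (hn : n ≠ 0) :
    ENNReal.ofReal (projCov W (min j₁ j₂) r₁ r₂ ^ 2) ≤ risk (W.psiMC j₁ j₂ n) P := by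
  rw [risk_psiMC hW h₁ h₂ hA hY, integral_estMC_sub_sq hW h₁ h₂ j₁ j₂ hn]
  refine ENNReal.ofReal_le_ofReal ?_
  have hb := sq_bias_le_integral_estINT hW h₁ h₂ j₁ j₂ hn
  rw [bias_eq_projCov hW hj₁ hj₂ h₁.bdd_r h₂.bdd_r] at hb
  refine hb.trans (le_add_of_nonneg_left (integral_nonneg fun D₁ => integral_nonneg fun D₂ => ?_))
  refine mul_nonneg (by positivity) (sub_nonneg.mpr (sq_integral_le _ ?_))
  exact ((isBddMeas_projEst hW j₁ h₁.meas h₁.bdd).section_left D₁).mul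
    ((isBddMeas_projEst hW j₂ h₂.meas h₂.bdd).section_left D₂)

/-- The worst-case risk of the Monte Carlo estimator is at least of the order of the worst squared
bias, which is attained by perturbations hidden from the projection. -/
lemma exists_bias_le_worstRisk_psiMC (hW : W.IsCDVBasis J₀) (hd : 0 < d) {α β M C₁ C₂ : ℝ}
    (hα : 0 < α) (hβ : 0 < β) (hαS : α < S) (hβS : β < S) (hM : 0 < M) (hC : C₁ < C₂)
    (hne : ∃ M' < M, (model W d J₀ α β M' C₁ C₂).Nonempty) :
    ∃ c : ℝ, 0 < c ∧ ∀ j₁, J₀ ≤ j₁ → ∀ j₂, J₀ ≤ j₂ → ∀ n : ℕ, n ≠ 0 →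
      ENNReal.ofReal (c * 2 ^ (-(2 * ((α + β) * (min j₁ j₂ : ℕ)))))
        ≤ worstRisk (model W d J₀ α β M C₁ C₂) (W.psiMC j₁ j₂ n) := by
  obtain ⟨p, b, ε, δ, hpm, hbm, hε, hε1, hp, hb, hδ, hδε, Hp, Hb⟩ :=
    exists_perturbable hW hα hβ hαS hβS hM hC hne
  set E := (∫ y, unitBump y ^ 2) ^ d
  have hE : 0 < E := pow_pos integral_unitBump_sq_pos d
  have hL : 0 < (C₂ - C₁) / 2 := by linarith
  set L := (C₂ - C₁) / 2 with hLdef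
  set κ := L ^ 2 * δ ^ 2 * 2 ^ (-(α + β)) * E / 4 with hκ
  refine ⟨κ ^ 2, by positivity, fun j₁ hj₁ j₂ hj₂ n hn => ?_⟩
  have hj : J₀ ≤ min j₁ j₂ := le_min hj₁ hj₂
  set j := min j₁ j₂ with hjdef
  obtain ⟨c, hc, hcE⟩ := exists_bumpSum_sub_proj hW hd hj
  have habs : ∀ s : ℝ, |s| = 1 → ∀ q, |s * c q| ≤ 1 := by
    intro s hs q
    have : |c q| * |c q| = 1 := by rw [← abs_mul, hc, abs_one]
    rw [abs_mul, hs, one_mul]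
    nlinarith [abs_nonneg (c q)]
  let u : ℝ → ℝ → (Fin d → ℝ) → ℝ := fun a s x =>
    δ * (2 ^ (-(a * (j + 1 : ℕ))) * bumpSum (j + 1) (fun q => s * c q) x)
  have hus : ∀ a s x, u a s x = s * (δ * 2 ^ (-(a * (j + 1 : ℕ))) * bumpSum (j + 1) c x) := by
    intro a s x
    simp only [u, bumpSum, Finset.mul_sum]
    exact Finset.sum_congr rfl fun q _ => by ring
  have hum : ∀ a s, IsBddMeas (u a s) := fun a s =>
    ((isBddMeas_bumpSum _ _).const_mul _).const_mul _
  have hub : ∀ a s, 0 < a → |s| = 1 → ∀ x, |u a s x| ≤ ε / 4 := by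
    intro a s ha hs x
    have h1 : (2 : ℝ) ^ (-(a * (j + 1 : ℕ))) ≤ 1 :=
      Real.rpow_le_one_of_one_le_of_nonpos one_le_two (by
        have : 0 ≤ a * (j + 1 : ℕ) := by positivity
        linarith)
    have h2 := abs_bumpSum_le (habs s hs) x
    simp only [u]
    rw [abs_mul, abs_mul, abs_of_pos hδ, abs_of_pos (Real.rpow_pos_of_pos two_pos _)]
    refine le_trans ?_ hδε
    exact mul_le_of_le_one_right hδ.le (mul_le_one₀ h1 (abs_nonneg _) h2)
  have hmean : ∀ s t : ℝ, |s| = 1 → |t| = 1 → IsSignMeans C₁ (fun x => p x + u α s x)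
      (fun x => b x + u β t x) (fun x => p x * b x + p x * u β t x + b x * u α s x) :=
    fun s t hs ht => isSignMeans_perturbed C₁ hε hp hb (hub α s hα hs) (hub β t hβ ht) hpm hbm
      (hum _ _) (hum _ _)
  let r : (a : ℝ) → (g : (Fin d → ℝ) → ℝ) → ℝ → (Fin d → ℝ) → ℝ := fun a g s x =>
    ofSign C₁ C₂ (g x + u a s x)
  have hrm : ∀ a g s, IsBddMeas g → IsBddMeas (r a g s) := fun a g s hg =>
    (hg.add (hum a s)).ofSign C₁ C₂
  by_contra! hlt
  have hsmall : ∀ s t : ℝ, |s| = 1 → |t| = 1 →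
      |projCov W j (r α p s) (r β b t)| ≤ κ * 2 ^ (-((α + β) * (j : ℕ))) := by
    intro s t hs ht
    have hmem := signLaw_mem_model hC (hmean s t hs ht) (W := W) (J₀ := J₀) (α := α) (β := β)
      (M := M) (Hp _ _ (habs s hs)) (Hb _ _ (habs t ht))
    have h1 := sq_projCov_le_risk_psiMC hW (isRegression_signLaw_fst hC (hmean s t hs ht))
      (isRegression_signLaw_snd hC (hmean s t hs ht)) (ae_signLaw_fst hC (hmean s t hs ht))
      (ae_signLaw_snd hC (hmean s t hs ht)) hj₁ hj₂ hn
    have h2 := (h1.trans (le_iSup₂ (f := fun P _ => risk (W.psiMC j₁ j₂ n) P) _ hmem)).trans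
      hlt.le
    rw [ENNReal.ofReal_le_ofReal_iff (by positivity), ← sq_two_rpow_neg] at h2
    exact abs_le_of_sq_le_sq h2 (by positivity)
  have hfour := exists_le_abs_projCov hW j (hrm α p 1 hpm) (hrm α p (-1) hpm) (hrm β b 1 hbm)
    (hrm β b (-1) hbm) (hsmall 1 1 (by simp) (by simp)) (hsmall (-1) 1 (by simp) (by simp))
    (hsmall 1 (-1) (by simp) (by simp)) (hsmall (-1) (-1) (by simp) (by simp))
  have hdiff : ∀ (a : ℝ) (g : (Fin d → ℝ) → ℝ), (fun x => r a g 1 x - r a g (-1) x)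
      = fun x => (2 * L * δ * 2 ^ (-(a * (j + 1 : ℕ)))) * bumpSum (j + 1) c x := by
    intro a g
    funext x
    simp only [r, hus, ofSign, ← hLdef]
    ring
  rw [hdiff, hdiff, projCov_const_mul] at hfour
  have hpow : (2 : ℝ) ^ (-(α * (j + 1 : ℕ))) * 2 ^ (-(β * (j + 1 : ℕ)))
      = 2 ^ (-(α + β)) * 2 ^ (-((α + β) * (j : ℕ))) := by
    rw [← Real.rpow_add two_pos, ← Real.rpow_add two_pos]
    congr 1
    push_cast
    ring
  have hge : 2 * L * δ * 2 ^ (-(α * (j + 1 : ℕ))) * (2 * L * δ * 2 ^ (-(β * (j + 1 : ℕ)))) * (E / 2)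
      ≤ 4 * (κ * 2 ^ (-((α + β) * (j : ℕ)))) :=
    le_trans (mul_le_mul_of_nonneg_left hcE (by positivity)) hfour
  have hκ' : 2 * L * δ * 2 ^ (-(α * (j + 1 : ℕ))) * (2 * L * δ * 2 ^ (-(β * (j + 1 : ℕ)))) * (E / 2)
      = 8 * (κ * 2 ^ (-((α + β) * (j : ℕ)))) := by
    rw [hκ]
    linear_combination 2 * L ^ 2 * δ ^ 2 * E * hpow
  rw [hκ'] at hge
  have : 0 < κ * (2 : ℝ) ^ (-((α + β) * (j : ℕ))) := by positivity
  linarith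

end BiasLower

/-! ### The variance of the Monte Carlo estimator, and the size of the sample -/

section Reduction

variable {d S J₀ : ℕ} {W : BoundaryWavelets S}

/-- At an unperturbed law of the model the conditional variances are bounded away from zero, so
that the variance of the Monte Carlo step is of its maximal order. -/
lemma exists_variance_le_worstRisk_psiMC (hW : W.IsCDVBasis J₀) {α β M C₁ C₂ : ℝ}
    (hα : 0 < α) (hβ : 0 < β) (hαS : α < S) (hβS : β < S) (hM : 0 < M) (hC : C₁ < C₂)
    (hne : ∃ M' < M, (model W d J₀ α β M' C₁ C₂).Nonempty) :
    ∃ c C : ℝ, 0 < c ∧ 0 < C ∧ ∀ j₁, J₀ ≤ j₁ → ∀ j₂, J₀ ≤ j₂ → ∀ n : ℕ, n ≠ 0 →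
      ENNReal.ofReal
          (1 / n * (c * (2 ^ (j₁ * d) / n * (2 ^ (j₂ * d) / n)) - C * (1 + 2 ^ (j₂ * d) / n)))
        ≤ worstRisk (model W d J₀ α β M C₁ C₂) (W.psiMC j₁ j₂ n) := by
  obtain ⟨p, b, ε, δ, hpm, hbm, hε, hε1, hp, hb, -, -, Hp, Hb⟩ :=
    exists_perturbable hW hα hβ hαS hβS hM hC hne
  have h := isSignMeans_perturbed C₁ hε hp hb (u := fun _ => 0) (v := fun _ => 0)
    (fun _ => by rw [abs_zero]; linarith) (fun _ => by rw [abs_zero]; linarith) hpm hbm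
    (.const 0) (.const 0)
  have hp' := Hp 0 (fun _ => 0) fun _ => by simp
  have hb' := Hb 0 (fun _ => 0) fun _ => by simp
  simp only [bumpSum, zero_mul, Finset.sum_const_zero, mul_zero, add_zero] at h hp' hb'
  have hmem := signLaw_mem_model hC h hp' hb'
  have hsq : ∀ {f : (Fin d → ℝ) → ℝ}, (∀ x, |f x| ≤ 1 - ε) → ∀ x, f x ^ 2 ≤ 1 - ε := by
    intro f hf x
    rw [← sq_abs]
    nlinarith [hf x, abs_nonneg (f x)]
  have hpair := isRegressionPair_signLaw hC h (fun x => (hp x).trans (by linarith))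
    (fun x => (hb x).trans (by linarith))
  have hL : 0 < ((C₂ - C₁) / 2) ^ 2 * ε := mul_pos (pow_pos (by linarith) 2) hε
  obtain ⟨c, C, hc, hC0, H⟩ := exists_le_integral_estMC d hW (max |C₁| |C₂|) hL
  refine ⟨c, C, hc, hC0, fun j₁ hj₁ j₂ hj₂ n hn => ?_⟩
  refine le_trans ?_ (le_iSup₂ (f := fun P _ => risk (W.psiMC j₁ j₂ n) P) _ hmem)
  rw [risk_psiMC hW hpair.fst hpair.snd (ae_signLaw_fst hC h) (ae_signLaw_snd hC h)]
  exact ENNReal.ofReal_le_ofReal (H _ _ _ _ _ _ hpair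
    (fun g hg hg0 => le_integral_sq_signLaw_fst hC h (hsq hp) hg hg0)
    (fun g hg hg0 => le_integral_sq_signLaw_snd hC h (hsq hb) hg hg0) j₁ hj₁ j₂ hj₂ n hn)

lemma measurable_psiMC (hW : W.IsCDVBasis J₀) (j₁ j₂ n : ℕ) :
    Measurable (W.psiMC j₁ j₂ n : (Fin 4 × Fin n → Obs d) → ℝ) := by
  refine Measurable.sub (by fun_prop)
    ((Finset.measurable_fun_sum Finset.univ fun i _ => ?_).const_mul _)
  exact (measurable_projEst_param hW j₁ measurable_fst measurable_fst_obs
    (measurable_fibre (0 : Fin 4)) (by fun_prop)).mul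
    (measurable_projEst_param hW j₂ measurable_fst measurable_snd_obs
      (measurable_fibre (1 : Fin 4)) (by fun_prop))

lemma measurable_psiIF (hW : W.IsCDVBasis J₀) (j₁ j₂ n : ℕ) :
    Measurable (W.psiIF j₁ j₂ n : (Fin 3 × Fin n → Obs d) → ℝ) := by
  refine (Finset.measurable_fun_sum Finset.univ fun i _ => ?_).const_mul _
  exact (Measurable.sub (by fun_prop) (measurable_projEst_param hW j₁ measurable_fst
      measurable_fst_obs (measurable_fibre (0 : Fin 3)) (by fun_prop))).mul
    (Measurable.sub (by fun_prop) (measurable_projEst_param hW j₂ measurable_fst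
      measurable_snd_obs (measurable_fibre (1 : Fin 3)) (by fun_prop)))

/-- A subsample of an i.i.d. sample is an i.i.d. sample. -/
lemma pi_map_comp_injective {I J Ω : Type*} [Fintype I] [Fintype J] [MeasurableSpace Ω]
    (P : Measure Ω) [IsProbabilityMeasure P] {f : J → I} (hf : Function.Injective f) :
    (Measure.pi fun _ : I => P).map (fun O j => O (f j)) = Measure.pi fun _ : J => P := by
  have h1 : ProbabilityTheory.iIndepFun (fun i (O : I → Ω) => O i) (Measure.pi fun _ : I => P) :=
    ProbabilityTheory.iIndepFun_pi (X := fun _ ω => ω) fun _ => aemeasurable_id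
  have h2 := h1.precomp hf
  rw [ProbabilityTheory.iIndepFun_iff_map_fun_eq_pi_map
    fun j => (measurable_pi_apply _).aemeasurable] at h2
  refine h2.trans ?_
  congr 1
  funext j
  exact (measurePreserving_eval (fun _ : I => P) (f j)).map_eq

/-- More observations do not increase the minimax risk. -/
lemma minimaxRisk_le_of_injective (Q : Set (ProbabilityMeasure (Obs d))) {I J : Type} [Fintype I]
    [Fintype J] {f : J → I} (hf : Function.Injective f) :
    minimaxRisk Q I ≤ minimaxRisk Q J := by
  refine le_iInf₂ fun T hT => ?_
  have hm : Measurable fun (O : I → Obs d) (j : J) => O (f j) := by fun_prop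
  refine (iInf₂_le (fun O => T fun j => O (f j)) (hT.comp hm)).trans ?_
  refine iSup₂_mono fun P _ => le_of_eq ?_
  unfold risk
  rw [← pi_map_comp_injective (P : Measure (Obs d)) hf,
    lintegral_map (((hT.sub_const _).pow_const 2).ennreal_ofReal) hm]

lemma minimaxRisk_le_worstRisk (Q : Set (ProbabilityMeasure (Obs d))) {I : Type} [Fintype I]
    {T : (I → Obs d) → ℝ} (hT : Measurable T) : minimaxRisk Q I ≤ worstRisk Q T :=
  iInf₂_le T hT

end Reduction

/-! ### Comparison of rates -/

section Rates

lemma asympLE_ofReal_iff {a b : ℕ → ℝ} (hb : ∀ n, 0 ≤ b n) :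
    AsympLE (fun n => ENNReal.ofReal (a n)) (fun n => ENNReal.ofReal (b n)) ↔
      ∃ C : ℝ, 0 < C ∧ ∃ n₀ : ℕ, ∀ n ≥ n₀, a n ≤ C * b n := by
  constructor
  · rintro ⟨C, hC, n₀, h⟩
    refine ⟨C, hC, n₀, fun n hn => ?_⟩
    have : ENNReal.ofReal (a n) ≤ C * ENNReal.ofReal (b n) := h n hn
    rwa [← ENNReal.ofReal_coe_nnreal, ← ENNReal.ofReal_mul C.coe_nonneg,
      ENNReal.ofReal_le_ofReal_iff (mul_nonneg C.coe_nonneg (hb n))] at this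
  · rintro ⟨C, hC, n₀, h⟩
    refine ⟨C.toNNReal, Real.toNNReal_pos.mpr hC, n₀, fun n hn => ?_⟩
    change ENNReal.ofReal (a n) ≤ ENNReal.ofReal C * ENNReal.ofReal (b n)
    rw [← ENNReal.ofReal_mul hC.le]
    exact ENNReal.ofReal_le_ofReal (h n hn)

lemma AsympLE.trans {a b c : ℕ → ℝ≥0∞} (h₁ : AsympLE a b) (h₂ : AsympLE b c) : AsympLE a c := by
  obtain ⟨C, hC, n₀, h⟩ := h₁
  obtain ⟨D, hD, n₁, h'⟩ := h₂
  refine ⟨C * D, mul_pos hC hD, max n₀ n₁, fun n hn => ?_⟩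
  refine (h n (le_of_max_le_left hn)).trans ?_
  rw [ENNReal.coe_mul, mul_assoc]
  gcongr
  exact h' n (le_of_max_le_right hn)

lemma asympLE_of_le {a b : ℕ → ℝ≥0∞} (h : ∀ n, a n ≤ b n) : AsympLE a b :=
  ⟨1, one_pos, 0, fun n _ => by simpa using h n⟩

/-- The real-valued resolution at level `j`. -/
noncomputable def realResol (d j : ℕ) : ℝ := 2 ^ (j * d)

lemma realResol_pos (d j : ℕ) : 0 < realResol d j := by unfold realResol; positivity

lemma resol_eq (d : ℕ) (j : ℕ → ℕ) :
    resol d j = fun n => ENNReal.ofReal (realResol d (j n)) := by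
  funext n
  rw [resol, ← ENNReal.ofReal_natCast, realResol]
  push_cast
  rfl

lemma monotone_realResol (d : ℕ) : Monotone (realResol d) := fun _ _ h =>
  pow_le_pow_right₀ one_le_two (Nat.mul_le_mul_right d h)

lemma min_resol (d : ℕ) (j₁ j₂ : ℕ → ℕ) :
    (fun n => min (resol d j₁ n) (resol d j₂ n)) = resol d fun n => min (j₁ n) (j₂ n) := by
  funext n
  simp only [resol_eq]
  rw [← ENNReal.ofReal_min, (monotone_realResol d).map_min]

lemma max_resol (d : ℕ) (j₁ j₂ : ℕ → ℕ) :
    (fun n => max (resol d j₁ n) (resol d j₂ n)) = resol d fun n => max (j₁ n) (j₂ n) := by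
  funext n
  simp only [resol_eq]
  rw [← ENNReal.ofReal_max, (monotone_realResol d).map_max]

lemma powRate_le_resol_iff {d : ℕ} {j : ℕ → ℕ} {r : ℝ} : AsympLE (powRate r) (resol d j) ↔
    ∃ C : ℝ, 0 < C ∧ ∃ n₀ : ℕ, ∀ n ≥ n₀, (n : ℝ) ^ r ≤ C * realResol d (j n) := by
  rw [resol_eq]
  exact asympLE_ofReal_iff fun n => (realResol_pos d (j n)).le

lemma resol_le_powRate_iff {d : ℕ} {j : ℕ → ℕ} {r : ℝ} : AsympLE (resol d j) (powRate r) ↔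
    ∃ C : ℝ, 0 < C ∧ ∃ n₀ : ℕ, ∀ n ≥ n₀, realResol d (j n) ≤ C * (n : ℝ) ^ r := by
  rw [resol_eq]
  exact asympLE_ofReal_iff fun n => by positivity

/-- The bias at level `j` in terms of the resolution. -/
lemma two_rpow_eq_realResol {d : ℕ} (hd : 0 < d) (a : ℝ) (j : ℕ) :
    (2 : ℝ) ^ (-(2 * (a * j))) = realResol d j ^ (-(2 * a / d)) := by
  have hd' : (d : ℝ) ≠ 0 := by exact_mod_cast hd.ne'
  rw [realResol, ← Real.rpow_natCast, ← Real.rpow_mul two_pos.le]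
  congr 1
  push_cast
  field_simp

lemma rpow_neg_le_of_le {x k C e s : ℝ} (hx : 0 < x) (hC : 0 < C) (hs : 0 ≤ s)
    (h : x ^ e ≤ C * k) : k ^ (-s) ≤ C ^ s * x ^ (-(e * s)) := by
  have hxe : 0 < x ^ e := Real.rpow_pos_of_pos hx e
  have hk : x ^ e / C ≤ k := by rw [div_le_iff₀ hC]; linarith
  calc k ^ (-s) ≤ (x ^ e / C) ^ (-s) :=
        Real.rpow_le_rpow_of_nonpos (by positivity) hk (by linarith)
    _ = C ^ s * x ^ (-(e * s)) := by
        rw [Real.div_rpow hxe.le hC.le, Real.rpow_neg hC.le, div_inv_eq_mul, ← Real.rpow_mul hx.le,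
          mul_comm, mul_neg]

lemma le_rpow_neg_of_le {x k C e s : ℝ} (hx : 0 < x) (hC : 0 < C) (hk0 : 0 < k) (hs : 0 ≤ s)
    (h : k ≤ C * x ^ e) : C ^ (-s) * x ^ (-(e * s)) ≤ k ^ (-s) := by
  have hxe : 0 < x ^ e := Real.rpow_pos_of_pos hx e
  calc C ^ (-s) * x ^ (-(e * s)) = (C * x ^ e) ^ (-s) := by
        rw [Real.mul_rpow hC.le hxe.le, ← Real.rpow_mul hx.le, mul_neg]
    _ ≤ k ^ (-s) := Real.rpow_le_rpow_of_nonpos hk0 h (by linarith)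

/-- Resolutions of any prescribed order of magnitude exist. -/
lemma exists_level {d : ℕ} (hd : 0 < d) (J₀ : ℕ) : ∃ K : ℝ, 1 ≤ K ∧ ∀ x : ℝ, 1 ≤ x →
    ∃ j, J₀ ≤ j ∧ x ≤ realResol d j ∧ realResol d j ≤ K * x := by
  refine ⟨2 ^ ((J₀ + 1) * d), one_le_pow₀ one_le_two, fun x hx => ?_⟩
  obtain ⟨m, hm, hm'⟩ := exists_nat_pow_near hx
    (one_lt_pow₀ (one_lt_two (α := ℝ)) hd.ne' : (1 : ℝ) < 2 ^ d)
  rw [← pow_mul, mul_comm] at hm hm'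
  refine ⟨J₀ + m + 1, by omega, hm'.le.trans ?_, ?_⟩
  · exact pow_le_pow_right₀ one_le_two (Nat.mul_le_mul_right d (by omega))
  · rw [realResol, show (J₀ + m + 1) * d = (J₀ + 1) * d + m * d by ring, pow_add]
    exact mul_le_mul_of_nonneg_left hm (by positivity)

section Bounds

variable {x k k' C e f s ρ : ℝ}

lemma one_add_div_le (hx : 1 ≤ x) (hf : 1 ≤ f) (h : k ≤ C * x ^ f) :
    1 + k / x ≤ (1 + C) * x ^ (f - 1) := by
  have h1 : 1 ≤ x ^ (f - 1) := Real.one_le_rpow hx (by linarith)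
  have h2 : k / x ≤ C * x ^ (f - 1) := by
    rw [Real.rpow_sub_one (by linarith), ← mul_div_assoc]
    gcongr
  nlinarith

/-- Variance and squared bias of the plug-in estimator with exact integration. -/
lemma risk_bound_le (hx : 1 ≤ x) (hC : 0 < C) (hs : 0 ≤ s) (hf : 1 ≤ f) (hfρ : f ≤ 2 - ρ)
    (hes : ρ ≤ e * s) (h1 : x ^ e ≤ C * k') (h2 : k ≤ C * x ^ f) :
    (1 + k / x) / x + k' ^ (-s) ≤ (1 + C + C ^ s) * x ^ (-ρ) := by
  have hx0 : 0 < x := by linarith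
  have h3 : (1 + k / x) / x ≤ (1 + C) * x ^ (-ρ) := by
    calc (1 + k / x) / x ≤ (1 + C) * x ^ (f - 1) / x := by
          gcongr; exact one_add_div_le hx hf h2
      _ = (1 + C) * x ^ (f - 1 - 1) := by rw [mul_div_assoc, ← Real.rpow_sub_one hx0.ne']
      _ ≤ (1 + C) * x ^ (-ρ) := by gcongr; linarith
  have h4 := rpow_neg_le_of_le hx0 hC hs h1
  have h5 : C ^ s * x ^ (-(e * s)) ≤ C ^ s * x ^ (-ρ) := by gcongr
  nlinarith

/-- Variance and squared bias when two independent regression estimators are evaluated at the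
sample points. -/
lemma risk_bound_mul_le {l : ℝ} {f' : ℝ} (hx : 1 ≤ x) (hC : 0 < C) (hs : 0 ≤ s) (hf : 1 ≤ f)
    (hf' : 1 ≤ f') (hfρ : f + f' ≤ 3 - ρ) (hes : ρ ≤ e * s) (hl : 0 ≤ l)
    (h1 : x ^ e ≤ C * k') (h2 : k ≤ C * x ^ f) (h3 : l ≤ C * x ^ f') :
    (1 + k / x) * (1 + l / x) / x + k' ^ (-s) ≤ ((1 + C) ^ 2 + C ^ s) * x ^ (-ρ) := by
  have hx0 : 0 < x := by linarith
  have h4 : (1 + k / x) * (1 + l / x) / x ≤ (1 + C) ^ 2 * x ^ (-ρ) := by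
    calc (1 + k / x) * (1 + l / x) / x
        ≤ ((1 + C) * x ^ (f - 1)) * ((1 + C) * x ^ (f' - 1)) / x := by
          gcongr
          · exact one_add_div_le hx hf h2
          · exact one_add_div_le hx hf' h3
      _ = (1 + C) ^ 2 * x ^ (f - 1 + (f' - 1) - 1) := by
          rw [Real.rpow_sub_one hx0.ne' (f - 1 + (f' - 1)), Real.rpow_add hx0]; ring
      _ ≤ (1 + C) ^ 2 * x ^ (-ρ) := by gcongr; linarith
  have h5 := rpow_neg_le_of_le hx0 hC hs h1
  have h6 : C ^ s * x ^ (-(e * s)) ≤ C ^ s * x ^ (-ρ) := by gcongr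
  nlinarith

/-- If both resolutions are large, the variance of the Monte Carlo step dominates. -/
lemma le_variance_bound {l c : ℝ} (hx : 0 < x) (hc : 0 < c) (hC : 0 < C) (he : 1 ≤ e)
    (hbig : 4 * C ≤ c * x ^ (e - 1)) (hx1 : 1 ≤ x) (hk : x ^ e ≤ k) (hl : x ^ e ≤ l) :
    c / 2 * x ^ (2 * e - 3) ≤ 1 / x * (c * (k / x * (l / x)) - C * (1 + l / x)) := by
  have hX : 1 ≤ x ^ (e - 1) := Real.one_le_rpow hx1 (by linarith)
  have hk' : x ^ (e - 1) ≤ k / x := by rw [Real.rpow_sub_one hx.ne']; gcongr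
  have hl' : x ^ (e - 1) ≤ l / x := by rw [Real.rpow_sub_one hx.ne']; gcongr
  have e1 : c / 2 * x ^ (2 * e - 3) = 1 / x * (c / 2 * (x ^ (e - 1) * x ^ (e - 1))) := by
    rw [← Real.rpow_add hx, show e - 1 + (e - 1) = 2 * e - 3 + 1 by ring, Real.rpow_add_one hx.ne']
    field_simp
  rw [e1]
  set X := x ^ (e - 1)
  set κ := k / x
  set l' := l / x
  gcongr
  have h1 : X * X ≤ κ * l' := mul_le_mul hk' hl' (by linarith) (by linarith)
  have h2 : 4 * C * l' ≤ c * κ * l' :=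
    mul_le_mul_of_nonneg_right (hbig.trans (mul_le_mul_of_nonneg_left hk' hc.le)) (by linarith)
  have h3 : C * 1 ≤ C * l' := mul_le_mul_of_nonneg_left (by linarith) hC.le
  nlinarith

end Bounds

end Rates

/-! ### The minimax rate and the worst-case risk of the Monte Carlo estimator -/

section MinimaxRate

variable {d S J₀ : ℕ} {W : BoundaryWavelets S} {α β M C₁ C₂ : ℝ}

/-- The exponent of the minimax rate `n ^ (-ρ)`, with `γ` the sum of the two smoothnesses. -/
noncomputable def minimaxExponent (d : ℕ) (γ : ℝ) : ℝ := by
  classical exact if (d : ℝ) / 4 ≤ γ / 2 then 1 else 4 * γ / (2 * γ + d)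

lemma minimaxExponent_of_le {γ : ℝ} (h : (d : ℝ) / 4 ≤ γ / 2) : minimaxExponent d γ = 1 := by
  simp [minimaxExponent, h]

lemma minimaxExponent_of_lt {γ : ℝ} (h : γ / 2 < (d : ℝ) / 4) :
    minimaxExponent d γ = 4 * γ / (2 * γ + d) := by
  simp [minimaxExponent, not_le.mpr h]

/-- The upper bounds for the worst-case risks in terms of the resolutions. -/
lemma exists_worstRisk_le_realResol (hW : W.IsCDVBasis J₀) (hd : 0 < d) (hα : 0 < α) (hβ : 0 < β)
    (M : ℝ) (hC : C₁ ≤ C₂) : ∃ C : ℝ, 0 < C ∧ ∀ j₁, J₀ ≤ j₁ → ∀ j₂, J₀ ≤ j₂ → ∀ n : ℕ, n ≠ 0 →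
      worstRisk (model W d J₀ α β M C₁ C₂) (W.psiINT j₁ j₂ n) ≤ ENNReal.ofReal
        (C * ((1 + realResol d (min j₁ j₂) / n) / n
          + realResol d (min j₁ j₂) ^ (-(2 * (α + β) / d)))) ∧
      worstRisk (model W d J₀ α β M C₁ C₂) (W.psiMC j₁ j₂ n) ≤ ENNReal.ofReal
        (C * ((1 + realResol d j₁ / n) * (1 + realResol d j₂ / n) / n
          + realResol d (min j₁ j₂) ^ (-(2 * (α + β) / d)))) ∧
      worstRisk (model W d J₀ α β M C₁ C₂) (W.psiIF j₁ j₂ n) ≤ ENNReal.ofReal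
        (C * ((1 + realResol d j₁ / n) * (1 + realResol d j₂ / n) / n
          + realResol d (max j₁ j₂) ^ (-(2 * (α + β) / d)))) := by
  obtain ⟨C, hC0, h⟩ := exists_worstRisk_le (C₁ := C₁) (C₂ := C₂) hW d hα hβ M hC
  refine ⟨C, hC0, fun j₁ hj₁ j₂ hj₂ n hn => ?_⟩
  have := h j₁ hj₁ j₂ hj₂ n hn
  simpa only [two_rpow_eq_realResol hd, realResol] using this

/-- The two lower bounds combined: the second one is only needed below the critical smoothness,
and the level of the perturbations is chosen according to the size of the sample. -/
lemma exists_rate_le_minimaxRisk (hW : W.IsCDVBasis J₀) (hd : 0 < d) (hα : 0 < α) (hβ : 0 < β)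
    (hαS : α < S) (hβS : β < S) (hM : 0 < M) (hC : C₁ < C₂)
    (hne : ∃ M' < M, (model W d J₀ α β M' C₁ C₂).Nonempty) :
    ∃ c : ℝ, 0 < c ∧ ∀ (I : Type) [Fintype I] [Nonempty I],
      ENNReal.ofReal (c * (Fintype.card I : ℝ) ^ (-minimaxExponent d (α + β)))
        ≤ minimaxRisk (model W d J₀ α β M C₁ C₂) I := by
  have hd' : (0 : ℝ) < d := by exact_mod_cast hd
  have hγ : 0 < α + β := by positivity
  rcases le_or_gt ((d : ℝ) / 4) ((α + β) / 2) with hreg | hreg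
  · obtain ⟨c, hc, h⟩ := exists_le_minimaxRisk_parametric hW hα hβ hαS hβS hM hC hne
    refine ⟨c, hc, fun I _ _ => ?_⟩
    rw [minimaxExponent_of_le hreg, Real.rpow_neg_one, ← div_eq_mul_inv]
    exact h I
  · obtain ⟨c, hc, h⟩ := exists_le_minimaxRisk_nonparametric hW hα hβ hαS hβS hM hC hne
    obtain ⟨K, hK, hlev⟩ := exists_level hd 0
    set γ := α + β
    set s := 2 * γ / d with hs
    set e := 2 * d / (2 * γ + d) with he
    have hs0 : 0 ≤ s := by positivity
    have he1 : 1 ≤ e := by rw [he, le_div_iff₀ (by positivity)]; linarith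
    have hes : e * s = 4 * γ / (2 * γ + d) := by rw [he, hs]; field_simp; ring
    have hes2 : e + e * s = 2 := by rw [hes, he]; field_simp; ring
    refine ⟨c * (39 * K) ^ (-s), by positivity, fun I _ _ => ?_⟩
    have hN : (1 : ℝ) ≤ Fintype.card I := by exact_mod_cast Fintype.card_pos
    set N : ℝ := (Fintype.card I : ℝ)
    have hN0 : 0 < N := by linarith
    have hNe : N ≤ N ^ e := Real.self_le_rpow_of_one_le hN he1
    obtain ⟨j, -, hj1, hj2⟩ := hlev (39 * N ^ e) (by linarith)
    have hk := realResol_pos d j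
    have hbias := two_rpow_eq_realResol hd γ j
    have hup : realResol d j ^ (-s) ≤ N ^ (-(e * s)) := by
      have := rpow_neg_le_of_le (k := realResol d j) (C := 1) hN0 one_pos hs0
        (show N ^ e ≤ 1 * realResol d j by linarith [Real.rpow_pos_of_pos hN0 e])
      simpa using this
    have hlow : (39 * K) ^ (-s) * N ^ (-(e * s)) ≤ realResol d j ^ (-s) :=
      le_rpow_neg_of_le hN0 (by positivity) hk hs0 (by linarith)
    rw [minimaxExponent_of_lt hreg, ← hes]
    refine le_trans (ENNReal.ofReal_le_ofReal ?_) (h I j ?_ ?_)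
    · rw [show -(2 * (α + β) * (j : ℝ)) = -(2 * (γ * j)) by ring, hbias, mul_assoc]
      exact mul_le_mul_of_nonneg_left hlow hc.le
    · change 35 * N ≤ realResol d j
      linarith
    · change 39 * N ^ 2 ≤ realResol d j * _
      have h1 : (2 : ℝ) ^ (2 * (α + β) * (j : ℝ)) = (realResol d j ^ (-s))⁻¹ := by
        rw [← hbias, ← Real.rpow_neg two_pos.le]
        congr 1
        ring
      have h2 : N ^ (e * s) ≤ (realResol d j ^ (-s))⁻¹ := by
        rw [le_inv_comm₀ (by positivity) (by positivity), ← Real.rpow_neg hN0.le]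
        exact hup
      rw [h1]
      calc 39 * N ^ 2 = 39 * N ^ e * N ^ (e * s) := by
            rw [mul_assoc, ← Real.rpow_add hN0, hes2, Real.rpow_two]
        _ ≤ _ := mul_le_mul hj1 h2 (by positivity) hk.le

/-- The plug-in estimator with exact integration attains the rate at suitable levels. -/
lemma exists_worstRisk_psiINT_le (hW : W.IsCDVBasis J₀) (hd : 0 < d) (hα : 0 < α) (hβ : 0 < β)
    (M : ℝ) (hC : C₁ ≤ C₂) : ∃ C : ℝ, 0 < C ∧ ∀ n : ℕ, n ≠ 0 → ∃ j, J₀ ≤ j ∧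
      worstRisk (model W d J₀ α β M C₁ C₂) (W.psiINT j j n)
        ≤ ENNReal.ofReal (C * (n : ℝ) ^ (-minimaxExponent d (α + β))) := by
  obtain ⟨C, hC0, h⟩ := exists_worstRisk_le_realResol (C₁ := C₁) (C₂ := C₂) hW hd hα hβ M hC
  obtain ⟨K, hK, hlev⟩ := exists_level hd J₀
  have hd' : (0 : ℝ) < d := by exact_mod_cast hd
  have hγ : 0 < α + β := by positivity
  set γ := α + β
  have hs0 : 0 ≤ 2 * γ / d := by positivity
  obtain ⟨e, f, he, hef, hf, hfρ, hes⟩ : ∃ e f : ℝ, 0 ≤ e ∧ e ≤ f ∧ 1 ≤ f ∧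
      f ≤ 2 - minimaxExponent d γ ∧ minimaxExponent d γ ≤ e * (2 * γ / d) := by
    rcases le_or_gt ((d : ℝ) / 4) (γ / 2) with hreg | hreg
    · rw [minimaxExponent_of_le hreg]
      refine ⟨d / (2 * γ), 1, by positivity, ?_, le_rfl, by norm_num, le_of_eq ?_⟩
      · rw [div_le_one (by positivity)]; linarith
      · field_simp
    · rw [minimaxExponent_of_lt hreg]
      refine ⟨2 * d / (2 * γ + d), 2 * d / (2 * γ + d), by positivity, le_rfl, ?_, le_of_eq ?_,
        le_of_eq ?_⟩
      · rw [le_div_iff₀ (by positivity)]; linarith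
      · field_simp; ring
      · field_simp; ring
  refine ⟨C * (1 + K + K ^ (2 * γ / d)), by positivity, fun n hn => ?_⟩
  have hn1 : (1 : ℝ) ≤ n := by exact_mod_cast Nat.one_le_iff_ne_zero.mpr hn
  obtain ⟨j, hj, hj1, hj2⟩ := hlev ((n : ℝ) ^ e) (Real.one_le_rpow hn1 he)
  refine ⟨j, hj, (h j hj j hj n hn).1.trans (ENNReal.ofReal_le_ofReal ?_)⟩
  rw [min_self, mul_assoc]
  refine mul_le_mul_of_nonneg_left (risk_bound_le (e := e) (f := f) hn1 (by linarith) hs0 hf hfρ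
    hes (hj1.trans (le_mul_of_one_le_left (realResol_pos d j).le hK)) (hj2.trans ?_)) hC0.le
  gcongr

/-- The integral estimator on three subsamples of size `⌊n / 3⌋` attains the rate; the factor lost is
constant because `n ≤ 9 ⌊n / 3⌋` for `n ≥ 3`. -/
lemma exists_minimaxRisk_le_rate (hW : W.IsCDVBasis J₀) (hd : 0 < d) (hα : 0 < α) (hβ : 0 < β)
    (M : ℝ) (hC : C₁ ≤ C₂) : ∃ C : ℝ, 0 < C ∧ ∀ n : ℕ, 3 ≤ n →
      minimaxRisk (model W d J₀ α β M C₁ C₂) (Fin n)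
        ≤ ENNReal.ofReal (C * (n : ℝ) ^ (-minimaxExponent d (α + β))) := by
  obtain ⟨C, hC0, h⟩ := exists_worstRisk_psiINT_le (C₁ := C₁) (C₂ := C₂) hW hd hα hβ M hC
  have hρ : 0 ≤ minimaxExponent d (α + β) := by
    unfold minimaxExponent; split_ifs <;> positivity
  set ρ := minimaxExponent d (α + β)
  refine ⟨C * 9 ^ ρ, by positivity, fun n hn => ?_⟩
  have hm : n / 3 ≠ 0 := by omega
  obtain ⟨j, hj, hj'⟩ := h (n / 3) hm
  have hinj : Function.Injective fun p : Fin 3 × Fin (n / 3) =>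
      (Fin.castLE (Nat.mul_div_le n 3) (finProdFinEquiv p) : Fin n) :=
    (Fin.castLE_injective _).comp finProdFinEquiv.injective
  refine (minimaxRisk_le_of_injective _ hinj).trans ((minimaxRisk_le_worstRisk _
    (measurable_psiINT hW j j _)).trans (hj'.trans (ENNReal.ofReal_le_ofReal ?_)))
  rw [mul_assoc]
  refine mul_le_mul_of_nonneg_left ?_ hC0.le
  have h9 : (n : ℝ) ≤ 9 * ((n / 3 : ℕ) : ℝ) := by
    have : n ≤ 9 * (n / 3) := by omega
    exact_mod_cast this
  have hn0 : (0 : ℝ) < n := by exact_mod_cast (by omega : 0 < n)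
  have := rpow_neg_le_of_le (e := 1) (C := 9) hn0 (by norm_num) hρ (by simpa using h9)
  simpa using this

/-- Below the critical smoothness the Monte Carlo estimator cannot be faster than
`n ^ (-3 γ / (γ + d))`: if one of the resolutions is smaller than `n ^ (3 d / (2 γ + 2 d))`, its
bias is too large, and otherwise its variance. -/
lemma exists_rate_le_worstRisk_psiMC (hW : W.IsCDVBasis J₀) (hd : 0 < d) (hα : 0 < α) (hβ : 0 < β)
    (hαS : α < S) (hβS : β < S) (hM : 0 < M) (hC : C₁ < C₂)
    (hne : ∃ M' < M, (model W d J₀ α β M' C₁ C₂).Nonempty) (hreg : (α + β) / 2 < (d : ℝ) / 4) :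
    ∃ c : ℝ, 0 < c ∧ ∃ n₀ : ℕ, ∀ n ≥ n₀, ∀ j₁, J₀ ≤ j₁ → ∀ j₂, J₀ ≤ j₂ →
      ENNReal.ofReal (c * (n : ℝ) ^ (-(3 * (α + β) / (α + β + d))))
        ≤ worstRisk (model W d J₀ α β M C₁ C₂) (W.psiMC j₁ j₂ n) := by
  obtain ⟨cb, hcb, hb⟩ := exists_bias_le_worstRisk_psiMC hW hd hα hβ hαS hβS hM hC hne
  obtain ⟨c, C, hc, hC0, hv⟩ := exists_variance_le_worstRisk_psiMC hW hα hβ hαS hβS hM hC hne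
  have hd' : (0 : ℝ) < d := by exact_mod_cast hd
  have hγ : 0 < α + β := by positivity
  set γ := α + β
  set s := 2 * γ / d with hs
  set e := 3 * d / (2 * γ + 2 * d) with he
  have hs0 : 0 ≤ s := by positivity
  have he1 : 1 < e := by rw [he, lt_div_iff₀ (by positivity)]; linarith
  have hes : e * s = 3 * γ / (γ + d) := by rw [he, hs]; field_simp
  have hes2 : 2 * e - 3 = -(3 * γ / (γ + d)) := by rw [he]; field_simp; ring
  have hlim : Filter.Tendsto (fun n : ℕ => c * (n : ℝ) ^ (e - 1)) Filter.atTop Filter.atTop :=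
    ((tendsto_rpow_atTop (by linarith)).comp tendsto_natCast_atTop_atTop).const_mul_atTop hc
  obtain ⟨n₁, hn₁⟩ := Filter.eventually_atTop.mp (hlim.eventually_ge_atTop (4 * C))
  refine ⟨min cb (c / 2), by positivity, max n₁ 1, fun n hn j₁ hj₁ j₂ hj₂ => ?_⟩
  have hnN : 1 ≤ n := le_of_max_le_right hn
  have hn1 : (1 : ℝ) ≤ n := by exact_mod_cast hnN
  have hn0 : (0 : ℝ) < n := by linarith
  rcases le_or_gt (realResol d (min j₁ j₂)) ((n : ℝ) ^ e) with hk | hk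
  · refine le_trans (ENNReal.ofReal_le_ofReal ?_) (hb j₁ hj₁ j₂ hj₂ n (by omega))
    rw [two_rpow_eq_realResol hd]
    have h1 := le_rpow_neg_of_le (C := 1) hn0 one_pos (realResol_pos d _) hs0
      (by rwa [one_mul])
    rw [Real.one_rpow, one_mul, hes] at h1
    exact mul_le_mul (min_le_left _ _) h1 (by positivity) hcb.le
  · refine le_trans (ENNReal.ofReal_le_ofReal ?_) (hv j₁ hj₁ j₂ hj₂ n (by omega))
    have h1 := le_variance_bound hn0 hc hC0 he1.le (hn₁ n (le_of_max_le_left hn)) hn1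
      (hk.le.trans (monotone_realResol d (min_le_left _ _)))
      (hk.le.trans (monotone_realResol d (min_le_right _ _)))
    rw [hes2] at h1
    refine le_trans ?_ h1
    gcongr
    exact min_le_right _ _

/-- A sufficient condition for rate optimality. -/
lemma isMinimaxRateOptimal_of_le (hW : W.IsCDVBasis J₀) (hd : 0 < d) (hα : 0 < α) (hβ : 0 < β)
    (hαS : α < S) (hβS : β < S) (hM : 0 < M) (hC : C₁ < C₂)
    (hne : ∃ M' < M, (model W d J₀ α β M' C₁ C₂).Nonempty) {s : ℕ} (hs : s ≠ 0)
    {T : ∀ n : ℕ, (Fin s × Fin n → Obs d) → ℝ} (hT : ∀ n, Measurable (T n))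
    (h : ∃ C : ℝ, 0 < C ∧ ∃ n₀ : ℕ, ∀ n ≥ n₀, worstRisk (model W d J₀ α β M C₁ C₂) (T n)
      ≤ ENNReal.ofReal (C * (n : ℝ) ^ (-minimaxExponent d (α + β)))) :
    IsMinimaxRateOptimal (model W d J₀ α β M C₁ C₂) s T := by
  refine ⟨?_, asympLE_of_le fun n => minimaxRisk_le_worstRisk _ (hT n)⟩
  obtain ⟨c, hc, hlow⟩ := exists_rate_le_minimaxRisk hW hd hα hβ hαS hβS hM hC hne
  obtain ⟨C, hC0, n₀, h⟩ := h
  set ρ := minimaxExponent d (α + β)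
  have hs' : (0 : ℝ) < s := by exact_mod_cast Nat.pos_of_ne_zero hs
  refine ⟨(C / (c * (s : ℝ) ^ (-ρ))).toNNReal, Real.toNNReal_pos.mpr (by positivity), max n₀ 1,
    fun n hn => (h n (le_of_max_le_left hn)).trans ?_⟩
  have hn1 : 1 ≤ n := le_of_max_le_right hn
  have : Nonempty (Fin s × Fin n) := ⟨(⟨0, by omega⟩, ⟨0, by omega⟩)⟩
  refine le_trans (le_of_eq ?_) (mul_le_mul_right (hlow (Fin s × Fin n)) _)
  change _ = ENNReal.ofReal _ * _
  rw [← ENNReal.ofReal_mul (by positivity), Fintype.card_prod, Fintype.card_fin, Fintype.card_fin,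
    Nat.cast_mul, Real.mul_rpow hs'.le (Nat.cast_nonneg n)]
  congr 1
  field_simp

end MinimaxRate

/-! ### Rate optimality -/

section Optimality

variable {d S J₀ : ℕ} {W : BoundaryWavelets S} {α β M C₁ C₂ : ℝ}

/-- A common constant in several eventual bounds. -/
lemma exists_eventually_and {p q : ℝ → ℕ → Prop}
    (hp : ∃ C : ℝ, 0 < C ∧ ∃ n₀ : ℕ, ∀ n ≥ n₀, p C n)
    (hq : ∃ C : ℝ, 0 < C ∧ ∃ n₀ : ℕ, ∀ n ≥ n₀, q C n)
    (hpm : ∀ n, Monotone fun C => p C n) (hqm : ∀ n, Monotone fun C => q C n) :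
    ∃ C : ℝ, 0 < C ∧ ∃ n₀ : ℕ, ∀ n ≥ n₀, p C n ∧ q C n := by
  obtain ⟨C, hC, n₀, h⟩ := hp
  obtain ⟨D, hD, n₁, h'⟩ := hq
  exact ⟨max C D, lt_max_of_lt_left hC, max n₀ n₁, fun n hn =>
    ⟨hpm n (le_max_left _ _) (h n (le_of_max_le_left hn)),
      hqm n (le_max_right _ _) (h' n (le_of_max_le_right hn))⟩⟩

lemma exists_resol_bounds {i j : ℕ → ℕ} {e f : ℝ} (h : AsympLE (powRate e) (resol d i))
    (h' : AsympLE (resol d j) (powRate f)) : ∃ C : ℝ, 0 < C ∧ ∃ n₀ : ℕ, ∀ n ≥ n₀,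
      (n : ℝ) ^ e ≤ C * realResol d (i n) ∧ realResol d (j n) ≤ C * (n : ℝ) ^ f :=
  exists_eventually_and (powRate_le_resol_iff.mp h) (resol_le_powRate_iff.mp h')
    (fun n _ _ hab hp => hp.trans (mul_le_mul_of_nonneg_right hab (realResol_pos d (i n)).le))
    (fun n _ _ hab hp => hp.trans (mul_le_mul_of_nonneg_right hab (by positivity)))

lemma exists_worstRisk_psiINT_le_rate (hW : W.IsCDVBasis J₀) (hd : 0 < d) (hα : 0 < α) (hβ : 0 < β)
    (M : ℝ) (hC : C₁ ≤ C₂) {j₁ j₂ : ℕ → ℕ} (hj₁ : ∀ n, J₀ ≤ j₁ n) (hj₂ : ∀ n, J₀ ≤ j₂ n)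
    {e f ρ : ℝ} (hf : 1 ≤ f) (hfρ : f ≤ 2 - ρ) (hes : ρ ≤ e * (2 * (α + β) / d))
    (h : AsympLE (powRate e) (resol d fun n => min (j₁ n) (j₂ n)))
    (h' : AsympLE (resol d fun n => min (j₁ n) (j₂ n)) (powRate f)) :
    ∃ C : ℝ, 0 < C ∧ ∃ n₀ : ℕ, ∀ n ≥ n₀,
      worstRisk (model W d J₀ α β M C₁ C₂) (W.psiINT (j₁ n) (j₂ n) n)
        ≤ ENNReal.ofReal (C * (n : ℝ) ^ (-ρ)) := by
  obtain ⟨C, hC0, hup⟩ := exists_worstRisk_le_realResol (C₁ := C₁) (C₂ := C₂) hW hd hα hβ M hC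
  obtain ⟨D, hD, n₀, hb⟩ := exists_resol_bounds h h'
  refine ⟨C * (1 + D + D ^ (2 * (α + β) / d)), by positivity, max n₀ 1, fun n hn => ?_⟩
  have hnN : 1 ≤ n := le_of_max_le_right hn
  have hb := hb n (le_of_max_le_left hn)
  refine (hup _ (hj₁ n) _ (hj₂ n) n (by omega)).1.trans (ENNReal.ofReal_le_ofReal ?_)
  rw [mul_assoc]
  exact mul_le_mul_of_nonneg_left (risk_bound_le (by exact_mod_cast hnN) hD (by positivity) hf hfρ
    hes hb.1 hb.2) hC0.le

lemma exists_worstRisk_psiMC_le_rate (hW : W.IsCDVBasis J₀) (hd : 0 < d) (hα : 0 < α) (hβ : 0 < β)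
    (M : ℝ) (hC : C₁ ≤ C₂) {j₁ j₂ : ℕ → ℕ} (hj₁ : ∀ n, J₀ ≤ j₁ n) (hj₂ : ∀ n, J₀ ≤ j₂ n)
    {e f ρ : ℝ} (hf : 1 ≤ f) (hfρ : f + f ≤ 3 - ρ) (hes : ρ ≤ e * (2 * (α + β) / d))
    (h₁ : AsympLE (powRate e) (resol d j₁)) (h₁' : AsympLE (resol d j₁) (powRate f))
    (h₂ : AsympLE (powRate e) (resol d j₂)) (h₂' : AsympLE (resol d j₂) (powRate f)) :
    ∃ C : ℝ, 0 < C ∧ ∃ n₀ : ℕ, ∀ n ≥ n₀,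
      worstRisk (model W d J₀ α β M C₁ C₂) (W.psiMC (j₁ n) (j₂ n) n)
        ≤ ENNReal.ofReal (C * (n : ℝ) ^ (-ρ)) := by
  obtain ⟨C, hC0, hup⟩ := exists_worstRisk_le_realResol (C₁ := C₁) (C₂ := C₂) hW hd hα hβ M hC
  obtain ⟨D, hD, n₀, hb⟩ := exists_eventually_and (exists_resol_bounds h₁ h₁')
    (exists_resol_bounds h₂ h₂')
    (fun n _ _ hab hp => ⟨hp.1.trans (mul_le_mul_of_nonneg_right hab (realResol_pos d _).le),
      hp.2.trans (mul_le_mul_of_nonneg_right hab (by positivity))⟩)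
    (fun n _ _ hab hp => ⟨hp.1.trans (mul_le_mul_of_nonneg_right hab (realResol_pos d _).le),
      hp.2.trans (mul_le_mul_of_nonneg_right hab (by positivity))⟩)
  refine ⟨C * ((1 + D) ^ 2 + D ^ (2 * (α + β) / d)), by positivity, max n₀ 1, fun n hn => ?_⟩
  have hnN : 1 ≤ n := le_of_max_le_right hn
  obtain ⟨⟨a1, a2⟩, b1, b2⟩ := hb n (le_of_max_le_left hn)
  refine (hup _ (hj₁ n) _ (hj₂ n) n (by omega)).2.1.trans (ENNReal.ofReal_le_ofReal ?_)
  have hmin : (n : ℝ) ^ e ≤ D * realResol d (min (j₁ n) (j₂ n)) := by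
    rcases min_choice (j₁ n) (j₂ n) with h | h <;> rw [h] <;> assumption
  rw [mul_assoc]
  exact mul_le_mul_of_nonneg_left (risk_bound_mul_le (by exact_mod_cast hnN) hD (by positivity) hf
    hf hfρ hes (realResol_pos d _).le hmin a2 b2) hC0.le

lemma exists_worstRisk_psiIF_le_rate (hW : W.IsCDVBasis J₀) (hd : 0 < d) (hα : 0 < α) (hβ : 0 < β)
    (M : ℝ) (hC : C₁ ≤ C₂) {j₁ j₂ : ℕ → ℕ} (hj₁ : ∀ n, J₀ ≤ j₁ n) (hj₂ : ∀ n, J₀ ≤ j₂ n)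
    {e f ρ : ℝ} (hf : 1 ≤ f) (hfρ : f ≤ 2 - ρ) (hes : ρ ≤ e * (2 * (α + β) / d))
    (h₁ : AsympLE (powRate e) (resol d fun n => max (j₁ n) (j₂ n)))
    (h₁' : AsympLE (resol d fun n => max (j₁ n) (j₂ n)) (powRate f))
    (h₂ : AsympLE (resol d fun n => min (j₁ n) (j₂ n)) (powRate 1)) :
    ∃ C : ℝ, 0 < C ∧ ∃ n₀ : ℕ, ∀ n ≥ n₀,
      worstRisk (model W d J₀ α β M C₁ C₂) (W.psiIF (j₁ n) (j₂ n) n)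
        ≤ ENNReal.ofReal (C * (n : ℝ) ^ (-ρ)) := by
  obtain ⟨C, hC0, hup⟩ := exists_worstRisk_le_realResol (C₁ := C₁) (C₂ := C₂) hW hd hα hβ M hC
  obtain ⟨D, hD, n₀, hb⟩ := exists_eventually_and (exists_resol_bounds h₁ h₁')
    (resol_le_powRate_iff.mp h₂)
    (fun n _ _ hab hp => ⟨hp.1.trans (mul_le_mul_of_nonneg_right hab (realResol_pos d _).le),
      hp.2.trans (mul_le_mul_of_nonneg_right hab (by positivity))⟩)
    (fun n _ _ hab hp => hp.trans (mul_le_mul_of_nonneg_right hab (by positivity)))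
  refine ⟨C * ((1 + D) ^ 2 + D ^ (2 * (α + β) / d)), by positivity, max n₀ 1, fun n hn => ?_⟩
  have hnN : 1 ≤ n := le_of_max_le_right hn
  obtain ⟨⟨a1, a2⟩, b⟩ := hb n (le_of_max_le_left hn)
  refine (hup _ (hj₁ n) _ (hj₂ n) n (by omega)).2.2.trans (ENNReal.ofReal_le_ofReal ?_)
  -- the product of the two variance factors is symmetric in the two levels
  have hsymm : (1 + realResol d (j₁ n) / n) * (1 + realResol d (j₂ n) / n)
      = (1 + realResol d (max (j₁ n) (j₂ n)) / n) * (1 + realResol d (min (j₁ n) (j₂ n)) / n) := by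
    rcases le_total (j₁ n) (j₂ n) with h | h
    · rw [max_eq_right h, min_eq_left h, mul_comm]
    · rw [max_eq_left h, min_eq_right h]
  rw [hsymm, mul_assoc]
  exact mul_le_mul_of_nonneg_left (risk_bound_mul_le (by exact_mod_cast hnN) hD (by positivity) hf
    le_rfl (by linarith) hes (realResol_pos d _).le a1 a2 b) hC0.le

lemma asymp_minimaxRisk (hW : W.IsCDVBasis J₀) (hd : 0 < d) (hα : 0 < α) (hβ : 0 < β)
    (hαS : α < S) (hβS : β < S) (hM : 0 < M) (hC : C₁ < C₂)
    (hne : ∃ M' < M, (model W d J₀ α β M' C₁ C₂).Nonempty) :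
    Asymp (fun n => minimaxRisk (model W d J₀ α β M C₁ C₂) (Fin n))
      (powRate (-minimaxExponent d (α + β))) := by
  obtain ⟨c, hc, hlow⟩ := exists_rate_le_minimaxRisk hW hd hα hβ hαS hβS hM hC hne
  obtain ⟨C, hC0, hup⟩ := exists_minimaxRisk_le_rate (C₁ := C₁) (C₂ := C₂) hW hd hα hβ M hC.le
  refine ⟨⟨C.toNNReal, Real.toNNReal_pos.mpr hC0, 3, fun n hn => ?_⟩,
    ⟨c⁻¹.toNNReal, Real.toNNReal_pos.mpr (inv_pos.mpr hc), 1, fun n hn => ?_⟩⟩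
  · change _ ≤ ENNReal.ofReal C * ENNReal.ofReal _
    rw [← ENNReal.ofReal_mul hC0.le]
    exact hup n hn
  · change ENNReal.ofReal _ ≤ ENNReal.ofReal c⁻¹ * _
    have : Nonempty (Fin n) := ⟨⟨0, hn⟩⟩
    refine le_trans (le_of_eq ?_) (mul_le_mul_right (hlow (Fin n)) _)
    rw [← ENNReal.ofReal_mul (inv_pos.mpr hc).le, Fintype.card_fin, inv_mul_cancel_left₀ hc.ne']

lemma powRate_asympLE_of_le {T : ℕ → ℝ≥0∞} {ρ : ℝ}
    (h : ∃ c : ℝ, 0 < c ∧ ∃ n₀ : ℕ, ∀ n ≥ n₀, ENNReal.ofReal (c * (n : ℝ) ^ (-ρ)) ≤ T n) :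
    AsympLE (powRate (-ρ)) T := by
  obtain ⟨c, hc, n₀, h⟩ := h
  refine ⟨c⁻¹.toNNReal, Real.toNNReal_pos.mpr (inv_pos.mpr hc), n₀, fun n hn => ?_⟩
  refine le_trans (le_of_eq ?_) (mul_le_mul_right (h n hn) _)
  change ENNReal.ofReal _ = ENNReal.ofReal c⁻¹ * _
  rw [← ENNReal.ofReal_mul (inv_pos.mpr hc).le, inv_mul_cancel_left₀ hc.ne']

lemma asympLE_powRate_of_le {T : ℕ → ℝ≥0∞} {ρ : ℝ}
    (h : ∃ C : ℝ, 0 < C ∧ ∃ n₀ : ℕ, ∀ n ≥ n₀, T n ≤ ENNReal.ofReal (C * (n : ℝ) ^ (-ρ))) :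
    AsympLE T (powRate (-ρ)) := by
  obtain ⟨C, hC, n₀, h⟩ := h
  refine ⟨C.toNNReal, Real.toNNReal_pos.mpr hC, n₀, fun n hn => ?_⟩
  change _ ≤ ENNReal.ofReal C * ENNReal.ofReal _
  rw [← ENNReal.ofReal_mul hC.le]
  exact h n hn

lemma not_powRate_asympLE {r s : ℝ} (h : s < r) : ¬ AsympLE (powRate r) (powRate s) := by
  intro hle
  obtain ⟨C, hC, n₀, hb⟩ := (asympLE_ofReal_iff (a := fun n : ℕ => (n : ℝ) ^ r)
    (b := fun n : ℕ => (n : ℝ) ^ s) fun n => by positivity).mp hle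
  have hlim : Filter.Tendsto (fun n : ℕ => (n : ℝ) ^ (r - s)) Filter.atTop Filter.atTop :=
    (tendsto_rpow_atTop (by linarith)).comp tendsto_natCast_atTop_atTop
  obtain ⟨n, hn, h1, h2⟩ := ((Filter.eventually_ge_atTop n₀).and
    ((hlim.eventually_gt_atTop C).and (Filter.eventually_ge_atTop 1))).exists
  have hn0 : (0 : ℝ) < n := by exact_mod_cast h2
  have h3 := hb n hn
  rw [Real.rpow_sub hn0, lt_div_iff₀ (by positivity)] at h1
  linarith

/-- Below the critical smoothness the Monte Carlo estimator is slower than the minimax rate. -/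
lemma not_isMinimaxRateOptimal_psiMC (hW : W.IsCDVBasis J₀) (hd : 0 < d) (hα : 0 < α) (hβ : 0 < β)
    (hαS : α < S) (hβS : β < S) (hM : 0 < M) (hC : C₁ < C₂)
    (hne : ∃ M' < M, (model W d J₀ α β M' C₁ C₂).Nonempty) (hreg : (α + β) / 2 < (d : ℝ) / 4)
    {j₁ j₂ : ℕ → ℕ} (hj₁ : ∀ n, J₀ ≤ j₁ n) (hj₂ : ∀ n, J₀ ≤ j₂ n) :
    ¬ IsMinimaxRateOptimal (model W d J₀ α β M C₁ C₂) 4 fun n => W.psiMC (j₁ n) (j₂ n) n := by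
  intro hopt
  obtain ⟨c, hc, n₀, hlow⟩ := exists_rate_le_worstRisk_psiMC hW hd hα hβ hαS hβS hM hC hne hreg
  have h1 : AsympLE (powRate (-(3 * (α + β) / (α + β + d)))) fun n =>
      worstRisk (model W d J₀ α β M C₁ C₂) (W.psiMC (j₁ n) (j₂ n) n) :=
    powRate_asympLE_of_le ⟨c, hc, n₀, fun n hn => hlow n hn _ (hj₁ n) _ (hj₂ n)⟩
  have h2 : AsympLE (fun n => minimaxRisk (model W d J₀ α β M C₁ C₂) (Fin 4 × Fin n))
      fun n => minimaxRisk (model W d J₀ α β M C₁ C₂) (Fin n) :=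
    asympLE_of_le fun n => minimaxRisk_le_of_injective _ (f := fun i : Fin n => ((0 : Fin 4), i))
      fun _ _ h => (Prod.mk.inj h).2
  have h3 := ((h1.trans hopt.1).trans h2).trans
    (asymp_minimaxRisk hW hd hα hβ hαS hβS hM hC hne).1
  refine not_powRate_asympLE ?_ h3
  have hd' : (0 : ℝ) < d := by exact_mod_cast hd
  rw [minimaxExponent_of_lt hreg, neg_lt_neg_iff, div_lt_div_iff₀ (by positivity) (by positivity)]
  have : 0 < (α + β) * (d - 2 * (α + β)) := mul_pos (by positivity) (by linarith)
  nlinarith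

end Optimality

/-- Levels whose resolutions are of a given polynomial order. -/
lemma exists_levels {d : ℕ} (hd : 0 < d) (J₀ : ℕ) (e : ℝ) (he : 0 ≤ e) : ∃ j : ℕ → ℕ,
    (∀ n, J₀ ≤ j n) ∧ AsympLE (resol d j) (powRate e) ∧ AsympLE (powRate e) (resol d j) := by
  obtain ⟨K, hK, hlev⟩ := exists_level hd J₀
  choose! j hj hj1 hj2 using hlev
  have hx : ∀ n : ℕ, n ≥ 1 → 1 ≤ (n : ℝ) ^ e := fun n hn =>
    Real.one_le_rpow (by exact_mod_cast hn) he
  refine ⟨fun n => j (max 1 ((n : ℝ) ^ e)), fun n => hj _ (le_max_left _ _),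
    resol_le_powRate_iff.mpr ⟨K, by linarith, 1, fun n hn => ?_⟩,
    powRate_le_resol_iff.mpr ⟨1, one_pos, 1, fun n hn => ?_⟩⟩
  · rw [max_eq_right (hx n hn)]
    exact hj2 _ (hx n hn)
  · rw [max_eq_right (hx n hn), one_mul]
    exact hj1 _ (hx n hn)

theorem mainTheorem8 (d : ℕ) (hd : 0 < d) (S J₀ : ℕ) (W : BoundaryWavelets S)
    (hW : W.IsCDVBasis J₀) (α β M C₁ C₂ : ℝ) (hα : 0 < α) (hβ : 0 < β) (hαS : α < S)
    (hβS : β < S) (hM : 0 < M) (hC : C₁ < C₂)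
    (hne : ∃ M' < M, (model W d J₀ α β M' C₁ C₂).Nonempty) :
    -- the minimax rate
    Asymp (fun n => minimaxRisk (model W d J₀ α β M C₁ C₂) (Fin n))
      (if (d : ℝ) / 4 ≤ (α + β) / 2 then powRate (-1)
        else powRate (-(4 * α + 4 * β) / (2 * α + 2 * β + d))) ∧
    -- the regime `(α + β) / 2 ≥ d / 4`
    ((d : ℝ) / 4 ≤ (α + β) / 2 →
      ∀ j₁ j₂ : ℕ → ℕ, (∀ n, J₀ ≤ j₁ n) → (∀ n, J₀ ≤ j₂ n) →
        (AsympLE (powRate (d / (2 * α + 2 * β)))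
              (fun n => min (resol d j₁ n) (resol d j₂ n)) →
            AsympLE (fun n => min (resol d j₁ n) (resol d j₂ n)) (powRate 1) →
            IsMinimaxRateOptimal (model W d J₀ α β M C₁ C₂) 3
              (fun n => W.psiINT (j₁ n) (j₂ n) n)) ∧
        (AsympLE (powRate (d / (2 * α + 2 * β))) (resol d j₁) →
            AsympLE (resol d j₁) (powRate 1) →
            AsympLE (powRate (d / (2 * α + 2 * β))) (resol d j₂) →
            AsympLE (resol d j₂) (powRate 1) →
            IsMinimaxRateOptimal (model W d J₀ α β M C₁ C₂) 4
              (fun n => W.psiMC (j₁ n) (j₂ n) n)) ∧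
        (AsympLE (powRate (d / (2 * α + 2 * β)))
              (fun n => max (resol d j₁ n) (resol d j₂ n)) →
            AsympLE (fun n => max (resol d j₁ n) (resol d j₂ n)) (powRate 1) →
            IsMinimaxRateOptimal (model W d J₀ α β M C₁ C₂) 3
              (fun n => W.psiIF (j₁ n) (j₂ n) n))) ∧
    -- the regime `(α + β) / 2 < d / 4`
    ((α + β) / 2 < (d : ℝ) / 4 →
      (∀ j₁ j₂ : ℕ → ℕ, (∀ n, J₀ ≤ j₁ n) → (∀ n, J₀ ≤ j₂ n) →
        (Asymp (fun n => min (resol d j₁ n) (resol d j₂ n))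
              (powRate (2 * d / (2 * α + 2 * β + d))) →
            IsMinimaxRateOptimal (model W d J₀ α β M C₁ C₂) 3
              (fun n => W.psiINT (j₁ n) (j₂ n) n)) ∧
        ¬ IsMinimaxRateOptimal (model W d J₀ α β M C₁ C₂) 4
              (fun n => W.psiMC (j₁ n) (j₂ n) n) ∧
        (Asymp (resol d j₁) (powRate (3 * d / (2 * α + 2 * β + 2 * d))) →
            Asymp (resol d j₂) (powRate (3 * d / (2 * α + 2 * β + 2 * d))) →
            Asymp (fun n => worstRisk (model W d J₀ α β M C₁ C₂) (W.psiMC (j₁ n) (j₂ n) n))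
              (powRate (-(3 * α + 3 * β) / (α + β + d)))) ∧
        (Asymp (fun n => max (resol d j₁ n) (resol d j₂ n))
              (powRate (2 * d / (2 * α + 2 * β + d))) →
            AsympLE (fun n => min (resol d j₁ n) (resol d j₂ n)) (powRate 1) →
            IsMinimaxRateOptimal (model W d J₀ α β M C₁ C₂) 3
              (fun n => W.psiIF (j₁ n) (j₂ n) n))) ∧
      -- the best worst-case risk of the Monte Carlo estimator over all choices of resolutions
      Asymp
        (fun n => ⨅ j₁ : ℕ, ⨅ _ : J₀ ≤ j₁, ⨅ j₂ : ℕ, ⨅ _ : J₀ ≤ j₂,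
          worstRisk (model W d J₀ α β M C₁ C₂) (W.psiMC j₁ j₂ n))
        (powRate (-(3 * α + 3 * β) / (α + β + d)))) := by
  have hd' : (0 : ℝ) < d := by exact_mod_cast hd
  have hγ : 0 < α + β := by positivity
  have e1 : (d : ℝ) / (2 * α + 2 * β) * (2 * (α + β) / d) = 1 := by
    rw [← mul_add]; field_simp
  have e2 : 2 * (d : ℝ) / (2 * α + 2 * β + d) * (2 * (α + β) / d)
      = 4 * (α + β) / (2 * (α + β) + d) := by
    rw [← mul_add]; field_simp; ring
  have e3 : 2 * (d : ℝ) / (2 * α + 2 * β + d) = 2 - 4 * (α + β) / (2 * (α + β) + d) := by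
    rw [← mul_add]; field_simp; ring
  have e4 : 3 * (d : ℝ) / (2 * α + 2 * β + 2 * d) * (2 * (α + β) / d)
      = 3 * (α + β) / (α + β + d) := by
    rw [← mul_add]; field_simp
  have e5 : 3 * (d : ℝ) / (2 * α + 2 * β + 2 * d) + 3 * (d : ℝ) / (2 * α + 2 * β + 2 * d)
      = 3 - 3 * (α + β) / (α + β + d) := by
    rw [← mul_add 2 α β]; field_simp; ring
  have e6 : -(3 * α + 3 * β) / (α + β + d) = -(3 * (α + β) / (α + β + d)) := by ring
  -- the resolutions below the critical smoothness exceed the size of the sample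
  have hexp : (α + β) / 2 < (d : ℝ) / 4 → 1 ≤ 2 * (d : ℝ) / (2 * α + 2 * β + d) ∧
      1 ≤ 3 * (d : ℝ) / (2 * α + 2 * β + 2 * d) := fun h => by
    rw [le_div_iff₀ (by positivity), le_div_iff₀ (by positivity)]
    constructor <;> linarith
  refine ⟨?_, fun hreg j₁ j₂ hj₁ hj₂ => ⟨fun h h' => ?_, fun h₁ h₁' h₂ h₂' => ?_, fun h h' => ?_⟩,
    fun hreg => ⟨fun j₁ j₂ hj₁ hj₂ => ⟨fun h => ?_, ?_, fun h₁ h₂ => ⟨?_, ?_⟩, fun h h' => ?_⟩,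
      ?_, ?_⟩⟩
  · convert asymp_minimaxRisk hW hd hα hβ hαS hβS hM hC hne using 1
    split_ifs with h
    · rw [minimaxExponent_of_le h]
    · rw [minimaxExponent_of_lt (not_le.mp h)]
      congr 1
      rw [← mul_add, ← mul_add, neg_div]
  · rw [min_resol] at h h'
    refine isMinimaxRateOptimal_of_le hW hd hα hβ hαS hβS hM hC hne (by norm_num)
      (fun n => measurable_psiINT hW _ _ n) ?_
    rw [minimaxExponent_of_le hreg]
    exact exists_worstRisk_psiINT_le_rate hW hd hα hβ M hC.le hj₁ hj₂ le_rfl (by norm_num)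
      e1.ge h h'
  · refine isMinimaxRateOptimal_of_le hW hd hα hβ hαS hβS hM hC hne (by norm_num)
      (fun n => measurable_psiMC hW _ _ n) ?_
    rw [minimaxExponent_of_le hreg]
    exact exists_worstRisk_psiMC_le_rate hW hd hα hβ M hC.le hj₁ hj₂ le_rfl (by norm_num) e1.ge
      h₁ h₁' h₂ h₂'
  · rw [max_resol] at h h'
    refine isMinimaxRateOptimal_of_le hW hd hα hβ hαS hβS hM hC hne (by norm_num)
      (fun n => measurable_psiIF hW _ _ n) ?_
    rw [minimaxExponent_of_le hreg]
    refine exists_worstRisk_psiIF_le_rate hW hd hα hβ M hC.le hj₁ hj₂ le_rfl (by norm_num) e1.ge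
      h h' ((asympLE_of_le fun n => ?_).trans h')
    rw [resol_eq, resol_eq]
    exact ENNReal.ofReal_le_ofReal (monotone_realResol d (min_le_max))
  · rw [min_resol] at h
    refine isMinimaxRateOptimal_of_le hW hd hα hβ hαS hβS hM hC hne (by norm_num)
      (fun n => measurable_psiINT hW _ _ n) ?_
    rw [minimaxExponent_of_lt hreg]
    exact exists_worstRisk_psiINT_le_rate hW hd hα hβ M hC.le hj₁ hj₂ (hexp hreg).1 e3.le e2.ge
      h.2 h.1
  · exact not_isMinimaxRateOptimal_psiMC hW hd hα hβ hαS hβS hM hC hne hreg hj₁ hj₂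
  · rw [e6]
    exact asympLE_powRate_of_le (exists_worstRisk_psiMC_le_rate hW hd hα hβ M hC.le hj₁ hj₂
      (hexp hreg).2 e5.le e4.ge h₁.2 h₁.1 h₂.2 h₂.1)
  · obtain ⟨c, hc, n₀, hlow⟩ := exists_rate_le_worstRisk_psiMC hW hd hα hβ hαS hβS hM hC hne hreg
    rw [e6]
    exact powRate_asympLE_of_le ⟨c, hc, n₀, fun n hn => hlow n hn _ (hj₁ n) _ (hj₂ n)⟩
  · rw [max_resol] at h
    rw [min_resol] at h'
    refine isMinimaxRateOptimal_of_le hW hd hα hβ hαS hβS hM hC hne (by norm_num)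
      (fun n => measurable_psiIF hW _ _ n) ?_
    rw [minimaxExponent_of_lt hreg]
    exact exists_worstRisk_psiIF_le_rate hW hd hα hβ M hC.le hj₁ hj₂ (hexp hreg).1 e3.le e2.ge
      h.2 h.1 h'
  · rw [e6]
    obtain ⟨j, hj, hj', hj''⟩ := exists_levels hd J₀ ((3 : ℝ) * d / (2 * α + 2 * β + 2 * d))
      (by linarith [(hexp hreg).2])
    obtain ⟨C, hC0, n₀, hup⟩ := exists_worstRisk_psiMC_le_rate hW hd hα hβ M hC.le hj hj
      (hexp hreg).2 e5.le e4.ge hj'' hj' hj'' hj'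
    exact asympLE_powRate_of_le ⟨C, hC0, n₀, fun n hn =>
      (iInf₂_le_of_le (j n) (hj n) (iInf₂_le (j n) (hj n))).trans (hup n hn)⟩
  · obtain ⟨c, hc, n₀, hlow⟩ := exists_rate_le_worstRisk_psiMC hW hd hα hβ hαS hβS hM hC hne hreg
    rw [e6]
    exact powRate_asympLE_of_le ⟨c, hc, n₀, fun n hn =>
      le_iInf₂ fun i hi => le_iInf₂ fun i' hi' => hlow n hn i hi i' hi'⟩
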